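/- **Theorem 2.1.** Let $X$ be a compact complex manifold of dimension $m$, let $\pi:\mathcal X\to B$ be a deformation of $X$, i.e. a proper holomorphic submersion onto a complex manifold $B$ of dimension $N$ with base point $0\in B$, with a closed holomorphic embedding $i:X\hookrightarrow\mathcal X$ onto $\pi^{-1}(0)$, and fix a diffeomorphism $T=(T_0,\pi):\mathcal X\cong X\times B$ such that the fibres of $T_0$ are complex submanifolds of $\mathcal X$. Let $E\to\mathcal X$ be a holomorphic vector bundle of finite rank with sheaf of holomorphic sections $\mathcal E$. Define the following sheaves. * $\mathcal C^{\omega\infty}_{\mathcal X}$: the complex functions on $\mathcal X$ that are $\mathcal C^\infty$ and real analytic in the direction of $B$ with respect to $T$, i.e. that in local coordinates $(y,t)$ of $X\times B$ ($y$ smooth coordinates on $X$, $t$ holomorphic coordinates on $B$) are locally of the form $H(y,t,\bar t)$ with $H(y,t,s)$ of class $\mathcal C^\infty$ and holomorphic in $(t,s)$. * $\mathcal A^p_{\mathcal X/B}(\mathcal E)$: the $E$-valued relative $(0,p)$-forms with coefficients in $\mathcal C^{\omega\infty}_{\mathcal X}$, locally $\sum_I a_I\,d\bar z^I$ with $a_I$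 sections of $E$ with coefficients in $\mathcal C^{\omega\infty}_{\mathcal X}$, where $(z,t)$ are holomorphic coordinates on $\mathcal X$ with $t$ coming from $B$; and $\bar\partial_{\mathcal X/B}$, given by $\bar\partial_{\mathcal X/B}\big(\sum_I a_I\,d\bar z^I\big)=\sum_{I,j}\frac{\partial a_I}{\partial\bar z_j}\,d\bar z_j\wedge d\bar z^I$ in a holomorphic frame of $E$. * $\mathcal O^\omega_{\mathcal X}=\pi^*\mathcal C^\omega_B$, the pullback, in the sense of complex spaces, of the sheaf of real analytic functions on $B$: the functions that are locally holomorphic functions of $(\xi,\bar t)$, with $\xi$ holomorphic coordinates on $\mathcal X$ and $t$ holomorphic coordinates on $B$. Put $\mathcal E^\omega=\mathcal E\otimes_{\mathcal O_{\mathcal X}}\mathcal O^\omega_{\mathcal X}$, the sections of $E$ with coefficients in $\mathcal O^\omega_{\mathcal X}$. * $\mathcal M$: the ideal generated by the functions $f\circ\pi$, with $f$ real analytic on $B$, complex valued, and $f(0)=0$. For $n\ge 0$ put $$\mathcal E_{\mathcal X|X^\omega_\infty}=i^{-1}\mathcal E^\omega,\qquad \mathcal E_{\mathcal X|X^\omega_n}=i^{-1}\big(\mathcal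 E^\omega/\mathcal M^{n+1}\mathcal E^\omega\big),\qquad \mathcal A^p_{X_n/B_n}=i^{-1}\big(\mathcal A^p_{\mathcal X/B}(\mathcal E)/\mathcal M^{n+1}\mathcal A^p_{\mathcal X/B}(\mathcal E)\big).$$ Then $\bar\partial_{\mathcal X/B}$ is a well-defined morphism of sheaves $\mathcal A^p_{\mathcal X/B}(\mathcal E)\to\mathcal A^{p+1}_{\mathcal X/B}(\mathcal E)$, it induces operators $\bar\partial_{X_n/B_n}:\mathcal A^p_{X_n/B_n}\to\mathcal A^{p+1}_{X_n/B_n}$, and the complexes of sheaves of complex vector spaces on $X$ $$0\to\mathcal E_{\mathcal X|X^\omega_\infty}\to i^{-1}\mathcal A^0_{\mathcal X/B}(\mathcal E)\xrightarrow{\bar\partial_{\mathcal X/B}}i^{-1}\mathcal A^1_{\mathcal X/B}(\mathcal E)\to\cdots\to i^{-1}\mathcal A^m_{\mathcal X/B}(\mathcal E)\to0,$$ $$0\to\mathcal E_{\mathcal X|X^\omega_n}\to\mathcal A^0_{X_n/B_n}\xrightarrow{\bar\partial_{X_n/B_n}}\mathcal A^1_{X_n/B_n}\to\cdots\to\mathcal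 A^m_{X_n/B_n}\to0$$ are $\Gamma$-acyclic resolutions. Consequently, for all $p\ge0$ and $n\ge0$, there are isomorphisms of complex vector spaces $$H^p(X^\omega_\infty,\mathcal E_{\mathcal X|X^\omega_\infty})\cong\frac{\mathrm{Ker}\big(\bar\partial_{\mathcal X/B}:\Gamma(X,i^{-1}\mathcal A^p_{\mathcal X/B}(\mathcal E))\to\Gamma(X,i^{-1}\mathcal A^{p+1}_{\mathcal X/B}(\mathcal E))\big)}{\mathrm{Im}\big(\bar\partial_{\mathcal X/B}:\Gamma(X,i^{-1}\mathcal A^{p-1}_{\mathcal X/B}(\mathcal E))\to\Gamma(X,i^{-1}\mathcal A^{p}_{\mathcal X/B}(\mathcal E))\big)},$$ $$H^p(X^\omega_n,\mathcal E_{\mathcal X|X^\omega_n})\cong\frac{\mathrm{Ker}\big(\bar\partial_{X_n/B_n}:\Gamma(X,\mathcal A^p_{X_n/B_n})\to\Gamma(X,\mathcal A^{p+1}_{X_n/B_n})\big)}{\mathrm{Im}\big(\bar\partial_{X_n/B_n}:\Gamma(X,\mathcal A^{p-1}_{X_n/B_n})\to\Gamma(X,\mathcal A^{p}_{X_n/B_n})\big)},$$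 where the sheaves in degree $-1$ are $0$. -/

import Mathlib

open CategoryTheory TopologicalSpace Opposite Filter Topology
open scoped Manifold ContDiff

noncomputable section

/-! ## Sheaves of complex vector spaces and their cohomology -/

/-- Sheaves of complex vector spaces on a topological space. -/
abbrev Sh (S : TopCat.{0}) := TopCat.Sheaf (ModuleCat.{0} ℂ) S

/-- The global sections functor `Γ(S, -)`. -/
def globalSections (S : TopCat.{0}) : Sh S ⥤ ModuleCat.{0} ℂ :=
  (sheafSections _ _).obj (op ⊤)

instance (S : TopCat.{0}) : (globalSections S).Additive where
  map_add := rfl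

/-- Sheaf cohomology `H^k(S, 𝓕)`: the `k`-th right derived functor of the global sections. -/
def sheafCohomology {S : TopCat.{0}} (k : ℕ) (𝓕 : Sh S) : ModuleCat.{0} ℂ :=
  ((globalSections S).rightDerived k).obj 𝓕

/-- `0 ⟶ 𝓔 ⟶ 𝓐⁰ ⟶ 𝓐¹ ⟶ ⋯` is a `Γ`-acyclic resolution of the sheaf `𝓔`: it is a complex, it is
exact, and the sheaves `𝓐ᵖ` have no higher cohomology. -/
structure IsAcyclicResolution {S : TopCat.{0}} {𝓔 : Sh S} {𝓐 : ℕ → Sh S}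
    (ε : 𝓔 ⟶ 𝓐 0) (d : ∀ p, 𝓐 p ⟶ 𝓐 (p + 1)) : Prop where
  mono : Mono ε
  aug_comp : ε ≫ d 0 = 0
  exact_zero : (ShortComplex.mk ε (d 0) aug_comp).Exact
  comp : ∀ p, d p ≫ d (p + 1) = 0
  exact_succ : ∀ p, (ShortComplex.mk (d p) (d (p + 1)) (comp p)).Exact
  acyclic : ∀ p k, 0 < k → Limits.IsZero (sheafCohomology k (𝓐 p))

section cohomology
variable {S : TopCat.{0}} {𝓐 : ℕ → Sh S} (d : ∀ p, 𝓐 p ⟶ 𝓐 (p + 1))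

/-- Global cocycles `Ker (d : Γ(S, 𝓐ᵖ) → Γ(S, 𝓐ᵖ⁺¹))`. -/
def cocycles (p : ℕ) : Submodule ℂ ((globalSections S).obj (𝓐 p)) :=
  LinearMap.ker ((globalSections S).map (d p)).hom

/-- Global coboundaries `Im (d : Γ(S, 𝓐ᵖ⁻¹) → Γ(S, 𝓐ᵖ))`, with `Γ(S, 𝓐⁻¹) = 0`. -/
def coboundaries : ∀ p : ℕ, Submodule ℂ ((globalSections S).obj (𝓐 p))
  | 0 => ⊥
  | p + 1 => LinearMap.range ((globalSections S).map (d p)).hom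

/-- The cohomology `Ker / Im` of the global sections of `𝓐⁰ ⟶ 𝓐¹ ⟶ ⋯`. -/
abbrev GlobalCohomology (p : ℕ) : Type :=
  (cocycles d p) ⧸ (coboundaries d p).submoduleOf (cocycles d p)

end cohomology

/-! ## Sheaves of sections given by local conditions -/

section localCondition

variable {Y : Type} [TopologicalSpace Y]

section
variable (T : Y → Type) [∀ y, AddCommGroup (T y)] [∀ y, Module ℂ (T y)]

/-- A linear condition, at every point, on the germ at that point of a family `s y ∈ T y`. -/
structure LocalCondition where
  at_ : Y → Submodule ℂ (∀ y, T y)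
  congr_at : ∀ (x : Y) (s s' : ∀ y, T y), (∀ᶠ y in 𝓝 x, s y = s' y) → s ∈ at_ x → s' ∈ at_ x
end

variable {T : Y → Type} [∀ y, AddCommGroup (T y)] [∀ y, Module ℂ (T y)]

open scoped Classical in
/-- Extension by zero of a family over an open set (only its germs at points of the open set
matter below). -/
def extendZero (U : Opens Y) : (∀ y : U, T y) →ₗ[ℂ] (∀ y, T y) where
  toFun s y := if h : y ∈ U then s ⟨y, h⟩ else 0
  map_add' s s' := by
    funext y
    by_cases h : y ∈ U <;> simp [h]
  map_smul' c s := by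
    funext y
    by_cases h : y ∈ U <;> simp [h]

lemma extendZero_apply {U : Opens Y} (s : ∀ y : U, T y) {y : Y} (h : y ∈ U) :
    extendZero U s y = s ⟨y, h⟩ := by
  simp [extendZero, h]

/-- Families over the open set `U` that satisfy the condition at every point of `U`. -/
def LocalCondition.sections (P : LocalCondition T) (U : Opens Y) : Submodule ℂ (∀ y : U, T y) where
  carrier := {s | ∀ x ∈ U, extendZero U s ∈ P.at_ x}
  add_mem' hs hs' x hx := by
    rw [map_add]
    exact (P.at_ x).add_mem (hs x hx) (hs' x hx)
  zero_mem' x _ := by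
    rw [map_zero]
    exact (P.at_ x).zero_mem
  smul_mem' c s hs x hx := by
    rw [map_smul]
    exact (P.at_ x).smul_mem c (hs x hx)

/-- Restriction to a smaller open set. -/
def LocalCondition.restrict (P : LocalCondition T) {U V : Opens Y} (h : V ≤ U) :
    P.sections U →ₗ[ℂ] P.sections V where
  toFun s := ⟨fun y => s.1 ⟨y, h y.2⟩, fun x hx => by
    refine P.congr_at x _ _ ?_ (s.2 x (h hx))
    filter_upwards [V.isOpen.mem_nhds hx] with y hy
    rw [extendZero_apply _ (h hy), extendZero_apply _ hy]⟩
  map_add' _ _ := rfl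
  map_smul' _ _ := rfl

/-- The presheaf of families that satisfy the condition. -/
def LocalCondition.presheaf (P : LocalCondition T) :
    TopCat.Presheaf (ModuleCat.{0} ℂ) (TopCat.of Y) where
  obj U := ModuleCat.of ℂ (P.sections U.unop)
  map f := ModuleCat.ofHom (P.restrict (leOfHom f.unop))
  map_id _ := rfl
  map_comp _ _ := rfl

/-- The same condition as a local predicate on families. -/
def LocalCondition.localPredicate (P : LocalCondition T) :
    TopCat.LocalPredicate (X := TopCat.of Y) T where
  pred {U} s := s ∈ P.sections U
  res {_ _} i f hf := (P.restrict (leOfHom i) ⟨f, hf⟩).2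
  locality {U} f hf x hx := by
    obtain ⟨V, hxV, i, hV⟩ := hf ⟨x, hx⟩
    refine P.congr_at x _ _ ?_ (hV x hxV)
    filter_upwards [V.isOpen.mem_nhds hxV] with y hy
    rw [extendZero_apply _ hy, extendZero_apply _ (leOfHom i hy)]
    rfl

lemma LocalCondition.isSheaf (P : LocalCondition T) : P.presheaf.IsSheaf := by
  rw [TopCat.Presheaf.isSheaf_iff_isSheaf_comp (CategoryTheory.forget (ModuleCat.{0} ℂ))]
  exact TopCat.subpresheafToTypes.isSheaf P.localPredicate

/-- The sheaf of families that satisfy the condition. -/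
def LocalCondition.sheaf (P : LocalCondition T) : Sh (TopCat.of Y) := ⟨P.presheaf, P.isSheaf⟩

/-- The inclusion of sheaves given by a stronger condition. -/
def LocalCondition.incl {P Q : LocalCondition T} (h : ∀ x, P.at_ x ≤ Q.at_ x) :
    P.sheaf ⟶ Q.sheaf :=
  ⟨{ app _ := ModuleCat.ofHom (Submodule.inclusion fun _ hs x hx => h x (hs x hx))
     naturality _ _ _ := rfl }⟩

end localCondition

/-! ## Deformations -/

/-- Coordinates on the fibres. -/
abbrev FibreModel (m : ℕ) := Fin m → ℂ
/-- Coordinates on the base. -/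
abbrev BaseModel (N : ℕ) := Fin N → ℂ
/-- Coordinates on the total space. -/
abbrev TotalModel (m N : ℕ) := FibreModel m × BaseModel N

/-- A deformation `i : X ⟶ 𝒳`, `π : 𝒳 ⟶ B` of `X` over a complex manifold `B` with base point,
together with a smooth trivialization `T = (T₀, π) : 𝒳 ≃ X × B` all of whose leaves `T₀ = x` are
complex submanifolds, i.e. images of holomorphic sections `b ↦ T⁻¹ (x, b)` of `π`. -/
structure Deformation (m N : ℕ) (X 𝒳 B : Type)
    [TopologicalSpace X] [ChartedSpace (FibreModel m) X]
    [TopologicalSpace 𝒳] [ChartedSpace (TotalModel m N) 𝒳]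
    [TopologicalSpace B] [ChartedSpace (BaseModel N) B] where
  π : 𝒳 → B
  b₀ : B
  i : X → 𝒳
  holomorphic_π : ContMDiff 𝓘(ℂ, TotalModel m N) 𝓘(ℂ, BaseModel N) ω π
  submersion_π : ∀ x, Function.Surjective
    (mfderiv 𝓘(ℂ, TotalModel m N) 𝓘(ℂ, BaseModel N) π x)
  proper_π : IsProperMap π
  holomorphic_i : ContMDiff 𝓘(ℂ, FibreModel m) 𝓘(ℂ, TotalModel m N) ω i
  immersion_i : ∀ x, Function.Injective
    (mfderiv 𝓘(ℂ, FibreModel m) 𝓘(ℂ, TotalModel m N) i x)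
  injective_i : Function.Injective i
  range_i : Set.range i = π ⁻¹' {b₀}
  T : Diffeomorph 𝓘(ℝ, TotalModel m N) (𝓘(ℝ, FibreModel m).prod 𝓘(ℝ, BaseModel N)) 𝒳 (X × B) ∞
  T_snd : ∀ x, (T x).2 = π x
  T_leaf : ∀ x : X, ContMDiff 𝓘(ℂ, BaseModel N) 𝓘(ℂ, TotalModel m N) ω fun b => T.symm (x, b)

namespace Deformation

variable {m N : ℕ} {X 𝒳 B : Type}
    [TopologicalSpace X] [ChartedSpace (FibreModel m) X]
    [TopologicalSpace 𝒳] [ChartedSpace (TotalModel m N) 𝒳]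
    [TopologicalSpace B] [ChartedSpace (BaseModel N) B]
    (D : Deformation m N X 𝒳 B)

/-- The inclusion of the central fibre, as a map of topological spaces. -/
def incl : TopCat.of X ⟶ TopCat.of 𝒳 := TopCat.ofHom ⟨D.i, D.holomorphic_i.continuous⟩

/-- The inverse image functor `i⁻¹` on sheaves. -/
def restr : Sh (TopCat.of 𝒳) ⥤ Sh (TopCat.of X) := TopCat.Sheaf.pullback _ D.incl

/-- The base coordinate `t (π x)`, for the chart `t` of `B` at `π x₀`. -/
def baseCoord (x₀ x : 𝒳) : BaseModel N := chartAt (BaseModel N) (D.π x₀) (D.π x)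

section functions

variable {G : Type*} [NormedAddCommGroup G] [NormedSpace ℂ G]

/-- `(y, t, t̄)` at the point `x`, where `y` are the coordinates of `T₀ x` in the chart of `X` at
`T₀ x₀`, and `t` those of `π x`. -/
def smoothCoord (x₀ x : 𝒳) : FibreModel m × (BaseModel N × BaseModel N) :=
  (chartAt (FibreModel m) (D.T x₀).1 (D.T x).1, (D.baseCoord x₀ x, star (D.baseCoord x₀ x)))

/-- The germ of `g` at `x₀` is `C^∞` and real analytic in the direction of `B`: in the coordinates
`(y, t)` given by `T`, near `x₀`, it is of the form `H (y, t, t̄)` with `H (y, t, s)` of class `C^∞`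
and holomorphic in `(t, s)`. Thus locally `g` is a convergent power series in `t, t̄`, whose domain
of convergence is uniform in `y` and whose sum depends smoothly on `y`. -/
def IsSmoothAnalyticAt [NormedSpace ℝ G] (x₀ : 𝒳) (g : 𝒳 → G) : Prop :=
  ∃ (O : Set (FibreModel m × (BaseModel N × BaseModel N)))
    (H : FibreModel m × (BaseModel N × BaseModel N) → G),
    IsOpen O ∧ D.smoothCoord x₀ x₀ ∈ O ∧ ContDiffOn ℝ ∞ H O ∧
    (∀ q ∈ O, DifferentiableAt ℂ (fun τ => H (q.1, τ)) q.2) ∧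
    ∀ᶠ x in 𝓝 x₀, g x = H (D.smoothCoord x₀ x)

/-- Coordinates `(ξ, t̄)` on the fibre product of `𝒳` and `B^ω` over `B`: here `ξ` are holomorphic
coordinates on `𝒳` and `t` holomorphic coordinates on `B`. -/
def analyticCoord (x₀ x : 𝒳) : TotalModel m N × BaseModel N :=
  (chartAt (TotalModel m N) x₀ x, star (D.baseCoord x₀ x))

/-- The germ of `g` at `x₀` is a section of `𝒪_𝒳^ω`, the pullback by `π` of the sheaf of real
analytic functions on `B` (the pullback in the sense of complex spaces: real analytic functions
on `B` are locally the holomorphic functions of `(t, t̄)`, so their pullbacks to `𝒳` generate the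
holomorphic functions of `(ξ, t̄)`). -/
def IsRelAnalyticAt (x₀ : 𝒳) (g : 𝒳 → G) : Prop :=
  ∃ H : TotalModel m N × BaseModel N → G,
    AnalyticAt ℂ H (D.analyticCoord x₀ x₀) ∧ ∀ᶠ x in 𝓝 x₀, g x = H (D.analyticCoord x₀ x)

end functions

/-- The relative (vertical) tangent space `Ker dπ` at a point. -/
def vert (x : 𝒳) : Submodule ℂ (TangentSpace 𝓘(ℂ, TotalModel m N) x) :=
  LinearMap.ker
    (mfderiv 𝓘(ℂ, TotalModel m N) 𝓘(ℂ, BaseModel N) D.π x).toLinearMap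

/-- `ψ = (z, t)` is a holomorphic chart of `𝒳` around `x₀` whose last coordinates are those of
the chart of `B` at `π x₀`. -/
structure IsRelChart (x₀ : 𝒳) (ψ : OpenPartialHomeomorph 𝒳 (TotalModel m N)) : Prop where
  mem_atlas : ψ ∈ IsManifold.maximalAtlas 𝓘(ℂ, TotalModel m N) ω 𝒳
  mem_source : x₀ ∈ ψ.source
  base_mem : ∀ x ∈ ψ.source, D.π x ∈ (chartAt (BaseModel N) (D.π x₀)).source
  snd_eq : ∀ x ∈ ψ.source, (ψ x).2 = D.baseCoord x₀ x

/-- The differential `dz` of the fibre coordinates of `ψ = (z, t)`, on vertical vectors. -/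
def dz (ψ : OpenPartialHomeomorph 𝒳 (TotalModel m N)) (x : 𝒳) (w : D.vert x) : FibreModel m :=
  mfderiv 𝓘(ℂ, TotalModel m N) 𝓘(ℂ, FibreModel m) (fun y => (ψ y).1) x w.1

section bundle

variable (F : Type) [NormedAddCommGroup F] [NormedSpace ℂ F] (E : 𝒳 → Type)
  [TopologicalSpace (Bundle.TotalSpace F E)] [∀ x, TopologicalSpace (E x)]
  [∀ x, AddCommGroup (E x)] [∀ x, Module ℂ (E x)] [FiberBundle F E] [VectorBundle ℂ F E]

/-- The value, in the preferred trivialization at `x₀`, of an element of `E x`. -/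
def triv (x₀ x : 𝒳) : E x →ₗ[ℂ] F := (trivializationAt F E x₀).linearMapAt ℂ x

/-- The sections of `𝓔 ⊗ 𝒪_𝒳^ω`: sections of `E` with coefficients in `𝒪_𝒳^ω`. -/
def analyticSections : LocalCondition E where
  at_ x₀ :=
    { carrier := {s | D.IsRelAnalyticAt x₀ fun x => triv F E x₀ x (s x)}
      add_mem' := by
        rintro s s' ⟨H, hH, h⟩ ⟨H', hH', h'⟩
        refine ⟨H + H', hH.add hH', ?_⟩
        filter_upwards [h, h'] with x hx hx'
        simp [hx, hx']
      zero_mem' := ⟨0, analyticAt_const, by simp⟩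
      smul_mem' := by
        rintro c s ⟨H, hH, h⟩
        refine ⟨c • H, hH.const_smul, ?_⟩
        filter_upwards [h] with x hx
        simp [hx] }
  congr_at := by
    rintro x₀ s s' hs ⟨H, hH, h⟩
    refine ⟨H, hH, ?_⟩
    filter_upwards [hs, h] with x hx hx'
    rw [← hx, hx']

/-- Relative `(0, p)`-forms at the point `x` with values in `E x`: alternating forms on the relative
tangent space, conjugate-linear in every argument. -/
def RelForm (p : ℕ) (x : 𝒳) : Submodule ℂ (D.vert x [⋀^Fin p]→ₗ[ℝ] E x) where
  carrier := {α | ∀ (v : Fin p → D.vert x) (j : Fin p) (c : ℂ),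
    α (Function.update v j (c • v j)) = starRingEnd ℂ c • α v}
  add_mem' h h' v j c := by
    simp only [AlternatingMap.add_apply, h v j c, h' v j c, smul_add]
  zero_mem' v j c := by simp
  smul_mem' a α h v j c := by
    simp only [AlternatingMap.smul_apply, h v j c, smul_comm a]

/-- Near `x₀` the relative form `α` is represented, in the relative chart `ψ` and the preferred
trivialization of `E` at `x₀`, by the family `a` of alternating forms on the fibre coordinates:
`α = ∑_I a_I dz̄^I`. -/
def Represents {p : ℕ} (x₀ : 𝒳) (ψ : OpenPartialHomeomorph 𝒳 (TotalModel m N))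
    (α : ∀ x, D.RelForm E p x) (a : 𝒳 → FibreModel m [⋀^Fin p]→L[ℝ] F) : Prop :=
  ∀ᶠ x in 𝓝 x₀, ∀ w : Fin p → D.vert x,
    triv F E x₀ x ((α x).1 w) = a x fun j => D.dz ψ x (w j)

/-- The sections of `𝓐^p_{𝒳/B}(𝓔)`: relative `(0, p)`-forms with values in `E` whose coefficients
are `C^∞` and real analytic in the direction of `B`. -/
def smoothForms (p : ℕ) : LocalCondition fun x => D.RelForm E p x where
  at_ x₀ :=
    { carrier := {α | ∀ ψ, D.IsRelChart x₀ ψ → ∃ a : 𝒳 → FibreModel m [⋀^Fin p]→L[ℝ] F,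
        D.IsSmoothAnalyticAt x₀ a ∧ D.Represents F E x₀ ψ α a}
      add_mem' := by
        intro α α' h h' ψ hψ
        obtain ⟨a, ⟨O, H, h₁, h₂, h₃, h₄, h₅⟩, ha⟩ := h ψ hψ
        obtain ⟨a', ⟨O', H', h₁', h₂', h₃', h₄', h₅'⟩, ha'⟩ := h' ψ hψ
        refine ⟨a + a', ⟨O ∩ O', H + H', h₁.inter h₁', ⟨h₂, h₂'⟩,
          (h₃.mono Set.inter_subset_left).add (h₃'.mono Set.inter_subset_right),
          fun q hq => (h₄ q hq.1).add (h₄' q hq.2), ?_⟩, ?_⟩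
        · filter_upwards [h₅, h₅'] with x hx hx'
          simp [hx, hx']
        · filter_upwards [ha, ha'] with x hx hx' w
          simp [hx w, hx' w]
      zero_mem' := fun ψ hψ => ⟨0, ⟨Set.univ, 0, isOpen_univ, trivial, contDiffOn_const,
        fun q _ => differentiableAt_const _, by simp⟩, by simp [Represents]⟩
      smul_mem' := by
        intro c α h ψ hψ
        obtain ⟨a, ⟨O, H, h₁, h₂, h₃, h₄, h₅⟩, ha⟩ := h ψ hψ
        refine ⟨c • a, ⟨O, c • H, h₁, h₂, h₃.const_smul c, fun q hq => (h₄ q hq).const_smul c, ?_⟩,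
          ?_⟩
        · filter_upwards [h₅] with x hx
          simp [hx]
        · filter_upwards [ha] with x hx w
          simp [hx w] }
  congr_at := by
    intro x₀ α α' hα h ψ hψ
    obtain ⟨a, h₁, ha⟩ := h ψ hψ
    refine ⟨a, h₁, ?_⟩
    filter_upwards [hα, ha] with x hx hx' w
    rw [← hx, hx' w]

/-- The conjugate-linear part of a real-linear map. -/
def antilinearPart {V G : Type*} [NormedAddCommGroup V] [NormedSpace ℂ V] [NormedAddCommGroup G]
    [NormedSpace ℝ G] [NormedSpace ℂ G] [SMulCommClass ℝ ℂ G] (L : V →L[ℝ] G) : V →L[ℝ] G :=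
  (1 / 2 : ℂ) • (L + Complex.I • L.comp (Complex.I • ContinuousLinearMap.id ℝ V))

/-- `∂̄` in a relative chart `ψ = (z, t)`, at the point `x`: the alternating sum of the
conjugate-linear part of the derivative in `z`, that is,
`∂̄ (∑_I a_I dz̄^I) = ∑_{I, j} (∂a_I / ∂z̄_j) dz̄_j ∧ dz̄^I`. -/
def coordDbar {p : ℕ} (ψ : OpenPartialHomeomorph 𝒳 (TotalModel m N))
    (a : 𝒳 → FibreModel m [⋀^Fin p]→L[ℝ] F) (x : 𝒳) : FibreModel m [⋀^Fin (p + 1)]→L[ℝ] F :=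
  ContinuousAlternatingMap.alternatizeUncurryFin
    (antilinearPart (fderiv ℝ (fun z => a (ψ.symm (z, (ψ x).2))) (ψ x).1))

/-- At the point `x₀`, `β` is the relative Dolbeault derivative of `α`. -/
def IsDbarAt {p : ℕ} (x₀ : 𝒳) (α : ∀ x, D.RelForm E p x) (β : ∀ x, D.RelForm E (p + 1) x) : Prop :=
  ∀ ψ, D.IsRelChart x₀ ψ → ∀ a b, D.Represents F E x₀ ψ α a → D.Represents F E x₀ ψ β b →
    b x₀ = coordDbar F ψ a x₀

/-- The sheaf `𝓔 ⊗ 𝒪_𝒳^ω` on `𝒳`. -/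
abbrev analyticSheaf : Sh (TopCat.of 𝒳) := (D.analyticSections F E).sheaf

/-- The sheaf `𝓐^p_{𝒳/B}(𝓔)` on `𝒳`. -/
abbrev formSheaf (p : ℕ) : Sh (TopCat.of 𝒳) := (D.smoothForms F E p).sheaf

/-- The morphisms `d p` are the relative Dolbeault operators `∂̄_{𝒳/B}`. -/
def IsDolbeault (d : ∀ p, D.formSheaf F E p ⟶ D.formSheaf F E (p + 1)) : Prop :=
  ∀ (p : ℕ) (U : Opens 𝒳) (α : (D.smoothForms F E p).sections U)
    (β : (D.smoothForms F E (p + 1)).sections U), ((d p).hom.app (op U)).hom α = β →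
    ∀ x ∈ U, D.IsDbarAt F E x (extendZero U α.1) (extendZero U β.1)

/-- The morphism `ε` is the inclusion of `𝓔 ⊗ 𝒪_𝒳^ω` in the sheaf of relative `(0, 0)`-forms. -/
def IsInclusion (ε : D.analyticSheaf F E ⟶ D.formSheaf F E 0) : Prop :=
  ∀ (U : Opens 𝒳) (s : (D.analyticSections F E).sections U)
    (α : (D.smoothForms F E 0).sections U), (ε.hom.app (op U)).hom s = α →
    ∀ (x : U) (w : Fin 0 → D.vert x.1), (α.1 x).1 w = s.1 x

end bundle

section infinitesimal

variable {T : 𝒳 → Type} [∀ y, AddCommGroup (T y)] [∀ y, Module ℂ (T y)]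

/-- The condition defining `𝓜^k 𝓕`, where `𝓕` is the sheaf defined by `P` and `𝓜` is the ideal
generated by the pullbacks of the real analytic functions on `B` that vanish at the base point:
a germ is a finite sum of `(f₁ ∘ π) ⋯ (f_k ∘ π) a`, with such functions `f_l` and a section `a`
of `𝓕`. -/
def idealMul (P : LocalCondition T) (k : ℕ) : LocalCondition T where
  at_ x₀ := P.at_ x₀ ⊓ Submodule.span ℂ {s | ∃ (f : Fin k → B → ℂ) (a : ∀ x, T x),
    (∀ l, ContMDiffAt 𝓘(ℝ, BaseModel N) 𝓘(ℝ, ℂ) ω (f l) (D.π x₀) ∧ f l D.b₀ = 0) ∧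
    (∀ᶠ x in 𝓝 x₀, a ∈ P.at_ x) ∧ ∀ᶠ x in 𝓝 x₀, s x = (∏ l, f l (D.π x)) • a x}
  congr_at := by
    rintro x₀ s s' hs ⟨h, h'⟩
    refine ⟨P.congr_at x₀ s s' hs h, ?_⟩
    rw [← add_sub_cancel s s']
    refine Submodule.add_mem _ h' (Submodule.subset_span ⟨fun _ _ => 0, 0, fun l =>
      ⟨contMDiffAt_const, rfl⟩, Eventually.of_forall fun x => (P.at_ x).zero_mem, ?_⟩)
    filter_upwards [hs] with x hx
    simp [hx]

/-- The inclusion `𝓜^k 𝓕 ⟶ 𝓕`. -/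
def idealIncl (P : LocalCondition T) (k : ℕ) : (D.idealMul P k).sheaf ⟶ P.sheaf :=
  LocalCondition.incl fun _ => inf_le_left

/-- The quotient sheaf `𝓕 / 𝓜^{n+1} 𝓕` on `𝒳`, the restriction of `𝓕` to the `n`-th order
neighbourhood of the central fibre. -/
def jetSheaf (P : LocalCondition T) (n : ℕ) : Sh (TopCat.of 𝒳) :=
  Limits.cokernel (D.idealIncl P (n + 1))

/-- The projection `𝓕 ⟶ 𝓕 / 𝓜^{n+1} 𝓕`. -/
def jetProj (P : LocalCondition T) (n : ℕ) : P.sheaf ⟶ D.jetSheaf P n :=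
  Limits.cokernel.π (D.idealIncl P (n + 1))

end infinitesimal

end Deformation

end

noncomputable section
set_option linter.unusedSectionVars false

/-! ## Sections, restriction and local exactness -/

namespace Sh

variable {S : TopCat.{0}} {F G H : Sh S}

/-- The sections of `F` over `U`. -/
abbrev Sec (F : Sh S) (U : Opens S) : Type := F.obj.obj (op U)

/-- The restriction of sections. -/
def res (F : Sh S) {U V : Opens S} (h : V ≤ U) : F.Sec U →ₗ[ℂ] F.Sec V :=
  (F.obj.map (homOfLE h).op).hom

/-- A morphism of sheaves on sections. -/
def mapSec (f : F ⟶ G) (U : Opens S) : F.Sec U →ₗ[ℂ] G.Sec U := (f.hom.app (op U)).hom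

lemma mapSec_res (f : F ⟶ G) {U V : Opens S} (h : V ≤ U) (s : F.Sec U) :
  mapSec f V (F.res h s) = G.res h (mapSec f U s) := by
  have := f.hom.naturality (homOfLE h).op
  exact congrArg (fun φ => φ.hom s) this

@[simp] lemma res_res (F : Sh S) {U V W : Opens S} (h : V ≤ U) (h' : W ≤ V) (s : F.Sec U) :
  F.res h' (F.res h s) = F.res (h'.trans h) s := by
  have := F.obj.map_comp (homOfLE h).op (homOfLE h').op
  exact (congrArg (fun φ => φ.hom s) this).symm

@[simp] lemma res_self (F : Sh S) {U : Opens S} (h : U ≤ U) (s : F.Sec U) : F.res h s = s := by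
  have := F.obj.map_id (op U)
  exact congrArg (fun φ => φ.hom s) this

@[simp] lemma mapSec_comp (f : F ⟶ G) (g : G ⟶ H) (U : Opens S) (s : F.Sec U) :
  mapSec (f ≫ g) U s = mapSec g U (mapSec f U s) := rfl

@[simp] lemma mapSec_id (U : Opens S) (s : F.Sec U) : mapSec (𝟙 F) U s = s := rfl

@[simp] lemma mapSec_zero (U : Opens S) (s : F.Sec U) : mapSec (0 : F ⟶ G) U s = 0 := rfl

@[simp] lemma mapSec_add (f g : F ⟶ G) (U : Opens S) (s : F.Sec U) :
  mapSec (f + g) U s = mapSec f U s + mapSec g U s := rfl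

@[simp] lemma mapSec_sub (f g : F ⟶ G) (U : Opens S) (s : F.Sec U) :
  mapSec (f - g) U s = mapSec f U s - mapSec g U s := rfl

lemma hom_ext_sec {f g : F ⟶ G} (h : ∀ U s, mapSec f U s = mapSec g U s) : f = g := by
  apply ObjectProperty.hom_ext
  ext U s
  exact h U.unop s

lemma eq_of_locally (F : Sh S) {U : Opens S} {s t : F.Sec U}
  (h : ∀ x ∈ U, ∃ (V : Opens S) (hV : V ≤ U), x ∈ V ∧ F.res hV s = F.res hV t) : s = t := by
  choose V hV hx hst using h
  refine TopCat.Sheaf.eq_of_locally_eq'.{0} F (fun x : U => V x.1 x.2) U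
    (fun x => homOfLE (hV x.1 x.2)) (fun x hxU => Opens.mem_iSup.2 ⟨⟨x, hxU⟩, hx x hxU⟩) s t
    fun x => hst x.1 x.2

lemma eq_of_cover (F : Sh S) {U V W : Opens S} (hV : V ≤ U) (hW : W ≤ U) (hVW : U ≤ V ⊔ W)
  {s t : F.Sec U} (h₁ : F.res hV s = F.res hV t) (h₂ : F.res hW s = F.res hW t) : s = t :=
  F.eq_of_locally fun _ hx => (hVW hx).elim (fun hx => ⟨V, hV, hx, h₁⟩) fun hx => ⟨W, hW, hx, h₂⟩

lemma exists_glue (F : Sh S) {ι : Type} {U : Opens S} (V : ι → Opens S) (hV : ∀ i, V i ≤ U)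
  (hU : U ≤ iSup V) (s : ∀ i, F.Sec (V i))
  (h : ∀ i j, F.res (inf_le_left : V i ⊓ V j ≤ V i) (s i) = F.res inf_le_right (s j)) :
  ∃ t : F.Sec U, ∀ i, F.res (hV i) t = s i :=
  (TopCat.Sheaf.existsUnique_gluing'.{0} F V U (fun i => homOfLE (hV i)) hU s
    fun i j => h i j).exists

lemma exists_glue_two (F : Sh S) {U V W : Opens S} (hV : V ≤ U) (hW : W ≤ U) (hU : U ≤ V ⊔ W)
  (s : F.Sec V) (t : F.Sec W) (h : F.res (inf_le_left : V ⊓ W ≤ V) s = F.res inf_le_right t) :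
  ∃ r : F.Sec U, F.res hV r = s ∧ F.res hW r = t := by
  let Z : Bool → Opens S := fun b => bif b then V else W
  obtain ⟨r, hr⟩ := F.exists_glue (ι := Bool) (U := U) Z (by rintro (_ | _) <;> assumption)
    (hU.trans (sup_le (le_iSup Z true) (le_iSup Z false)))
    (fun b => match b with | true => s | false => t) (by
      rintro (_ | _) (_ | _)
      · rfl
      · have h' := congrArg (F.res (le_of_eq (inf_comm W V))) h
        simp only [res_res] at h'
        exact h'.symm
      · exact h
      · rfl)
  exact ⟨r, hr true, hr false⟩

/-- Sections of `G` killed by `g` come locally from `F`. -/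
def LocallyExact (f : F ⟶ G) (g : G ⟶ H) : Prop :=
  ∀ (U : Opens S) (s : G.Sec U), mapSec g U s = 0 →
    ∀ x ∈ U, ∃ (V : Opens S) (hV : V ≤ U), x ∈ V ∧ ∃ r : F.Sec V, mapSec f V r = G.res hV s

/-- The stalk functor on sheaves. -/
abbrev stalkAt (x : S) : Sh S ⥤ ModuleCat.{0} ℂ :=
  TopCat.Sheaf.forget (ModuleCat.{0} ℂ) S ⋙ TopCat.Presheaf.stalkFunctor (ModuleCat.{0} ℂ) x

/-- The germ of a section. -/
def germ (F : Sh S) (U : Opens S) (x : S) (hx : x ∈ U) : F.Sec U →ₗ[ℂ] (stalkAt x).obj F :=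
  (TopCat.Presheaf.germ F.obj U x hx).hom

lemma exists_germ (F : Sh S) {x : S} (t : (stalkAt x).obj F) :
  ∃ (U : Opens S) (hx : x ∈ U) (s : F.Sec U), F.germ U x hx s = t :=
  TopCat.Presheaf.exists_germ_eq F.obj t

lemma stalk_germ (f : F ⟶ G) (U : Opens S) (x : S) (hx : x ∈ U) (s : F.Sec U) :
  ((stalkAt x).map f).hom (F.germ U x hx s) = G.germ U x hx (mapSec f U s) :=
  TopCat.Presheaf.stalkFunctor_map_germ_apply U x hx f.hom s

lemma germ_res (F : Sh S) {U V : Opens S} (h : V ≤ U) (x : S) (hx : x ∈ V) (s : F.Sec U) :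
  F.germ V x hx (F.res h s) = F.germ U x (h hx) s :=
  TopCat.Presheaf.germ_res_apply F.obj (homOfLE h) x hx s

lemma exists_res_eq_of_germ_eq (F : Sh S) {U V : Opens S} (x : S) (hU : x ∈ U) (hV : x ∈ V)
  {s : F.Sec U} {t : F.Sec V} (h : F.germ U x hU s = F.germ V x hV t) :
  ∃ (W : Opens S) (_ : x ∈ W) (h₁ : W ≤ U) (h₂ : W ≤ V), F.res h₁ s = F.res h₂ t := by
  obtain ⟨W, hW, i, j, h⟩ := TopCat.Presheaf.germ_eq F.obj x hU hV s t h
  exact ⟨W, hW, leOfHom i, leOfHom j, h⟩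

lemma eq_of_germ (F : Sh S) {U : Opens S} {s t : F.Sec U}
  (h : ∀ x (hx : x ∈ U), F.germ U x hx s = F.germ U x hx t) : s = t :=
  TopCat.Presheaf.section_ext F U s t h

theorem exact_iff_locallyExact (K : ShortComplex (Sh S)) : K.Exact ↔ LocallyExact K.f K.g := by
  rw [TopCat.Sheaf.exact_iff_stalkFunctor_map_exact]
  simp only [ShortComplex.moduleCat_exact_iff]
  constructor
  · intro h U s hs x hx
    obtain ⟨r, hr⟩ := h x (K.X₂.germ U x hx s) ((stalk_germ K.g U x hx s).trans (by rw [hs, map_zero]; rfl))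
    obtain ⟨V, hV, r, rfl⟩ := exists_germ K.X₁ r
    have hr' := (stalk_germ K.f V x hV r).symm.trans hr
    obtain ⟨W, hW, h₁, h₂, e⟩ := K.X₂.exists_res_eq_of_germ_eq x hV hx hr'
    exact ⟨W, h₂, hW, K.X₁.res h₁ r, by rw [mapSec_res, e]⟩
  · intro h x t ht
    obtain ⟨U, hU, s, rfl⟩ := exists_germ K.X₂ t
    have ht' : K.X₃.germ U x hU (mapSec K.g U s) = K.X₃.germ U x hU 0 :=
      ((stalk_germ K.g U x hU s).symm.trans ht).trans (map_zero _).symm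
    obtain ⟨W, hW, h₁, h₂, e⟩ := K.X₃.exists_res_eq_of_germ_eq x hU hU ht'
    obtain ⟨V, hV, hx, r, hr⟩ := h W (K.X₂.res h₁ s) (by rw [mapSec_res, e, map_zero]) x hW
    refine ⟨K.X₁.germ V x hx r, (stalk_germ K.f V x hx r).trans ?_⟩
    rw [hr, germ_res, germ_res]

lemma mono_iff_injective (f : F ⟶ G) : Mono f ↔ ∀ U, Function.Injective (mapSec f U) := by
  rw [TopCat.Presheaf.mono_iff_stalk_mono]
  simp only [ModuleCat.mono_iff_injective]
  exact TopCat.Presheaf.app_injective_iff_stalkFunctor_map_injective f.hom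

lemma mapSec_injective (f : F ⟶ G) [Mono f] (U : Opens S) : Function.Injective (mapSec f U) :=
  (mono_iff_injective f).1 inferInstance U

/-- Epimorphisms of sheaves are locally surjective. -/
lemma locally_surjective (f : F ⟶ G) [Epi f] (U : Opens S) (s : G.Sec U) (x : S) (hx : x ∈ U) :
  ∃ (V : Opens S) (hV : V ≤ U), x ∈ V ∧ ∃ r : F.Sec V, mapSec f V r = G.res hV s :=
  (exact_iff_locallyExact (ShortComplex.mk f (0 : G ⟶ G) (by simp))).1
    ((ShortComplex.exact_iff_epi _ rfl).2 ‹_›) U s rfl x hx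

/-- The kernel of a morphism on sections, in the case of a cokernel. -/
lemma exists_of_cokernel_eq_zero (f : F ⟶ G) [Mono f] (U : Opens S) (s : G.Sec U)
  (hs : mapSec (Limits.cokernel.π f) U s = 0) : ∃ r : F.Sec U, mapSec f U r = s := by
  have h := (exact_iff_locallyExact (ShortComplex.mk f (Limits.cokernel.π f) (by simp))).1
    (ShortComplex.exact_cokernel f) U s hs
  choose V hV hx r hr using h
  obtain ⟨t, ht⟩ := F.exists_glue (fun x : U => V x.1 x.2) (fun x => hV x.1 x.2)
    (fun x hxU => Opens.mem_iSup.2 ⟨⟨x, hxU⟩, hx x hxU⟩) (fun x => r x.1 x.2) (by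
      intro x y
      apply mapSec_injective f
      rw [mapSec_res, mapSec_res, hr, hr, res_res, res_res])
  refine ⟨t, G.eq_of_locally fun x hxU => ⟨V x hxU, hV x hxU, hx x hxU, ?_⟩⟩
  rw [← mapSec_res, ht ⟨x, hxU⟩, hr]

lemma isZero_of_subsingleton (h : ∀ U, Subsingleton (F.Sec U)) : Limits.IsZero F := by
  rw [Limits.IsZero.iff_id_eq_zero]
  exact hom_ext_sec fun U s => Subsingleton.elim _ _

/-! ## Inverse images and stalks -/

section pullback
variable {Z : TopCat.{0}} (φ : S ⟶ Z)

lemma comp_comp_eq {C : Type*} [Category C] {a b b' c d : C} {f : a ⟶ b} {g : b ⟶ c}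
  {f' : a ⟶ b'} {g' : b' ⟶ c} (h : f ≫ g = f' ≫ g') (k : c ⟶ d) : f ≫ g ≫ k = f' ≫ g' ≫ k := by
  rw [← Category.assoc, h, Category.assoc]

lemma square_paste {C : Type*} [Category C] {x₁ x₂ x₃ y₁ y₂ y₃ : C} {a : x₁ ⟶ y₁} {b : x₂ ⟶ y₂}
  {c : x₃ ⟶ y₃} {p : x₁ ⟶ x₂} {q : x₂ ⟶ x₃} {p' : y₁ ⟶ y₂} {q' : y₂ ⟶ y₃}
  (h : a ≫ p' = p ≫ b) (h' : b ≫ q' = q ≫ c) : a ≫ p' ≫ q' = (p ≫ q) ≫ c := by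
  rw [← Category.assoc, h, Category.assoc, h', Category.assoc]

lemma stalkPullbackHom_naturality (x : S) {F G : TopCat.Presheaf (ModuleCat.{0} ℂ) Z} (f : F ⟶ G) :
  (TopCat.Presheaf.stalkFunctor _ (φ x)).map f ≫
  TopCat.Presheaf.stalkPullbackHom (ModuleCat.{0} ℂ) φ G x =
  TopCat.Presheaf.stalkPullbackHom (ModuleCat.{0} ℂ) φ F x ≫
  (TopCat.Presheaf.stalkFunctor _ x).map ((TopCat.Presheaf.pullback _ φ).map f) := by
  apply TopCat.Presheaf.stalk_hom_ext
  intro U hU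
  have h := congrArg (fun η => NatTrans.app η (op U))
    ((TopCat.Presheaf.pullbackPushforwardAdjunction (ModuleCat.{0} ℂ) φ).unit.naturality f)
  refine (TopCat.Presheaf.stalkFunctor_map_germ_assoc U (φ x) hU f _).trans ?_
  refine (congrArg (f.app (op U) ≫ ·)
    (TopCat.Presheaf.germ_stalkPullbackHom (ModuleCat.{0} ℂ) φ G x U hU)).trans ?_
  refine Eq.trans ?_ (TopCat.Presheaf.germ_stalkPullbackHom_assoc (ModuleCat.{0} ℂ) φ F x U hU
    _).symm
  refine Eq.trans ?_ (congrArg (((TopCat.Presheaf.pullbackPushforwardAdjunction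
    (ModuleCat.{0} ℂ) φ).unit.app F).app (op U) ≫ ·) (TopCat.Presheaf.stalkFunctor_map_germ
      ((Opens.map φ).obj U) x hU ((TopCat.Presheaf.pullback (ModuleCat.{0} ℂ) φ).map f)).symm)
  exact comp_comp_eq h _

/-- The stalks of an inverse image. -/
def stalkPullback (x : S) :
  stalkAt (φ x) ≅ TopCat.Sheaf.pullback (ModuleCat.{0} ℂ) φ ⋙ stalkAt x := by
  refine (NatIso.ofComponents (fun F => ?_) ?_ :
    stalkAt (φ x) ≅ (TopCat.Sheaf.forget (ModuleCat.{0} ℂ) Z ⋙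
      TopCat.Presheaf.pullback (ModuleCat.{0} ℂ) φ ⋙ presheafToSheaf _ _) ⋙ stalkAt x) ≪≫
    Functor.isoWhiskerRight (TopCat.Sheaf.pullbackIso _ φ).symm (stalkAt x)
  · refine TopCat.Presheaf.stalkPullbackIso (ModuleCat.{0} ℂ) φ F.obj x ≪≫ ?_
    have := TopCat.Presheaf.stalkFunctor_map_unit_toSheafify_isIso x (ModuleCat.{0} ℂ)
      ((TopCat.Presheaf.pullback (ModuleCat.{0} ℂ) φ).obj F.obj)
    exact @asIso _ _ _ _ _ this
  · intro F G f
    have h₁ := stalkPullbackHom_naturality φ x f.hom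
    have h₂ := congrArg (TopCat.Presheaf.stalkFunctor (ModuleCat.{0} ℂ) x).map
      (CategoryTheory.toSheafify_naturality (Opens.grothendieckTopology S)
        ((TopCat.Presheaf.pullback (ModuleCat.{0} ℂ) φ).map f.hom))
    rw [Functor.map_comp, Functor.map_comp] at h₂
    exact square_paste h₁ h₂

instance : (TopCat.Sheaf.pullback (ModuleCat.{0} ℂ) φ).Additive :=
  haveI : (TopCat.Sheaf.pushforward (ModuleCat.{0} ℂ) φ).Additive := ⟨rfl⟩
  (TopCat.Sheaf.pullbackPushforwardAdjunction (ModuleCat.{0} ℂ) φ).left_adjoint_additive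

lemma pullback_exact {K : ShortComplex (Sh Z)} (hK : K.Exact) :
  (K.map (TopCat.Sheaf.pullback (ModuleCat.{0} ℂ) φ)).Exact := by
  rw [TopCat.Sheaf.exact_iff_stalkFunctor_map_exact] at hK ⊢
  intro x
  exact (ShortComplex.exact_iff_of_iso (K.mapNatIso (stalkPullback φ x))).1 (hK (φ x))

open ZeroObject in
lemma pullback_mono {F G : Sh Z} (f : F ⟶ G) [Mono f] :
  Mono ((TopCat.Sheaf.pullback (ModuleCat.{0} ℂ) φ).map f) := by
  have h := pullback_exact φ ((ShortComplex.exact_iff_mono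
    (ShortComplex.mk (0 : 0 ⟶ F) f (by simp)) rfl).2 ‹_›)
  exact (ShortComplex.exact_iff_mono _ (Functor.map_zero _ _ _)).1 h

lemma pullback_stalk_eq_zero (x : S) {F G : Sh Z} (f : F ⟶ G) (h : (stalkAt (φ x)).map f = 0) :
  (stalkAt x).map ((TopCat.Sheaf.pullback (ModuleCat.{0} ℂ) φ).map f) = 0 := by
  have := (stalkPullback φ x).hom.naturality f
  rw [h, Limits.zero_comp] at this
  rw [← cancel_epi ((stalkPullback φ x).hom.app F), Limits.comp_zero]
  exact this.symm

end pullback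

end Sh

/-! ## Soft sheaves -/

namespace Sh

variable {S : TopCat.{0}} {F G H : Sh S}

/-- Sections near a closed set extend to global sections, after shrinking. -/
def IsSoft (F : Sh S) : Prop :=
  ∀ (U : Opens S) (s : F.Sec U) (K : Set S), IsClosed K → K ⊆ U →
    ∃ (t : F.Sec ⊤) (V : Opens S) (hV : V ≤ U), K ⊆ V ∧ F.res le_top t = F.res hV s

lemma IsSoft.of_retract (hG : IsSoft G) (i : F ⟶ G) (r : G ⟶ F) (h : i ≫ r = 𝟙 F) : IsSoft F := by
  intro U s K hK hKU
  obtain ⟨t, V, hV, hKV, e⟩ := hG U (mapSec i U s) K hK hKU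
  refine ⟨mapSec r ⊤ t, V, hV, hKV, ?_⟩
  rw [← mapSec_res, e, mapSec_res, ← mapSec_comp, h, mapSec_id]

lemma exists_of_locallyExact (f : F ⟶ G) [Mono f] (g : G ⟶ H) (h : LocallyExact f g)
  (U : Opens S) (s : G.Sec U) (hs : mapSec g U s = 0) : ∃ r : F.Sec U, mapSec f U r = s := by
  have h := h U s hs
  choose V hV hx r hr using h
  obtain ⟨t, ht⟩ := F.exists_glue (fun x : U => V x.1 x.2) (fun x => hV x.1 x.2)
    (fun x hxU => Opens.mem_iSup.2 ⟨⟨x, hxU⟩, hx x hxU⟩) (fun x => r x.1 x.2) (by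
      intro x y
      apply mapSec_injective f
      rw [mapSec_res, mapSec_res, hr, hr, res_res, res_res])
  refine ⟨t, G.eq_of_locally fun x hxU => ⟨V x hxU, hV x hxU, hx x hxU, ?_⟩⟩
  rw [← mapSec_res, ht ⟨x, hxU⟩, hr]

section

variable [CompactSpace S] [T2Space S]

/-- Sections of a quotient by a soft subsheaf lift near closed sets. -/
lemma exists_lift_near (f : F ⟶ G) [Mono f] (g : G ⟶ H) (w : f ≫ g = 0) (hfg : LocallyExact f g)
  (hF : IsSoft F) (hg : ∀ (U : Opens S) (s : H.Sec U), ∀ x ∈ U,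
  ∃ (V : Opens S) (hV : V ≤ U), x ∈ V ∧ ∃ r : G.Sec V, mapSec g V r = H.res hV s)
  (U : Opens S) (s : H.Sec U) (K : Set S) (hK : IsClosed K) (hKU : K ⊆ U) :
  ∃ (V : Opens S) (hV : V ≤ U), K ⊆ V ∧ ∃ t : G.Sec V, mapSec g V t = H.res hV s := by
  suffices h : ∃ (V : Opens S) (hV : V ≤ U), closure K ⊆ V ∧
      ∃ t : G.Sec V, mapSec g V t = H.res hV s by rwa [hK.closure_eq] at h
  refine hK.isCompact.induction_on (p := fun A => ∃ (V : Opens S) (hV : V ≤ U), closure A ⊆ V ∧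
    ∃ t : G.Sec V, mapSec g V t = H.res hV s) ?_ ?_ ?_ ?_
  · refine ⟨⊥, bot_le, by simp, 0, H.eq_of_locally fun x hx => hx.elim⟩
  · rintro A B hAB ⟨V, hV, h, t⟩
    exact ⟨V, hV, (closure_mono hAB).trans h, t⟩
  · rintro A B ⟨V₁, hV₁, h₁, t₁, e₁⟩ ⟨V₂, hV₂, h₂, t₂, e₂⟩
    obtain ⟨e, he⟩ := exists_of_locallyExact f g hfg (V₁ ⊓ V₂)
      (G.res inf_le_left t₁ - G.res inf_le_right t₂) (by
        rw [map_sub, mapSec_res, mapSec_res, e₁, e₂, res_res, res_res, sub_self])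
    obtain ⟨e', W, hW, hKW, hee⟩ := hF _ e (closure A ∩ closure B)
      (isClosed_closure.inter isClosed_closure) fun x hx => ⟨h₁ hx.1, h₂ hx.2⟩
    obtain ⟨O₁, O₂, hO₁, hO₂, hA, hB, hd⟩ := NormalSpace.normal (closure A \ W) (closure B \ W)
      (isClosed_closure.sdiff W.isOpen) (isClosed_closure.sdiff W.isOpen) (by
        rw [Set.disjoint_left]
        rintro x ⟨ha, hw⟩ ⟨hb, -⟩
        exact hw (hKW ⟨ha, hb⟩))
    let V₁' := V₁ ⊓ (⟨O₁, hO₁⟩ ⊔ W)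
    let V₂' := V₂ ⊓ (⟨O₂, hO₂⟩ ⊔ W)
    have hVW : V₁' ⊓ V₂' ≤ W := by
      rintro x ⟨⟨-, hx₁⟩, -, hx₂⟩
      rcases hx₁ with hx₁ | hx₁
      · rcases hx₂ with hx₂ | hx₂
        · exact (Set.disjoint_left.1 hd hx₁ hx₂).elim
        · exact hx₂
      · exact hx₁
    obtain ⟨r, hr₁, hr₂⟩ := G.exists_glue_two (U := V₁' ⊔ V₂') le_sup_left le_sup_right le_rfl
      (G.res inf_le_left t₁) (G.res inf_le_left t₂ + G.res le_top (mapSec f ⊤ e')) (by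
        have h := congrArg (fun z => G.res hVW (mapSec f W z)) hee
        simp only [mapSec_res, he, map_sub, res_res] at h
        rw [map_add, res_res, res_res, res_res, h]
        abel)
    have hle₁ : V₁' ≤ U := inf_le_left.trans hV₁
    have hle₂ : V₂' ≤ U := inf_le_left.trans hV₂
    refine ⟨V₁' ⊔ V₂', sup_le hle₁ hle₂, ?_, r, ?_⟩
    · rw [closure_union]
      rintro x (hx | hx)
      · refine Or.inl ⟨h₁ hx, ?_⟩
        by_cases hw : x ∈ W
        · exact Or.inr hw
        · exact Or.inl (hA ⟨hx, hw⟩)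
      · refine Or.inr ⟨h₂ hx, ?_⟩
        by_cases hw : x ∈ W
        · exact Or.inr hw
        · exact Or.inl (hB ⟨hx, hw⟩)
    · refine H.eq_of_cover (V := V₁') (W := V₂') le_sup_left le_sup_right le_rfl ?_ ?_
      · rw [← mapSec_res, hr₁, mapSec_res, e₁, res_res, res_res]
      · rw [← mapSec_res, hr₂, map_add, mapSec_res, e₂, res_res, res_res, mapSec_res,
          ← mapSec_comp, w, mapSec_zero, map_zero, add_zero]
  · intro x hx
    obtain ⟨V, hV, hxV, r, hr⟩ := hg U s x (hKU hx)
    obtain ⟨A, hA, hA', hAV⟩ := exists_mem_nhds_isClosed_subset (V.isOpen.mem_nhds hxV)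
    exact ⟨A, mem_nhdsWithin_of_mem_nhds hA, V, hV, by rwa [hA'.closure_eq], r, hr⟩

lemma isSoft_quotient (f : F ⟶ G) [Mono f] (g : G ⟶ H) (w : f ≫ g = 0)
  (hfg : LocallyExact f g) (hF : IsSoft F) (hG : IsSoft G)
  (hg : ∀ (U : Opens S) (s : H.Sec U), ∀ x ∈ U,
  ∃ (V : Opens S) (hV : V ≤ U), x ∈ V ∧ ∃ r : G.Sec V, mapSec g V r = H.res hV s) : IsSoft H := by
  intro U s K hK hKU
  obtain ⟨V, hV, hKV, t, ht⟩ := exists_lift_near f g w hfg hF hg U s K hK hKU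
  obtain ⟨t', W, hW, hKW, e⟩ := hG V t K hK hKV
  refine ⟨mapSec g ⊤ t', W, hW.trans hV, hKW, ?_⟩
  rw [← mapSec_res, e, mapSec_res, ht, res_res]

/-- An exact complex of soft sheaves stays exact on global sections. -/
theorem exact_sections_of_isSoft {K : ℕ → Sh S} (d : ∀ n, K n ⟶ K (n + 1)) [Mono (d 0)]
  (w : ∀ n, d n ≫ d (n + 1) = 0) (hd : ∀ n, LocallyExact (d n) (d (n + 1)))
  (hK : ∀ n, IsSoft (K n)) (n : ℕ) (z : (K (n + 1)).Sec ⊤) (hz : mapSec (d (n + 1)) ⊤ z = 0) :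
  ∃ y, mapSec (d n) ⊤ y = z := by
  have hker : ∀ {A B : Sh S} (f : A ⟶ B), LocallyExact (Limits.kernel.ι f) f := fun f =>
    (exact_iff_locallyExact _).1 (ShortComplex.exact_kernel f)
  let g (n) : K n ⟶ Limits.kernel (d (n + 1)) := Limits.kernel.lift _ (d n) (w n)
  have hg (n) : g n ≫ Limits.kernel.ι _ = d n := Limits.kernel.lift_ι _ _ _
  have wg (n) : Limits.kernel.ι (d n) ≫ g n = 0 := by
    rw [← cancel_mono (Limits.kernel.ι (d (n + 1))), Category.assoc, hg,
      Limits.kernel.condition, Limits.zero_comp]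
  have eg (n) : LocallyExact (Limits.kernel.ι (d n)) (g n) := fun U s hs =>
    hker (d n) U s (by rw [← hg n, mapSec_comp, hs, map_zero])
  have sg (n) : ∀ (U : Opens S) (s : (Limits.kernel (d (n + 1))).Sec U), ∀ x ∈ U,
      ∃ (V : Opens S) (hV : V ≤ U), x ∈ V ∧ ∃ r : (K n).Sec V, mapSec (g n) V r =
        (Limits.kernel (d (n + 1))).res hV s := by
    intro U s x hx
    obtain ⟨V, hV, hxV, r, hr⟩ := hd n U (mapSec (Limits.kernel.ι (d (n + 1))) U s) (by
      rw [← mapSec_comp, Limits.kernel.condition, mapSec_zero]) x hx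
    refine ⟨V, hV, hxV, r, mapSec_injective (Limits.kernel.ι (d (n + 1))) V ?_⟩
    rw [← mapSec_comp, hg, hr, mapSec_res]
  have soft (n) : IsSoft (Limits.kernel (d n)) := by
    induction n with
    | zero =>
      intro U s L hL hLU
      have : s = 0 := by
        apply mapSec_injective (Limits.kernel.ι (d 0))
        apply mapSec_injective (d 0)
        rw [← mapSec_comp, Limits.kernel.condition, mapSec_zero, map_zero, map_zero]
      exact ⟨0, U, le_rfl, hLU, by simp [this]⟩
    | succ n ih => exact isSoft_quotient _ (g n) (wg n) (eg n) ih (hK n) (sg n)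
  obtain ⟨z', rfl⟩ := exists_of_locallyExact _ _ (hker (d (n + 1))) ⊤ z hz
  obtain ⟨V, hV, hTV, t, ht⟩ := exists_lift_near _ (g n) (wg n) (eg n) (soft n) (sg n) ⊤ z'
    Set.univ isClosed_univ (fun _ _ => trivial)
  obtain rfl : V = ⊤ := top_le_iff.1 fun x _ => hTV trivial
  refine ⟨t, ?_⟩
  rw [← hg n, mapSec_comp, ht, res_self]

end

/-! ### Injective sheaves are soft -/

/-- The condition defining the sheaf of arbitrary families of germs. -/
def anyGerms (F : Sh S) : LocalCondition (Y := S) fun x => ((stalkAt x).obj F : Type) where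
  at_ _ := ⊤
  congr_at _ _ _ _ _ := trivial

/-- The sheaf of arbitrary families of germs. -/
def godement (F : Sh S) : Sh S := F.anyGerms.sheaf

/-- The embedding of a sheaf in its sheaf of families of germs. -/
def toGodement (F : Sh S) : F ⟶ F.godement :=
  ⟨{ app U := ModuleCat.ofHom
      { toFun s := ⟨fun x => F.germ U.unop x.1 x.2 s, fun _ _ => trivial⟩
        map_add' s t := by
          apply Subtype.ext
          funext x
          exact map_add (F.germ U.unop x.1 x.2) s t
        map_smul' c s := by
          apply Subtype.ext
          funext x
          exact map_smul (F.germ U.unop x.1 x.2) c s }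
     naturality U V f := by
      ext s
      apply Subtype.ext
      funext x
      exact F.germ_res (leOfHom f.unop) x.1 x.2 s }⟩

instance (F : Sh S) : Mono F.toGodement := by
  rw [mono_iff_injective]
  intro U s t h
  apply F.eq_of_germ
  intro x hx
  exact congrFun (congrArg Subtype.val h) ⟨x, hx⟩

open scoped Classical in
lemma isSoft_godement (F : Sh S) : IsSoft F.godement := by
  intro U s K hK hKU
  refine ⟨⟨fun x => if h : x.1 ∈ U then s.1 ⟨x.1, h⟩ else 0, fun _ _ => trivial⟩, U, le_rfl, hKU,
    ?_⟩
  apply Subtype.ext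
  funext x
  exact dif_pos x.2

lemma isSoft_of_injective (F : Sh S) [Injective F] : IsSoft F :=
  F.isSoft_godement.of_retract F.toGodement (Injective.factorThru (𝟙 F) F.toGodement)
    (Injective.comp_factorThru _ _)

lemma IsSoft.biprod (hF : IsSoft F) (hG : IsSoft G) : IsSoft (F ⊞ G) := by
  intro U s K hK hKU
  obtain ⟨t, V, hV, hKV, e⟩ := hF U (mapSec Limits.biprod.fst U s) K hK hKU
  obtain ⟨t', V', hV', hKV', e'⟩ := hG U (mapSec Limits.biprod.snd U s) K hK hKU
  refine ⟨mapSec Limits.biprod.inl ⊤ t + mapSec Limits.biprod.inr ⊤ t', V ⊓ V',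
    inf_le_left.trans hV, fun x hx => ⟨hKV hx, hKV' hx⟩, ?_⟩
  have e₁ := congrArg (F.res (inf_le_left : V ⊓ V' ≤ V)) e
  have e₂ := congrArg (G.res (inf_le_right : V ⊓ V' ≤ V')) e'
  rw [res_res, res_res] at e₁ e₂
  rw [map_add, ← mapSec_res, ← mapSec_res, e₁, e₂, mapSec_res, mapSec_res, ← mapSec_comp,
    ← mapSec_comp, ← map_add, ← mapSec_add, Limits.biprod.total, mapSec_id]

end Sh

/-! ## Cohomology of soft sheaves and soft resolutions -/

/-- Extension of a morphism from an exact complex to a complex of injectives. -/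
lemma exists_hom_to_injectives {C : Type*} [Category C] [Abelian C] {E : C} {A I : ℕ → C}
  (ε : E ⟶ A 0) [Mono ε] (d : ∀ n, A n ⟶ A (n + 1)) (wε : ε ≫ d 0 = 0)
  (w : ∀ n, d n ≫ d (n + 1) = 0) (e₀ : (ShortComplex.mk ε (d 0) wε).Exact)
  (e : ∀ n, (ShortComplex.mk (d n) (d (n + 1)) (w n)).Exact)
  [∀ n, Injective (I n)] (η : E ⟶ I 0) (δ : ∀ n, I n ⟶ I (n + 1)) (wη : η ≫ δ 0 = 0)
  (wδ : ∀ n, δ n ≫ δ (n + 1) = 0) :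
  ∃ f : ∀ n, A n ⟶ I n, ε ≫ f 0 = η ∧ ∀ n, f n ≫ δ n = d n ≫ f (n + 1) := by
  let f₀ := Injective.factorThru η ε
  have h₀ : ε ≫ f₀ = η := Injective.comp_factorThru _ _
  let f₁ := e₀.descToInjective (f₀ ≫ δ 0)
    (by change ε ≫ f₀ ≫ δ 0 = 0; rw [← Category.assoc, h₀, wη])
  have h₁ : d 0 ≫ f₁ = f₀ ≫ δ 0 := e₀.comp_descToInjective _ _
  let step (n : ℕ) (p : (f : A n ⟶ I n) ×' (f' : A (n + 1) ⟶ I (n + 1)) ×'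
      f ≫ δ n = d n ≫ f') :
      (f' : A (n + 1) ⟶ I (n + 1)) ×' (f'' : A (n + 2) ⟶ I (n + 2)) ×'
        f' ≫ δ (n + 1) = d (n + 1) ≫ f'' :=
    have h : d n ≫ p.2.1 ≫ δ (n + 1) = 0 := by
      rw [← Category.assoc, ← p.2.2, Category.assoc, wδ, Limits.comp_zero]
    ⟨p.2.1, (e n).descToInjective (p.2.1 ≫ δ (n + 1)) h,
      ((e n).comp_descToInjective _ h).symm⟩
  let q : ∀ n, (f : A n ⟶ I n) ×' (f' : A (n + 1) ⟶ I (n + 1)) ×' f ≫ δ n = d n ≫ f' :=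
    fun n => Nat.rec ⟨f₀, f₁, h₁.symm⟩ step n
  exact ⟨fun n => (q n).1, h₀, fun n => (q n).2.2⟩

namespace Sh

variable {S : TopCat.{0}}

/-- The terms of the mapping cone of a morphism of complexes, with the first one augmented. -/
def coneObj (A I : ℕ → Sh S) : ℕ → Sh S
  | 0 => A 0
  | n + 1 => A (n + 1) ⊞ I n

open Limits in
/-- The differential of the mapping cone. -/
def coneD {A I : ℕ → Sh S} (d : ∀ n, A n ⟶ A (n + 1)) (δ : ∀ n, I n ⟶ I (n + 1))
    (f : ∀ n, A n ⟶ I n) : ∀ n, coneObj A I n ⟶ coneObj A I (n + 1)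
  | 0 => biprod.lift (-d 0) (f 0)
  | n + 1 => biprod.lift (-(biprod.fst ≫ d (n + 1))) (biprod.fst ≫ f (n + 1) + biprod.snd ≫ δ n)

lemma biprod_ext_sec {F G : Sh S} {U : Opens S} {s t : (F ⊞ G).Sec U}
  (h₁ : mapSec Limits.biprod.fst U s = mapSec Limits.biprod.fst U t)
  (h₂ : mapSec Limits.biprod.snd U s = mapSec Limits.biprod.snd U t) : s = t := by
  rw [← mapSec_id U s, ← mapSec_id U t, ← Limits.biprod.total, mapSec_add, mapSec_add,
    mapSec_comp, mapSec_comp, mapSec_comp, mapSec_comp, h₁, h₂]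

lemma mapSec_mapSec {F G H : Sh S} {f : F ⟶ G} {g : G ⟶ H} {k : F ⟶ H} (h : f ≫ g = k)
  (U : Opens S) (s : F.Sec U) : mapSec g U (mapSec f U s) = mapSec k U s := by
  rw [← h, mapSec_comp]

lemma biprod_fst_add {F G : Sh S} {U : Opens S} (a : F.Sec U) (i : G.Sec U) :
  mapSec (Limits.biprod.fst : F ⊞ G ⟶ F) U
  (mapSec Limits.biprod.inl U a + mapSec Limits.biprod.inr U i) = a := by
  rw [map_add, ← mapSec_comp, ← mapSec_comp, Limits.biprod.inl_fst, Limits.biprod.inr_fst,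
    mapSec_id, mapSec_zero, add_zero]

lemma biprod_snd_add {F G : Sh S} {U : Opens S} (a : F.Sec U) (i : G.Sec U) :
  mapSec (Limits.biprod.snd : F ⊞ G ⟶ G) U
  (mapSec Limits.biprod.inl U a + mapSec Limits.biprod.inr U i) = i := by
  rw [map_add, ← mapSec_comp, ← mapSec_comp, Limits.biprod.inl_snd, Limits.biprod.inr_snd,
    mapSec_id, mapSec_zero, zero_add]

section cone

variable {E : Sh S} {A I : ℕ → Sh S} (ε : E ⟶ A 0) (d : ∀ n, A n ⟶ A (n + 1))
  (η : E ⟶ I 0) (δ : ∀ n, I n ⟶ I (n + 1)) (f : ∀ n, A n ⟶ I n)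

/-- The pair `(a, i)` as a section of the cone. -/
def conePair {n : ℕ} {U : Opens S} (a : (A (n + 1)).Sec U) (i : (I n).Sec U) :
  (coneObj A I (n + 1)).Sec U :=
  mapSec Limits.biprod.inl U a + mapSec Limits.biprod.inr U i

/-- The first component of a section of the cone. -/
def coneFst {n : ℕ} {U : Opens S} : (coneObj A I (n + 1)).Sec U →ₗ[ℂ] (A (n + 1)).Sec U :=
  mapSec (Limits.biprod.fst : A (n + 1) ⊞ I n ⟶ _) U
/-- The second component of a section of the cone. -/
def coneSnd {n : ℕ} {U : Opens S} : (coneObj A I (n + 1)).Sec U →ₗ[ℂ] (I n).Sec U :=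
  mapSec (Limits.biprod.snd : A (n + 1) ⊞ I n ⟶ _) U

@[simp] lemma coneFst_pair {n : ℕ} {U : Opens S} (a : (A (n + 1)).Sec U) (i : (I n).Sec U) :
  coneFst (conePair a i) = a := biprod_fst_add a i

@[simp] lemma coneSnd_pair {n : ℕ} {U : Opens S} (a : (A (n + 1)).Sec U) (i : (I n).Sec U) :
  coneSnd (conePair a i) = i := biprod_snd_add a i

lemma cone_ext {n : ℕ} {U : Opens S} {s t : (coneObj A I (n + 1)).Sec U}
  (h₁ : coneFst s = coneFst t) (h₂ : coneSnd s = coneSnd t) : s = t :=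
  biprod_ext_sec h₁ h₂

@[simp] lemma coneFst_d_zero {U : Opens S} (s : (A 0).Sec U) :
  coneFst (mapSec (coneD d δ f 0) U s) = -mapSec (d 0) U s :=
  mapSec_mapSec (Limits.biprod.lift_fst (-d 0) (f 0)) U s

@[simp] lemma coneSnd_d_zero {U : Opens S} (s : (A 0).Sec U) :
  coneSnd (mapSec (coneD d δ f 0) U s) = mapSec (f 0) U s :=
  mapSec_mapSec (Limits.biprod.lift_snd (-d 0) (f 0)) U s

@[simp] lemma coneFst_d_succ (n : ℕ) {U : Opens S} (s : (coneObj A I (n + 1)).Sec U) :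
  coneFst (mapSec (coneD d δ f (n + 1)) U s) = -mapSec (d (n + 1)) U (coneFst s) :=
  mapSec_mapSec (F := A (n + 1) ⊞ I n) (Limits.biprod.lift_fst (-(Limits.biprod.fst ≫ d (n + 1)))
    (Limits.biprod.fst ≫ f (n + 1) + Limits.biprod.snd ≫ δ n)) U s

@[simp] lemma coneSnd_d_succ (n : ℕ) {U : Opens S} (s : (coneObj A I (n + 1)).Sec U) :
  coneSnd (mapSec (coneD d δ f (n + 1)) U s) =
  mapSec (f (n + 1)) U (coneFst s) + mapSec (δ n) U (coneSnd s) :=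
  mapSec_mapSec (F := A (n + 1) ⊞ I n) (Limits.biprod.lift_snd (-(Limits.biprod.fst ≫ d (n + 1)))
    (Limits.biprod.fst ≫ f (n + 1) + Limits.biprod.snd ≫ δ n)) U s

lemma coneObj_isSoft (hA : ∀ n, IsSoft (A n)) (hI : ∀ n, IsSoft (I n)) :
    ∀ n, IsSoft (coneObj A I n)
  | 0 => hA 0
  | n + 1 => (hA (n + 1)).biprod (hI n)

variable {ε d η δ f}

lemma coneD_mono (e₀ : LocallyExact ε (d 0)) [Mono ε] [Mono η] (hf₀ : ε ≫ f 0 = η) :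
  Mono (coneD d δ f 0) := by
  rw [mono_iff_injective]
  intro U
  rw [injective_iff_map_eq_zero]
  intro s hs
  have h₁ := coneFst_d_zero d δ f s
  have h₂ := coneSnd_d_zero d δ f s
  rw [hs, map_zero] at h₁ h₂
  obtain ⟨r, rfl⟩ := exists_of_locallyExact ε (d 0) e₀ U s (neg_eq_zero.1 h₁.symm)
  rw [mapSec_mapSec hf₀] at h₂
  rw [mapSec_injective η U (h₂.symm.trans (map_zero _).symm)]
  exact map_zero _

lemma coneD_comp (w : ∀ n, d n ≫ d (n + 1) = 0) (wδ : ∀ n, δ n ≫ δ (n + 1) = 0)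
  (hf : ∀ n, f n ≫ δ n = d n ≫ f (n + 1)) (n : ℕ) : coneD d δ f n ≫ coneD d δ f (n + 1) = 0 := by
  have hw (n) {U} (s : (A n).Sec U) : mapSec (d (n + 1)) U (mapSec (d n) U s) = 0 :=
    mapSec_mapSec (w n) U s
  have hwδ (n) {U} (s : (I n).Sec U) : mapSec (δ (n + 1)) U (mapSec (δ n) U s) = 0 :=
    mapSec_mapSec (wδ n) U s
  have hc (n) {U} (s : (A n).Sec U) :
      mapSec (δ n) U (mapSec (f n) U s) = mapSec (f (n + 1)) U (mapSec (d n) U s) :=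
    mapSec_mapSec (hf n) U s
  apply hom_ext_sec
  intro U s
  change mapSec _ U (mapSec _ U s) = 0
  refine cone_ext ?_ ?_
  · rw [coneFst_d_succ, map_zero, neg_eq_zero]
    cases n with
    | zero =>
      exact (congrArg _ (coneFst_d_zero d δ f s)).trans ((map_neg _ _).trans
        ((congrArg Neg.neg (hw 0 s)).trans neg_zero))
    | succ n => rw [coneFst_d_succ, map_neg, hw, neg_zero]
  · rw [coneSnd_d_succ, map_zero]
    cases n with
    | zero =>
      refine (congrArg₂ (fun a b => mapSec (f 1) U a + mapSec (δ 0) U b)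
        (coneFst_d_zero d δ f s) (coneSnd_d_zero d δ f s)).trans ?_
      exact (congrArg₂ (· + ·) (map_neg _ _) (hc 0 s)).trans (neg_add_cancel _)
    | succ n => simp [hwδ, hc]

lemma coneD_exact (e : ∀ n, LocallyExact (d n) (d (n + 1))) (e₀' : LocallyExact η (δ 0))
    (e' : ∀ n, LocallyExact (δ n) (δ (n + 1))) (wε : ε ≫ d 0 = 0) (hf₀ : ε ≫ f 0 = η)
    (hf : ∀ n, f n ≫ δ n = d n ≫ f (n + 1)) (n : ℕ) :
    LocallyExact (coneD d δ f n) (coneD d δ f (n + 1)) := by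
  have hc (n) {U} (s : (A n).Sec U) :
      mapSec (δ n) U (mapSec (f n) U s) = mapSec (f (n + 1)) U (mapSec (d n) U s) :=
    mapSec_mapSec (hf n) U s
  have hres {n} {U V : Opens S} (h : V ≤ U) (s : (coneObj A I (n + 1)).Sec U) :
      coneFst ((coneObj A I (n + 1)).res h s) = (A (n + 1)).res h (coneFst s) ∧
      coneSnd ((coneObj A I (n + 1)).res h s) = (I n).res h (coneSnd s) :=
    ⟨mapSec_res (F := A (n + 1) ⊞ I n) _ _ _, mapSec_res (F := A (n + 1) ⊞ I n) _ _ _⟩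
  intro U s hs x hx
  have h₁ := coneFst_d_succ d δ f n s
  have h₂ := coneSnd_d_succ d δ f n s
  rw [hs, map_zero] at h₁ h₂
  obtain ⟨V, hV, hxV, a, ha⟩ := e n U (coneFst s) (neg_eq_zero.1 h₁.symm) x hx
  have h₃ : mapSec (δ n) V (mapSec (f n) V a + (I n).res hV (coneSnd s)) = 0 := by
    rw [map_add, hc, ha, mapSec_res, mapSec_res, ← map_add, ← h₂, map_zero]
  cases n with
  | zero =>
    obtain ⟨W, hW, hxW, r, hr⟩ := e₀' V _ h₃ x hxV
    refine ⟨W, hW.trans hV, hxW, mapSec ε W r - (A 0).res hW a, cone_ext ?_ ?_⟩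
    · rw [coneFst_d_zero, map_sub, mapSec_mapSec wε, (hres _ _).1, mapSec_res, ha]
      simp
    · rw [coneSnd_d_zero, map_sub, mapSec_mapSec hf₀, (hres _ _).2, mapSec_res, hr]
      simp
  | succ n =>
    obtain ⟨W, hW, hxW, r, hr⟩ := e' n V _ h₃ x hxV
    refine ⟨W, hW.trans hV, hxW, conePair (-(A (n + 1)).res hW a) r, cone_ext ?_ ?_⟩
    · rw [coneFst_d_succ, coneFst_pair, (hres _ _).1, map_neg, mapSec_res, ha]
      simp
    · rw [coneSnd_d_succ, coneFst_pair, coneSnd_pair, (hres _ _).2, hr, map_neg, mapSec_res]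
      simp

end cone

section cohomology

lemma injRes_data {F : Sh S} (R : InjectiveResolution F) :
  Mono (R.ι.f 0) ∧ LocallyExact (F := F) (R.ι.f 0) (R.cocomplex.d 0 1) ∧
    ∀ n, LocallyExact (R.cocomplex.d n (n + 1)) (R.cocomplex.d (n + 1) (n + 2)) :=
  ⟨inferInstance, (exact_iff_locallyExact _).1 R.exact₀,
    fun n => (exact_iff_locallyExact _).1 (R.exact_succ n)⟩

/-- The cohomology of a short complex of modules. -/
def homologyEquiv (K : ShortComplex (ModuleCat.{0} ℂ)) : K.homology ≃ₗ[ℂ] (LinearMap.ker K.g.hom) ⧸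
  (LinearMap.range K.f.hom).submoduleOf (LinearMap.ker K.g.hom) :=
  K.moduleCatHomologyIso.toLinearEquiv.trans (Submodule.quotEquivOfEq _ _ (by
    ext x
    constructor
    · rintro ⟨y, rfl⟩
      exact ⟨y, rfl⟩
    · rintro ⟨y, hy⟩
      exact ⟨y, Subtype.ext hy⟩))

/-- Cohomology by an injective resolution. -/
def sheafCohomologyEquivAux {F : Sh S} (R : InjectiveResolution F) (n i : ℕ)
  (hi : (ComplexShape.up ℕ).prev n = i) :
  sheafCohomology n F ≃ₗ[ℂ] (LinearMap.ker (mapSec (R.cocomplex.d n (n + 1)) ⊤)) ⧸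
  (LinearMap.range (mapSec (R.cocomplex.d i n) ⊤)).submoduleOf
  (LinearMap.ker (mapSec (R.cocomplex.d n (n + 1)) ⊤)) :=
  (R.isoRightDerivedObj (globalSections S) n).toLinearEquiv.trans
    ((ShortComplex.homologyMapIso (HomologicalComplex.isoSc' _ i n (n + 1) hi
      (by simp))).toLinearEquiv.trans (homologyEquiv _))

/-- Cohomology by an injective resolution. -/
def sheafCohomologyEquiv {F : Sh S} (R : InjectiveResolution F) (n : ℕ) :
    sheafCohomology n F ≃ₗ[ℂ] GlobalCohomology (fun n => R.cocomplex.d n (n + 1)) n :=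
  match n with
  | 0 => (sheafCohomologyEquivAux R 0 0 (by simp)).trans (Submodule.quotEquivOfEq _ _ (by
      rw [R.cocomplex.shape 0 0 (by simp)]
      ext x
      constructor
      · rintro ⟨y, hy⟩
        exact hy.symm
      · intro h
        exact ⟨0, (Eq.symm h : _)⟩))
  | n + 1 => sheafCohomologyEquivAux R (n + 1) n (by simp)

/-- The terms of an augmented complex. -/
def augObj (F : Sh S) (I : ℕ → Sh S) : ℕ → Sh S
  | 0 => F
  | n + 1 => I n

/-- The differential of an augmented complex. -/
def augD {F : Sh S} {I : ℕ → Sh S} (η : F ⟶ I 0) (δ : ∀ n, I n ⟶ I (n + 1)) :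
    ∀ n, augObj F I n ⟶ augObj F I (n + 1)
  | 0 => η
  | n + 1 => δ n

variable [CompactSpace S] [T2Space S]

/-- Exactness of the global sections of an augmented complex of soft sheaves. -/
lemma exact_sections_aug {F : Sh S} {I : ℕ → Sh S} (η : F ⟶ I 0) [Mono η]
  (δ : ∀ n, I n ⟶ I (n + 1)) (wη : η ≫ δ 0 = 0) (w : ∀ n, δ n ≫ δ (n + 1) = 0)
  (e₀ : LocallyExact η (δ 0)) (e : ∀ n, LocallyExact (δ n) (δ (n + 1)))
  (hF : IsSoft F) (hI : ∀ n, IsSoft (I n)) (n : ℕ) (z : (I (n + 1)).Sec ⊤)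
  (hz : mapSec (δ (n + 1)) ⊤ z = 0) : ∃ y, mapSec (δ n) ⊤ y = z := by
  have : Mono (augD η δ 0) := ‹Mono η›
  refine exact_sections_of_isSoft (augD η δ) ?_ ?_ ?_ (n + 1) z hz
  · rintro (_ | n)
    exacts [wη, w n]
  · rintro (_ | n)
    exacts [e₀, e n]
  · rintro (_ | n)
    exacts [hF, hI n]

/-- Soft sheaves on a compact Hausdorff space are acyclic. -/
theorem IsSoft.isZero_cohomology {F : Sh S} (hF : IsSoft F) (k : ℕ) (hk : 0 < k) :
  Limits.IsZero (sheafCohomology k F) := by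
  obtain ⟨n, rfl⟩ := Nat.exists_eq_succ_of_ne_zero hk.ne'
  let R : InjectiveResolution F := (HasInjectiveResolution.out (Z := F)).some
  obtain ⟨h₀, h₁, h₂⟩ := injRes_data R
  have : Mono (C := Sh S) (X := F) (R.ι.f 0) := h₀
  have key := exact_sections_aug (F := F) (I := R.cocomplex.X) (R.ι.f 0) (fun n => R.cocomplex.d n (n + 1))
    R.ι_f_zero_comp_complex_d R.complex_d_comp h₁ h₂ hF
    (fun n => isSoft_of_injective (R.cocomplex.X n)) n
  have : Subsingleton (sheafCohomology (n + 1) F) := by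
    refine (sheafCohomologyEquiv R (n + 1)).toEquiv.subsingleton_congr.2
      (Submodule.Quotient.subsingleton_iff.2 ?_)
    rw [eq_top_iff]
    rintro ⟨z, hz⟩ -
    exact key z hz
  exact ModuleCat.isZero_of_subsingleton _

/-- A linear map induces an isomorphism of subquotients. -/
lemma nonempty_quotient_equiv {M M' : Type*} [AddCommGroup M] [Module ℂ M] [AddCommGroup M']
  [Module ℂ M'] (φ : M →ₗ[ℂ] M') (Z B : Submodule ℂ M) (Z' B' : Submodule ℂ M')
  (hZ : ∀ a ∈ Z, φ a ∈ Z') (surj : ∀ z ∈ Z', ∃ a ∈ Z, φ a - z ∈ B')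
  (inj : ∀ a ∈ Z, φ a ∈ B' ↔ a ∈ B) :
  Nonempty ((Z' ⧸ B'.submoduleOf Z') ≃ₗ[ℂ] (Z ⧸ B.submoduleOf Z)) := by
  let Q := B'.submoduleOf Z'
  let ψ : Z →ₗ[ℂ] Z' ⧸ Q := Q.mkQ.comp (φ.restrict hZ)
  have hψ : Function.Surjective ψ := by
    intro q
    obtain ⟨⟨z, hz⟩, rfl⟩ := Q.mkQ_surjective q
    obtain ⟨a, ha, h⟩ := surj z hz
    exact ⟨⟨a, ha⟩, (Submodule.Quotient.eq Q).2 h⟩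
  have ker : LinearMap.ker ψ = B.submoduleOf Z := by
    ext ⟨a, ha⟩
    exact (Submodule.Quotient.mk_eq_zero Q).trans (inj a ha)
  exact ⟨(LinearMap.quotKerEquivOfSurjective ψ hψ).symm.trans (Submodule.quotEquivOfEq _ _ ker)⟩

/-- Soft resolutions of the same sheaf have the same cohomology, if the second is injective. -/
theorem nonempty_globalCohomology_equiv {E : Sh S} {A I : ℕ → Sh S} (ε : E ⟶ A 0) [Mono ε]
  (d : ∀ n, A n ⟶ A (n + 1)) (wε : ε ≫ d 0 = 0) (w : ∀ n, d n ≫ d (n + 1) = 0)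
  (e₀ : LocallyExact ε (d 0)) (e : ∀ n, LocallyExact (d n) (d (n + 1)))
  (hA : ∀ n, IsSoft (A n)) [∀ n, Injective (I n)] (η : E ⟶ I 0) [Mono η]
  (δ : ∀ n, I n ⟶ I (n + 1)) (wη : η ≫ δ 0 = 0) (wδ : ∀ n, δ n ≫ δ (n + 1) = 0)
  (h₁ : LocallyExact η (δ 0)) (h₂ : ∀ n, LocallyExact (δ n) (δ (n + 1))) (n : ℕ) :
  Nonempty (GlobalCohomology δ n ≃ₗ[ℂ] GlobalCohomology d n) := by
  obtain ⟨f, hf₀, hf⟩ := exists_hom_to_injectives ε d wε w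
    ((exact_iff_locallyExact _).2 e₀) (fun n => (exact_iff_locallyExact _).2 (e n)) η δ wη wδ
  have := coneD_mono (δ := δ) e₀ hf₀
  have key := exact_sections_of_isSoft (coneD d δ f) (coneD_comp w wδ hf)
    (coneD_exact e h₁ h₂ wε hf₀ hf) (coneObj_isSoft hA fun n => isSoft_of_injective (I n))
  have hc (n) (s : (A n).Sec ⊤) :
      mapSec (δ n) ⊤ (mapSec (f n) ⊤ s) = mapSec (f (n + 1)) ⊤ (mapSec (d n) ⊤ s) :=
    mapSec_mapSec (hf n) ⊤ s
  have pair (n) (a : (A (n + 1)).Sec ⊤) (i : (I n).Sec ⊤)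
      (ha : mapSec (d (n + 1)) ⊤ a = 0) (h : mapSec (f (n + 1)) ⊤ a + mapSec (δ n) ⊤ i = 0) :
      ∃ y, mapSec (coneD d δ f n) ⊤ y = conePair a i := by
    refine key n (conePair a i) (cone_ext ?_ ?_)
    · rw [coneFst_d_succ, coneFst_pair, ha, neg_zero, map_zero]
    · rw [coneSnd_d_succ, coneFst_pair, coneSnd_pair, h, map_zero]
  have hfst (n) (a : (A (n + 1)).Sec ⊤) (i : (I n).Sec ⊤) (y) (h : mapSec (coneD d δ f n) ⊤ y =
      conePair a i) : coneFst (mapSec (coneD d δ f n) ⊤ y) = a :=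
    (congrArg coneFst h).trans (coneFst_pair a i)
  have hsnd (n) (a : (A (n + 1)).Sec ⊤) (i : (I n).Sec ⊤) (y) (h : mapSec (coneD d δ f n) ⊤ y =
      conePair a i) : coneSnd (mapSec (coneD d δ f n) ⊤ y) = i :=
    (congrArg coneSnd h).trans (coneSnd_pair a i)
  refine nonempty_quotient_equiv (mapSec (f n) ⊤) (cocycles d n) (coboundaries d n) (cocycles δ n)
    (coboundaries δ n) (fun s hs => (hc n s).trans
      ((congrArg (mapSec (f (n + 1)) ⊤) hs).trans (map_zero _))) ?_ ?_
  · intro z hz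
    obtain ⟨y, hy⟩ := pair n 0 z (map_zero _)
      ((congrArg (· + _) (map_zero _)).trans ((zero_add _).trans hz))
    have y₁ := hfst _ _ _ _ hy
    have y₂ := hsnd _ _ _ _ hy
    cases n with
    | zero =>
      refine ⟨y, neg_eq_zero.1 ((coneFst_d_zero d δ f y).symm.trans y₁), ?_⟩
      exact (sub_eq_zero.2 ((coneSnd_d_zero d δ f y).symm.trans y₂) :)
    | succ n =>
      have y₃ := (coneSnd_d_succ d δ f n y).symm.trans y₂
      refine ⟨coneFst y, neg_eq_zero.1 ((coneFst_d_succ d δ f n y).symm.trans y₁),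
        -coneSnd y, (map_neg (mapSec (δ n) ⊤) (coneSnd y)).trans ?_⟩
      refine Eq.trans ?_ (congrArg (mapSec (f (n + 1)) ⊤ (coneFst y) - ·) y₃)
      exact (sub_add_cancel_left _ _).symm
  · intro a ha
    cases n with
    | zero =>
      constructor
      · intro (h : mapSec (f 0) ⊤ a = 0)
        refine mapSec_injective (coneD d δ f 0) ⊤ (cone_ext ?_ ?_)
        · exact (coneFst_d_zero d δ f a).trans ((neg_eq_zero.2 ha).trans
            (((congrArg coneFst (map_zero _)).trans (map_zero _)).symm))
        · exact (coneSnd_d_zero d δ f a).trans (h.trans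
            (((congrArg coneSnd (map_zero _)).trans (map_zero _)).symm))
      · intro (h : a = 0)
        exact (congrArg (mapSec (f 0) ⊤) h).trans (map_zero _)
    | succ n =>
      constructor
      · rintro ⟨i, hi⟩
        obtain ⟨y, hy⟩ := pair n a (-i) ha ((congrArg (mapSec (f (n + 1)) ⊤ a + ·)
          ((map_neg (mapSec (δ n) ⊤) i).trans (congrArg Neg.neg hi))).trans (add_neg_cancel _))
        have y₁ := hfst _ _ _ _ hy
        cases n with
        | zero =>
          exact ⟨-y, (map_neg (mapSec (d 0) ⊤) y).trans
            ((coneFst_d_zero d δ f y).symm.trans y₁)⟩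
        | succ n =>
          exact ⟨-coneFst y, (map_neg (mapSec (d (n + 1)) ⊤) (coneFst y)).trans
            ((coneFst_d_succ d δ f n y).symm.trans y₁)⟩
      · rintro ⟨b, hb⟩
        exact ⟨mapSec (f n) ⊤ b, (hc n b).trans (congrArg _ hb)⟩

/-- Soft resolutions compute cohomology. -/
theorem nonempty_cohomology_equiv {E : Sh S} {A : ℕ → Sh S} (ε : E ⟶ A 0) [Mono ε]
  (d : ∀ n, A n ⟶ A (n + 1)) (wε : ε ≫ d 0 = 0) (w : ∀ n, d n ≫ d (n + 1) = 0)
  (e₀ : LocallyExact ε (d 0)) (e : ∀ n, LocallyExact (d n) (d (n + 1)))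
  (hA : ∀ n, IsSoft (A n)) (n : ℕ) : Nonempty (sheafCohomology n E ≃ₗ[ℂ] GlobalCohomology d n) := by
  let R : InjectiveResolution E := (HasInjectiveResolution.out (Z := E)).some
  obtain ⟨h₀, h₁, h₂⟩ := injRes_data R
  have : Mono (C := Sh S) (X := E) (R.ι.f 0) := h₀
  obtain ⟨φ⟩ := nonempty_globalCohomology_equiv (I := R.cocomplex.X) ε d wε w e₀ e hA (R.ι.f 0)
    (fun n => R.cocomplex.d n (n + 1)) R.ι_f_zero_comp_complex_d R.complex_d_comp h₁ h₂ n
  exact ⟨(sheafCohomologyEquiv R n).trans φ⟩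

/-- Exact complexes of soft sheaves are acyclic resolutions. -/
theorem isAcyclicResolution_of_isSoft {E : Sh S} {A : ℕ → Sh S} (ε : E ⟶ A 0) [Mono ε]
  (d : ∀ n, A n ⟶ A (n + 1)) (wε : ε ≫ d 0 = 0) (w : ∀ n, d n ≫ d (n + 1) = 0)
  (e₀ : (ShortComplex.mk ε (d 0) wε).Exact)
  (e : ∀ n, (ShortComplex.mk (d n) (d (n + 1)) (w n)).Exact)
  (hA : ∀ n, IsSoft (A n)) : IsAcyclicResolution ε d where
  mono := inferInstance
  aug_comp := wε
  exact_zero := e₀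
  comp := w
  exact_succ := e
  acyclic p := (hA p).isZero_cohomology

end cohomology

/-! ## Fine sheaves -/

/-- There are endomorphisms that are the identity near a given closed set and vanish away from a
given neighbourhood. -/
def IsFine (F : Sh S) : Prop :=
  ∀ (U : Opens S) (K : Set S), IsClosed K → K ⊆ U → ∃ (φ : F ⟶ F) (V W : Opens S),
    K ⊆ V ∧ U ⊔ W = ⊤ ∧ (∀ x ∈ V, (stalkAt x).map (φ - 𝟙 F) = 0) ∧
    ∀ x ∈ W, (stalkAt x).map φ = 0

lemma mapSec_eq_zero_of_stalk {F G : Sh S} (φ : F ⟶ G) (U : Opens S)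
  (h : ∀ x ∈ U, (stalkAt x).map φ = 0) (s : F.Sec U) : mapSec φ U s = 0 := by
  apply G.eq_of_germ
  intro x hx
  rw [← stalk_germ, h x hx, map_zero]
  rfl

theorem IsFine.isSoft {F : Sh S} (hF : IsFine F) : IsSoft F := by
  intro U s K hK hKU
  obtain ⟨φ, V, W, hKV, hUW, hV, hW⟩ := hF U K hK hKU
  obtain ⟨t, ht, -⟩ := F.exists_glue_two (U := ⊤) le_top le_top hUW.ge (mapSec φ U s)
    (0 : F.Sec W) (by
      rw [map_zero, ← mapSec_res]
      exact mapSec_eq_zero_of_stalk φ (U ⊓ W) (fun x hx => hW x hx.2) _)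
  refine ⟨t, U ⊓ V, inf_le_left, fun x hx => ⟨hKU hx, hKV hx⟩, ?_⟩
  have h := mapSec_eq_zero_of_stalk (φ - 𝟙 F) (U ⊓ V) (fun x hx => hV x hx.2)
    (F.res inf_le_left s)
  rw [mapSec_sub, mapSec_id, sub_eq_zero] at h
  rw [← h, mapSec_res, ← ht, res_res]

end Sh

/-! ## Integrals depending smoothly on parameters -/

section

open Complex (I)
open ContinuousLinearMap (inl inr compL inr_apply)
open Metric (ball closedBall mem_ball mem_closedBall mem_ball_self)
open IsManifold (chart_mem_maximalAtlas maximalAtlas)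
open Set (Icc)
open ContinuousLinearMap renaming comp_apply → clm_comp_apply, ext → clm_ext, apply → applyCLM,
  prod_apply → clm_prod_apply, id → idCLM

local notation "Fib" => FibreModel
local notation "Bas" => BaseModel
local notation "Tot" => TotalModel

variable {m p N : ℕ} {P Q Θ G G' G'' F : Type} [NormedAddCommGroup P] [NormedSpace ℝ P]
  [NormedAddCommGroup Q] [NormedSpace ℝ Q] [NormedAddCommGroup Θ] [NormedSpace ℝ Θ]
  [NormedSpace ℂ Θ] [IsScalarTower ℝ ℂ Θ] [NormedAddCommGroup G] [NormedSpace ℝ G]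
  [NormedSpace ℂ G] [IsScalarTower ℝ ℂ G] [NormedAddCommGroup G'] [NormedSpace ℝ G']
  [NormedSpace ℂ G'] [IsScalarTower ℝ ℂ G'] [NormedAddCommGroup G''] [NormedSpace ℝ G'']
  [NormedSpace ℂ G''] [IsScalarTower ℝ ℂ G''] [NormedAddCommGroup F] [NormedSpace ℂ F]

section paramIntegral

open MeasureTheory

variable {A : Type} [FiniteDimensional ℝ Q] [NormedAddCommGroup A] [NormedSpace ℝ A]
  [MeasurableSpace A] [BorelSpace A] [SecondCountableTopology A] (μ : Measure A)
  [IsFiniteMeasureOnCompacts μ] {K : Set A}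

lemma hasFDerivAt_setIntegral_param (hK : IsCompact K) {f : Q × A → G}
  (hf : ContDiff ℝ 1 f) (q : Q) : HasFDerivAt (fun q => ∫ a in K, f (q, a) ∂μ)
  (∫ a in K, (fderiv ℝ f (q, a)).comp (inl ℝ Q A) ∂μ) q := by
  have : ProperSpace Q := FiniteDimensional.proper ℝ Q
  have hf' : Continuous fun p : Q × A =>
      (fderiv ℝ f p).comp (inl ℝ Q A) :=
    (hf.continuous_fderiv one_ne_zero).clm_comp continuous_const
  obtain ⟨C, hC⟩ := ((isCompact_closedBall q 1).prod hK).exists_bound_of_continuousOn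
    hf'.continuousOn
  have hfin : IsFiniteMeasure (μ.restrict K) := ⟨by simpa using hK.measure_lt_top⟩
  have hc (q : Q) : Continuous fun a => f (q, a) := hf.continuous.comp (by fun_prop)
  refine hasFDerivAt_integral_of_dominated_of_fderiv_le (bound := fun _ => C)
    (F' := fun q a => (fderiv ℝ f (q, a)).comp (inl ℝ Q A))
    (Metric.ball_mem_nhds q one_pos) (.of_forall fun q => (hc q).aestronglyMeasurable)
    ((hc q).continuousOn.integrableOn_compact hK)
    (hf'.comp (by fun_prop : Continuous fun a : A => (q, a))).aestronglyMeasurable ?_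
    (integrable_const C) ?_
  · filter_upwards [ae_restrict_mem₀ hK.measurableSet.nullMeasurableSet] with a ha p hp
    exact hC (p, a) ⟨Metric.ball_subset_closedBall hp, ha⟩
  · refine Eventually.of_forall fun a p _ => ?_
    exact ((hf.differentiable one_ne_zero) (p, a)).hasFDerivAt.comp p
      (hasFDerivAt_prodMk_left p a)

lemma contDiff_setIntegral_param (hK : IsCompact K) {f : Q × A → G} (hf : ContDiff ℝ ∞ f) :
    ContDiff ℝ ∞ fun q => ∫ a in K, f (q, a) ∂μ := by
  rw [contDiff_infty]
  intro n
  induction n generalizing G with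
  | zero =>
    refine contDiff_zero.2 (continuous_iff_continuousAt.2 fun q => ?_)
    exact (hasFDerivAt_setIntegral_param μ hK (hf.of_le (by simp)) q).continuousAt
  | succ n ih =>
    refine contDiff_succ_iff_hasFDerivAt.2 ⟨_, ih
      (f := fun p => (fderiv ℝ f p).comp (inl ℝ Q A)) ?_,
      fun q => hasFDerivAt_setIntegral_param μ hK (hf.of_le (by simp)) q⟩
    exact (contDiff_infty_iff_fderiv.1 hf).2.clm_comp contDiff_const

lemma fderiv_setIntegral_param_apply [CompleteSpace G] (hK : IsCompact K) {f : Q × A → G}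
  (hf : ContDiff ℝ 1 f) (q v : Q) : fderiv ℝ (fun q => ∫ a in K, f (q, a) ∂μ) q v =
  ∫ a in K, fderiv ℝ (fun q => f (q, a)) q v ∂μ := by
  rw [(hasFDerivAt_setIntegral_param μ hK hf q).fderiv, ContinuousLinearMap.integral_apply]
  · refine integral_congr_ae (.of_forall fun a => ?_)
    have h : HasFDerivAt (fun q => f (q, a)) _ q :=
      ((hf.differentiable one_ne_zero) (q, a)).hasFDerivAt.comp q (hasFDerivAt_prodMk_left q a)
    exact (congrArg (· v) h.fderiv).symm
  · have hf' : Continuous fun a : A =>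
        (fderiv ℝ f (q, a)).comp (inl ℝ Q A) :=
      ((hf.continuous_fderiv one_ne_zero).comp (by fun_prop : Continuous fun a : A =>
        (q, a))).clm_comp continuous_const
    exact hf'.continuousOn.integrableOn_compact hK

end paramIntegral

/-! ## Functions killed by complexified vector fields -/

section classes

/-- The derivative along the complex constant vector field `v + i w`. -/
def cderiv (v w : Q) (f : Q → G) (q : Q) : G := fderiv ℝ f q v + I • fderiv ℝ f q w

/-- Germs at `q₀` of smooth functions killed by the vector fields `v + i w`, `(v, w) ∈ S`. -/
structure SmoothKer (S : Set (Q × Q)) (q₀ : Q) (f : Q → G) : Prop where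
  smooth : ∀ᶠ q in 𝓝 q₀, ContDiffAt ℝ ∞ f q
  ker : ∀ p ∈ S, ∀ᶠ q in 𝓝 q₀, cderiv p.1 p.2 f q = 0

lemma cderiv_congr {v w : Q} {f g : Q → G} {q : Q} (h : f =ᶠ[𝓝 q] g) :
  cderiv v w f q = cderiv v w g q := by
  rw [cderiv, cderiv, h.fderiv_eq]

lemma cderiv_eventuallyEq {v w : Q} {f g : Q → G} {q : Q} (h : f =ᶠ[𝓝 q] g) :
  cderiv v w f =ᶠ[𝓝 q] cderiv v w g :=
  (eventually_eventually_nhds.2 h).mono fun _ h => cderiv_congr h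

lemma cderiv_add {v w : Q} {f g : Q → G} {q : Q} (hf : DifferentiableAt ℝ f q)
  (hg : DifferentiableAt ℝ g q) : cderiv v w (f + g) q = cderiv v w f q + cderiv v w g q := by
  simp only [cderiv, fderiv_add hf hg, add_apply, smul_add]
  abel

lemma cderiv_clm_comp {v w : Q} {f : Q → G} {q : Q} (hf : DifferentiableAt ℝ f q)
  (L : G →L[ℂ] G') : cderiv v w (fun q => L (f q)) q = L (cderiv v w f q) := by
  have h : HasFDerivAt (fun q => L (f q)) ((L.restrictScalars ℝ).comp (fderiv ℝ f q)) q :=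
    (L.restrictScalars ℝ).hasFDerivAt.comp q hf.hasFDerivAt
  simp [cderiv, h.fderiv]

namespace SmoothKer

variable {S : Set (Q × Q)} {q₀ : Q} {f g : Q → G}

lemma differentiable (hf : SmoothKer S q₀ f) : ∀ᶠ q in 𝓝 q₀, DifferentiableAt ℝ f q :=
  hf.smooth.mono fun _ h => h.differentiableAt (by simp)

lemma congr (hf : SmoothKer S q₀ f) (h : f =ᶠ[𝓝 q₀] g) : SmoothKer S q₀ g where
  smooth := by
    filter_upwards [hf.smooth, eventually_eventually_nhds.2 h] with q hq h
    exact hq.congr_of_eventuallyEq (EventuallyEq.symm h)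
  ker p hp := by
    filter_upwards [hf.ker p hp, cderiv_eventuallyEq h] with q hq h
    rw [← h, hq]

lemma mono {S' : Set (Q × Q)} (hf : SmoothKer S q₀ f) (h : S' ⊆ S) : SmoothKer S' q₀ f :=
  ⟨hf.smooth, fun p hp => hf.ker p (h hp)⟩

lemma const (c : G) : SmoothKer S q₀ fun _ => c :=
  ⟨Eventually.of_forall fun _ => contDiffAt_const, fun p _ => Eventually.of_forall fun q => by
    simp [cderiv]⟩

lemma add (hf : SmoothKer S q₀ f) (hg : SmoothKer S q₀ g) : SmoothKer S q₀ (f + g) where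
  smooth := by
    filter_upwards [hf.smooth, hg.smooth] with q h h'
    exact h.add h'
  ker p hp := by
    filter_upwards [hf.ker p hp, hg.ker p hp, hf.differentiable, hg.differentiable]
      with q h h' d d'
    rw [cderiv_add d d', h, h', add_zero]

lemma clm_comp (hf : SmoothKer S q₀ f) (L : G →L[ℂ] G') : SmoothKer S q₀ fun q => L (f q) where
  smooth := by
    filter_upwards [hf.smooth] with q h
    exact (L.restrictScalars ℝ).contDiff.contDiffAt.comp q h
  ker p hp := by
    filter_upwards [hf.ker p hp, hf.differentiable] with q h d
    rw [cderiv_clm_comp d, h, map_zero]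

lemma neg (hf : SmoothKer S q₀ f) : SmoothKer S q₀ (-f) :=
  hf.clm_comp (-idCLM ℂ G)

lemma sub (hf : SmoothKer S q₀ f) (hg : SmoothKer S q₀ g) : SmoothKer S q₀ (f - g) := by
  rw [sub_eq_add_neg]
  exact hf.add hg.neg

/-- Composition with a function whose derivative is `ℂ`-linear. -/
lemma comp_holomorphic {φ : G → G'} (hf : SmoothKer S q₀ f) 
  (h₁ : ∀ᶠ x in 𝓝 (f q₀), ContDiffAt ℝ ∞ φ x)
  (h : ∀ᶠ x in 𝓝 (f q₀), DifferentiableAt ℂ φ x) : SmoothKer S q₀ fun q => φ (f q) := by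
  have hc : ContinuousAt f q₀ := hf.smooth.self_of_nhds.continuousAt
  refine ⟨?_, fun p hp => ?_⟩
  · filter_upwards [hf.smooth, hc.eventually h₁] with q h h'
    exact h'.comp q h
  · filter_upwards [hf.ker p hp, hf.differentiable, hc.eventually h] with q hk hd hφ
    have h := (hφ.hasFDerivAt.restrictScalars ℝ).comp q hd.hasFDerivAt
    have h' : fderiv ℝ (fun q => φ (f q)) q = _ := h.fderiv
    rw [cderiv, h']
    simp only [clm_comp_apply, ContinuousLinearMap.coe_restrictScalars']
    rw [← map_smul, ← map_add]
    exact (congrArg _ hk).trans (map_zero _)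

lemma prodMk {g : Q → G'} (hf : SmoothKer S q₀ f) (hg : SmoothKer S q₀ g) :
  SmoothKer S q₀ fun q => (f q, g q) where
  smooth := by
    filter_upwards [hf.smooth, hg.smooth] with q h h'
    exact h.prodMk h'
  ker p hp := by
    filter_upwards [hf.ker p hp, hg.ker p hp, hf.differentiable, hg.differentiable]
      with q h h' d d'
    have := (d.hasFDerivAt.prodMk d'.hasFDerivAt).fderiv
    rw [cderiv, this]
    exact Prod.ext h h'

/-- Bilinear products. -/
lemma bilin (L : G →L[ℂ] G' →L[ℂ] G'') {g : Q → G'} (hf : SmoothKer S q₀ f)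
  (hg : SmoothKer S q₀ g) : SmoothKer S q₀ fun q => L (f q) (g q) := by
  have h : IsBoundedBilinearMap ℂ fun p : G × G' => L p.1 p.2 := L.isBoundedBilinearMap
  have h' : IsBoundedBilinearMap ℝ fun p : G × G' => L p.1 p.2 :=
    { h with
      smul_left := fun c x y => by
        simp
      smul_right := fun c x y => by
        simp }
  exact (hf.prodMk hg).comp_holomorphic (φ := fun p : G × G' => L p.1 p.2)
    (.of_forall fun _ => h'.contDiff.contDiffAt) (.of_forall fun p => h.differentiableAt p)

end SmoothKer

end classes

/-! ## The `∂̄`-equation in one variable -/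

section cauchyTransform

open MeasureTheory

variable [FiniteDimensional ℝ Q]

lemma real_smul_eq (c : ℝ) (x : G) : c • x = (c : ℂ) • x :=
  (algebraMap_smul ℂ c x).symm

/-- Polar coordinates. -/
def polar (a : ℝ × ℝ) : ℂ := a.1 * Complex.exp (a.2 * I)

/-- The integrand of the Cauchy transform, in polar coordinates. -/
def cauchyIntegrand (e : ℂ →L[ℝ] Q) (f : Q → G) (p : Q × (ℝ × ℝ)) : G :=
  Complex.exp (-(p.2.2 * I)) • f (p.1 - e (polar p.2))

/-- The Cauchy transform along `e`, in polar coordinates: the integral of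
`(π ζ)⁻¹ f (q - e ζ)` over a disc. -/
def cauchyTransform (e : ℂ →L[ℝ] Q) (R : ℝ) (f : Q → G) (q : Q) : G :=
  (1 / Real.pi : ℂ) • ∫ a in Icc 0 R ×ˢ Icc 0 (2 * Real.pi), cauchyIntegrand e f (q, a)

lemma contDiff_polar : ContDiff ℝ ∞ polar := by
  unfold polar
  have h : ContDiff ℝ ∞ (fun x : ℝ => (x : ℂ)) := Complex.ofRealCLM.contDiff
  have h1 : ContDiff ℝ ∞ fun a : ℝ × ℝ => (a.1 : ℂ) := h.comp contDiff_fst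
  have h2 : ContDiff ℝ ∞ fun a : ℝ × ℝ => (a.2 : ℂ) := h.comp contDiff_snd
  exact h1.mul ((h2.mul contDiff_const).cexp)

lemma contDiff_cauchyIntegrand (e : ℂ →L[ℝ] Q) {f : Q → G} (hf : ContDiff ℝ ∞ f) :
  ContDiff ℝ ∞ (cauchyIntegrand e f) := by
  unfold cauchyIntegrand
  have h : ContDiff ℝ ∞ (fun x : ℝ => (x : ℂ)) := Complex.ofRealCLM.contDiff
  have h2 : ContDiff ℝ ∞ fun p : Q × (ℝ × ℝ) => (p.2.2 : ℂ) :=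
    h.comp (contDiff_snd.comp contDiff_snd)
  refine ContDiff.smul ((h2.mul contDiff_const).neg.cexp) (hf.comp (contDiff_fst.sub ?_))
  exact e.contDiff.comp (contDiff_polar.comp contDiff_snd)

variable [CompleteSpace G]

lemma contDiff_cauchyTransform (e : ℂ →L[ℝ] Q) (R : ℝ) {f : Q → G} (hf : ContDiff ℝ ∞ f) :
  ContDiff ℝ ∞ (cauchyTransform e R f) :=
  (contDiff_setIntegral_param volume (isCompact_Icc.prod isCompact_Icc)
    (contDiff_cauchyIntegrand e hf)).const_smul _

lemma cderiv_cauchyTransform (e : ℂ →L[ℝ] Q) (R : ℝ) {f : Q → G} (hf : ContDiff ℝ ∞ f)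
  (v w q : Q) : cderiv v w (cauchyTransform e R f) q = cauchyTransform e R (cderiv v w f) q := by
  have hK : IsCompact (Icc 0 R ×ˢ Icc 0 (2 * Real.pi)) := isCompact_Icc.prod isCompact_Icc
  have hc := contDiff_cauchyIntegrand e hf
  have hd (q) : DifferentiableAt ℝ f q := hf.differentiable (by simp) q
  have hI (q) : DifferentiableAt ℝ (fun q => ∫ a in Icc 0 R ×ˢ Icc 0 (2 * Real.pi),
      cauchyIntegrand e f (q, a)) q :=
    (contDiff_setIntegral_param volume hK hc).differentiable (by simp) q
  have key (v : Q) (a : ℝ × ℝ) : fderiv ℝ (fun q => cauchyIntegrand e f (q, a)) q v =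
      cauchyIntegrand e (fun q => fderiv ℝ f q v) (q, a) := by
    have h₁ : HasFDerivAt (fun q => f (q - e (polar a))) (fderiv ℝ f (q - e (polar a))) q := by
      refine HasFDerivAt.congr_fderiv (f := fun q => f (q - e (polar a)))
        ((hd (q - e (polar a))).hasFDerivAt.comp q
          ((hasFDerivAt_id q).sub_const (e (polar a)))) ?_
      exact ContinuousLinearMap.comp_id _
    have h₂ := h₁.const_smul (Complex.exp (-(a.2 * I)))
    exact congrArg (· v) h₂.fderiv
  have hint (v : Q) : Integrable (fun a => cauchyIntegrand e (fun q => fderiv ℝ f q v) (q, a))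
      (volume.restrict (Icc 0 R ×ˢ Icc 0 (2 * Real.pi))) := by
    refine ContinuousOn.integrableOn_compact hK (Continuous.continuousOn ?_)
    refine (contDiff_cauchyIntegrand e ?_).continuous.comp (by fun_prop)
    exact (contDiff_infty_iff_fderiv.1 hf).2.clm_apply contDiff_const
  have h₃ (v : Q) : fderiv ℝ (cauchyTransform e R f) q v =
      cauchyTransform e R (fun q => fderiv ℝ f q v) q := by
    have h := ((hI q).hasFDerivAt.const_smul (1 / Real.pi : ℂ)).fderiv
    have h' : fderiv ℝ (cauchyTransform e R f) q = _ := h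
    rw [h', cauchyTransform]
    rw [smul_apply, fderiv_setIntegral_param_apply volume hK (hc.of_le (by simp))]
    simp_rw [key]
  rw [cderiv, h₃, h₃, cauchyTransform, cauchyTransform, cauchyTransform, smul_comm I,
    ← smul_add, ← integral_smul]
  refine congrArg _ ((integral_add (hint v) ((hint w).smul I)).symm.trans ?_)
  congr 1
  ext a
  simp only [cauchyIntegrand, cderiv, smul_add]
  rw [Pi.smul_apply, smul_comm I]

/-- The Cauchy–Pompeiu formula. -/
lemma cauchyTransform_cderiv (e : ℂ →L[ℝ] Q) {R : ℝ} (hR : 0 < R) {f : Q → G}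
  (hf : ContDiff ℝ ∞ f) (q : Q) (h₀ : ∀ θ : ℝ, f (q - e (polar (R, θ))) = 0) :
  cauchyTransform e R (cderiv (e 1) (e I) f) q = (2 : ℂ) • f q := by
  have hpi := Real.pi_pos
  have he (ζ : ℂ) : e ζ = ζ.re • e 1 + ζ.im • e I := by
    rw [← map_smul, ← map_smul, ← map_add]
    congr 1
    simp
  have hdf : Continuous (fderiv ℝ f) := hf.continuous_fderiv (by simp)
  have hpol : Continuous polar := contDiff_polar.continuous
  -- the radial and the angular parts
  let a : ℝ × ℝ → G := fun p => fderiv ℝ f (q - e (polar p)) (e (Complex.exp (p.2 * I)))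
  let b : ℝ × ℝ → G := fun p =>
    fderiv ℝ f (q - e (polar p)) (e (I * Complex.exp (p.2 * I)))
  have hsplit (p : ℝ × ℝ) : cauchyIntegrand e (cderiv (e 1) (e I) f) (q, p) =
      a p + I • b p := by
    simp only [cauchyIntegrand, cderiv, a, b]
    rw [he (Complex.exp _), he (I * _)]
    set X := fderiv ℝ f (q - e (polar p)) (e 1)
    set Y := fderiv ℝ f (q - e (polar p)) (e I)
    simp only [map_add, map_smul]
    have h1 : Complex.exp (p.2 * I) = Real.cos p.2 + Real.sin p.2 * I := by
      rw [Complex.exp_mul_I]; push_cast; rfl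
    have h2 : Complex.exp (-(p.2 * I)) = Real.cos p.2 - Real.sin p.2 * I := by
      rw [← neg_mul, Complex.exp_mul_I, Complex.cos_neg, Complex.sin_neg]; push_cast; ring
    rw [h1, h2]
    simp only [real_smul_eq, Complex.add_re, Complex.add_im, Complex.mul_re, Complex.mul_im,
      Complex.ofReal_re, Complex.ofReal_im, Complex.I_re, Complex.I_im]
    simp only [smul_add, smul_smul]
    push_cast
    match_scalars
    · ring_nf
    · ring_nf; simp
  have hexp : Continuous fun p : ℝ × ℝ => Complex.exp (p.2 * I) := by fun_prop
  have ha : Continuous a := (hdf.comp (by fun_prop)).clm_apply (by fun_prop)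
  have hb : Continuous b := (hdf.comp (by fun_prop)).clm_apply (by fun_prop)
  have hK : IsCompact (Icc 0 R ×ˢ Icc 0 (2 * Real.pi)) := isCompact_Icc.prod isCompact_Icc
  have hradial (θ : ℝ) : ∫ r in (0)..R, a (r, θ) = f q := by
    have hder (r : ℝ) : HasDerivAt (fun r : ℝ => -f (q - e (polar (r, θ)))) (a (r, θ)) r := by
      have h₁ : HasDerivAt (fun r : ℝ => polar (r, θ)) (Complex.exp (θ * I)) r := by
        simpa [polar] using (Complex.ofRealCLM.hasDerivAt (x := r)).mul_const
          (Complex.exp (θ * I))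
      have h₂ := (e.hasFDerivAt.comp_hasDerivAt r h₁).const_sub q
      have h₃ := ((hf.differentiable (by simp) (q - e (polar (r, θ)))).hasFDerivAt.comp_hasDerivAt
        r h₂).neg
      refine HasDerivAt.congr_deriv (f := fun r : ℝ => -f (q - e (polar (r, θ)))) h₃ ?_
      simp [a]
    rw [intervalIntegral.integral_eq_sub_of_hasDerivAt (fun r _ => hder r)
      ((ha.comp (by fun_prop : Continuous fun r : ℝ => (r, θ))).intervalIntegrable _ _)]
    rw [h₀]
    simp [polar]
  have hangular (r : ℝ) (hr : 0 < r) : ∫ θ in (0)..(2 * Real.pi), b (r, θ) = 0 := by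
    have hder (θ : ℝ) : HasDerivAt (fun θ : ℝ => -f (q - e (polar (r, θ)))) (r • b (r, θ)) θ := by
      have h₁ : HasDerivAt (fun θ : ℝ => polar (r, θ))
          (r • (I * Complex.exp (θ * I))) θ := by
        have := (((Complex.ofRealCLM.hasDerivAt (x := θ)).mul_const I).cexp).const_mul
          (r : ℂ)
        simp only [Complex.ofRealCLM_apply] at this
        refine this.congr_deriv ?_
        rw [real_smul_eq, smul_eq_mul]
        push_cast
        ring
      have h₂ := (e.hasFDerivAt.comp_hasDerivAt θ h₁).const_sub q
      have h₃ := ((hf.differentiable (by simp) (q - e (polar (r, θ)))).hasFDerivAt.comp_hasDerivAt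
        θ h₂).neg
      refine HasDerivAt.congr_deriv (f := fun θ : ℝ => -f (q - e (polar (r, θ)))) h₃ ?_
      simp only [map_neg, neg_neg, map_smul, b]
    have h := intervalIntegral.integral_eq_sub_of_hasDerivAt (a := 0) (b := 2 * Real.pi)
      (fun θ _ => hder θ) ((by fun_prop :
        Continuous fun θ : ℝ => r • b (r, θ)).intervalIntegrable _ _)
    rw [intervalIntegral.integral_smul] at h
    have h' : polar (r, 2 * Real.pi) = polar (r, 0) := by
      simp [polar]
    rw [h', sub_self] at h
    exact (smul_eq_zero.1 h).resolve_left hr.ne'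
  have hai : IntegrableOn a (Icc 0 R ×ˢ Icc 0 (2 * Real.pi)) :=
    ha.continuousOn.integrableOn_compact hK
  have hbi : IntegrableOn b (Icc 0 R ×ˢ Icc 0 (2 * Real.pi)) :=
    hb.continuousOn.integrableOn_compact hK
  have hA : ∫ p in Icc 0 R ×ˢ Icc 0 (2 * Real.pi), a p = (2 * Real.pi) • f q := by
    rw [Measure.volume_eq_prod, ← Measure.prod_restrict, integral_prod_symm _ (by
      rwa [Measure.prod_restrict, ← Measure.volume_eq_prod])]
    have (θ : ℝ) : ∫ r in Icc 0 R, a (r, θ) = f q := by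
      rw [integral_Icc_eq_integral_Ioc, ← intervalIntegral.integral_of_le hR.le, hradial]
    simp_rw [this]
    rw [integral_const]
    simp [hpi.le]
  have hB : ∫ p in Icc 0 R ×ˢ Icc 0 (2 * Real.pi), b p = 0 := by
    rw [Measure.volume_eq_prod, setIntegral_prod _ (by rwa [← Measure.volume_eq_prod]),
      integral_Icc_eq_integral_Ioc]
    refine setIntegral_eq_zero_of_forall_eq_zero fun r hr => ?_
    rw [integral_Icc_eq_integral_Ioc, ← intervalIntegral.integral_of_le (by positivity),
      hangular r hr.1]
  rw [cauchyTransform]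
  simp_rw [hsplit]
  have hab : ∫ p in Icc 0 R ×ˢ Icc 0 (2 * Real.pi), a p + I • b p =
      (2 * Real.pi) • f q := by
    refine (integral_add hai (hbi.smul I)).trans ?_
    rw [hA, Pi.smul_def, integral_smul, hB, smul_zero, add_zero]
  rw [hab, real_smul_eq, smul_smul]
  congr 1
  have : (Real.pi : ℂ) ≠ 0 := by exact_mod_cast hpi.ne'
  push_cast
  field_simp

/-- Local solution of the inhomogeneous Cauchy–Riemann equation in one complex direction `e`. The
solution inherits linear conditions on the values, and the complexified constant vector fields
transversal to `e` that kill the data. -/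
theorem exists_cauchyRiemann_solution (e : ℂ →L[ℝ] Q) (c : Q →L[ℝ] ℂ) (hce : ∀ ζ, c (e ζ) = ζ)
  (f : Q → G) (q₀ : Q) (O : Set Q) (hO : O ∈ 𝓝 q₀) (hf : ∀ q ∈ O, ContDiffAt ℝ ∞ f q) :
  ∃ u : Q → G, ∃ O' ∈ 𝓝 q₀, (∀ q, ContDiffAt ℝ ∞ u q) ∧
  (∀ q ∈ O', cderiv (e 1) (e I) u q = (2 : ℂ) • f q) ∧
  (∀ v w, c v = 0 → c w = 0 → (∀ q ∈ O, cderiv v w f q = 0) → ∀ q ∈ O', cderiv v w u q = 0) ∧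
  ∀ (G' : Type) [NormedAddCommGroup G'] [NormedSpace ℝ G'] [NormedSpace ℂ G']
  [IsScalarTower ℝ ℂ G'] [CompleteSpace G'] (L : G →L[ℂ] G'),
  (∀ q ∈ O, L (f q) = 0) → ∀ q, L (u q) = 0 := by
  obtain ⟨r, hr, hrO⟩ := Metric.mem_nhds_iff.1 hO
  -- cut off
  obtain ⟨δ, hδ, hδr⟩ : ∃ δ > 0, 2 * δ * (1 + ‖e‖) ≤ r / 2 := by
    refine ⟨r / 4 / (1 + ‖e‖), by positivity, le_of_eq ?_⟩
    field_simp
    ring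
  let b₁ : ContDiffBump (0 : ℂ) := ⟨δ, 2 * δ, hδ, by linarith⟩
  let b₂ : ContDiffBump (0 : Q) := ⟨δ, 2 * δ, hδ, by linarith⟩
  let p : Q → Q := fun q => (q - q₀) - e (c (q - q₀))
  let g : Q → G := fun q => (b₁ (c (q - q₀)) * b₂ (p q)) • f q
  have hp : ContDiff ℝ ∞ p := by fun_prop
  have hsupp (q : Q) (h : r / 2 < ‖q - q₀‖) : g q = 0 := by
    by_cases h₁ : ‖c (q - q₀)‖ < 2 * δ
    · have h₂ : 2 * δ ≤ ‖p q‖ := by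
        by_contra! h₂
        have : ‖q - q₀‖ ≤ ‖p q‖ + ‖e‖ * ‖c (q - q₀)‖ := by
          have : q - q₀ = p q + e (c (q - q₀)) := by simp [p]
          calc ‖q - q₀‖ = ‖p q + e (c (q - q₀))‖ := by rw [← this]
            _ ≤ _ := (norm_add_le _ _).trans (by gcongr; exact e.le_opNorm _)
        have : ‖e‖ * ‖c (q - q₀)‖ ≤ ‖e‖ * (2 * δ) := by gcongr
        nlinarith
      have : b₂ (p q) = 0 := b₂.zero_of_le_dist (by simpa [b₂] using h₂)
      simp only [g, this, mul_zero, zero_smul]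
    · have : b₁ (c (q - q₀)) = 0 := b₁.zero_of_le_dist (by simpa [b₁] using h₁)
      simp only [g, this, zero_mul, zero_smul]
  have hfar (q : Q) (h : q ∉ ball q₀ r) : g =ᶠ[𝓝 q] 0 := by
    have : {q : Q | r / 2 < ‖q - q₀‖} ∈ 𝓝 q := by
      refine (isOpen_lt continuous_const (by fun_prop)).mem_nhds ?_
      simp only [mem_ball, dist_eq_norm, not_lt] at h
      exact lt_of_lt_of_le (by linarith) h
    filter_upwards [this] with q hq using hsupp q hq
  have hg : ContDiff ℝ ∞ g := by
    rw [contDiff_iff_contDiffAt]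
    intro q
    by_cases h : q ∈ ball q₀ r
    · have h₁ : ContDiff ℝ ∞ fun q => b₁ (c (q - q₀)) := b₁.contDiff.comp (by fun_prop)
      exact (h₁.mul (b₂.contDiff.comp hp)).contDiffAt.smul (hf q (hrO h))
    · exact contDiffAt_const.congr_of_eventuallyEq (hfar q h)
  have hgeq : ∀ᶠ q in 𝓝 q₀, g q = f q := by
    have h₁ : ∀ᶠ q in 𝓝 q₀, ‖c (q - q₀)‖ < δ :=
      (by fun_prop : Continuous fun q => ‖c (q - q₀)‖).continuousAt.eventually_lt
        continuousAt_const (by simpa using hδ)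
    have h₂ : ∀ᶠ q in 𝓝 q₀, ‖p q‖ < δ :=
      (hp.continuous.norm).continuousAt.eventually_lt
        continuousAt_const (by simpa [p] using hδ)
    filter_upwards [h₁, h₂] with q h₁ h₂
    have e₁ : b₁ (c (q - q₀)) = 1 := b₁.one_of_mem_closedBall (by simpa [b₁] using h₁.le)
    have e₂ : b₂ (p q) = 1 := b₂.one_of_mem_closedBall (by simpa [b₂] using h₂.le)
    simp only [g, e₁, e₂, mul_one, one_smul]
  have hcnear : ∀ᶠ q in 𝓝 q₀, ‖c (q - q₀)‖ < δ :=
    (by fun_prop : Continuous fun q => ‖c (q - q₀)‖).continuousAt.eventually_lt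
      continuousAt_const (by simpa using hδ)
  have hpnear : ∀ᶠ q in 𝓝 q₀, ‖p q‖ < δ :=
    (hp.continuous.norm).continuousAt.eventually_lt
      continuousAt_const (by simpa [p] using hδ)
  refine ⟨cauchyTransform e (4 * δ) g, {q | ‖c (q - q₀)‖ < δ ∧ ‖p q‖ < δ ∧ g q = f q},
    (hcnear.and (hpnear.and hgeq)),
    fun q => (contDiff_cauchyTransform e _ hg).contDiffAt, ?_, ?_, ?_⟩
  · rintro q ⟨hq₁, -, hq₃⟩
    rw [cderiv_cauchyTransform e _ hg, cauchyTransform_cderiv e (by linarith) hg q, hq₃]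
    intro θ
    have : b₁ (c (q - e (polar (4 * δ, θ)) - q₀)) = 0 := by
      refine b₁.zero_of_le_dist ?_
      have h₁ : c (q - e (polar (4 * δ, θ)) - q₀) = c (q - q₀) - polar (4 * δ, θ) := by
        rw [sub_right_comm, map_sub, hce]
      have h₂ : ‖polar (4 * δ, θ)‖ = 4 * δ := by
        simp [polar, Complex.norm_exp_ofReal_mul_I, abs_of_pos hδ]
      have h₃ := norm_sub_norm_le (polar (4 * δ, θ)) (c (q - q₀))
      rw [norm_sub_rev] at h₃
      rw [h₁, dist_zero_right]
      change 2 * δ ≤ _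
      linarith
    simp only [g, this, zero_mul, zero_smul]
  · rintro v w hv hw hk q ⟨-, hq₂, -⟩
    rw [cderiv_cauchyTransform e _ hg, cauchyTransform]
    have hpe (ζ : ℂ) : p (q - e ζ) = p q := by
      simp only [p, map_sub, hce]
      abel
    have key (ζ : ℂ) : cderiv v w g (q - e ζ) = 0 := by
      by_cases h : q - e ζ ∈ ball q₀ r
      · have hd := (hf _ (hrO h)).differentiableAt (by simp)
        have hloc : g =ᶠ[𝓝 (q - e ζ)] fun q => b₁ (c (q - q₀)) • f q := by
          have : ∀ᶠ q' in 𝓝 (q - e ζ), ‖p q'‖ < δ :=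
            (hp.continuous.norm).continuousAt.eventually_lt continuousAt_const
              (by rw [hpe]; exact hq₂)
          filter_upwards [this] with q' h'
          have e₂ : b₂ (p q') = 1 := b₂.one_of_mem_closedBall (by simpa [b₂] using h'.le)
          simp only [g, e₂, mul_one]
        have h₁ : HasFDerivAt (fun q => b₁ (c (q - q₀)))
            ((fderiv ℝ b₁ (c (q - e ζ - q₀))).comp c) (q - e ζ) := by
          refine HasFDerivAt.comp (q - e ζ) (f := fun q => c (q - q₀)) (g := b₁) ?_ ?_
          · exact (b₁.contDiff (n := 1)).differentiable (by simp) _ |>.hasFDerivAt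
          · exact c.hasFDerivAt.comp _ ((hasFDerivAt_id _).sub_const q₀)
        have h₂ := (h₁.smul hd.hasFDerivAt).fderiv
        rw [cderiv_congr hloc, cderiv]
        have h₃ := hk _ (hrO h)
        rw [cderiv] at h₃
        have h₄ : fderiv ℝ (fun q => b₁ (c (q - q₀)) • f q) (q - e ζ) = _ := h₂
        rw [h₄]
        simp [hv, hw]
        rw [smul_comm, ← smul_add, h₃, smul_zero]
      · rw [cderiv_congr (hfar _ h)]
        simp [cderiv]
    simp [cauchyIntegrand, key]
  · intro G' _ _ _ _ _ L hL q
    have hLg (q : Q) : L (g q) = 0 := by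
      by_cases h : q ∈ ball q₀ r
      · simp only [g]
        rw [real_smul_eq, map_smul, hL q (hrO h), smul_zero]
      · rw [(hfar q h).self_of_nhds]
        exact map_zero L
    have hint : IntegrableOn (fun a => cauchyIntegrand e g (q, a))
        (Icc 0 (4 * δ) ×ˢ Icc 0 (2 * Real.pi)) :=
      ((contDiff_cauchyIntegrand e hg).continuous.comp
        (by fun_prop)).continuousOn.integrableOn_compact (isCompact_Icc.prod isCompact_Icc)
    have h := (L.restrictScalars ℝ).integral_comp_comm hint
    have h' (a) : (L.restrictScalars ℝ) (cauchyIntegrand e g (q, a)) = 0 := by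
      simp [cauchyIntegrand, hLg]
    simp_rw [h'] at h
    rw [integral_zero] at h
    rw [cauchyTransform, map_smul]
    exact (congrArg _ h.symm).trans (smul_zero _)

end cauchyTransform

/-! ## Complexification of derivatives -/

section complexify

/-- Complex conjugation of coordinates. -/
def conjCLM (m : ℕ) : Fib m →L[ℝ] Fib m :=
  LinearMap.toContinuousLinearMap
    { toFun := star
      map_add' := star_add
      map_smul' := fun c v => by ext i; simp }

@[simp] lemma conjCLM_apply (v : Fib m) : conjCLM m v = star v := rfl

@[simp] lemma I_smul_I_smul (x : G) : I • I • x = -x := by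
  rw [smul_smul, Complex.I_mul_I, neg_one_smul]

lemma map_complex_smul (L : Fib m →L[ℝ] G) (c : ℂ) (v : Fib m) :
  L (c • v) = c.re • L v + c.im • L (I • v) := by
  rw [← map_smul, ← map_smul, ← map_add]
  congr 1
  conv_lhs => rw [← Complex.re_add_im c]
  rw [add_smul, mul_smul, real_smul_eq, real_smul_eq]

/-- The complex-linear map on `V × V` which on the real form `{(v, v̄)}` is the given real-linear
map on `V`. -/
def complexifyAux (L : Fib m →L[ℝ] G) : Fib m × Fib m →L[ℂ] G :=
  LinearMap.toContinuousLinearMap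
    { toFun := fun v => (1 / 2 : ℂ) • (L v.1 - I • L (I • v.1)) +
        (1 / 2 : ℂ) • (L (star v.2) + I • L (I • star v.2))
      map_add' := fun v w => by
        simp only [Prod.fst_add, Prod.snd_add, map_add, smul_add, star_add]
        module
      map_smul' := fun c v => by
        have h (w : Fib m) : I • c • w = c • I • w := smul_comm _ _ _
        have h' (w : Fib m) : I • star c • w = star c • I • w :=
          smul_comm _ _ _
        simp only [Prod.smul_fst, Prod.smul_snd, star_smul, h, h', map_complex_smul L c,
          map_complex_smul L (star c), I_smul_I_smul, map_neg, RingHom.id_apply]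
        have hc : c = c.re + c.im * I := (Complex.re_add_im c).symm
        simp only [real_smul_eq]
        have e₁ : (star c).re = c.re := rfl
        have e₂ : (star c).im = -c.im := rfl
        rw [e₁, e₂]
        generalize c.re = a at *
        generalize c.im = b at *
        subst hc
        push_cast
        match_scalars <;> ring_nf <;> simp <;> ring }

/-- The complex-linear map on `V × V` which on the real form `{(v, v̄)}` is the given real-linear
map on `V`. -/
def complexify : (Fib m →L[ℝ] G) →L[ℂ] (Fib m × Fib m →L[ℂ] G) :=
  LinearMap.mkContinuous
    { toFun := complexifyAux
      map_add' := fun L L' => by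
        ext v <;> simp [complexifyAux] <;> module
      map_smul' := fun c L => by
        ext v <;> simp [complexifyAux] <;> module } 2 fun L => by
    refine ContinuousLinearMap.opNorm_le_bound _ (by positivity) fun v => ?_
    have hI (x : G) : ‖I • x‖ = ‖x‖ := by rw [norm_smul]; simp
    have hI' (x : Fib m) : ‖I • x‖ = ‖x‖ := by rw [norm_smul]; simp
    have h (w : Fib m) : ‖L w‖ ≤ ‖L‖ * ‖w‖ := L.le_opNorm w
    have h₁ : ‖v.1‖ ≤ ‖v‖ := norm_fst_le v
    have h₂ : ‖v.2‖ ≤ ‖v‖ := norm_snd_le v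
    have hn : ‖(1 / 2 : ℂ)‖ = 1 / 2 := by norm_num
    have b₁ : ‖(1 / 2 : ℂ) • (L v.1 - I • L (I • v.1))‖ ≤ ‖L‖ * ‖v‖ := by
      rw [norm_smul, hn]
      have := norm_sub_le (L v.1) (I • L (I • v.1))
      have e₁ := h v.1
      have e₂ := h (I • v.1)
      rw [hI] at this
      rw [hI'] at e₂
      have : ‖L‖ * ‖v.1‖ ≤ ‖L‖ * ‖v‖ := by gcongr
      linarith
    have b₂ : ‖(1 / 2 : ℂ) • (L (star v.2) + I • L (I • star v.2))‖ ≤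
        ‖L‖ * ‖v‖ := by
      rw [norm_smul, hn]
      have := norm_add_le (L (star v.2)) (I • L (I • star v.2))
      have e₁ := h (star v.2)
      have e₂ := h (I • star v.2)
      rw [hI] at this
      rw [hI', norm_star] at e₂
      rw [norm_star] at e₁
      have : ‖L‖ * ‖v.2‖ ≤ ‖L‖ * ‖v‖ := by gcongr
      linarith
    calc _ ≤ _ := norm_add_le _ _
      _ ≤ ‖L‖ * ‖v‖ + ‖L‖ * ‖v‖ := add_le_add b₁ b₂
      _ = 2 * ‖L‖ * ‖v‖ := by ring

lemma complexify_apply (L : Fib m →L[ℝ] G) (v w : Fib m) :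
  complexify L (v, w) = (1 / 2 : ℂ) • (L v - I • L (I • v)) +
  (1 / 2 : ℂ) • (L (star w) + I • L (I • star w)) := rfl

lemma complexify_conj (L : Fib m →L[ℝ] G) (v : Fib m) : complexify L (v, star v) = L v := by
  rw [complexify_apply, star_star]
  module

lemma complexify_unique {L : Fib m →L[ℝ] G}
  {T : Fib m × Fib m →L[ℂ] G} (h : ∀ v, T (v, star v) = L v) : complexify L = T := by
  refine clm_ext fun p => ?_
  obtain ⟨a, b, rfl⟩ : ∃ a b : Fib m, p = (a, star a) + I • (b, star b) := by
    refine ⟨(1 / 2 : ℂ) • (p.1 + star p.2), (1 / 2 : ℂ) • (-I) • (p.1 - star p.2), ?_⟩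
    have hI : star I = -I := Complex.conj_I
    have h2 : star (1 / 2 : ℂ) = 1 / 2 := by
      change (starRingEnd ℂ) (1 / 2) = _
      rw [map_div₀, map_one, map_ofNat]
    have e (x : Fib m) : I • (1 / 2 : ℂ) • (-I) • x = (1 / 2 : ℂ) • x := by
      rw [smul_comm I, neg_smul, smul_neg, I_smul_I_smul, neg_neg]
    have e' (x : Fib m) : I • (1 / 2 : ℂ) • I • x = -((1 / 2 : ℂ) • x) := by
      rw [smul_comm I, I_smul_I_smul, smul_neg]
    refine Prod.ext ?_ ?_
    · simp only [Prod.fst_add, Prod.smul_fst, e]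
      module
    · simp only [Prod.snd_add, Prod.smul_snd, star_smul, star_add, star_sub, star_star, h2,
        star_neg, hI, neg_neg, e']
      module
  rw [map_add, map_add, map_smul, map_smul, complexify_conj, complexify_conj, h, h]

lemma complexify_clm_comp (T : G →L[ℂ] G') (L : Fib m →L[ℝ] G) :
  complexify ((T.restrictScalars ℝ).comp L) = T.comp (complexify L) :=
  complexify_unique fun v => by simp [complexify_conj]

lemma complexify_comp {k : ℕ} (L : Fib k →L[ℝ] G) (A : Fib m →L[ℝ] Fib k) :
  complexify (L.comp A) = (complexify L).comp
  ((complexify A).prod (complexify ((conjCLM k).comp A))) :=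
  complexify_unique fun v => by
    simp only [clm_comp_apply, clm_prod_apply, complexify_conj,
      conjCLM_apply]

lemma complexify_id : complexify (idCLM ℝ (Fib m)) =
  ContinuousLinearMap.fst ℂ _ _ := complexify_unique fun _ => rfl

lemma complexify_conjCLM : complexify (conjCLM m) = ContinuousLinearMap.snd ℂ _ _ :=
  complexify_unique fun _ => rfl

lemma complexify_restrictScalars (T : Fib m →L[ℂ] G) :
  complexify (T.restrictScalars ℝ) = T.comp (ContinuousLinearMap.fst ℂ _ _) :=
  complexify_unique fun _ => rfl

end complexify

/-! ## Complexified first-order operators and forms -/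

section operators

/-- The complexified partial derivative in the first variable. -/
def pderiv (a : Fib m × P → G) (q : Fib m × P) : Fib m × Fib m →L[ℂ] G :=
  complexify ((fderiv ℝ a q).comp (inl ℝ _ _))

lemma pderiv_congr {a b : Fib m × P → G} {q : Fib m × P} (h : a =ᶠ[𝓝 q] b) :
  pderiv a q = pderiv b q := by
  rw [pderiv, pderiv, h.fderiv_eq]

lemma pderiv_apply (a : Fib m × P → G) (q : Fib m × P) (v w : Fib m) :
  pderiv a q (v, w) = (1 / 2 : ℂ) • cderiv (v, 0) (-(I • v), 0) a q +
  (1 / 2 : ℂ) • cderiv (star w, 0) (I • star w, 0) a q := by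
  have h : ((-(I • v), 0) : Fib m × P) = -(I • v, 0) := by simp
  rw [pderiv, complexify_apply, cderiv, cderiv, h, map_neg, smul_neg, ← sub_eq_add_neg]
  rfl

lemma pderiv_clm_comp {a : Fib m × P → G} {q : Fib m × P}
  (ha : DifferentiableAt ℝ a q) (L : G →L[ℂ] G') :
  pderiv (fun q => L (a q)) q = L.comp (pderiv a q) := by
  have h : HasFDerivAt (fun q => L (a q)) ((L.restrictScalars ℝ).comp (fderiv ℝ a q)) q :=
    (L.restrictScalars ℝ).hasFDerivAt.comp q ha.hasFDerivAt
  rw [pderiv, h.fderiv, pderiv, ContinuousLinearMap.comp_assoc, complexify_clm_comp]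

lemma pderiv_add {a b : Fib m × P → G} {q : Fib m × P}
  (ha : DifferentiableAt ℝ a q) (hb : DifferentiableAt ℝ b q) :
  pderiv (a + b) q = pderiv a q + pderiv b q := by
  rw [pderiv, fderiv_add ha hb, ContinuousLinearMap.add_comp, map_add]
  rfl

/-- The complexified partial derivative as a complex-linear function of the derivative. -/
def pderivCLM (m : ℕ) (P G : Type) [NormedAddCommGroup P] [NormedSpace ℝ P] [NormedAddCommGroup G]
  [NormedSpace ℝ G] [NormedSpace ℂ G] [IsScalarTower ℝ ℂ G] :
  (Fib m × P →L[ℝ] G) →L[ℂ] (Fib m × Fib m →L[ℂ] G) :=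
  complexify.comp
    ({  toFun := fun L => L.comp (inl ℝ (Fib m) P)
        map_add' := fun _ _ => rfl
        map_smul' := fun _ _ => rfl
        cont := (ContinuousLinearMap.precomp (𝕜₃ := ℝ) G
          (inl ℝ (Fib m) P)).continuous } :
      (Fib m × P →L[ℝ] G) →L[ℂ] (Fib m →L[ℝ] G))

lemma contDiffAt_pderiv {a : Fib m × P → G} {q : Fib m × P}
  (ha : ContDiffAt ℝ ∞ a q) : ContDiffAt ℝ ∞ (pderiv a) q :=
  ((pderivCLM m P G).restrictScalars ℝ).contDiff.contDiffAt.comp q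
    (ha.fderiv_right (m := ∞) (by simp))

lemma cderiv_comm {a : Q → G} {q : Q} (ha : ContDiffAt ℝ ∞ a q) (v w v' w' : Q) :
  cderiv v w (cderiv v' w' a) q = cderiv v' w' (cderiv v w a) q := by
  have hd : DifferentiableAt ℝ (fderiv ℝ a) q :=
    (ha.fderiv_right (m := ∞) (by simp)).differentiableAt (by simp)
  have hs : IsSymmSndFDerivAt ℝ a q := ha.isSymmSndFDerivAt (by
    rw [minSmoothness_of_isRCLikeNormedField]; 
    exact (WithTop.coe_le_coe.2 (le_top : (2 : ℕ∞) ≤ ⊤) : ((2 : ℕ∞) : ℕ∞ω) ≤ ∞))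
  have key (v w x : Q) : fderiv ℝ (cderiv v w a) q x =
      fderiv ℝ (fderiv ℝ a) q x v + I • fderiv ℝ (fderiv ℝ a) q x w := by
    have h (v : Q) : HasFDerivAt (fun q => fderiv ℝ a q v)
        ((applyCLM ℝ G v).comp (fderiv ℝ (fderiv ℝ a) q)) q :=
      (applyCLM ℝ G v).hasFDerivAt.comp q hd.hasFDerivAt
    have h' : HasFDerivAt (cderiv v w a) _ q := (h v).add ((h w).const_smul I)
    rw [h'.fderiv]
    rfl
  rw [cderiv, cderiv, key, key, key, key, hs.eq v v', hs.eq v w', hs.eq w v', hs.eq w w']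
  simp only [smul_add]
  abel

lemma contDiffAt_cderiv {a : Q → G} {q : Q} (ha : ContDiffAt ℝ ∞ a q) (v w : Q) : ContDiffAt ℝ ∞
  (cderiv v w a) q := by
  have h := ha.fderiv_right (m := ∞) (by simp)
  exact (h.clm_apply contDiffAt_const).add ((h.clm_apply contDiffAt_const).const_smul _)

lemma cderiv_pderiv {a : Fib m × P → G} {q : Fib m × P} (ha : ContDiffAt ℝ ∞ a q)
  (v w : Fib m × P) : cderiv v w (pderiv a) q = pderiv (cderiv v w a) q := by
  have hd := (contDiffAt_pderiv ha).differentiableAt (by simp)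
  have hc (v w) := (contDiffAt_cderiv ha v w).differentiableAt (by simp)
  refine clm_ext fun ⟨x, y⟩ => ?_
  have h := cderiv_clm_comp hd (v := v) (w := w) (applyCLM ℂ G (x, y))
  refine h.symm.trans ?_
  change cderiv v w (fun q => pderiv a q (x, y)) q = _
  simp_rw [pderiv_apply]
  refine (cderiv_add ((hc _ _).const_smul (1 / 2 : ℂ)) ((hc _ _).const_smul (1 / 2 : ℂ))).trans ?_
  have hs (v' w') : cderiv v w ((1 / 2 : ℂ) • cderiv v' w' a) q =
      (1 / 2 : ℂ) • cderiv v w (cderiv v' w' a) q :=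
    cderiv_clm_comp (hc v' w') ((1 / 2 : ℂ) • idCLM ℂ G)
  rw [hs, hs, cderiv_comm ha, cderiv_comm ha (v' := (star y, 0))]

lemma SmoothKer.pderiv {S : Set ((Fib m × P) × (Fib m × P))} {q₀ : Fib m × P}
  {a : Fib m × P → G} (ha : SmoothKer S q₀ a) : SmoothKer S q₀ (pderiv a) where
  smooth := ha.smooth.mono fun _ h => contDiffAt_pderiv h
  ker p hp := by
    filter_upwards [ha.smooth, eventually_eventually_nhds.2 (ha.ker p hp)] with q h h'
    rw [cderiv_pderiv h, pderiv_congr (b := fun _ => 0) h']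
    simp [_root_.pderiv]

end operators

/-! ## The Dolbeault lemma with parameters, in standard coordinates -/

section forms

/-- Complex-linear alternating forms. -/
abbrev CForm (m p : ℕ) (F : Type) [NormedAddCommGroup F] [NormedSpace ℂ F] : Type :=
  Fib m [⋀^Fin p]→L[ℂ] F

/-- Contraction of a form with a vector. -/
def contract (v : Fib m) : CForm m (p + 1) F →L[ℂ] CForm m p F :=
  (applyCLM ℂ _ v).comp
    (ContinuousAlternatingMap.curryLeftLI (𝕜 := ℂ)).toContinuousLinearMap

lemma contract_apply (v : Fib m) (f : CForm m (p + 1) F) (w : Fin p → Fib m) :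
  contract v f w = f (Matrix.vecCons v w) := rfl

lemma contract_contract (v : Fib m) (f : CForm m (p + 2) F) : contract v (contract v f) = 0 :=
  ContinuousAlternatingMap.curryLeft_same f v

lemma contract_swap (v w : Fib m) (f : CForm m (p + 2) F) :
  contract v (contract w f) = -contract w (contract v f) := by
  have h := contract_contract (v + w) f
  have e (u : Fib m) (g : CForm m (p + 2) F) :
    contract (v + w) g = contract v g + contract w g := map_add g.curryLeft v w
  have e' (u : Fib m) (g : CForm m (p + 1) F) :
    contract (v + w) g = contract v g + contract w g := map_add g.curryLeft v w
  rw [e v, e' v, map_add, map_add, contract_contract, contract_contract] at h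
  rw [eq_neg_iff_add_eq_zero]
  simpa [add_comm] using h

open ContinuousAlternatingMap (alternatizeUncurryFin alternatizeUncurryFinCLM
  alternatizeUncurryFin_apply)

/-- A formal version of Cartan's formula. -/
lemma contract_alternatize (T : Fib m →L[ℂ] CForm m (p + 1) F) (v : Fib m) :
  contract v (alternatizeUncurryFin T) = T v - alternatizeUncurryFin ((contract v).comp T) := by
  ext w
  rw [contract_apply, alternatizeUncurryFin_apply, Fin.sum_univ_succ,
    ContinuousAlternatingMap.sub_apply,
    alternatizeUncurryFin_apply, sub_eq_add_neg, ← Finset.sum_neg_distrib]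
  congr 1
  · simp
  · refine Finset.sum_congr rfl fun i _ => ?_
    have : Fin.removeNth i.succ (Matrix.vecCons v w) = Matrix.vecCons v (Fin.removeNth i w) :=
      Fin.cons_comp_succ_succAbove v w i
    simp only [Fin.val_succ, pow_succ, mul_neg, mul_one, neg_smul, Matrix.cons_val_succ]
    rw [this]
    rfl

lemma contract_alternatize_zero (T : Fib m →L[ℂ] CForm m 0 F) (v : Fib m) :
  contract v (alternatizeUncurryFin T) = T v := by
  ext w
  rw [contract_apply, alternatizeUncurryFin_apply]
  simp only [Fin.sum_univ_succ, Fin.val_zero, pow_zero, one_smul, Matrix.cons_val_zero,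
    Finset.univ_eq_empty, Finset.sum_empty, add_zero]
  congr 1

lemma eq_zero_of_contract_eq_zero (f : CForm m (p + 1) F)
  (h : ∀ j : Fin m, contract (Pi.single j 1) f = 0) : f = 0 := by
  have : f.curryLeft = 0 := by
    refine clm_ext fun v => ?_
    rw [pi_eq_sum_univ' v, map_sum]
    refine Finset.sum_eq_zero fun j _ => ?_
    rw [map_smul]
    exact (congrArg _ (h j)).trans (smul_zero _)
  ext w
  have h' : f (Matrix.vecCons (w 0) (Fin.tail w)) = 0 :=
    congrArg (fun g => g (w 0) (Fin.tail w)) this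
  rwa [show Matrix.vecCons (w 0) (Fin.tail w) = w from Fin.cons_self_tail w] at h'

end forms

section dolbeault

lemma _root_.ContDiffAt.clm_complex {f : Q → G} {q : Q} (hf : ContDiffAt ℝ ∞ f q) (L : G →L[ℂ] G') :
  ContDiffAt ℝ ∞ (fun q => L (f q)) q :=
  (L.restrictScalars ℝ).contDiff.contDiffAt.comp q hf

/-- The derivatives `∂/∂z̄` in the standard coordinates. -/
def pbar (a : Fib m × P → G) (q : Fib m × P) : Fib m →L[ℂ] G :=
  (pderiv a q).comp (inr ℂ _ _)

lemma pbar_apply (a : Fib m × P → G) (q : Fib m × P) (w : Fib m) :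
  pbar a q w = (1 / 2 : ℂ) • cderiv (star w, 0) (I • star w, 0) a q := by
  rw [pbar, clm_comp_apply, inr_apply, pderiv_apply]
  have h₀ : ((0, 0) : Fib m × P) = 0 := rfl
  simp [cderiv, h₀]

lemma pbar_congr {a b : Fib m × P → G} {q : Fib m × P} (h : a =ᶠ[𝓝 q] b) : pbar a q = pbar b q := by
  rw [pbar, pbar, pderiv_congr h]

lemma pbar_clm_comp {a : Fib m × P → G} {q : Fib m × P} (ha : DifferentiableAt ℝ a q)
  (L : G →L[ℂ] G') : pbar (fun q => L (a q)) q = L.comp (pbar a q) := by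
  rw [pbar, pderiv_clm_comp ha, pbar, ContinuousLinearMap.comp_assoc]

lemma contDiffAt_pbar {a : Fib m × P → G} {q : Fib m × P}
  (ha : ContDiffAt ℝ ∞ a q) : ContDiffAt ℝ ∞ (pbar a) q :=
  (contDiffAt_pderiv ha).clm_complex (ContinuousLinearMap.precomp (𝕜₃ := ℂ) G
    (inr ℂ (Fib m) (Fib m)))

lemma pbar_symm {a : Fib m × P → G} {q : Fib m × P} (ha : ContDiffAt ℝ ∞ a q)
  (v w : Fib m) : pbar (pbar a) q v w = pbar (pbar a) q w v := by
  have hc (v w) := (contDiffAt_cderiv ha v w).differentiableAt (by simp)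
  have key (v w) : pbar (pbar a) q v w = (1 / 2 : ℂ) • (1 / 2 : ℂ) •
      cderiv (star v, 0) (I • star v, 0)
        (cderiv (star w, 0) (I • star w, 0) a) q := by
    have h := pbar_clm_comp ((contDiffAt_pbar ha).differentiableAt (by simp))
      (applyCLM ℂ G w)
    have h' : pbar (pbar a) q v w = pbar (fun q => pbar a q w) q v := by
      refine Eq.trans ?_ (congrArg (· v) h.symm)
      rfl
    rw [h', pbar_apply]
    simp_rw [pbar_apply]
    congr 1
    exact cderiv_clm_comp (hc _ _) ((1 / 2 : ℂ) • idCLM ℂ G)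
  rw [key, key, cderiv_comm ha]

open ContinuousAlternatingMap (alternatizeUncurryFin alternatizeUncurryFinCLM
  alternatizeUncurryFin_apply)

/-- The Dolbeault operator in the standard coordinates; the form `α` stands for `α (dz̄, …, dz̄)`. -/
def dbarStd (α : Fib m × P → CForm m p F) (q : Fib m × P) : CForm m (p + 1) F :=
  alternatizeUncurryFin (pbar α q)

lemma contDiffAt_dbarStd {α : Fib m × P → CForm m p F} {q : Fib m × P}
  (h : ContDiffAt ℝ ∞ α q) : ContDiffAt ℝ ∞ (dbarStd α) q :=
  (contDiffAt_pbar h).clm_complex (alternatizeUncurryFinCLM ℂ (Fib m) F)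

lemma dbarStd_congr {α β : Fib m × P → CForm m p F} {q : Fib m × P}
  (h : α =ᶠ[𝓝 q] β) : dbarStd α q = dbarStd β q := by
  rw [dbarStd, dbarStd, pbar_congr h]

lemma dbarStd_dbarStd {α : Fib m × P → CForm m p F} {q : Fib m × P}
  (h : ContDiffAt ℝ ∞ α q) : dbarStd (dbarStd α) q = 0 := by
  have h₁ : pbar (dbarStd α) q = _ :=
    pbar_clm_comp ((contDiffAt_pbar h).differentiableAt (by simp))
    (alternatizeUncurryFinCLM ℂ (Fib m) F)
  rw [dbarStd, h₁]
  exact ContinuousAlternatingMap.alternatizeUncurryFin_alternatizeUncurryFinCLM_comp_of_symmetric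
     (pbar_symm h)

lemma dbarStd_zero (q : Fib m × P) : dbarStd (0 : Fib m × P → CForm m p F) q = 0 := by
  have : pbar (0 : Fib m × P → CForm m p F) q = 0 := by
    refine clm_ext fun v => ?_
    rw [pbar_apply]
    simp [cderiv]
  rw [dbarStd, this]
  exact map_zero (alternatizeUncurryFinCLM ℂ (Fib m) F)

lemma dbarStd_add {α β : Fib m × P → CForm m p F} {q : Fib m × P}
  (h : ContDiffAt ℝ ∞ α q) (h' : ContDiffAt ℝ ∞ β q) :
  dbarStd (α + β) q = dbarStd α q + dbarStd β q := by
  have : pbar (α + β) q = pbar α q + pbar β q := by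
    rw [pbar, pderiv_add (h.differentiableAt (by simp)) (h'.differentiableAt (by simp))]
    rfl
  rw [dbarStd, this]
  exact map_add (alternatizeUncurryFinCLM ℂ (Fib m) F) _ _

lemma dbarStd_sub {α β : Fib m × P → CForm m p F} {q : Fib m × P}
  (h : ContDiffAt ℝ ∞ α q) (h' : ContDiffAt ℝ ∞ β q) :
  dbarStd (α - β) q = dbarStd α q - dbarStd β q := by
  have : pbar (α - β) q = pbar α q - pbar β q := by
    rw [pbar, pderiv, fderiv_sub (h.differentiableAt (by simp)) (h'.differentiableAt (by simp)),
      ContinuousLinearMap.sub_comp, map_sub, ContinuousLinearMap.sub_comp]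
    rfl
  rw [dbarStd, this]
  exact map_sub (alternatizeUncurryFinCLM ℂ (Fib m) F) _ _

lemma contract_dbarStd {α : Fib m × P → CForm m (p + 1) F} {q : Fib m × P}
  (h : ContDiffAt ℝ ∞ α q) (v : Fib m) :
  contract v (dbarStd α q) = pbar α q v - dbarStd (fun q => contract v (α q)) q := by
  rw [dbarStd, contract_alternatize, dbarStd,
    pbar_clm_comp (h.differentiableAt (by simp)) (contract v)]

variable [FiniteDimensional ℂ F] [FiniteDimensional ℝ P]

/-- The inclusion of a coordinate line. -/
def lineCLM (m : ℕ) (P : Type) [NormedAddCommGroup P] [NormedSpace ℝ P] (k : Fin m) :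
  ℂ →L[ℝ] Fib m × P :=
  (inl ℝ (Fib m) P).comp
    ((ContinuousLinearMap.single ℂ (fun _ : Fin m => ℂ) k).restrictScalars ℝ)

/-- The coordinate functions. -/
def coordCLM (m : ℕ) (P : Type) [NormedAddCommGroup P] [NormedSpace ℝ P] (k : Fin m) :
  Fib m × P →L[ℝ] ℂ :=
  ((ContinuousLinearMap.proj (R := ℂ) (φ := fun _ : Fin m => ℂ) k).restrictScalars ℝ).comp
    (ContinuousLinearMap.fst ℝ (Fib m) P)

lemma lineCLM_apply (k : Fin m) (c : ℂ) : lineCLM m P k c = (Pi.single k c, 0) := rfl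
lemma coordCLM_apply (k : Fin m) (q : Fib m × P) : coordCLM m P k q = q.1 k := rfl

lemma pbar_single (a : Fib m × P → G) (q : Fib m × P) (k : Fin m) : pbar a q (Pi.single k 1) =
  (1 / 2 : ℂ) • cderiv (lineCLM m P k 1) (lineCLM m P k I) a q := by
  have h₁ : star (Pi.single k 1 : Fib m) = Pi.single k 1 := by
    rw [← Pi.single_star, star_one]
  have h₂ : I • (Pi.single k 1 : Fib m) = Pi.single k I := by
    rw [← Pi.single_smul, smul_eq_mul, mul_one]
  rw [pbar_apply, h₁, h₂]
  rfl

lemma exists_pbar_single_solution [CompleteSpace G] (k : Fin m) (f : Fib m × P → G)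
  (q₀ : Fib m × P) (hf : ∀ᶠ q in 𝓝 q₀, ContDiffAt ℝ ∞ f q) (J : Set (Fin m)) (hJ : k ∉ J)
  (hk : ∀ j ∈ J, ∀ᶠ q in 𝓝 q₀, pbar f q (Pi.single j 1) = 0)
  {G' : Type} [NormedAddCommGroup G'] [NormedSpace ℝ G'] [NormedSpace ℂ G']
  [IsScalarTower ℝ ℂ G'] [CompleteSpace G'] (L : Fin m → G →L[ℂ] G') (J' : Set (Fin m))
  (hL : ∀ j ∈ J', ∀ᶠ q in 𝓝 q₀, L j (f q) = 0) :
  ∃ u : Fib m × P → G, (∀ᶠ q in 𝓝 q₀, ContDiffAt ℝ ∞ u q) ∧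
  (∀ᶠ q in 𝓝 q₀, pbar u q (Pi.single k 1) = f q) ∧
  (∀ j ∈ J, ∀ᶠ q in 𝓝 q₀, pbar u q (Pi.single j 1) = 0) ∧
  ∀ j ∈ J', ∀ᶠ q in 𝓝 q₀, L j (u q) = 0 := by
  have e₁ : ∀ᶠ q in 𝓝 q₀, ∀ j ∈ J, pbar f q (Pi.single j 1) = 0 :=
    eventually_all.2 fun j => by
      by_cases h : j ∈ J
      · exact (hk j h).mono fun _ h _ => h
      · simp [h]
  have e₂ : ∀ᶠ q in 𝓝 q₀, ∀ j ∈ J', L j (f q) = 0 :=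
    eventually_all.2 fun j => by
      by_cases h : j ∈ J'
      · exact (hL j h).mono fun _ h _ => h
      · simp [h]
  obtain ⟨u, O', hO', h₁, h₂, h₃, h₄⟩ := exists_cauchyRiemann_solution (lineCLM m P k)
    (coordCLM m P k) (fun ζ => by simp [lineCLM_apply, coordCLM_apply]) f q₀ _
    (hf.and (e₁.and e₂)) fun q h => h.1
  refine ⟨u, Eventually.of_forall h₁, ?_, fun j hj => ?_, fun j hj => ?_⟩
  · filter_upwards [hO'] with q hq
    rw [pbar_single, h₂ q hq, smul_smul]
    norm_num
  · filter_upwards [hO'] with q hq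
    have hkj : j ≠ k := fun h => hJ (h ▸ hj)
    have hz (c : ℂ) : coordCLM m P k (lineCLM m P j c) = 0 := by
      simp [lineCLM_apply, coordCLM_apply, hkj.symm]
    rw [pbar_single, h₃ _ _ (hz _) (hz _) ?_ q hq, smul_zero]
    intro q hq
    have h := hq.2.1 j hj
    rw [pbar_single] at h
    exact (smul_eq_zero.1 h).resolve_left (by norm_num)
  · exact Eventually.of_forall fun q => h₄ G' (L j) (fun q hq => hq.2.2 j hj) q

lemma exists_dbarStd_primitive_aux (q₀ : Fib m × P) :
    ∀ (d k : ℕ), k + d = m → ∀ {p : ℕ} (α : Fib m × P → CForm m (p + 1) F),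
      (∀ᶠ q in 𝓝 q₀, ContDiffAt ℝ ∞ α q) → (∀ᶠ q in 𝓝 q₀, dbarStd α q = 0) →
      (∀ j : Fin m, j < k → ∀ᶠ q in 𝓝 q₀, contract (Pi.single j 1) (α q) = 0) →
      ∃ β : Fib m × P → CForm m p F, (∀ᶠ q in 𝓝 q₀, ContDiffAt ℝ ∞ β q) ∧
        ∀ᶠ q in 𝓝 q₀, dbarStd β q = α q := by
  intro d
  induction d with
  | zero =>
    intro k hk p α hα hc hz
    refine ⟨0, Eventually.of_forall fun q => contDiffAt_const, ?_⟩
    have : ∀ᶠ q in 𝓝 q₀, ∀ j : Fin m, contract (Pi.single j 1) (α q) = 0 :=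
      eventually_all.2 fun j => hz j (by omega)
    filter_upwards [this] with q hq
    rw [eq_zero_of_contract_eq_zero _ hq]
    exact dbarStd_zero q
  | succ d ih =>
    intro k hk p α hα hc hz
    let κ : Fin m := ⟨k, by omega⟩
    -- derivatives in the previous directions vanish
    have hder (j : Fin m) (hj : j < k) : ∀ᶠ q in 𝓝 q₀, pbar α q (Pi.single j 1) = 0 := by
      filter_upwards [hα, hc, eventually_eventually_nhds.2 (hz j hj)] with q h₁ h₂ h₃
      have h := contract_dbarStd h₁ (Pi.single j 1)
      have h₄ : dbarStd (fun q => contract (Pi.single j 1) (α q)) q = 0 := by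
        rw [dbarStd_congr (β := 0) h₃, dbarStd_zero]
      rw [h₂, h₄, map_zero, sub_zero] at h
      exact h.symm
    let b : Fib m × P → CForm m p F := fun q => contract (Pi.single κ 1) (α q)
    have hb : ∀ᶠ q in 𝓝 q₀, ContDiffAt ℝ ∞ b q := by
      filter_upwards [hα] with q hq
      exact ((contract (Pi.single κ 1)).restrictScalars ℝ).contDiff.contDiffAt.comp q hq
    have hbder (j : Fin m) (hj : j < k) : ∀ᶠ q in 𝓝 q₀, pbar b q (Pi.single j 1) = 0 := by
      filter_upwards [hα, hder j hj] with q h₁ h₂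
      rw [pbar_clm_comp (h₁.differentiableAt (by simp)) (contract (Pi.single κ 1)),
        clm_comp_apply, h₂, map_zero]
    have key : ∃ δ : Fib m × P → CForm m p F, (∀ᶠ q in 𝓝 q₀, ContDiffAt ℝ ∞ δ q) ∧
        ∀ j : Fin m, j < k + 1 → ∀ᶠ q in 𝓝 q₀,
          contract (Pi.single j 1) (α q - dbarStd δ q) = 0 := by
      cases p with
      | zero =>
        obtain ⟨δ, h₁, h₂, h₃, -⟩ := exists_pbar_single_solution (G' := ℂ) κ b q₀ hb {j | j < κ}
          (by simp) (fun j hj => hbder j hj) (fun _ => 0) ∅ (by simp)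
        refine ⟨δ, h₁, fun j hj => ?_⟩
        rcases Nat.lt_succ_iff_lt_or_eq.1 hj with hj | hj
        · filter_upwards [hz j hj, h₃ j hj] with q e₁ e₂
          rw [map_sub, e₁, dbarStd, contract_alternatize_zero, e₂, sub_zero]
        · obtain rfl : j = κ := Fin.ext hj
          filter_upwards [h₂] with q e₂
          rw [map_sub, dbarStd, contract_alternatize_zero, e₂]
          exact sub_self _
      | succ p =>
        have hcc (j : Fin m) (hj : j ≤ κ) : ∀ᶠ q in 𝓝 q₀, contract (Pi.single j 1) (b q) = 0 := by
          rcases lt_or_eq_of_le hj with hj | rfl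
          · filter_upwards [hz j hj] with q e₁
            change contract _ (contract _ _) = 0
            rw [contract_swap, e₁, map_zero, neg_zero]
          · exact Eventually.of_forall fun q => contract_contract _ _
        obtain ⟨δ, h₁, h₂, h₃, h₄⟩ := exists_pbar_single_solution κ b q₀ hb {j | j < κ}
          (by simp) (fun j hj => hbder j hj)
          (fun j => (contract (Pi.single j 1) : CForm m (p + 1) F →L[ℂ] CForm m p F)) {j | j ≤ κ} hcc
        have hdc (j : Fin m) (hj : j ≤ κ) : ∀ᶠ q in 𝓝 q₀,
            contract (Pi.single j 1) (dbarStd δ q) = pbar δ q (Pi.single j 1) := by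
          filter_upwards [h₁, eventually_eventually_nhds.2 (h₄ j hj)] with q e₁ e₂
          rw [contract_dbarStd e₁, dbarStd_congr (β := 0) e₂, dbarStd_zero, sub_zero]
        refine ⟨δ, h₁, fun j hj => ?_⟩
        rcases Nat.lt_succ_iff_lt_or_eq.1 hj with hj | hj
        · filter_upwards [hz j hj, h₃ j hj, hdc j (Fin.le_def.2 hj.le)] with q e₁ e₂ e₃
          rw [map_sub, e₁, e₃, e₂, sub_zero]
        · obtain rfl : j = κ := Fin.ext hj
          filter_upwards [h₂, hdc κ le_rfl] with q e₂ e₃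
          rw [map_sub, e₃, e₂, sub_self]
    obtain ⟨δ, hδ, hδ'⟩ := key
    have hα' : ∀ᶠ q in 𝓝 q₀, ContDiffAt ℝ ∞ (α - dbarStd δ) q := by
      filter_upwards [hα, hδ] with q h₁ h₂
      exact h₁.sub (contDiffAt_dbarStd h₂)
    obtain ⟨β, hβ, hβ'⟩ := ih (k + 1) (by omega) (α - dbarStd δ) hα' (by
      filter_upwards [hα, hδ, hc] with q h₁ h₂ h₃
      rw [dbarStd_sub h₁ (contDiffAt_dbarStd h₂), h₃, dbarStd_dbarStd h₂, sub_zero]) hδ'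
    refine ⟨β + δ, ?_, ?_⟩
    · filter_upwards [hβ, hδ] with q h₁ h₂
      exact h₁.add h₂
    · filter_upwards [hβ, hδ, hβ'] with q h₁ h₂ h₃
      rw [dbarStd_add h₁ h₂, h₃]
      exact sub_add_cancel _ _

/-- The Dolbeault lemma with smooth parameters. -/
theorem exists_dbarStd_primitive (q₀ : Fib m × P) {p : ℕ}
  (α : Fib m × P → CForm m (p + 1) F) (hα : ∀ᶠ q in 𝓝 q₀, ContDiffAt ℝ ∞ α q)
  (hc : ∀ᶠ q in 𝓝 q₀, dbarStd α q = 0) :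
  ∃ β : Fib m × P → CForm m p F, (∀ᶠ q in 𝓝 q₀, ContDiffAt ℝ ∞ β q) ∧
  ∀ᶠ q in 𝓝 q₀, dbarStd β q = α q :=
  exists_dbarStd_primitive_aux q₀ m 0 (zero_add m) α hα hc (by simp)

end dolbeault

/-! ## Tools: spaces of forms, inverse functions, product rules -/

section tools

lemma finiteDimensional_alternating (𝕜 V F : Type) [RCLike 𝕜] [NormedAddCommGroup V]
  [NormedSpace 𝕜 V] [FiniteDimensional 𝕜 V] [NormedAddCommGroup F] [NormedSpace 𝕜 F]
  [FiniteDimensional 𝕜 F] (p : ℕ) : FiniteDimensional 𝕜 (V [⋀^Fin p]→L[𝕜] F) := by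
  let φ : (V [⋀^Fin p]→L[𝕜] F) →ₗ[𝕜] MultilinearMap 𝕜 (fun _ : Fin p => V) F :=
    { toFun := fun f => f.toContinuousMultilinearMap.toMultilinearMap
      map_add' := fun _ _ => rfl
      map_smul' := fun _ _ => rfl }
  refine Module.Finite.of_injective φ fun f g h => ?_
  ext v
  exact congrArg (fun h => h v) h

lemma finiteDimensional_multilinear (𝕜 V F : Type) [RCLike 𝕜] [NormedAddCommGroup V]
  [NormedSpace 𝕜 V] [FiniteDimensional 𝕜 V] [NormedAddCommGroup F] [NormedSpace 𝕜 F]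
  [FiniteDimensional 𝕜 F] (p : ℕ) :
  FiniteDimensional 𝕜 (ContinuousMultilinearMap 𝕜 (fun _ : Fin p => V) F) := by
  let φ : (ContinuousMultilinearMap 𝕜 (fun _ : Fin p => V) F) →ₗ[𝕜]
      MultilinearMap 𝕜 (fun _ : Fin p => V) F :=
    { toFun := fun f => f.toMultilinearMap
      map_add' := fun _ _ => rfl
      map_smul' := fun _ _ => rfl }
  refine Module.Finite.of_injective φ fun f g h => ?_
  ext v
  exact congrArg (fun h => h v) h

lemma exists_clm_leftInverse {𝕜 E G : Type} [RCLike 𝕜] [NormedAddCommGroup E] [NormedSpace 𝕜 E]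
  [NormedAddCommGroup G] [NormedSpace 𝕜 G] [FiniteDimensional 𝕜 G] (f : E →ₗ[𝕜] G)
  (hf : Function.Injective f) : ∃ g : G →L[𝕜] E, ∀ x, g (f x) = x := by
  obtain ⟨g, hg⟩ := f.exists_leftInverse_of_injective (LinearMap.ker_eq_bot.2 hf)
  exact ⟨LinearMap.toContinuousLinearMap g, fun x => congrArg (fun h => h x) hg⟩

/-- The pullback of alternating forms is a smooth function of both arguments. -/
lemma contDiff_compContinuousLinearMap (m p : ℕ) (F : Type) [NormedAddCommGroup F]
  [NormedSpace ℂ F] [FiniteDimensional ℂ F] :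
  ContDiff ℂ ∞ fun x : CForm m p F × (Fib m →L[ℂ] Fib m) => x.1.compContinuousLinearMap x.2 := by
  have := finiteDimensional_multilinear ℂ (Fib m) F p
  obtain ⟨g, hg⟩ := exists_clm_leftInverse
    (ContinuousAlternatingMap.toContinuousMultilinearMapLinear (R := ℂ) (A := ℂ)
      (M := Fib m) (N := F) (ι := Fin p))
    ContinuousAlternatingMap.toContinuousMultilinearMap_injective
  have h₁ : ContDiff ℂ ∞ fun x : CForm m p F × (Fib m →L[ℂ] Fib m) =>
      (ContinuousMultilinearMap.compContinuousLinearMapContinuousMultilinear ℂ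
        (fun _ : Fin p => Fib m) (fun _ => Fib m) F) (fun _ => x.2) :=
    (ContinuousMultilinearMap.contDiff _).comp (contDiff_pi.2 fun _ => contDiff_snd)
  have h₂ : ContDiff ℂ ∞ fun x : CForm m p F × (Fib m →L[ℂ] Fib m) =>
      x.1.toContinuousMultilinearMap :=
    ContDiff.comp (g := fun f : CForm m p F => f.toContinuousMultilinearMap)
      (ContinuousAlternatingMap.toContinuousMultilinearMapCLM (𝕜 := ℂ) (E := Fib m)
        (F := F) (ι := Fin p) ℂ).contDiff contDiff_fst
  have h₃ := g.contDiff.comp (h₁.clm_apply h₂)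
  convert h₃ using 1
  funext x
  exact (hg (x.1.compContinuousLinearMap x.2)).symm

lemma exists_local_inverse {Q' : Type} [CompleteSpace Q] [NormedAddCommGroup Q'] [NormedSpace ℝ Q']
  [CompleteSpace Q'] (Φ : Q → Q') (q₀ : Q)
  (hΦ : ∀ᶠ q in 𝓝 q₀, ContDiffAt ℝ ∞ Φ q) (hinv : (fderiv ℝ Φ q₀).IsInvertible) :
  ∃ Ψ : Q' → Q, Ψ (Φ q₀) = q₀ ∧ (∀ᶠ q in 𝓝 q₀, Ψ (Φ q) = q) ∧
  (∀ᶠ p in 𝓝 (Φ q₀), Φ (Ψ p) = p) ∧ ∀ᶠ p in 𝓝 (Φ q₀), ContDiffAt ℝ ∞ Ψ p := by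
  obtain ⟨e, he⟩ := hinv
  have h₀ := hΦ.self_of_nhds
  have hd : HasFDerivAt Φ (e : Q →L[ℝ] Q') q₀ := by
    rw [he]
    exact (h₀.differentiableAt (by simp)).hasFDerivAt
  let f := h₀.toOpenPartialHomeomorph Φ hd (by simp)
  have hfΦ : ⇑f = Φ := h₀.toOpenPartialHomeomorph_coe hd (by simp)
  have hs : q₀ ∈ f.source := h₀.mem_toOpenPartialHomeomorph_source hd (by simp)
  have ht : Φ q₀ ∈ f.target := by
    have := f.map_source hs
    rwa [hfΦ] at this
  have hleft (q) (hq : q ∈ f.source) : f.symm (Φ q) = q := by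
    have := f.left_inv hq
    rwa [hfΦ] at this
  have hright (q) (hq : q ∈ f.target) : Φ (f.symm q) = q := by
    have := f.right_inv hq
    rwa [hfΦ] at this
  refine ⟨f.symm, hleft _ hs, ?_, ?_, ?_⟩
  · filter_upwards [f.open_source.mem_nhds hs] using hleft
  · filter_upwards [f.open_target.mem_nhds ht] using hright
  · have hc : ContinuousAt f.symm (Φ q₀) := f.continuousAt_symm ht
    have hc' : Tendsto f.symm (𝓝 (Φ q₀)) (𝓝 q₀) := by
      rw [ContinuousAt, hleft _ hs] at hc
      exact hc
    have hcd : ContinuousAt (fderiv ℝ Φ) q₀ := (h₀.fderiv_right (m := ∞) (by simp)).continuousAt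
    have hopen : ∀ᶠ q in 𝓝 q₀, fderiv ℝ Φ q ∈ Set.range ((↑) : (Q ≃L[ℝ] Q') → Q →L[ℝ] Q') := by
      refine hcd.eventually ?_
      rw [← he]
      exact ContinuousLinearEquiv.nhds e
    filter_upwards [f.open_target.mem_nhds ht, hc'.eventually hΦ, hc'.eventually hopen]
      with p hp h₁ h₂
    obtain ⟨e', he'⟩ := h₂
    refine f.contDiffAt_symm (f₀' := e') hp ?_ ?_
    · rw [hfΦ, he']
      exact (h₁.differentiableAt (by simp)).hasFDerivAt
    · rwa [hfΦ]

lemma eventually_isInvertible {Q E E' : Type} [TopologicalSpace Q] {𝕜 : Type} [RCLike 𝕜]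
  [NormedAddCommGroup E] [NormedSpace 𝕜 E] [CompleteSpace E] [NormedAddCommGroup E']
  [NormedSpace 𝕜 E'] {A : Q → E →L[𝕜] E'} {q₀ : Q} (hA : ContinuousAt A q₀)
  (h : (A q₀).IsInvertible) : ∀ᶠ q in 𝓝 q₀, (A q).IsInvertible := by
  refine hA.eventually ?_
  obtain ⟨e, he⟩ := h
  rw [← he]
  exact ContinuousLinearEquiv.nhds e

lemma cderiv_bilin (L : G →L[ℂ] G' →L[ℂ] G'') {f : Q → G} {g : Q → G'} {q : Q}
  (hf : DifferentiableAt ℝ f q) (hg : DifferentiableAt ℝ g q) (v w : Q) :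
  cderiv v w (fun q => L (f q) (g q)) q = L (cderiv v w f q) (g q) + L (f q) (cderiv v w g q) := by
  let A := L.isBoundedBilinearMap
  have h := ((A.hasFDerivAt (f q, g q)).restrictScalars ℝ).comp q
    (hf.hasFDerivAt.prodMk hg.hasFDerivAt)
  have h' : fderiv ℝ (fun q => L (f q) (g q)) q = _ := h.fderiv
  rw [cderiv, h']
  simp only [cderiv, clm_comp_apply, ContinuousLinearMap.coe_restrictScalars',
    IsBoundedBilinearMap.deriv_apply, clm_prod_apply, map_add, map_smul,
    add_apply, smul_apply, smul_add]
  abel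

lemma _root_.SmoothKer.inverse {E E' : Type} [NormedAddCommGroup E] [NormedSpace ℝ E]
  [NormedSpace ℂ E] [IsScalarTower ℝ ℂ E] [CompleteSpace E] [NormedAddCommGroup E']
  [NormedSpace ℝ E'] [NormedSpace ℂ E'] [IsScalarTower ℝ ℂ E'] {S : Set (Q × Q)} {q₀ : Q}
  {A : Q → E →L[ℂ] E'} (hA : SmoothKer S q₀ A) (h : (A q₀).IsInvertible) :
  SmoothKer S q₀ fun q => (A q).inverse := by
  have hinv : ∀ᶠ T in 𝓝 (A q₀), T.IsInvertible := by
    obtain ⟨e, he⟩ := h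
    rw [← he]
    exact ContinuousLinearEquiv.nhds e
  refine hA.comp_holomorphic ?_ ?_
  · filter_upwards [hinv] with T hT
    exact (hT.contDiffAt_map_inverse (n := ∞)).restrict_scalars ℝ
  · filter_upwards [hinv] with T hT
    exact (hT.contDiffAt_map_inverse (n := ∞)).differentiableAt (by simp)

lemma _root_.SmoothKer.formComp [FiniteDimensional ℂ F] {S : Set (Q × Q)} {q₀ : Q}
  {a : Q → CForm m p F} {B : Q → Fib m →L[ℂ] Fib m} (ha : SmoothKer S q₀ a)
  (hB : SmoothKer S q₀ B) : SmoothKer S q₀ fun q => (a q).compContinuousLinearMap (B q) :=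
  (ha.prodMk hB).comp_holomorphic
    (φ := fun x : CForm m p F × (Fib m →L[ℂ] Fib m) =>
      x.1.compContinuousLinearMap x.2)
    (.of_forall fun _ =>
      ((contDiff_compContinuousLinearMap m p F).restrict_scalars ℝ).contDiffAt)
    (.of_forall fun _ =>
      (contDiff_compContinuousLinearMap m p F).differentiable (by simp) _)

lemma _root_.SmoothKer.comp_clm {E E' E'' : Type} [NormedAddCommGroup E] [NormedSpace ℝ E]
  [NormedSpace ℂ E] [IsScalarTower ℝ ℂ E] [NormedAddCommGroup E']
  [NormedSpace ℝ E'] [NormedSpace ℂ E'] [IsScalarTower ℝ ℂ E'] [NormedAddCommGroup E'']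
  [NormedSpace ℝ E''] [NormedSpace ℂ E''] [IsScalarTower ℝ ℂ E''] {S : Set (Q × Q)} {q₀ : Q}
  {A : Q → E' →L[ℂ] E''} {B : Q → E →L[ℂ] E'} (hA : SmoothKer S q₀ A) (hB : SmoothKer S q₀ B) :
  SmoothKer S q₀ fun q => (A q).comp (B q) :=
  SmoothKer.bilin (compL ℂ E E' E'') hA hB

lemma contDiffAt_formComp [FiniteDimensional ℂ F] {q : Q} {a : Q → CForm m p F}
  {B : Q → Fib m →L[ℂ] Fib m} (ha : ContDiffAt ℝ ∞ a q) (hB : ContDiffAt ℝ ∞ B q) :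
  ContDiffAt ℝ ∞ (fun q => (a q).compContinuousLinearMap (B q)) q :=
  ((contDiff_compContinuousLinearMap m p F).restrict_scalars ℝ).contDiffAt.comp q
    (ha.prodMk hB)

end tools

/-! ## Change of coframe -/

section changeOfFrame

open ContinuousAlternatingMap (alternatizeUncurryFin alternatizeUncurryFinCLM
  alternatizeUncurryFin_apply)

lemma pbar_formComp {b : Fib m × P → CForm m p F}
  {B : Fib m × P → Fib m →L[ℂ] Fib m} {q : Fib m × P}
  (hb : DifferentiableAt ℝ b q) (hB : DifferentiableAt ℝ B q) :
  pbar (fun q => (b q).compContinuousLinearMap (B q)) q =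
  (ContinuousAlternatingMap.compContinuousLinearMapCLM (B q)).comp (pbar b q) +
  ((b q).fderivCompContinuousLinearMap (B q)).comp (pbar B q) := by
  have h := ((ContinuousAlternatingMap.hasStrictFDerivAt_compContinuousLinearMap (𝕜 := ℂ)
    (b q, B q)).hasFDerivAt.restrictScalars ℝ).comp q (hb.hasFDerivAt.prodMk hB.hasFDerivAt)
  have h' : fderiv ℝ (fun q => (b q).compContinuousLinearMap (B q)) q = _ := h.fderiv
  refine clm_ext fun v => ?_
  rw [add_apply, clm_comp_apply, clm_comp_apply, pbar_apply,
    pbar_apply, pbar_apply, cderiv, cderiv, cderiv, h']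
  simp only [clm_comp_apply, ContinuousLinearMap.coe_restrictScalars',
    clm_prod_apply, map_add, map_smul, add_apply, smul_add,
    ContinuousLinearMap.coe_fst', ContinuousLinearMap.coe_snd']
  abel

/-- `∂̄` after the change of coframe given by the closed forms `dbar W'`. -/
lemma dbarStd_formComp {b : Fib m × P → CForm m p F} {W' : Fib m × P → Fib m}
  {q : Fib m × P} (hb : DifferentiableAt ℝ b q) (hW : ContDiffAt ℝ ∞ W' q)
  {T : Fib m →L[ℂ] CForm m p F} (hT : pbar b q = T.comp (pbar W' q)) :
  dbarStd (fun q => (b q).compContinuousLinearMap (pbar W' q)) q =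
  (alternatizeUncurryFin T).compContinuousLinearMap (pbar W' q) := by
  have hB : DifferentiableAt ℝ (pbar W') q := (contDiffAt_pbar hW).differentiableAt (by simp)
  rw [dbarStd, pbar_formComp hb hB, ContinuousAlternatingMap.alternatizeUncurryFin_add,
    ContinuousAlternatingMap.alternatizeUncurryFin_fderivCompContinuousLinearMap_eq_zero _ _
      (pbar_symm hW), add_zero, hT]
  ext v
  simp +unfoldPartialApp [alternatizeUncurryFin_apply, Fin.removeNth, Function.comp_def]

end changeOfFrame

/-! ## The Dolbeault operator of a coframe -/

section frame

/-- The complexified partial derivative of the pair `(Z, W)`. -/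
def frameMap (Z W : Fib m × P → Fib m) (q : Fib m × P) : Fib m × Fib m →L[ℂ] Fib m × Fib m :=
  (pderiv Z q).prod (pderiv W q)

/-- The derivatives along `W` of a function, in the coordinates `(Z, W)`. -/
def pop (Z W : Fib m × P → Fib m) (a : Fib m × P → G) (q : Fib m × P) : Fib m →L[ℂ] G :=
  (pderiv a q).comp ((frameMap Z W q).inverse.comp (inr ℂ _ _))

variable {Z W : Fib m × P → Fib m} {q : Fib m × P}

lemma pop_unique (h : (frameMap Z W q).IsInvertible) {a : Fib m × P → G} (S T : Fib m →L[ℂ] G)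
  (hST : ∀ v, fderiv ℝ a q (v, 0) = S (fderiv ℝ Z q (v, 0)) + T (fderiv ℝ W q (v, 0))) :
  pop Z W a q = T := by
  have e : pderiv a q = (S.coprod T).comp (frameMap Z W q) :=
    complexify_unique fun v => by
      have e : frameMap Z W q (v, star v) = (fderiv ℝ Z q (v, 0), fderiv ℝ W q (v, 0)) :=
        Prod.ext (complexify_conj _ v) (complexify_conj _ v)
      rw [clm_comp_apply, e, ContinuousLinearMap.coprod_apply, ← hST]
      rfl
  refine clm_ext fun v => ?_
  rw [pop, e]
  simp only [clm_comp_apply]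
  rw [h.self_apply_inverse]
  simp

lemma pop_congr {a b : Fib m × P → G} (h : a =ᶠ[𝓝 q] b) : pop Z W a q = pop Z W b q := by
  rw [pop, pop, pderiv_congr h]

lemma pop_add {a b : Fib m × P → G} (ha : DifferentiableAt ℝ a q) (hb : DifferentiableAt ℝ b q) :
  pop Z W (a + b) q = pop Z W a q + pop Z W b q := by
  rw [pop, pderiv_add ha hb]
  rfl

lemma pop_clm_comp {a : Fib m × P → G} (ha : DifferentiableAt ℝ a q) (L : G →L[ℂ] G') :
  pop Z W (fun q => L (a q)) q = L.comp (pop Z W a q) := by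
  rw [pop, pderiv_clm_comp ha]
  rfl

/-- The change of variables in the coframe: `B` is invertible. -/
lemma isInvertible_pbar_of_comp {W' : Fib m × P → Fib m}
  (hZ : DifferentiableAt ℝ Z q) (hW' : DifferentiableAt ℝ W' (Z q, q.2))
  (hW : W =ᶠ[𝓝 q] fun q => W' (Z q, q.2)) (h : (frameMap Z W q).IsInvertible) :
  (pbar W' (Z q, q.2)).IsInvertible := by
  have hd (v : Fib m) : fderiv ℝ W q (v, 0) =
      fderiv ℝ W' (Z q, q.2) (fderiv ℝ Z q (v, 0), 0) := by
    have h₁ : HasFDerivAt (fun q => W' (Z q, q.2)) _ q :=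
      hW'.hasFDerivAt.comp q (hZ.hasFDerivAt.prodMk hasFDerivAt_snd)
    rw [hW.fderiv_eq, h₁.fderiv]
    rfl
  have hc : pderiv W q = (pderiv W' (Z q, q.2)).comp
      ((complexify ((fderiv ℝ Z q).comp (inl ℝ _ _))).prod
        (complexify ((conjCLM m).comp ((fderiv ℝ Z q).comp (inl ℝ _ _))))) := by
    rw [pderiv, pderiv, ← complexify_comp]
    congr 1
    refine clm_ext fun v => ?_
    exact hd v
  have hs : Function.Surjective (pbar W' (Z q, q.2)) := by
    intro v
    obtain ⟨x, hx⟩ := h.bijective.2 (0, v)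
    have h₁ : pderiv Z q x = 0 := congrArg Prod.fst hx
    have h₂ : pderiv W q x = v := congrArg Prod.snd hx
    rw [hc] at h₂
    refine ⟨complexify ((conjCLM m).comp ((fderiv ℝ Z q).comp (inl ℝ _ _))) x,
      Eq.trans ?_ h₂⟩
    rw [pbar, clm_comp_apply, clm_comp_apply]
    congr 1
    exact Prod.ext h₁.symm rfl
  exact ⟨(LinearEquiv.ofBijective (pbar W' (Z q, q.2)).toLinearMap
    ⟨(LinearMap.injective_iff_surjective (f := (pbar W' (Z q, q.2)).toLinearMap)).2 hs,
      hs⟩).toContinuousLinearEquiv, by ext; rfl⟩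

lemma pop_comp {W' : Fib m × P → Fib m} {b : Fib m × P → G}
  (hZ : DifferentiableAt ℝ Z q) (hW' : DifferentiableAt ℝ W' (Z q, q.2))
  (hW : W =ᶠ[𝓝 q] fun q => W' (Z q, q.2)) (h : (frameMap Z W q).IsInvertible)
  (hb : DifferentiableAt ℝ b (Z q, q.2)) :
  pbar b (Z q, q.2) = (pop Z W (fun q => b (Z q, q.2)) q).comp (pbar W' (Z q, q.2)) := by
  have hB := isInvertible_pbar_of_comp hZ hW' hW h
  have hd {H : Type} [NormedAddCommGroup H] [NormedSpace ℝ H] [NormedSpace ℂ H]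
      [IsScalarTower ℝ ℂ H] {b : Fib m × P → H} (hb : DifferentiableAt ℝ b (Z q, q.2))
      (v : Fib m) : fderiv ℝ (fun q => b (Z q, q.2)) q (v, 0) =
        (pderiv b (Z q, q.2)).comp (inl ℂ _ _) (fderiv ℝ Z q (v, 0)) +
          pbar b (Z q, q.2) (star (fderiv ℝ Z q (v, 0))) := by
    have h₁ : HasFDerivAt (fun q => b (Z q, q.2)) _ q :=
      hb.hasFDerivAt.comp q (hZ.hasFDerivAt.prodMk hasFDerivAt_snd)
    rw [h₁.fderiv, pbar, clm_comp_apply, clm_comp_apply,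
      clm_comp_apply, ← map_add, ContinuousLinearMap.inl_apply, inr_apply, Prod.mk_add_mk, add_zero,
      zero_add, pderiv, complexify_conj]
    rfl
  rw [pop_unique h ((pderiv b (Z q, q.2)).comp (inl ℂ _ _) -
    ((pbar b (Z q, q.2)).comp (pbar W' (Z q, q.2)).inverse).comp
      ((pderiv W' (Z q, q.2)).comp (inl ℂ _ _)))
    ((pbar b (Z q, q.2)).comp (pbar W' (Z q, q.2)).inverse)]
  · refine clm_ext fun v => ?_
    rw [clm_comp_apply, clm_comp_apply, hB.inverse_apply_self]
  · intro v
    have e := hd hW' v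
    rw [← hW.fderiv_eq] at e
    rw [hd hb v, e, sub_apply, map_add]
    have e' := hB.inverse_apply_self (star (fderiv ℝ Z q (v, 0)))
    simp only [clm_comp_apply] at e' ⊢
    rw [e']
    abel

open ContinuousAlternatingMap (alternatizeUncurryFin alternatizeUncurryFinCLM)

/-- The Dolbeault operator of the coframe `(Z, W)`; the form `α` stands for `α (dW, …, dW)`. -/
def dbar (Z W : Fib m × P → Fib m) (α : Fib m × P → CForm m p F)
  (q : Fib m × P) : CForm m (p + 1) F :=
  alternatizeUncurryFin (pop Z W α q)

lemma dbar_congr {α β : Fib m × P → CForm m p F} (h : α =ᶠ[𝓝 q] β) :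
  dbar Z W α q = dbar Z W β q := by
  rw [dbar, dbar, pop_congr h]

lemma dbar_add {α β : Fib m × P → CForm m p F}
  (ha : DifferentiableAt ℝ α q) (hb : DifferentiableAt ℝ β q) :
  dbar Z W (α + β) q = dbar Z W α q + dbar Z W β q := by
  rw [dbar, pop_add ha hb]
  exact map_add (alternatizeUncurryFinCLM ℂ (Fib m) F) _ _

lemma dbar_const_smul {α : Fib m × P → CForm m p F}
  (ha : DifferentiableAt ℝ α q) (c : ℂ) : dbar Z W (c • α) q = c • dbar Z W α q := by
  have h := pop_clm_comp (Z := Z) (W := W) ha (c • idCLM ℂ (CForm m p F))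
  have h' : pop Z W (c • α) q = c • pop Z W α q := h
  rw [dbar, h']
  exact map_smul (alternatizeUncurryFinCLM ℂ (Fib m) F) _ _

lemma dbar_sub {α β : Fib m × P → CForm m p F}
  (ha : DifferentiableAt ℝ α q) (hb : DifferentiableAt ℝ β q) :
  dbar Z W (α - β) q = dbar Z W α q - dbar Z W β q := by
  have h : α - β = α + (-1 : ℂ) • β := by module
  rw [h, dbar_add ha (hb.const_smul (-1 : ℂ)), dbar_const_smul hb]
  module

/-- `(Z, W)` is a coframe near `q₀`, with `Z` a chart for each value of the parameters; both
functions are killed by the vector fields in `S`. -/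
structure IsFrame (S : Set ((Fib m × P) × (Fib m × P))) (q₀ : Fib m × P)
  (Z W : Fib m × P → Fib m) : Prop where
  left : SmoothKer S q₀ Z
  right : SmoothKer S q₀ W
  chart : ((fderiv ℝ Z q₀).comp (inl ℝ _ _)).IsInvertible
  frame : (frameMap Z W q₀).IsInvertible

namespace IsFrame

variable {S : Set ((Fib m × P) × (Fib m × P))} {q₀ : Fib m × P}

lemma mono {S' : Set ((Fib m × P) × (Fib m × P))} (h : IsFrame S q₀ Z W)
  (hS : S' ⊆ S) : IsFrame S' q₀ Z W :=
  ⟨h.left.mono hS, h.right.mono hS, h.chart, h.frame⟩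

lemma smoothKer_frameMap (h : IsFrame S q₀ Z W) : SmoothKer S q₀ (frameMap Z W) :=
  (h.left.pderiv.prodMk h.right.pderiv).clm_comp
    (ContinuousLinearMap.prodₗᵢ (R := ℂ) (𝕜 := ℂ) (E := Fib m × Fib m)
      (F := Fib m) (G := Fib m)).toContinuousLinearEquiv.toContinuousLinearMap

lemma eventually_frame (h : IsFrame S q₀ Z W) : ∀ᶠ q in 𝓝 q₀, (frameMap Z W q).IsInvertible :=
  eventually_isInvertible h.smoothKer_frameMap.smooth.self_of_nhds.continuousAt h.frame

/-- The inverse frame, along `W`. -/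
lemma smoothKer_inverse (h : IsFrame S q₀ Z W) : SmoothKer S q₀ fun q =>
  (frameMap Z W q).inverse.comp (inr ℂ (Fib m) (Fib m)) :=
  (h.smoothKer_frameMap.inverse h.frame).comp_clm (SmoothKer.const _)

lemma smoothKer_pop (h : IsFrame S q₀ Z W) {a : Fib m × P → G} (ha : SmoothKer S q₀ a) :
  SmoothKer S q₀ (pop Z W a) :=
  ha.pderiv.comp_clm h.smoothKer_inverse

lemma smoothKer_dbar (h : IsFrame S q₀ Z W) {a : Fib m × P → CForm m p F}
  (ha : SmoothKer S q₀ a) : SmoothKer S q₀ (dbar Z W a) :=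
  (h.smoothKer_pop ha).clm_comp (alternatizeUncurryFinCLM ℂ (Fib m) F)

lemma cderiv_pop (h : IsFrame S q₀ Z W) {a : Fib m × P → G}
  (ha : ∀ᶠ q in 𝓝 q₀, ContDiffAt ℝ ∞ a q) (v w : Fib m × P) (hvw : (v, w) ∈ S) :
  ∀ᶠ q in 𝓝 q₀, cderiv v w (pop Z W a) q = pop Z W (cderiv v w a) q := by
  filter_upwards [ha, h.smoothKer_inverse.smooth, h.smoothKer_inverse.ker _ hvw] with q h₁ h₂ h₃
  have e := cderiv_bilin (compL ℂ (Fib m)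
    (Fib m × Fib m) G) ((contDiffAt_pderiv h₁).differentiableAt (by simp))
    (h₂.differentiableAt (by simp)) v w
  refine e.trans ?_
  rw [h₃, map_zero, add_zero, cderiv_pderiv h₁]
  rfl

lemma cderiv_dbar (h : IsFrame S q₀ Z W) {a : Fib m × P → CForm m p F}
  (ha : ∀ᶠ q in 𝓝 q₀, ContDiffAt ℝ ∞ a q) (v w : Fib m × P) (hvw : (v, w) ∈ S) :
  ∀ᶠ q in 𝓝 q₀, cderiv v w (dbar Z W a) q = dbar Z W (cderiv v w a) q := by
  have hp := (IsFrame.smoothKer_pop (h.mono (Set.empty_subset S)) ⟨ha, by simp⟩).smooth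
  filter_upwards [h.cderiv_pop ha v w hvw, hp] with q h₁ h₂
  have e := cderiv_clm_comp (v := v) (w := w) (h₂.differentiableAt (by simp))
    (alternatizeUncurryFinCLM ℂ (Fib m) F (n := p))
  refine e.trans ?_
  rw [h₁]
  rfl

end IsFrame

end frame

/-! ## Exactness of the Dolbeault complex of a coframe -/

section frameExact

variable {Z W : Fib m × P → Fib m} {q₀ : Fib m × P}
  {S : Set ((Fib m × P) × (Fib m × P))}

/-- The map `(y, τ) ↦ (Z (y, τ), τ)`. -/
def frameChart (Z : Fib m × P → Fib m) (q : Fib m × P) : Fib m × P :=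
  (Z q, q.2)

/-- `Ψ` is a local inverse of `frameChart Z` at `q₀`. -/
structure IsFrameInverse (Z : Fib m × P → Fib m) (q₀ : Fib m × P)
  (Ψ : Fib m × P → Fib m × P) : Prop where
  map : Ψ (frameChart Z q₀) = q₀
  left : ∀ᶠ q in 𝓝 q₀, Ψ (frameChart Z q) = q
  right : ∀ᶠ p in 𝓝 (frameChart Z q₀), frameChart Z (Ψ p) = p
  smooth : ∀ᶠ p in 𝓝 (frameChart Z q₀), ContDiffAt ℝ ∞ Ψ p

lemma IsFrameInverse.tendsto {Ψ : Fib m × P → Fib m × P}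
  (h : IsFrameInverse Z q₀ Ψ) : Tendsto Ψ (𝓝 (frameChart Z q₀)) (𝓝 q₀) := by
  have := h.smooth.self_of_nhds.continuousAt
  rwa [ContinuousAt, h.map] at this

lemma contDiffAt_frameChart {q : Fib m × P} (h : ContDiffAt ℝ ∞ Z q) :
  ContDiffAt ℝ ∞ (frameChart Z) q :=
  h.prodMk contDiffAt_snd

lemma IsFrame.exists_inverse [CompleteSpace P] (h : IsFrame S q₀ Z W) :
  ∃ Ψ, IsFrameInverse Z q₀ Ψ := by
  have hd := h.left.smooth.self_of_nhds.differentiableAt (by simp)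
  have hd' : fderiv ℝ (frameChart Z) q₀ = (fderiv ℝ Z q₀).prod (ContinuousLinearMap.snd ℝ _ _) :=
    (hd.hasFDerivAt.prodMk hasFDerivAt_snd).fderiv
  obtain ⟨Ψ, h₁, h₂, h₃, h₄⟩ := exists_local_inverse (frameChart Z) q₀
    (h.left.smooth.mono fun q hq => contDiffAt_frameChart hq) (by
      rw [hd']
      obtain ⟨A, hA⟩ := h.chart
      have hA' (v : Fib m) (τ : P) :
          fderiv ℝ Z q₀ (v, τ) = A v + fderiv ℝ Z q₀ (0, τ) := by
        have : A v = fderiv ℝ Z q₀ (v, 0) := congrArg (· v) hA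
        rw [this, ← map_add]
        simp
      refine ContinuousLinearMap.IsInvertible.of_inverse
        (g := ((A.symm : Fib m →L[ℝ] Fib m).comp
          (ContinuousLinearMap.fst ℝ _ _ - ((fderiv ℝ Z q₀).comp
            (inr ℝ _ _)).comp (ContinuousLinearMap.snd ℝ _ _))).prod
          (ContinuousLinearMap.snd ℝ _ _)) ?_ ?_
      · refine clm_ext fun v => Prod.ext ?_ rfl
        change fderiv ℝ Z q₀ (A.symm (v.1 - fderiv ℝ Z q₀ (0, v.2)), v.2) = v.1
        rw [hA']
        simp
      · refine clm_ext fun v => Prod.ext ?_ rfl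
        change A.symm (fderiv ℝ Z q₀ (v.1, v.2) - fderiv ℝ Z q₀ (0, v.2)) = v.1
        rw [hA']
        simp)
  exact ⟨Ψ, h₁, h₂, h₃, h₄⟩

namespace IsFrame

variable {Ψ : Fib m × P → Fib m × P}

lemma eventually_straighten (h : IsFrame S q₀ Z W) (hΨ : IsFrameInverse Z q₀ Ψ) :
  ∀ᶠ p in 𝓝 (frameChart Z q₀), frameChart Z (Ψ p) = p ∧ ContDiffAt ℝ ∞ Ψ p ∧
  (∀ᶠ q in 𝓝 (Ψ p), Ψ (frameChart Z q) = q) ∧ ContDiffAt ℝ ∞ Z (Ψ p) ∧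
  ContDiffAt ℝ ∞ W (Ψ p) ∧ (frameMap Z W (Ψ p)).IsInvertible := by
  filter_upwards [hΨ.right, hΨ.smooth, hΨ.tendsto.eventually (eventually_eventually_nhds.2 hΨ.left),
    hΨ.tendsto.eventually h.left.smooth, hΨ.tendsto.eventually h.right.smooth,
    hΨ.tendsto.eventually h.eventually_frame] with p h₁ h₂ h₃ h₄ h₅ h₆
  exact ⟨h₁, h₂, h₃, h₄, h₅, h₆⟩

lemma isInvertible_pbar (h : IsFrame S q₀ Z W) (hΨ : IsFrameInverse Z q₀ Ψ) :
  ∀ᶠ p in 𝓝 (frameChart Z q₀), (pbar (fun p => W (Ψ p)) p).IsInvertible := by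
  filter_upwards [h.eventually_straighten hΨ] with p ⟨h₁, h₂, h₃, h₄, h₅, h₆⟩
  have h₁' : (Z (Ψ p), (Ψ p).2) = p := h₁
  have := isInvertible_pbar_of_comp (W' := fun p => W (Ψ p)) (h₄.differentiableAt (by simp)) (by
    rw [h₁']
    exact (h₅.comp p h₂).differentiableAt (by simp)) (by
    filter_upwards [h₃] with q hq
    exact congrArg W hq.symm) h₆
  rwa [h₁'] at this

lemma pbar_straighten (h : IsFrame S q₀ Z W) (hΨ : IsFrameInverse Z q₀ Ψ)
  {a : Fib m × P → G} (ha : ∀ᶠ q in 𝓝 q₀, ContDiffAt ℝ ∞ a q) :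
  ∀ᶠ p in 𝓝 (frameChart Z q₀), pbar (fun p => a (Ψ p)) p =
  (pop Z W a (Ψ p)).comp (pbar (fun p => W (Ψ p)) p) := by
  filter_upwards [h.eventually_straighten hΨ, hΨ.tendsto.eventually ha]
    with p ⟨h₁, h₂, h₃, h₄, h₅, h₆⟩ h₇
  have h₁' : (Z (Ψ p), (Ψ p).2) = p := h₁
  have := pop_comp (W' := fun p => W (Ψ p)) (b := fun p => a (Ψ p))
    (h₄.differentiableAt (by simp)) (by
    rw [h₁']
    exact (h₅.comp p h₂).differentiableAt (by simp)) (by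
    filter_upwards [h₃] with q hq
    exact congrArg W hq.symm) h₆ (by
    rw [h₁']
    exact (h₇.comp p h₂).differentiableAt (by simp))
  rw [h₁'] at this
  rw [this]
  congr 1
  refine pop_congr ?_
  filter_upwards [h₃] with q hq
  exact congrArg a hq

lemma dbarStd_straighten [FiniteDimensional ℂ F] (h : IsFrame S q₀ Z W)
  (hΨ : IsFrameInverse Z q₀ Ψ) {α : Fib m × P → CForm m p F}
  (hα : ∀ᶠ q in 𝓝 q₀, ContDiffAt ℝ ∞ α q) : ∀ᶠ p in 𝓝 (frameChart Z q₀),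
  dbarStd (fun p => (α (Ψ p)).compContinuousLinearMap (pbar (fun p => W (Ψ p)) p)) p =
  (dbar Z W α (Ψ p)).compContinuousLinearMap (pbar (fun p => W (Ψ p)) p) := by
  filter_upwards [h.eventually_straighten hΨ, hΨ.tendsto.eventually hα, h.pbar_straighten hΨ hα]
    with p ⟨h₁, h₂, h₃, h₄, h₅, h₆⟩ h₇ h₈
  exact dbarStd_formComp (W' := fun p => W (Ψ p)) (b := fun p => α (Ψ p))
    ((h₇.comp p h₂).differentiableAt (by simp)) (h₅.comp p h₂) h₈

lemma contDiffAt_straighten [FiniteDimensional ℂ F] (h : IsFrame S q₀ Z W)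
  (hΨ : IsFrameInverse Z q₀ Ψ) {α : Fib m × P → CForm m p F}
  (hα : ∀ᶠ q in 𝓝 q₀, ContDiffAt ℝ ∞ α q) : ∀ᶠ p in 𝓝 (frameChart Z q₀), ContDiffAt ℝ ∞
  (fun p => (α (Ψ p)).compContinuousLinearMap (pbar (fun p => W (Ψ p)) p)) p := by
  filter_upwards [h.eventually_straighten hΨ, hΨ.tendsto.eventually hα]
    with p ⟨h₁, h₂, h₃, h₄, h₅, h₆⟩ h₇
  exact contDiffAt_formComp (h₇.comp p h₂) (contDiffAt_pbar (h₅.comp p h₂))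

lemma eq_of_formComp_eq {B : Fib m →L[ℂ] Fib m} (hB : B.IsInvertible) {f g : CForm m p F}
  (h : f.compContinuousLinearMap B = g.compContinuousLinearMap B) : f = g := by
  ext v
  have := congrArg (fun f => f fun j => B.inverse (v j)) h
  simpa [Function.comp_def, hB.self_apply_inverse] using this

lemma eventually_of_straighten (hΨ : IsFrameInverse Z q₀ Ψ) (hZ : ContinuousAt Z q₀)
  {A : Fib m × P → Prop} (h : ∀ᶠ p in 𝓝 (frameChart Z q₀), A (Ψ p)) : ∀ᶠ q in 𝓝 q₀, A q := by
  have hc : Tendsto (frameChart Z) (𝓝 q₀) (𝓝 (frameChart Z q₀)) := hZ.prodMk continuousAt_snd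
  filter_upwards [hc.eventually h, hΨ.left] with q h₁ h₂
  rwa [h₂] at h₁

lemma dbar_dbar [CompleteSpace P] [FiniteDimensional ℂ F] (h : IsFrame S q₀ Z W)
  {α : Fib m × P → CForm m p F} (hα : ∀ᶠ q in 𝓝 q₀, ContDiffAt ℝ ∞ α q) :
  ∀ᶠ q in 𝓝 q₀, dbar Z W (dbar Z W α) q = 0 := by
  obtain ⟨Ψ, hΨ⟩ := h.exists_inverse
  refine eventually_of_straighten hΨ h.left.smooth.self_of_nhds.continuousAt ?_
  have hα' : ∀ᶠ q in 𝓝 q₀, ContDiffAt ℝ ∞ (dbar Z W α) q :=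
    ((h.mono (Set.empty_subset S)).smoothKer_dbar ⟨hα, by simp⟩).smooth
  filter_upwards [h.isInvertible_pbar hΨ, h.dbarStd_straighten hΨ hα',
    eventually_eventually_nhds.2 (h.dbarStd_straighten hΨ hα), h.contDiffAt_straighten hΨ hα]
    with p h₁ h₂ h₃ h₄
  refine eq_of_formComp_eq h₁ ?_
  rw [← h₂, ← dbarStd_congr h₃, dbarStd_dbarStd h₄]
  rfl

/-- Exactness for smooth forms. -/
lemma exists_smooth_primitive [FiniteDimensional ℝ P] [FiniteDimensional ℂ F]
  (h : IsFrame S q₀ Z W) {α : Fib m × P → CForm m (p + 1) F}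
  (hα : ∀ᶠ q in 𝓝 q₀, ContDiffAt ℝ ∞ α q) (hc : ∀ᶠ q in 𝓝 q₀, dbar Z W α q = 0) :
  ∃ γ : Fib m × P → CForm m p F, (∀ᶠ q in 𝓝 q₀, ContDiffAt ℝ ∞ γ q) ∧
  ∀ᶠ q in 𝓝 q₀, dbar Z W γ q = α q := by
  have : CompleteSpace P := FiniteDimensional.complete ℝ P
  obtain ⟨Ψ, hΨ⟩ := h.exists_inverse
  have hcont : Tendsto (frameChart Z) (𝓝 q₀) (𝓝 (frameChart Z q₀)) :=
    h.left.smooth.self_of_nhds.continuousAt.prodMk continuousAt_snd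
  obtain ⟨β, hβ, hβα⟩ := exists_dbarStd_primitive (frameChart Z q₀) _
    (h.contDiffAt_straighten hΨ hα) (by
      filter_upwards [h.dbarStd_straighten hΨ hα, hΨ.tendsto.eventually hc] with p h₁ h₂
      rw [h₁, h₂]
      rfl)
  let B := pbar (fun p => W (Ψ p))
  let b : Fib m × P → CForm m p F := fun p => (β p).compContinuousLinearMap (B p).inverse
  have hB : ∀ᶠ p in 𝓝 (frameChart Z q₀), ContDiffAt ℝ ∞ B p := by
    filter_upwards [h.eventually_straighten hΨ] with p ⟨h₁, h₂, h₃, h₄, h₅, h₆⟩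
    exact contDiffAt_pbar (h₅.comp p h₂)
  have hb : ∀ᶠ p in 𝓝 (frameChart Z q₀), ContDiffAt ℝ ∞ b p := by
    filter_upwards [hB, hβ, h.isInvertible_pbar hΨ] with p h₁ h₂ h₃
    exact contDiffAt_formComp h₂
      (((h₃.contDiffAt_map_inverse (n := ∞)).restrict_scalars ℝ).comp p h₁)
  have hg : ∀ᶠ q in 𝓝 q₀, ContDiffAt ℝ ∞ (fun q => b (frameChart Z q)) q := by
    filter_upwards [hcont.eventually hb, h.left.smooth] with q h₁ h₂
    exact h₁.comp q (contDiffAt_frameChart h₂)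
  refine ⟨fun q => b (frameChart Z q), hg, ?_⟩
  refine eventually_of_straighten hΨ h.left.smooth.self_of_nhds.continuousAt ?_
  have hbB : ∀ᶠ p in 𝓝 (frameChart Z q₀),
      (b (frameChart Z (Ψ p))).compContinuousLinearMap (B p) = β p := by
    filter_upwards [h.isInvertible_pbar hΨ, hΨ.right] with p h₁ h₂
    rw [h₂]
    ext v
    simp [b, B, Function.comp_def, h₁.inverse_apply_self]
  filter_upwards [h.isInvertible_pbar hΨ, h.dbarStd_straighten hΨ hg, hβα,
    eventually_eventually_nhds.2 hbB] with p h₁ h₂ h₃ h₄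
  refine eq_of_formComp_eq h₁ ?_
  rw [← h₂, ← h₃]
  exact dbarStd_congr h₄

end IsFrame

end frameExact

/-! ## Exactness for forms depending holomorphically on the parameters -/

section elimination

variable {Z W : Fib m × Θ → Fib m} {q₀ : Fib m × Θ}

/-- The antiholomorphic vector fields in the directions of the parameters. -/
def antiDirs (m : ℕ) (Θ : Type) [NormedAddCommGroup Θ] [NormedSpace ℂ Θ] :
  Set ((Fib m × Θ) × (Fib m × Θ)) :=
  {p | ∃ b : Θ, p = ((0, b), (0, I • b))}

lemma mem_antiDirs (b : Θ) : ((0, b), (0, I • b)) ∈ antiDirs m Θ := ⟨b, rfl⟩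

lemma cderiv_smul_dir (f : Fib m × Θ → G) (q : Fib m × Θ) (c : ℂ) (b : Θ) :
  cderiv (0, c • b) (0, I • c • b) f q = star c • cderiv (0, b) (0, I • b) f q := by
  have h₁ : ((0, c • b) : Fib m × Θ) = c.re • (0, b) + c.im • (0, I • b) := by
    refine Prod.ext (by simp) ?_
    conv_lhs => rw [← Complex.re_add_im c]
    simp only [Prod.snd_add, Prod.smul_snd, real_smul_eq]
    module
  have h₂ : ((0, I • c • b) : Fib m × Θ) =
      (-c.im) • (0, b) + c.re • (0, I • b) := by
    refine Prod.ext (by simp) ?_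
    conv_lhs => rw [← Complex.re_add_im c]
    simp only [Prod.snd_add, Prod.smul_snd, real_smul_eq]
    have := I_smul_I_smul (G := Θ) b
    rw [add_smul, smul_add, mul_smul, smul_comm I (c.im : ℂ), this,
      smul_comm I (c.re : ℂ)]
    push_cast
    module
  have hc : star c = (c.re : ℂ) - c.im * I := Complex.ext (by simp) (by simp)
  rw [cderiv, cderiv, h₁, h₂, map_add, map_add, map_smul, map_smul, map_smul, map_smul, hc]
  simp only [real_smul_eq, smul_add, sub_smul, mul_smul]
  rw [smul_comm I (c.re : ℂ), smul_comm I ((-c.im : ℝ) : ℂ), I_smul_I_smul]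
  push_cast
  module

lemma cderiv_add_dir (f : Fib m × Θ → G) (q v v' w w' : Fib m × Θ) :
  cderiv (v + v') (w + w') f q = cderiv v w f q + cderiv v' w' f q := by
  simp only [cderiv, map_add, smul_add]
  abel

/-- The first few antiholomorphic directions of a basis. -/
def basisDirs (m : ℕ) {n : ℕ} (b : Module.Basis (Fin n) ℂ Θ) (k : ℕ) :
  Set ((Fib m × Θ) × (Fib m × Θ)) :=
  {p | ∃ i : Fin n, i < k ∧ p = ((0, b i), (0, I • b i))}

lemma basisDirs_subset {n : ℕ} (b : Module.Basis (Fin n) ℂ Θ) (k : ℕ) :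
  basisDirs m b k ⊆ antiDirs m Θ := by
  rintro p ⟨i, -, rfl⟩
  exact ⟨b i, rfl⟩

lemma cderiv_eq_zero_of_basis {n : ℕ} (b : Module.Basis (Fin n) ℂ Θ) {f : Fib m × Θ → G}
    {q : Fib m × Θ} (h : ∀ i, cderiv (0, b i) (0, I • b i) f q = 0) (x : Θ) :
    cderiv (0, x) (0, I • x) f q = 0 := by
  rw [← b.sum_repr x]
  induction (Finset.univ : Finset (Fin n)) using Finset.induction_on with
  | empty =>
    have : ((0, 0) : Fib m × Θ) = 0 := rfl
    simp [cderiv, this]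
  | insert i s hi ih =>
    rw [Finset.sum_insert hi, smul_add]
    have e (x y : Θ) : ((0, x + y) : Fib m × Θ) = (0, x) + (0, y) := by simp
    rw [e, e, cderiv_add_dir, ih, cderiv_smul_dir, h, smul_zero, add_zero]

/-- All antiholomorphic derivatives vanish on a common neighbourhood. -/
lemma SmoothKer.eventually_forall [FiniteDimensional ℂ Θ] {f : Fib m × Θ → G}
  (h : SmoothKer (antiDirs m Θ) q₀ f) :
  ∀ᶠ q in 𝓝 q₀, ∀ x : Θ, cderiv (0, x) (0, I • x) f q = 0 := by
  have : ∀ᶠ q in 𝓝 q₀, ∀ i, cderiv (0, Module.finBasis ℂ Θ i)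
      (0, I • Module.finBasis ℂ Θ i) f q = 0 :=
    eventually_all.2 fun i => h.ker _ (mem_antiDirs _)
  filter_upwards [this] with q hq
  exact cderiv_eq_zero_of_basis _ hq

lemma SmoothKer.of_basis {n : ℕ} {b : Module.Basis (Fin n) ℂ Θ} {f : Fib m × Θ → G}
  (h : SmoothKer (basisDirs m b n) q₀ f) : SmoothKer (antiDirs m Θ) q₀ f := by
  refine ⟨h.smooth, ?_⟩
  rintro p ⟨x, rfl⟩
  have : ∀ᶠ q in 𝓝 q₀, ∀ i, cderiv (0, b i) (0, I • b i) f q = 0 :=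
    eventually_all.2 fun i => h.ker _ ⟨i, i.2, rfl⟩
  filter_upwards [this] with q hq
  exact cderiv_eq_zero_of_basis _ hq x

lemma SmoothKer.cderiv {S : Set (Q × Q)} {q₀ : Q} {f : Q → G} (h : SmoothKer S q₀ f) (v w : Q) :
  SmoothKer S q₀ (cderiv v w f) where
  smooth := h.smooth.mono fun _ h => contDiffAt_cderiv h v w
  ker p hp := by
    filter_upwards [h.smooth, eventually_eventually_nhds.2 (h.ker p hp)] with q h₁ h₂
    rw [cderiv_comm h₁, cderiv_congr (g := fun _ => 0) h₂]
    simp [_root_.cderiv]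

lemma exists_cderiv_solution [FiniteDimensional ℂ Θ] [CompleteSpace G] {n : ℕ}
  (b : Module.Basis (Fin n) ℂ Θ) (k : Fin n)
  {f : Fib m × Θ → G} (hf : ∀ᶠ q in 𝓝 q₀, ContDiffAt ℝ ∞ f q) (S : Set ((Fib m × Θ) × (Fib m × Θ)))
  (hS : ∀ p ∈ S, b.repr p.1.2 k = 0 ∧ b.repr p.2.2 k = 0)
  (hker : ∀ᶠ q in 𝓝 q₀, ∀ p ∈ S, cderiv p.1 p.2 f q = 0) :
  ∃ u : Fib m × Θ → G, (∀ᶠ q in 𝓝 q₀, ContDiffAt ℝ ∞ u q) ∧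
  (∀ᶠ q in 𝓝 q₀, cderiv (0, b k) (0, I • b k) u q = f q) ∧
  ∀ᶠ q in 𝓝 q₀, ∀ p ∈ S, cderiv p.1 p.2 u q = 0 := by
  have : FiniteDimensional ℝ Θ := Module.Finite.trans ℂ Θ
  let e : ℂ →L[ℝ] Fib m × Θ := (inr ℝ (Fib m) Θ).comp
    ((ContinuousLinearMap.toSpanSingleton ℂ (b k)).restrictScalars ℝ)
  let c : Fib m × Θ →L[ℝ] ℂ := ((LinearMap.toContinuousLinearMap (b.coord k)).restrictScalars
    ℝ).comp (ContinuousLinearMap.snd ℝ (Fib m) Θ)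
  have he (ζ : ℂ) : e ζ = (0, ζ • b k) := rfl
  have hc (q : Fib m × Θ) : c q = b.repr q.2 k := rfl
  obtain ⟨u, O', hO', h₁, h₂, h₃, -⟩ := exists_cauchyRiemann_solution e c
    (fun ζ => by simp [he, hc]) ((1 / 2 : ℂ) • f) q₀ _ (hf.and hker)
    fun q hq => hq.1.const_smul (1 / 2 : ℂ)
  refine ⟨u, Eventually.of_forall h₁, ?_, ?_⟩
  · filter_upwards [hO'] with q hq
    have h := h₂ q hq
    rw [he, he, one_smul] at h
    rw [h, Pi.smul_apply, smul_smul]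
    norm_num
  · filter_upwards [hO'] with q hq p hp
    refine h₃ _ _ (by rw [hc, (hS p hp).1]) (by rw [hc, (hS p hp).2]) (fun q hq => ?_) q hq
    have h := cderiv_clm_comp (v := p.1) (w := p.2) (hq.1.differentiableAt (by simp))
      ((1 / 2 : ℂ) • idCLM ℂ G)
    refine h.trans ?_
    rw [hq.2 p hp, map_zero]

/-- Transport to the coordinates `(z, τ)` of functions holomorphic in `z`. -/
lemma cderiv_comp_frameChart {f : Fib m × Θ → G} {q : Fib m × Θ}
  (hZ : DifferentiableAt ℝ Z q) (hf : DifferentiableAt ℝ f (frameChart Z q))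
  (h : pbar f (frameChart Z q) = 0) {v w : Fib m × Θ} (hvw : cderiv v w Z q = 0) :
  cderiv v w (fun q => f (frameChart Z q)) q = cderiv (0, v.2) (0, w.2) f (frameChart Z q) := by
  let L := (pderiv f (frameChart Z q)).comp (inl ℂ _ _)
  have hL (x : Fib m) (y : Θ) : fderiv ℝ f (frameChart Z q) (x, y) =
      L x + fderiv ℝ f (frameChart Z q) (0, y) := by
    have e : fderiv ℝ f (frameChart Z q) (x, 0) = pderiv f (frameChart Z q) (x, star x) :=
      (complexify_conj ((fderiv ℝ f (frameChart Z q)).comp (inl ℝ _ _)) x).symm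
    have e' : pderiv f (frameChart Z q) (x, star x) = L x + pbar f (frameChart Z q) (star x) := by
      change _ = pderiv f (frameChart Z q) (x, 0) + pderiv f (frameChart Z q) (0, star x)
      rw [← map_add]
      simp
    rw [h, zero_apply, add_zero] at e'
    rw [← e', ← e, ← map_add]
    simp
  have hd : HasFDerivAt (fun q => f (frameChart Z q)) _ q :=
    hf.hasFDerivAt.comp q (hZ.hasFDerivAt.prodMk hasFDerivAt_snd)
  have e (x : Fib m × Θ) : fderiv ℝ (fun q => f (frameChart Z q)) q x =
      L (fderiv ℝ Z q x) + fderiv ℝ f (frameChart Z q) (0, x.2) := by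
    rw [hd.fderiv]
    exact hL _ _
  have : L (cderiv v w Z q) = 0 := by rw [hvw, map_zero]
  rw [cderiv, map_add, map_smul] at this
  rw [cderiv, e, e, cderiv, smul_add]
  rw [show ∀ a b c d : G, a + b + (c + d) = (a + c) + (b + d) from fun _ _ _ _ => by abel, this,
    zero_add]

variable [FiniteDimensional ℂ Θ] [FiniteDimensional ℂ F]

namespace IsFrame

variable {n : ℕ} (b : Module.Basis (Fin n) ℂ Θ)

lemma cderiv_straighten (h : IsFrame (antiDirs m Θ) q₀ Z W)
  {Ψ : Fib m × Θ → Fib m × Θ} (hΨ : IsFrameInverse Z q₀ Ψ)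
  {f : Fib m × Θ → G} (hf : ∀ᶠ q in 𝓝 q₀, ContDiffAt ℝ ∞ f q) (hp : ∀ᶠ q in 𝓝 q₀, pop Z W f q = 0) :
  ∀ᶠ p in 𝓝 (frameChart Z q₀), pbar (fun p => f (Ψ p)) p = 0 ∧ ∀ x : Θ,
  cderiv (0, x) (0, I • x) (fun p => f (Ψ p)) p = cderiv (0, x) (0, I • x) f (Ψ p) := by
  filter_upwards [h.eventually_straighten hΨ, hΨ.tendsto.eventually hf, h.pbar_straighten hΨ hf,
    hΨ.tendsto.eventually hp, hΨ.tendsto.eventually h.left.eventually_forall]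
    with p ⟨h₁, h₂, h₃, h₄, h₅, h₆⟩ h₇ h₈ h₉ h₁₀
  have hpb : pbar (fun p => f (Ψ p)) p = 0 := by
    rw [h₈, h₉]
    rfl
  refine ⟨hpb, fun x => ?_⟩
  have := cderiv_comp_frameChart (f := fun p => f (Ψ p)) (h₄.differentiableAt (by simp)) (by
    rw [h₁]
    exact (h₇.comp p h₂).differentiableAt (by simp)) (by rw [h₁, hpb]) (h₁₀ x)
  rw [h₁] at this
  rw [← this]
  refine cderiv_congr ?_
  filter_upwards [h₃] with q hq
  rw [hq]

/-- Solution of the Cauchy-Riemann equation in the direction of a parameter, for functions killed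
by the Dolbeault operator. -/
lemma exists_cderiv_solution_of_pop_eq_zero [CompleteSpace G]
  (h : IsFrame (antiDirs m Θ) q₀ Z W) (k : Fin n) {f : Fib m × Θ → G}
  (hf : SmoothKer (basisDirs m b k) q₀ f) (hp : ∀ᶠ q in 𝓝 q₀, pop Z W f q = 0) :
  ∃ u : Fib m × Θ → G, SmoothKer (basisDirs m b k) q₀ u ∧
  (∀ᶠ q in 𝓝 q₀, cderiv (0, b k) (0, I • b k) u q = f q) ∧ ∀ᶠ q in 𝓝 q₀, pop Z W u q = 0 := by
  have : FiniteDimensional ℝ Θ := Module.Finite.trans ℂ Θ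
  have : CompleteSpace Θ := FiniteDimensional.complete ℝ Θ
  obtain ⟨Ψ, hΨ⟩ := h.exists_inverse
  have hcont : Tendsto (frameChart Z) (𝓝 q₀) (𝓝 (frameChart Z q₀)) :=
    h.left.smooth.self_of_nhds.continuousAt.prodMk continuousAt_snd
  have hfk : ∀ᶠ q in 𝓝 q₀, ∀ i : Fin n, i < k → cderiv (0, b i) (0, I • b i) f q = 0 := by
    refine eventually_all.2 fun i => ?_
    by_cases hi : i < k
    · exact (hf.ker _ ⟨i, hi, rfl⟩).mono fun _ h _ => h
    · simp [hi]
  obtain ⟨u, hu₁, hu₂, hu₃⟩ := exists_cderiv_solution (q₀ := frameChart Z q₀) b k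
    (f := fun p => f (Ψ p)) (by
      filter_upwards [hΨ.smooth, hΨ.tendsto.eventually hf.smooth] with p h₁ h₂
      exact h₂.comp p h₁) (basisDirs m b k ∪ {p | p.1.2 = 0 ∧ p.2 = (I • p.1.1, 0)}) (by
      rintro p (⟨i, hi, rfl⟩ | ⟨h₁, h₂⟩)
      · have hik : i ≠ k := fun h => absurd hi (by simp [h])
        simp [hik]
      · simp [h₁, h₂]) (by
      filter_upwards [h.cderiv_straighten hΨ hf.smooth hp, hΨ.tendsto.eventually hfk] with p h₁ h₂
      rintro ⟨v, w⟩ (⟨i, hi, he⟩ | ⟨h₃, h₄⟩)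
      · rw [he, h₁.2]
        exact h₂ i (Fin.lt_def.2 hi)
      · obtain ⟨v, v'⟩ := v
        simp only at h₃ h₄
        subst h₃ h₄
        have h₅ := congrArg (fun L => L (star v)) h₁.1
        simp only [pbar_apply, star_star, zero_apply] at h₅
        exact (smul_eq_zero.1 h₅).resolve_left (by norm_num))
  have hub : ∀ᶠ p in 𝓝 (frameChart Z q₀), pbar u p = 0 := by
    filter_upwards [hu₃] with p hp
    refine clm_ext fun v => ?_
    rw [pbar_apply, hp ((star v, 0), (I • star v, 0)) (Or.inr ⟨rfl, rfl⟩), smul_zero]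
    rfl
  have key : ∀ᶠ q in 𝓝 q₀, ∀ x : Θ, cderiv (0, x) (0, I • x)
      (fun q => u (frameChart Z q)) q = cderiv (0, x) (0, I • x) u (frameChart Z q) := by
    filter_upwards [hcont.eventually hub, hcont.eventually hu₁, h.left.smooth,
      h.left.eventually_forall] with q h₁ h₂ h₃ h₄ x
    exact cderiv_comp_frameChart (h₃.differentiableAt (by simp)) (h₂.differentiableAt (by simp))
      h₁ (h₄ x)
  have hus : ∀ᶠ q in 𝓝 q₀, ContDiffAt ℝ ∞ (fun q => u (frameChart Z q)) q := by
    filter_upwards [hcont.eventually hu₁, h.left.smooth] with q h₁ h₂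
    exact h₁.comp q (contDiffAt_frameChart h₂)
  refine ⟨fun q => u (frameChart Z q), ⟨hus, ?_⟩, ?_, ?_⟩
  · rintro p ⟨i, hi, rfl⟩
    filter_upwards [key, hcont.eventually hu₃] with q h₁ h₂
    rw [h₁]
    exact h₂ _ (Or.inl ⟨i, hi, rfl⟩)
  · filter_upwards [key, hcont.eventually hu₂, hΨ.left] with q h₁ h₂ h₃
    rw [h₁, h₂, h₃]
  · refine eventually_of_straighten hΨ h.left.smooth.self_of_nhds.continuousAt ?_
    filter_upwards [h.pbar_straighten hΨ hus, h.isInvertible_pbar hΨ,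
      eventually_eventually_nhds.2 hΨ.right, hub] with p h₁ h₂ h₃ h₄
    have h₅ : pbar (fun p => u (frameChart Z (Ψ p))) p = pbar u p := pbar_congr (by
      filter_upwards [h₃] with p hp
      rw [hp])
    rw [h₅, h₄] at h₁
    refine clm_ext fun v => ?_
    have := congrArg (fun L => L ((pbar (fun p => W (Ψ p)) p).inverse v)) h₁
    rw [clm_comp_apply, h₂.self_apply_inverse] at this
    exact this.symm

lemma exists_primitive_basis (h : IsFrame (antiDirs m Θ) q₀ Z W) (k : ℕ) (hk : k ≤ n) :
    ∀ {p : ℕ} (α : Fib m × Θ → CForm m (p + 1) F), SmoothKer (basisDirs m b k) q₀ α →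
      (∀ᶠ q in 𝓝 q₀, dbar Z W α q = 0) →
      ∃ γ : Fib m × Θ → CForm m p F, SmoothKer (basisDirs m b k) q₀ γ ∧
        ∀ᶠ q in 𝓝 q₀, dbar Z W γ q = α q := by
  have : FiniteDimensional ℝ Θ := Module.Finite.trans ℂ Θ
  have : CompleteSpace Θ := FiniteDimensional.complete ℝ Θ
  induction k with
  | zero =>
    intro p α hα hc
    obtain ⟨γ, h₁, h₂⟩ := h.exists_smooth_primitive hα.smooth hc
    refine ⟨γ, ⟨h₁, ?_⟩, h₂⟩
    rintro p ⟨i, hi, -⟩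
    simp at hi
  | succ k ih =>
    intro p α hα hc
    let κ : Fin n := ⟨k, hk⟩
    have hsub : basisDirs m b k ⊆ basisDirs m b (k + 1) := by
      rintro p ⟨i, hi, rfl⟩
      exact ⟨i, hi.trans (Nat.lt_succ_self k), rfl⟩
    obtain ⟨γ, hγ, hγα⟩ := ih (by omega) α (hα.mono hsub) hc
    let D (p : ℕ) (f : Fib m × Θ → CForm m p F) :=
      cderiv (0, b κ) (0, I • b κ) f
    have hD : ∀ᶠ q in 𝓝 q₀, dbar Z W (D p γ) q = 0 := by
      filter_upwards [h.cderiv_dbar hγ.smooth _ _ (mem_antiDirs (b κ)),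
        eventually_eventually_nhds.2 hγα,
        hα.ker ((0, b κ), (0, I • b κ)) ⟨κ, Nat.lt_succ_self k, rfl⟩] with q h₁ h₂ h₃
      rw [← h₁, cderiv_congr h₂, h₃]
    have key : ∃ ε : Fib m × Θ → CForm m p F, SmoothKer (basisDirs m b k) q₀ ε ∧
        (∀ᶠ q in 𝓝 q₀, dbar Z W ε q = 0) ∧ ∀ᶠ q in 𝓝 q₀, D p ε q = D p γ q := by
      cases p with
      | zero =>
        have hp : ∀ᶠ q in 𝓝 q₀, pop Z W (D 0 γ) q = 0 := by
          filter_upwards [hD] with q hq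
          refine clm_ext fun v => ?_
          rw [← contract_alternatize_zero (pop Z W (D 0 γ) q) v]
          exact (congrArg (contract v) hq).trans (map_zero _)
        obtain ⟨u, h₁, h₂, h₃⟩ := h.exists_cderiv_solution_of_pop_eq_zero b κ (hγ.cderiv _ _) hp
        refine ⟨u, h₁, ?_, h₂⟩
        filter_upwards [h₃] with q hq
        rw [dbar, hq]
        exact map_zero (ContinuousAlternatingMap.alternatizeUncurryFinCLM ℂ (Fib m) F)
      | succ p =>
        obtain ⟨δ, hδ, hδγ⟩ := ih (by omega) (D (p + 1) γ) (hγ.cderiv _ _) hD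
        obtain ⟨ε, h₁, h₂, h₃⟩ := exists_cderiv_solution b κ hδ.smooth (basisDirs m b k) (by
          rintro p ⟨i, hi, rfl⟩
          have hik : i ≠ κ := fun h => absurd hi (by simp [h, κ])
          simp [hik]) (by
          have : ∀ᶠ q in 𝓝 q₀, ∀ i : Fin n, i < κ →
              cderiv (0, b i) (0, I • b i) δ q = 0 := by
            refine eventually_all.2 fun i => ?_
            by_cases hi : i < κ
            · exact (hδ.ker _ ⟨i, hi, rfl⟩).mono fun _ h _ => h
            · simp [hi]
          filter_upwards [this] with q hq
          rintro p ⟨i, hi, rfl⟩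
          exact hq i hi)
        have hε : SmoothKer (basisDirs m b k) q₀ ε :=
          ⟨h₁, fun p hp => h₃.mono fun q hq => hq p hp⟩
        refine ⟨dbar Z W ε, (h.mono (basisDirs_subset b k)).smoothKer_dbar hε, h.dbar_dbar h₁, ?_⟩
        filter_upwards [h.cderiv_dbar h₁ _ _ (mem_antiDirs (b κ)),
          eventually_eventually_nhds.2 h₂, hδγ] with q e₁ e₂ e₃
        change cderiv _ _ _ _ = _
        rw [e₁, dbar_congr e₂, e₃]
    obtain ⟨ε, hε, hε₁, hε₂⟩ := key
    refine ⟨γ - ε, ⟨(hγ.sub hε).smooth, ?_⟩, ?_⟩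
    · rintro p ⟨i, hi, rfl⟩
      rcases Nat.lt_succ_iff_lt_or_eq.1 hi with hi | hi
      · exact (hγ.sub hε).ker _ ⟨i, hi, rfl⟩
      · obtain rfl : i = κ := Fin.ext hi
        filter_upwards [hε₂, hε.differentiable, hγ.differentiable] with q h₁ h₂ h₃
        have e : cderiv (0, b κ) (0, I • b κ) (γ - ε) q = D p γ q - D p ε q := by
          simp only [D, cderiv, fderiv_sub h₃ h₂, sub_apply, smul_sub]
          abel
        rw [e, h₁, sub_self]
    · filter_upwards [hγα, hε₁, hε.differentiable, hγ.differentiable] with q h₁ h₂ h₃ h₄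
      rw [dbar_sub h₄ h₃, h₁, h₂, sub_zero]

/-- Exactness of the Dolbeault complex of a coframe, for forms depending holomorphically on the
parameters. -/
theorem exists_primitive (h : IsFrame (antiDirs m Θ) q₀ Z W)
  {α : Fib m × Θ → CForm m (p + 1) F} (hα : SmoothKer (antiDirs m Θ) q₀ α)
  (hc : ∀ᶠ q in 𝓝 q₀, dbar Z W α q = 0) :
  ∃ γ : Fib m × Θ → CForm m p F, SmoothKer (antiDirs m Θ) q₀ γ ∧
  ∀ᶠ q in 𝓝 q₀, dbar Z W γ q = α q := by
  obtain ⟨γ, h₁, h₂⟩ := h.exists_primitive_basis (Module.finBasis ℂ Θ) _ le_rfl α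
    (hα.mono (basisDirs_subset _ _)) hc
  exact ⟨γ, h₁.of_basis, h₂⟩

end IsFrame

end elimination

/-! ## Functions with complex-linear derivative -/

section analyticity

variable {E G : Type} [NormedAddCommGroup E] [NormedSpace ℂ E] [NormedAddCommGroup G]
  [NormedSpace ℂ G]

lemma norm_iteratedFDeriv_le_of_ball {f : E → G} {x : E} {R M ρ : ℝ} (hρ : 0 < ρ)
    (hf : ContDiffOn ℂ ∞ f (ball x R)) (hb : ∀ y ∈ ball x R, ‖f y‖ ≤ M) (n : ℕ) :
    ∀ y ∈ ball x (R - n * ρ), ‖iteratedFDeriv ℂ n f y‖ ≤ M * (2 / ρ) ^ n := by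
  induction n with
  | zero =>
    intro y hy
    simpa using hb y (by simpa using hy)
  | succ n ih =>
    intro y hy
    have hsub : ball y ρ ⊆ ball x (R - n * ρ) := by
      refine Metric.ball_subset_ball' ?_
      rw [mem_ball] at hy
      push_cast at hy
      linarith
    have hsub' : ball x (R - n * ρ) ⊆ ball x R :=
      Metric.ball_subset_ball (by nlinarith [Nat.cast_nonneg (α := ℝ) n])
    have hd : DifferentiableOn ℂ (iteratedFDeriv ℂ n f) (ball y ρ) := fun z hz =>
      ((hf.contDiffAt (Metric.isOpen_ball.mem_nhds
        (hsub' (hsub hz)))).differentiableAt_iteratedFDeriv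
          (by exact_mod_cast WithTop.coe_lt_top _)).differentiableWithinAt
    rw [← norm_fderiv_iteratedFDeriv]
    refine (Complex.norm_fderiv_le_div_of_mapsTo_ball (R₂ := 2 * (M * (2 / ρ) ^ n)) hd
      (fun z hz => ?_) hρ).trans (le_of_eq ?_)
    · rw [mem_closedBall, dist_eq_norm]
      have h₁ := ih z (hsub hz)
      have h₂ := ih y (hsub (mem_ball_self hρ))
      linarith [norm_sub_le (iteratedFDeriv ℂ n f z) (iteratedFDeriv ℂ n f y)]
    · rw [pow_succ]
      ring

lemma iteratedDeriv_line {f : E → G} {U : Set E} (hU : IsOpen U) (hf : ContDiffOn ℂ ∞ f U)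
    (x v : E) (n : ℕ) : ∀ c : ℂ, x + c • v ∈ U →
      iteratedDeriv n (fun c : ℂ => f (x + c • v)) c = iteratedFDeriv ℂ n f (x + c • v) fun _ => v := by
  induction n with
  | zero =>
    intro c hc
    simp
  | succ n ih =>
    intro c hc
    have hl : Continuous fun c : ℂ => x + c • v := by fun_prop
    have he : iteratedDeriv n (fun c : ℂ => f (x + c • v)) =ᶠ[𝓝 c]
        fun c => iteratedFDeriv ℂ n f (x + c • v) fun _ => v := by
      filter_upwards [(hU.preimage hl).mem_nhds hc] with c' hc'
      exact ih c' hc'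
    rw [iteratedDeriv_succ, he.deriv_eq]
    have h₁ : HasFDerivAt (iteratedFDeriv ℂ n f) _ (x + c • v) :=
      ((hf.contDiffAt (hU.mem_nhds hc)).differentiableAt_iteratedFDeriv (m := n)
        (by exact_mod_cast WithTop.coe_lt_top _)).hasFDerivAt
    have h₂ : HasDerivAt (fun c : ℂ => x + c • v) v c := by
      simpa using ((hasDerivAt_id c).smul_const v).const_add x
    have h₃ : HasDerivAt (fun c : ℂ => iteratedFDeriv ℂ n f (x + c • v)) _ c :=
      h₁.comp_hasDerivAt c h₂
    have h₄ : HasDerivAt (fun c : ℂ => iteratedFDeriv ℂ n f (x + c • v) fun _ => v) _ c :=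
      ((ContinuousMultilinearMap.apply ℂ (fun _ : Fin n => E) G fun _ => v).hasFDerivAt.comp_hasDerivAt
        c h₃)
    rw [h₄.deriv, iteratedFDeriv_succ_apply_left]
    rfl

lemma analyticAt_of_contDiffOn [CompleteSpace G] {f : E → G} {x : E} {U : Set E}
  (hU : U ∈ 𝓝 x) (hf : ContDiffOn ℂ ∞ f U) : AnalyticAt ℂ f x := by
  have hc : ContinuousAt f x := (hf.contDiffAt hU).continuousAt
  obtain ⟨R, hR, hRU⟩ := Metric.mem_nhds_iff.1 (inter_mem hU
    (hc.norm.eventually (Iio_mem_nhds (lt_add_one ‖f x‖))))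
  set M := ‖f x‖ + 1
  have hM : 0 ≤ M := by positivity
  have hfR : ContDiffOn ℂ ∞ f (ball x R) := hf.mono fun y hy => (hRU hy).1
  have hbR : ∀ y ∈ ball x R, ‖f y‖ ≤ M := fun y hy => (hRU hy).2.le
  let p : FormalMultilinearSeries ℂ E G := fun n => ((n.factorial : ℂ)⁻¹) • iteratedFDeriv ℂ n f x
  let r : NNReal := ⟨R / (2 * Real.exp 1), by positivity⟩
  have hr : (r : ℝ) = R / (2 * Real.exp 1) := rfl
  have hr0 : (0 : ℝ) < r := by
    rw [hr]
    positivity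
  have hrR : (r : ℝ) < R := by
    rw [hr, div_lt_iff₀ (by positivity)]
    nlinarith [Real.add_one_le_exp 1]
  have hbound (n : ℕ) : ‖p n‖ * (r : ℝ) ^ n ≤ M * Real.exp 1 := by
    have h₁ := norm_iteratedFDeriv_le_of_ball (ρ := R / (n + 1)) (by positivity) hfR hbR n x
      (mem_ball_self (by
        have : (n : ℝ) * (R / (n + 1)) = R * (n / (n + 1)) := by ring
        have h₂ : (n : ℝ) / (n + 1) < 1 := by
          rw [div_lt_one (by positivity)]
          linarith
        nlinarith))
    have h₂ := Real.pow_div_factorial_le_exp (x := (n : ℝ) + 1) (by positivity) n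
    have h₃ : ‖p n‖ = (n.factorial : ℝ)⁻¹ * ‖iteratedFDeriv ℂ n f x‖ := by
      simp [p, norm_smul]
    rw [h₃, hr]
    calc _ ≤ (n.factorial : ℝ)⁻¹ * (M * (2 / (R / (n + 1))) ^ n) *
          (R / (2 * Real.exp 1)) ^ n := by gcongr
      _ = M * (((n : ℝ) + 1) ^ n / n.factorial) * (Real.exp 1)⁻¹ ^ n := by
        rw [mul_assoc, mul_assoc, ← mul_pow, show 2 / (R / ((n : ℝ) + 1)) * (R / (2 * Real.exp 1)) =
          ((n : ℝ) + 1) * (Real.exp 1)⁻¹ by field_simp, mul_pow]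
        ring
      _ ≤ M * Real.exp (n + 1) * (Real.exp 1)⁻¹ ^ n := by gcongr
      _ = M * Real.exp 1 := by
        rw [mul_assoc]
        congr 1
        rw [Real.exp_add, inv_pow, ← Real.exp_nat_mul, mul_one]
        field_simp
  have hrad : (r : ENNReal) ≤ p.radius := p.le_radius_of_bound _ hbound
  refine ⟨p, r, hrad, by exact_mod_cast hr0, fun {y} hy => ?_⟩
  have hy' : ‖y‖ < r := by
    rw [Metric.eball_coe] at hy
    simpa using hy
  obtain ⟨s, hs₁, hs₂⟩ : ∃ s : ℝ, 1 < s ∧ s * ‖y‖ < R := by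
    rcases eq_or_lt_of_le (norm_nonneg y) with h0 | h0
    · exact ⟨2, by norm_num, by rw [← h0]; simpa using hR⟩
    · obtain ⟨s, h₁, h₂⟩ := exists_between ((one_lt_div h0).2 (hy'.trans hrR))
      exact ⟨s, h₁, (lt_div_iff₀ h0).1 h₂⟩
  have hmem : ∀ c ∈ ball (0 : ℂ) s, x + c • y ∈ ball x R := by
    intro c hc
    rw [mem_ball_zero_iff] at hc
    rw [mem_ball, dist_eq_norm, add_sub_cancel_left, norm_smul]
    exact lt_of_le_of_lt (by gcongr) hs₂
  have hdiff : DifferentiableOn ℂ (fun c : ℂ => f (x + c • y)) (ball 0 s) := by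
    intro c hc
    have h₁ : DifferentiableAt ℂ f (x + c • y) :=
      (hfR.contDiffAt (Metric.isOpen_ball.mem_nhds (hmem c hc))).differentiableAt (by simp)
    exact (h₁.comp c (f := fun c : ℂ => x + c • y) (by fun_prop)).differentiableWithinAt
  have h := Complex.hasSum_taylorSeries_on_ball (z := 1) hdiff (by simpa using hs₁)
  simp only [one_smul, sub_zero, one_pow] at h
  convert h using 2 with n
  rw [iteratedDeriv_line Metric.isOpen_ball hfR x y n 0
    (hmem 0 (mem_ball_self (by linarith))), zero_smul, add_zero]
  rfl

variable [NormedSpace ℝ E] [IsScalarTower ℝ ℂ E] [NormedSpace ℝ G] [IsScalarTower ℝ ℂ G]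

lemma hasFDerivAt_complex {f : E → G} {x : E} (hf : DifferentiableAt ℝ f x)
  (h : ∀ v, fderiv ℝ f x (I • v) = I • fderiv ℝ f x v) : DifferentiableAt ℂ f x := by
  let L : E →L[ℂ] G :=
    { toFun := fderiv ℝ f x
      map_add' := map_add _
      map_smul' := fun c v => by
        conv_lhs => rw [← Complex.re_add_im c]
        rw [add_smul, mul_smul, ← real_smul_eq, ← real_smul_eq, map_add, map_smul, map_smul, h,
          real_smul_eq, real_smul_eq, ← mul_smul, ← add_smul, Complex.re_add_im]
        rfl
      cont := (fderiv ℝ f x).continuous }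
  exact (hasFDerivAt_of_restrictScalars ℝ (f' := L) hf.hasFDerivAt rfl).differentiableAt

lemma fderiv_complex_smul {f : E → G} {x : E} (hf : DifferentiableAt ℂ f x) (v : E) :
  fderiv ℝ f x v = fderiv ℂ f x v :=
  congrArg (· v) (hf.hasFDerivAt.restrictScalars ℝ).fderiv

lemma contDiffOn_complex_aux {k : ℕ} {U : Set (Fib k)} (hU : IsOpen U) (n : ℕ) :
    ∀ {G : Type} [NormedAddCommGroup G] [NormedSpace ℝ G] [NormedSpace ℂ G] [IsScalarTower ℝ ℂ G]
      {f : Fib k → G}, (∀ x ∈ U, ContDiffAt ℝ ∞ f x) →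
      (∀ x ∈ U, DifferentiableAt ℂ f x) → ContDiffOn ℂ n f U := by
  induction n with
  | zero =>
    intro G _ _ _ _ f h₁ h₂
    exact contDiffOn_zero.2 fun x hx => (h₁ x hx).continuousAt.continuousWithinAt
  | succ n ih =>
    intro G _ _ _ _ f h₁ h₂
    refine (contDiffOn_succ_iff_fderiv_of_isOpen (n := (n : ℕ∞ω)) hU).2
      ⟨fun x hx => (h₂ x hx).differentiableWithinAt, fun h => absurd h (by simp), ?_⟩
    let Λ : (Fib k →L[ℝ] G) →L[ℂ] (Fib k →L[ℂ] G) :=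
      (ContinuousLinearMap.precomp (𝕜₃ := ℂ) G
        (inl ℂ (Fib k) (Fib k))).comp complexify
    have hΛ (x) (hx : x ∈ U) : fderiv ℂ f x = Λ (fderiv ℝ f x) := by
      have e : fderiv ℝ f x = (fderiv ℂ f x).restrictScalars ℝ :=
        ((h₂ x hx).hasFDerivAt.restrictScalars ℝ).fderiv
      change _ = (complexify (fderiv ℝ f x)).comp (inl ℂ _ _)
      rw [e, complexify_restrictScalars]
      rfl
    have hev (x) (hx : x ∈ U) : fderiv ℂ f =ᶠ[𝓝 x] fun x => Λ (fderiv ℝ f x) := by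
      filter_upwards [hU.mem_nhds hx] with y hy
      exact hΛ y hy
    have hs (x) (hx : x ∈ U) : ContDiffAt ℝ ∞ (fderiv ℂ f) x :=
      (((h₁ x hx).fderiv_right (m := ∞) (by simp)).clm_complex Λ).congr_of_eventuallyEq (hev x hx)
    refine ih hs fun x hx => ?_
    refine hasFDerivAt_complex ((hs x hx).differentiableAt (by simp)) fun v => ?_
    have hd : DifferentiableAt ℝ (fderiv ℝ f) x :=
      ((h₁ x hx).fderiv_right (m := ∞) (by simp)).differentiableAt (by simp)
    have hsymm : IsSymmSndFDerivAt ℝ f x := (h₁ x hx).isSymmSndFDerivAt (by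
      rw [minSmoothness_of_isRCLikeNormedField]
      exact (WithTop.coe_le_coe.2 (le_top : (2 : ℕ∞) ≤ ⊤) : ((2 : ℕ∞) : ℕ∞ω) ≤ ∞))
    have key (v w : Fib k) :
        fderiv ℝ (fderiv ℂ f) x v w = fderiv ℝ (fderiv ℝ f) x w v := by
      have e₁ : HasFDerivAt (fun y => fderiv ℂ f y w)
          (((applyCLM ℂ G w).restrictScalars ℝ).comp (fderiv ℝ (fderiv ℂ f) x)) x :=
        ((applyCLM ℂ G w).restrictScalars ℝ).hasFDerivAt.comp x
          ((hs x hx).differentiableAt (by simp)).hasFDerivAt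
      have e₂ : HasFDerivAt (fun y => fderiv ℝ f y w)
          ((applyCLM ℝ G w).comp (fderiv ℝ (fderiv ℝ f) x)) x :=
        (applyCLM ℝ G w).hasFDerivAt.comp x hd.hasFDerivAt
      have e₃ : (fun y => fderiv ℂ f y w) =ᶠ[𝓝 x] fun y => fderiv ℝ f y w := by
        filter_upwards [hU.mem_nhds hx] with y hy
        exact (fderiv_complex_smul (h₂ y hy) w).symm
      have e₄ := e₁.unique (e₂.congr_of_eventuallyEq e₃)
      rw [hsymm.eq w v]
      exact congrArg (· v) e₄
    have hlin (w v : Fib k) : fderiv ℝ (fderiv ℝ f) x w (I • v) =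
        I • fderiv ℝ (fderiv ℝ f) x w v := by
      have e₂ (v : Fib k) : HasFDerivAt (fun y => fderiv ℝ f y v)
          ((applyCLM ℝ G v).comp (fderiv ℝ (fderiv ℝ f) x)) x :=
        (applyCLM ℝ G v).hasFDerivAt.comp x hd.hasFDerivAt
      have e₃ : (fun y => fderiv ℝ f y (I • v)) =ᶠ[𝓝 x]
          fun y => I • fderiv ℝ f y v := by
        filter_upwards [hU.mem_nhds hx] with y hy
        rw [fderiv_complex_smul (h₂ y hy), fderiv_complex_smul (h₂ y hy), map_smul]
      have e₄ := (e₂ (I • v)).unique (((e₂ v).const_smul I).congr_of_eventuallyEq e₃)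
      exact congrArg (· w) e₄
    refine clm_ext fun w => ?_
    rw [smul_apply, key, key, hlin]

/-- A smooth function whose derivative is complex-linear is analytic. -/
theorem analyticAt_of_smooth [FiniteDimensional ℂ E] [CompleteSpace G] {f : E → G} {x : E}
  (h₁ : ∀ᶠ y in 𝓝 x, ContDiffAt ℝ ∞ f y) (h₂ : ∀ᶠ y in 𝓝 x, DifferentiableAt ℂ f y) :
  AnalyticAt ℂ f x := by
  let e : E ≃L[ℂ] Fib (Module.finrank ℂ E) :=
    ContinuousLinearEquiv.ofFinrankEq (by simp)
  obtain ⟨U, hU, hUo, hxU⟩ := eventually_nhds_iff.1 (h₁.and h₂)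
  have hV : IsOpen (e.symm ⁻¹' U) := hUo.preimage e.symm.continuous
  have hg : ContDiffOn ℂ ∞ (fun y => f (e.symm y)) (e.symm ⁻¹' U) := by
    refine contDiffOn_infty.2 fun n => contDiffOn_complex_aux hV n (fun y hy => ?_) fun y hy => ?_
    · exact (hU _ hy).1.comp y (((e.symm.toContinuousLinearMap).restrictScalars ℝ).contDiff.contDiffAt
        (x := y) (n := ∞))
    · exact (hU _ hy).2.comp y e.symm.differentiableAt
  have ha := analyticAt_of_contDiffOn (x := e x) (hV.mem_nhds (by simpa using hxU)) hg
  have := ha.comp (f := e) (e.toContinuousLinearMap.analyticAt x)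
  refine this.congr (.of_forall fun y => ?_)
  simp

end analyticity

/-! ## Taylor expansion in the parameters -/

section taylor

variable {Y Θ : Type} [NormedAddCommGroup Y] [NormedSpace ℝ Y]
  [NormedAddCommGroup Θ] [NormedSpace ℝ Θ]

section
variable {G : Type} [NormedAddCommGroup G] [NormedSpace ℝ G]

/-- The derivative in the direction of the parameters. -/
def dparam (h : Y × Θ → G) (q : Y × Θ) : Θ →L[ℝ] G :=
  (fderiv ℝ h q).comp (inr ℝ Y Θ)

/-- The derivative in the direction of the first variable. -/
def dfst (h : Y × Θ → G) (q : Y × Θ) : Y →L[ℝ] G :=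
  (fderiv ℝ h q).comp (inl ℝ Y Θ)

/-- Germs of smooth functions. -/
def SmoothNear (q₀ : Y × Θ) (h : Y × Θ → G) : Prop := ∀ᶠ q in 𝓝 q₀, ContDiffAt ℝ ∞ h q

/-- Germs vanishing to order `k` in the parameters. -/
def VanishTo (q₀ : Y × Θ) (k : ℕ) (h : Y × Θ → G) : Prop :=
  ∃ C, ∀ᶠ q in 𝓝 q₀, ‖h q‖ ≤ C * ‖q.2 - q₀.2‖ ^ k

end

/-- The homogeneous terms of the Taylor expansion in the parameters. -/
def taylorTerm (τ₀ : Θ) : ∀ (_ : ℕ) {G : Type} [NormedAddCommGroup G] [NormedSpace ℝ G]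
    (_ : Y × Θ → G), Y × Θ → G
  | 0, _, _, _, h, q => h (q.1, τ₀)
  | l + 1, _, _, _, h, q => ((l : ℝ) + 1)⁻¹ • taylorTerm τ₀ l (dparam h) q (q.2 - τ₀)

section lemmas

variable {G G' : Type} [NormedAddCommGroup G] [NormedSpace ℝ G] [NormedAddCommGroup G']
  [NormedSpace ℝ G'] {q₀ : Y × Θ}

lemma tendsto_proj (q₀ : Y × Θ) : Tendsto (fun q : Y × Θ => (q.1, q₀.2)) (𝓝 q₀) (𝓝 q₀) := by
  have : Continuous fun q : Y × Θ => (q.1, q₀.2) := by fun_prop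
  exact this.tendsto' _ _ rfl

lemma SmoothNear.differentiable {h : Y × Θ → G} (hs : SmoothNear q₀ h) :
  ∀ᶠ q in 𝓝 q₀, DifferentiableAt ℝ h q :=
  hs.mono fun _ h => h.differentiableAt (by simp)

lemma SmoothNear.dparam {h : Y × Θ → G} (hs : SmoothNear q₀ h) : SmoothNear q₀ (dparam h) :=
  hs.mono fun _ h => (h.fderiv_right (m := ∞) (by simp)).clm_comp contDiffAt_const

lemma SmoothNear.dfst {h : Y × Θ → G} (hs : SmoothNear q₀ h) : SmoothNear q₀ (dfst h) :=
  hs.mono fun _ h => (h.fderiv_right (m := ∞) (by simp)).clm_comp contDiffAt_const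

lemma dparam_eventuallyEq {h h' : Y × Θ → G} (e : h =ᶠ[𝓝 q₀] h') : dparam h =ᶠ[𝓝 q₀] dparam h' := by
  filter_upwards [eventually_eventually_nhds.2 e] with q hq
  rw [dparam, dparam, EventuallyEq.fderiv_eq hq]

lemma dparam_clm {h : Y × Θ → G} {q : Y × Θ} (hd : DifferentiableAt ℝ h q) {A : Y → G →L[ℝ] G'}
  (hA : DifferentiableAt ℝ A q.1) :
  dparam (fun q => A q.1 (h q)) q = (A q.1).comp (dparam h q) := by
  have e : HasFDerivAt (fun q : Y × Θ => A q.1 (h q)) _ q :=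
    (hA.hasFDerivAt.comp q hasFDerivAt_fst).clm_apply hd.hasFDerivAt
  ext b
  simp [dparam, e.fderiv]

lemma fderiv_fderiv_symm {h : Y × Θ → G} {q : Y × Θ} (hs : ContDiffAt ℝ ∞ h q) (v w : Y × Θ) :
  fderiv ℝ (fderiv ℝ h) q v w = fderiv ℝ (fderiv ℝ h) q w v :=
  (hs.isSymmSndFDerivAt (by
    rw [minSmoothness_of_isRCLikeNormedField]
    exact (WithTop.coe_le_coe.2 (le_top : (2 : ℕ∞) ≤ ⊤) : ((2 : ℕ∞) : ℕ∞ω) ≤ ∞))).eq v w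

lemma fderiv_fderiv_comp {E : Type} [NormedAddCommGroup E] [NormedSpace ℝ E]
  {h : Y × Θ → G} {q : Y × Θ} (hs : ContDiffAt ℝ ∞ h q) (L : E →L[ℝ] Y × Θ) (v : Y × Θ) (w : E) :
  fderiv ℝ (fun q => (fderiv ℝ h q).comp L) q v w = fderiv ℝ (fderiv ℝ h) q v (L w) := by
  have hd : DifferentiableAt ℝ (fderiv ℝ h) q :=
    (hs.fderiv_right (m := ∞) (by simp)).differentiableAt (by simp)
  have e : HasFDerivAt (fun q => (fderiv ℝ h q).comp L) _ q :=
    hd.hasFDerivAt.clm_comp (hasFDerivAt_const L q)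
  rw [e.fderiv]
  simp

lemma taylorTerm_congr (l : ℕ) {h h' : Y × Θ → G} (e : h =ᶠ[𝓝 q₀] h') :
    taylorTerm q₀.2 l h =ᶠ[𝓝 q₀] taylorTerm q₀.2 l h' := by
  induction l generalizing G with
  | zero => exact (tendsto_proj q₀).eventually e
  | succ l ih =>
    filter_upwards [ih (dparam_eventuallyEq e)] with q hq
    simp only [taylorTerm, hq]

lemma SmoothNear.taylorTerm (l : ℕ) {h : Y × Θ → G} (hs : SmoothNear q₀ h) :
    SmoothNear q₀ (taylorTerm q₀.2 l h) := by
  induction l generalizing G with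
  | zero =>
    filter_upwards [(tendsto_proj q₀).eventually hs] with q hq
    exact hq.comp q (f := fun q : Y × Θ => (q.1, q₀.2)) (contDiffAt_fst.prodMk contDiffAt_const)
  | succ l ih =>
    filter_upwards [ih hs.dparam] with q hq
    exact (hq.clm_apply (contDiffAt_snd.sub contDiffAt_const)).const_smul _

lemma taylorTerm_clm (l : ℕ) {h : Y × Θ → G} (hs : SmoothNear q₀ h) {A : Y → G →L[ℝ] G'}
    (hA : ∀ᶠ y in 𝓝 q₀.1, ContDiffAt ℝ ∞ A y) :
    ∀ᶠ q in 𝓝 q₀, taylorTerm q₀.2 l (fun q => A q.1 (h q)) q = A q.1 (taylorTerm q₀.2 l h q) := by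
  induction l generalizing G G' with
  | zero => exact Eventually.of_forall fun q => rfl
  | succ l ih =>
    have e : dparam (fun q => A q.1 (h q)) =ᶠ[𝓝 q₀]
        fun q => (compL ℝ Θ G G' (A q.1)) (dparam h q) := by
      filter_upwards [hs.differentiable, continuous_fst.continuousAt.eventually hA] with q h₁ h₂
      exact dparam_clm h₁ (h₂.differentiableAt (by simp))
    filter_upwards [taylorTerm_congr l e, ih hs.dparam (A := fun y =>
      compL ℝ Θ G G' (A y)) (hA.mono fun y hy =>
        contDiffAt_const.clm_apply hy)] with q h₁ h₂
    simp only [taylorTerm]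
    rw [h₁, h₂, map_smul]
    rfl

lemma taylorTerm_const_clm (l : ℕ) {h : Y × Θ → G} (hs : SmoothNear q₀ h) (A : G →L[ℝ] G') :
  ∀ᶠ q in 𝓝 q₀, taylorTerm q₀.2 l (fun q => A (h q)) q = A (taylorTerm q₀.2 l h q) :=
  taylorTerm_clm l hs (A := fun _ => A) (.of_forall fun _ => contDiffAt_const)

lemma taylorTerm_zero_fun (l : ℕ) (τ₀ : Θ) (q : Y × Θ) :
    taylorTerm τ₀ l (fun _ : Y × Θ => (0 : G)) q = 0 := by
  induction l generalizing G with
  | zero => rfl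
  | succ l ih =>
    have e : dparam (fun _ : Y × Θ => (0 : G)) = fun _ => 0 := by
      funext q
      simp [dparam]
    simp only [taylorTerm, e, ih, zero_apply, smul_zero]

lemma taylorTerm_homogeneous (l : ℕ) (τ₀ : Θ) (h : Y × Θ → G) (c : ℝ) (q : Y × Θ) :
    taylorTerm τ₀ l h (q.1, τ₀ + c • (q.2 - τ₀)) = c ^ l • taylorTerm τ₀ l h q := by
  induction l generalizing G with
  | zero => simp [taylorTerm]
  | succ l ih =>
    simp only [taylorTerm, ih, add_sub_cancel_left, map_smul, smul_apply, pow_succ, smul_smul]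
    congr 1
    ring

/-- Derivatives in the first variable commute with the Taylor expansion. -/
lemma dfst_taylorTerm (l : ℕ) {h : Y × Θ → G} (hs : SmoothNear q₀ h) :
    ∀ᶠ q in 𝓝 q₀, dfst (taylorTerm q₀.2 l h) q = taylorTerm q₀.2 l (dfst h) q := by
  induction l generalizing G with
  | zero =>
    filter_upwards [(tendsto_proj q₀).eventually hs.differentiable] with q hq
    have e : HasFDerivAt (fun q : Y × Θ => h (q.1, q₀.2)) _ q :=
      HasFDerivAt.comp q (f := fun q : Y × Θ => (q.1, q₀.2)) hq.hasFDerivAt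
        (hasFDerivAt_fst.prodMk (hasFDerivAt_const q₀.2 q))
    change dfst (fun q : Y × Θ => h (q.1, q₀.2)) q = dfst h (q.1, q₀.2)
    rw [dfst, e.fderiv]
    rfl
  | succ l ih =>
    have e : dparam (dfst h) =ᶠ[𝓝 q₀] fun q =>
        (ContinuousLinearMap.flipₗᵢ ℝ Y Θ G).toContinuousLinearEquiv.toContinuousLinearMap
          (dfst (dparam h) q) := by
      filter_upwards [hs] with q hq
      ext b v
      exact (fderiv_fderiv_comp hq _ _ _).trans ((fderiv_fderiv_symm hq _ _).trans
        (fderiv_fderiv_comp hq _ _ _).symm)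
    filter_upwards [ih hs.dparam, taylorTerm_congr l e, taylorTerm_const_clm (G' := Θ →L[ℝ] Y →L[ℝ] G) l hs.dparam.dfst
      (ContinuousLinearMap.flipₗᵢ ℝ Y Θ G).toContinuousLinearEquiv.toContinuousLinearMap,
      (hs.dparam.taylorTerm l).differentiable] with q h₁ h₂ h₃ h₄
    have e' : HasFDerivAt (taylorTerm q₀.2 (l + 1) h) _ q :=
      (h₄.hasFDerivAt.clm_apply (hasFDerivAt_snd.sub_const q₀.2)).const_smul ((l : ℝ) + 1)⁻¹
    ext v
    rw [dfst, e'.fderiv]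
    simp only [taylorTerm]
    rw [h₂, h₃, ← h₁]
    simp [dfst]

/-- The derivative of a Taylor term. -/
lemma dparam_taylorTerm_succ (l : ℕ) {h : Y × Θ → G} (hs : SmoothNear q₀ h) :
    ∀ᶠ q in 𝓝 q₀, dparam (taylorTerm q₀.2 (l + 1) h) q = taylorTerm q₀.2 l (dparam h) q := by
  induction l generalizing G with
  | zero =>
    filter_upwards [(hs.dparam.taylorTerm 0).differentiable] with q h₄
    have e' : HasFDerivAt (taylorTerm q₀.2 1 h) _ q :=
      (h₄.hasFDerivAt.clm_apply (hasFDerivAt_snd.sub_const q₀.2)).const_smul (((0 : ℕ) : ℝ) + 1)⁻¹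
    ext v
    have e'' : fderiv ℝ (taylorTerm q₀.2 0 (dparam h)) q (0, v) = 0 := by
      have : HasFDerivAt (fun s : ℝ => taylorTerm q₀.2 0 (dparam h) (q + s • (0, v)))
          _ 0 := HasFDerivAt.comp (0 : ℝ) (f := fun s : ℝ => q + s • ((0, v) : Y × Θ))
          (g := taylorTerm q₀.2 0 (dparam h)) (by simpa using h₄.hasFDerivAt)
          (((hasFDerivAt_id (0 : ℝ)).smul_const ((0, v) : Y × Θ)).const_add q)
      have h₁ := this.unique (hasFDerivAt_const (dparam h (q.1, q₀.2)) (0 : ℝ) |>.congr_of_eventuallyEq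
        (.of_forall fun s => by simp [taylorTerm]))
      simpa using congrArg (fun L => L 1) h₁
    rw [dparam, e'.fderiv]
    simp [e'']
  | succ l ih =>
    have e : dparam (dparam h) =ᶠ[𝓝 q₀] fun q =>
        (ContinuousLinearMap.flipₗᵢ ℝ Θ Θ G).toContinuousLinearEquiv.toContinuousLinearMap
          (dparam (dparam h) q) := by
      filter_upwards [hs] with q hq
      ext b v
      exact (fderiv_fderiv_comp hq _ _ _).trans ((fderiv_fderiv_symm hq _ _).trans
        (fderiv_fderiv_comp hq _ _ _).symm)
    filter_upwards [ih hs.dparam, taylorTerm_congr l e, taylorTerm_const_clm (G' := Θ →L[ℝ] Θ →L[ℝ] G) l hs.dparam.dparam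
      (ContinuousLinearMap.flipₗᵢ ℝ Θ Θ G).toContinuousLinearEquiv.toContinuousLinearMap,
      (hs.dparam.taylorTerm (l + 1)).differentiable] with q h₁ h₂ h₃ h₄
    have e' : HasFDerivAt (taylorTerm q₀.2 (l + 1 + 1) h) _ q :=
      (h₄.hasFDerivAt.clm_apply (hasFDerivAt_snd.sub_const q₀.2)).const_smul
        (((l + 1 : ℕ) : ℝ) + 1)⁻¹
    ext v
    have hsymm (b c : Θ) : taylorTerm q₀.2 l (dparam (dparam h)) q b c =
        taylorTerm q₀.2 l (dparam (dparam h)) q c b := by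
      conv_lhs => rw [h₂, h₃]
      rfl
    have e₁ : fderiv ℝ (taylorTerm q₀.2 (l + 1) (dparam h)) q (0, v) =
        taylorTerm q₀.2 l (dparam (dparam h)) q v := congrArg (fun L => L v) h₁
    rw [dparam, e'.fderiv]
    simp only [clm_comp_apply, inr_apply, smul_apply, add_apply,
      ContinuousLinearMap.flip_apply, e₁, ContinuousLinearMap.coe_snd']
    simp only [taylorTerm, smul_apply]
    rw [hsymm v]
    generalize taylorTerm q₀.2 l (dparam (dparam h)) q (q.2 - q₀.2) v = x
    match_scalars
    field_simp
    ring

end lemmas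

end taylor

/-! ## Order of vanishing in the parameters -/

section vanishing

variable {Y Θ : Type} [NormedAddCommGroup Y] [NormedSpace ℝ Y]
  [NormedAddCommGroup Θ] [NormedSpace ℝ Θ]
  {G G' : Type} [NormedAddCommGroup G] [NormedSpace ℝ G] [NormedAddCommGroup G']
  [NormedSpace ℝ G'] {q₀ : Y × Θ} {h h' : Y × Θ → G} {k l : ℕ}

namespace VanishTo

lemma exists_pos (hv : VanishTo q₀ k h) :
  ∃ C : ℝ, 0 < C ∧ ∀ᶠ q in 𝓝 q₀, ‖h q‖ ≤ C * ‖q.2 - q₀.2‖ ^ k := by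
  obtain ⟨C, hC⟩ := hv
  refine ⟨|C| + 1, by positivity, hC.mono fun q hq => hq.trans ?_⟩
  gcongr
  linarith [le_abs_self C]

lemma congr (hv : VanishTo q₀ k h) (e : h =ᶠ[𝓝 q₀] h') : VanishTo q₀ k h' := by
  obtain ⟨C, hC⟩ := hv
  refine ⟨C, ?_⟩
  filter_upwards [hC, e] with q h₁ h₂
  rwa [← h₂]

lemma add (hv : VanishTo q₀ k h) (hv' : VanishTo q₀ k h') : VanishTo q₀ k (h + h') := by
  obtain ⟨C, hC⟩ := hv
  obtain ⟨C', hC'⟩ := hv'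
  refine ⟨C + C', ?_⟩
  filter_upwards [hC, hC'] with q h₁ h₂
  rw [add_mul]
  exact (norm_add_le _ _).trans (add_le_add h₁ h₂)

lemma neg (hv : VanishTo q₀ k h) : VanishTo q₀ k (-h) := by
  obtain ⟨C, hC⟩ := hv
  exact ⟨C, by simpa using hC⟩

lemma sub (hv : VanishTo q₀ k h) (hv' : VanishTo q₀ k h') : VanishTo q₀ k (h - h') := by
  rw [sub_eq_add_neg]
  exact hv.add hv'.neg

lemma mono (hv : VanishTo q₀ k h) (hl : l ≤ k) : VanishTo q₀ l h := by
  obtain ⟨C, hC0, hC⟩ := hv.exists_pos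
  refine ⟨C, ?_⟩
  have : ∀ᶠ q in 𝓝 q₀, ‖q.2 - q₀.2‖ < 1 := by
    have hc : Continuous fun q : Y × Θ => ‖q.2 - q₀.2‖ := by fun_prop
    exact (hc.tendsto' q₀ 0 (by simp)).eventually (Iio_mem_nhds one_pos)
  filter_upwards [hC, this] with q h₁ h₂
  refine h₁.trans ?_
  gcongr ?_ * ?_
  exact pow_le_pow_of_le_one (norm_nonneg _) h₂.le hl

/-- Products. -/
lemma bilin {H : Type} [NormedAddCommGroup H] [NormedSpace ℝ H] (L : G →L[ℝ] G' →L[ℝ] H)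
  {g : Y × Θ → G'} (hv : VanishTo q₀ k h) (hg : VanishTo q₀ l g) :
  VanishTo q₀ (k + l) fun q => L (h q) (g q) := by
  obtain ⟨C, hC0, hC⟩ := hv.exists_pos
  obtain ⟨C', hC0', hC'⟩ := hg.exists_pos
  refine ⟨‖L‖ * C * C', ?_⟩
  filter_upwards [hC, hC'] with q h₁ h₂
  calc _ ≤ ‖L‖ * ‖h q‖ * ‖g q‖ := L.le_opNorm₂ _ _
    _ ≤ ‖L‖ * (C * ‖q.2 - q₀.2‖ ^ k) * (C' * ‖q.2 - q₀.2‖ ^ l) := by gcongr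
    _ = _ := by rw [pow_add]; ring

lemma of_continuousAt (hc : ContinuousAt h q₀) : VanishTo q₀ 0 h := by
  refine ⟨‖h q₀‖ + 1, ?_⟩
  filter_upwards [hc.norm.eventually (Iio_mem_nhds (lt_add_one ‖h q₀‖))] with q hq
  simpa using hq.le

lemma clm (hv : VanishTo q₀ k h) (L : G →L[ℝ] G') : VanishTo q₀ k fun q => L (h q) := by
  obtain ⟨C, hC⟩ := hv
  refine ⟨‖L‖ * C, ?_⟩
  filter_upwards [hC] with q hq
  rw [mul_assoc]
  exact (L.le_opNorm _).trans (by gcongr)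

end VanishTo

lemma vanishTo_succ_of_dparam (hs : SmoothNear q₀ h) (h₀ : ∀ᶠ q in 𝓝 q₀, h (q.1, q₀.2) = 0)
  (hd : VanishTo q₀ k (dparam h)) : VanishTo q₀ (k + 1) h := by
  obtain ⟨C, hC0, hC⟩ := hd.exists_pos
  obtain ⟨r, hr, hball⟩ := Metric.eventually_nhds_iff_ball.1 (hC.and (hs.differentiable.and h₀))
  refine ⟨C, ?_⟩
  filter_upwards [Metric.ball_mem_nhds q₀ hr] with q hq
  have hq₁ : dist q.1 q₀.1 < r := lt_of_le_of_lt (le_max_left _ _) hq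
  have hq₂ : dist q.2 q₀.2 < r := lt_of_le_of_lt (le_max_right _ _) hq
  have hmem (s : Θ) (hs : s ∈ closedBall q₀.2 ‖q.2 - q₀.2‖) : (q.1, s) ∈ ball q₀ r := by
    rw [mem_closedBall, ← dist_eq_norm] at hs
    rw [mem_ball, Prod.dist_eq]
    exact max_lt hq₁ (hs.trans_lt hq₂)
  have hderiv (s : Θ) (hs : s ∈ closedBall q₀.2 ‖q.2 - q₀.2‖) :
      HasFDerivWithinAt (fun s => h (q.1, s)) (dparam h (q.1, s))
        (closedBall q₀.2 ‖q.2 - q₀.2‖) s :=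
    (HasFDerivAt.comp s (f := fun s => (q.1, s)) (hball _ (hmem s hs)).2.1.hasFDerivAt
      (hasFDerivAt_prodMk_right q.1 s)).hasFDerivWithinAt
  have hbound (s : Θ) (hs : s ∈ closedBall q₀.2 ‖q.2 - q₀.2‖) :
      ‖dparam h (q.1, s)‖ ≤ C * ‖q.2 - q₀.2‖ ^ k := by
    refine (hball _ (hmem s hs)).1.trans ?_
    rw [mem_closedBall, dist_eq_norm] at hs
    gcongr
  have key := (convex_closedBall q₀.2 ‖q.2 - q₀.2‖).norm_image_sub_le_of_norm_hasFDerivWithin_le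
    hderiv hbound (Metric.mem_closedBall_self (norm_nonneg _))
    (show q.2 ∈ _ by rw [mem_closedBall, dist_eq_norm])
  have hz : h (q.1, q₀.2) = 0 := (hball q hq).2.2
  rw [hz, sub_zero] at key
  rw [pow_succ, ← mul_assoc]
  exact key

lemma taylorTerm_proj_succ (l : ℕ) (τ₀ : Θ) (h : Y × Θ → G) (y : Y) :
  taylorTerm τ₀ (l + 1) h (y, τ₀) = 0 := by
  simp [taylorTerm]

lemma vanishTo_taylorTerm (l : ℕ) (hs : SmoothNear q₀ h) :
    VanishTo q₀ l (taylorTerm q₀.2 l h) := by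
  induction l generalizing G with
  | zero => exact .of_continuousAt (hs.taylorTerm 0).self_of_nhds.continuousAt
  | succ l ih =>
    obtain ⟨C, hC0, hC⟩ := (ih hs.dparam).exists_pos
    refine ⟨((l : ℝ) + 1)⁻¹ * C, ?_⟩
    filter_upwards [hC] with q hq
    have hpos : (0 : ℝ) < (l : ℝ) + 1 := by positivity
    simp only [taylorTerm]
    rw [norm_smul, Real.norm_of_nonneg (by positivity), pow_succ, mul_assoc]
    gcongr
    refine ((taylorTerm q₀.2 l (dparam h) q).le_opNorm _).trans ?_
    rw [← mul_assoc]
    gcongr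

/-- Taylor's theorem in the parameters. -/
lemma vanishTo_sub_sum (l : ℕ) (hs : SmoothNear q₀ h) :
    VanishTo q₀ l (fun q => h q - ∑ j ∈ Finset.range l, taylorTerm q₀.2 j h q) := by
  induction l generalizing G with
  | zero => exact .of_continuousAt (by simpa using hs.self_of_nhds.continuousAt)
  | succ l ih =>
    have hsm : SmoothNear q₀ (fun q => h q - ∑ j ∈ Finset.range (l + 1), taylorTerm q₀.2 j h q) := by
      have : ∀ᶠ q in 𝓝 q₀, ∀ j ∈ Finset.range (l + 1), ContDiffAt ℝ ∞ (taylorTerm q₀.2 j h) q :=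
        (Finset.eventually_all _).2 fun j _ => hs.taylorTerm j
      filter_upwards [hs, this] with q h₁ h₂
      exact h₁.sub (ContDiffAt.sum h₂)
    refine vanishTo_succ_of_dparam hsm (.of_forall fun q => ?_) ((ih hs.dparam).congr ?_)
    · rw [Finset.sum_range_succ', Finset.sum_eq_zero fun j _ => taylorTerm_proj_succ j _ _ _]
      simp [taylorTerm]
    · have h₁ : ∀ᶠ q in 𝓝 q₀, ∀ j ∈ Finset.range (l + 1),
          DifferentiableAt ℝ (taylorTerm q₀.2 j h) q :=
        (Finset.eventually_all _).2 fun j _ => (hs.taylorTerm j).differentiable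
      have h₂ : ∀ᶠ q in 𝓝 q₀, ∀ j ∈ Finset.range l,
          dparam (taylorTerm q₀.2 (j + 1) h) q = taylorTerm q₀.2 j (dparam h) q :=
        (Finset.eventually_all _).2 fun j _ => dparam_taylorTerm_succ j hs
      filter_upwards [h₁, h₂, hs.differentiable] with q h₁ h₂ h₃
      have e : HasFDerivAt (fun q => h q - ∑ j ∈ Finset.range (l + 1), taylorTerm q₀.2 j h q)
          (fderiv ℝ h q - ∑ j ∈ Finset.range (l + 1), fderiv ℝ (taylorTerm q₀.2 j h) q) q :=
        h₃.hasFDerivAt.sub (HasFDerivAt.fun_sum fun j hj => (h₁ j hj).hasFDerivAt)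
      have h₀ : dparam (taylorTerm q₀.2 0 h) q = 0 := by
        have hd := h₁ 0 (by simp)
        ext v
        have : HasFDerivAt (fun s : ℝ => taylorTerm q₀.2 0 h (q + s • (0, v)))
            _ 0 := HasFDerivAt.comp (0 : ℝ) (f := fun s : ℝ => q + s • ((0, v) : Y × Θ))
            (g := taylorTerm q₀.2 0 h) (by simpa using hd.hasFDerivAt)
            (((hasFDerivAt_id (0 : ℝ)).smul_const ((0, v) : Y × Θ)).const_add q)
        have h₁ := this.unique (hasFDerivAt_const (h (q.1, q₀.2)) (0 : ℝ) |>.congr_of_eventuallyEq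
          (.of_forall fun s => by simp [taylorTerm]))
        simpa [dparam] using congrArg (fun L => L 1) h₁
      have h₄ : ∑ j ∈ Finset.range (l + 1), dparam (taylorTerm q₀.2 j h) q =
          ∑ j ∈ Finset.range l, taylorTerm q₀.2 j (dparam h) q := by
        rw [Finset.sum_range_succ', h₀, add_zero]
        exact Finset.sum_congr rfl h₂
      rw [← h₄]
      change _ = (fderiv ℝ _ q).comp _
      rw [e.fderiv]
      ext v
      simp [dparam, sum_apply]

lemma eq_zero_of_norm_sum_pow_le (l : ℕ) (a : ℕ → G) (C : ℝ)
    (hb : ∀ᶠ c : ℝ in 𝓝[>] 0, ‖∑ j ∈ Finset.range l, c ^ j • a j‖ ≤ C * c ^ l) :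
    ∀ j < l, a j = 0 := by
  induction l generalizing a with
  | zero => simp
  | succ l ih =>
    have h₀ : a 0 = 0 := by
      have h₁ : Tendsto (fun c : ℝ => ∑ j ∈ Finset.range (l + 1), c ^ j • a j) (𝓝[>] 0) (𝓝 (a 0)) := by
        have hc : Continuous fun c : ℝ => ∑ j ∈ Finset.range (l + 1), c ^ j • a j := by fun_prop
        refine (hc.tendsto' 0 (a 0) ?_).mono_left nhdsWithin_le_nhds
        rw [Finset.sum_range_succ']
        simp
      have h₂ : Tendsto (fun c : ℝ => C * c ^ (l + 1)) (𝓝[>] 0) (𝓝 0) := by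
        have hc : Continuous fun c : ℝ => C * c ^ (l + 1) := by fun_prop
        exact (hc.tendsto' 0 0 (by simp)).mono_left nhdsWithin_le_nhds
      exact tendsto_nhds_unique h₁ (squeeze_zero_norm' hb h₂)
    have h₁ := ih (fun j => a (j + 1)) (by
      filter_upwards [hb, self_mem_nhdsWithin] with c hc hc0
      have hc0 : (0 : ℝ) < c := hc0
      rw [Finset.sum_range_succ', h₀, smul_zero, add_zero] at hc
      have e : ∑ j ∈ Finset.range l, c ^ (j + 1) • a (j + 1) =
          c • ∑ j ∈ Finset.range l, c ^ j • a (j + 1) := by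
        rw [Finset.smul_sum]
        refine Finset.sum_congr rfl fun j _ => ?_
        rw [smul_smul, pow_succ']
      rw [e, norm_smul, Real.norm_of_nonneg hc0.le] at hc
      have : c * ‖∑ j ∈ Finset.range l, c ^ j • a (j + 1)‖ ≤ c * (C * c ^ l) :=
        hc.trans (le_of_eq (by ring))
      exact le_of_mul_le_mul_left this hc0)
    rintro (_ | j) hj
    · exact h₀
    · exact h₁ j (by omega)

/-- Vanishing on the rays through a point near `q₀`. -/
lemma taylorTerm_eq_zero_of_ray (l : ℕ) (hs : SmoothNear q₀ h) :
  ∀ᶠ q in 𝓝 q₀, (∃ C : ℝ, ∀ᶠ c : ℝ in 𝓝[>] 0, ‖h (q.1, q₀.2 + c • (q.2 - q₀.2))‖ ≤ C * c ^ l) →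
  ∀ j < l, taylorTerm q₀.2 j h q = 0 := by
  obtain ⟨C', hC0', hC'⟩ := (vanishTo_sub_sum l hs).exists_pos
  have hray : ∀ᶠ q in 𝓝 q₀, ∀ᶠ c : ℝ in 𝓝[>] 0,
      ‖h (q.1, q₀.2 + c • (q.2 - q₀.2)) - ∑ j ∈ Finset.range l,
        taylorTerm q₀.2 j h (q.1, q₀.2 + c • (q.2 - q₀.2))‖ ≤ C' * ‖c • (q.2 - q₀.2)‖ ^ l := by
    filter_upwards [(tendsto_proj q₀).eventually (eventually_eventually_nhds.2 hC')] with q hq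
    have hc : Continuous fun c : ℝ => (q.1, q₀.2 + c • (q.2 - q₀.2)) := by fun_prop
    have ht : Tendsto (fun c : ℝ => (q.1, q₀.2 + c • (q.2 - q₀.2))) (𝓝[>] 0) (𝓝 (q.1, q₀.2)) :=
      (hc.tendsto' 0 _ (by simp)).mono_left nhdsWithin_le_nhds
    filter_upwards [ht.eventually hq] with c hc
    simpa using hc
  filter_upwards [hray] with q hq ⟨C, hC⟩
  refine eq_zero_of_norm_sum_pow_le l (fun j => taylorTerm q₀.2 j h q)
    (C + C' * ‖q.2 - q₀.2‖ ^ l) ?_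
  filter_upwards [hq, hC, self_mem_nhdsWithin] with c h₁ h₂ h₃
  have h₃ : (0 : ℝ) < c := h₃
  simp only [taylorTerm_homogeneous] at h₁
  rw [norm_smul, Real.norm_of_nonneg h₃.le, mul_pow] at h₁
  have h₄ := norm_sub_le (h (q.1, q₀.2 + c • (q.2 - q₀.2)))
    (h (q.1, q₀.2 + c • (q.2 - q₀.2)) - ∑ j ∈ Finset.range l, c ^ j • taylorTerm q₀.2 j h q)
  rw [sub_sub_cancel] at h₄
  linarith

lemma vanishTo_iff_taylorTerm (hs : SmoothNear q₀ h) :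
  VanishTo q₀ k h ↔ ∀ j < k, ∀ᶠ q in 𝓝 q₀, taylorTerm q₀.2 j h q = 0 := by
  constructor
  · rintro hv j hj
    obtain ⟨C, hC0, hC⟩ := hv.exists_pos
    filter_upwards [taylorTerm_eq_zero_of_ray k hs,
      (tendsto_proj q₀).eventually (eventually_eventually_nhds.2 hC)] with q h₁ h₂
    refine h₁ ⟨C * ‖q.2 - q₀.2‖ ^ k, ?_⟩ j hj
    have hc : Continuous fun c : ℝ => (q.1, q₀.2 + c • (q.2 - q₀.2)) := by fun_prop
    have ht : Tendsto (fun c : ℝ => (q.1, q₀.2 + c • (q.2 - q₀.2))) (𝓝[>] 0) (𝓝 (q.1, q₀.2)) :=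
      (hc.tendsto' 0 _ (by simp)).mono_left nhdsWithin_le_nhds
    filter_upwards [ht.eventually h₂, self_mem_nhdsWithin] with c hc hc0
    have hc0 : (0 : ℝ) < c := hc0
    refine hc.trans (le_of_eq ?_)
    simp only [add_sub_cancel_left]
    rw [norm_smul, Real.norm_of_nonneg hc0.le]
    ring
  · intro hz
    refine (vanishTo_sub_sum k hs).congr ?_
    have : ∀ᶠ q in 𝓝 q₀, ∀ j ∈ Finset.range k, taylorTerm q₀.2 j h q = 0 :=
      (Finset.eventually_all _).2 fun j hj => hz j (Finset.mem_range.1 hj)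
    filter_upwards [this] with q hq
    rw [Finset.sum_eq_zero hq, sub_zero]

lemma VanishTo.dparam (hs : SmoothNear q₀ h) (hv : VanishTo q₀ (k + 1) h) :
  VanishTo q₀ k (dparam h) := by
  refine (vanishTo_iff_taylorTerm hs.dparam).2 fun j hj => ?_
  have h₁ := (vanishTo_iff_taylorTerm hs).1 hv (j + 1) (by omega)
  filter_upwards [dparam_taylorTerm_succ j hs, dparam_eventuallyEq (h' := fun _ => 0) h₁] with q e₁ e₂
  rw [← e₁, e₂]
  simp [_root_.dparam]

lemma VanishTo.dfst (hs : SmoothNear q₀ h) (hv : VanishTo q₀ k h) : VanishTo q₀ k (dfst h) := by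
  refine (vanishTo_iff_taylorTerm hs.dfst).2 fun j hj => ?_
  have h₁ := (vanishTo_iff_taylorTerm hs).1 hv j hj
  filter_upwards [dfst_taylorTerm j hs, eventually_eventually_nhds.2 h₁] with q e₁ e₂
  rw [← e₁, _root_.dfst, EventuallyEq.fderiv_eq (f := fun _ => (0:G)) e₂]
  simp

/-- The leading term. -/
lemma VanishTo.sub_taylorTerm (hs : SmoothNear q₀ h) (hv : VanishTo q₀ k h) :
  VanishTo q₀ (k + 1) (h - taylorTerm q₀.2 k h) := by
  refine (vanishTo_sub_sum (k + 1) hs).congr ?_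
  have : ∀ᶠ q in 𝓝 q₀, ∀ j ∈ Finset.range k, taylorTerm q₀.2 j h q = 0 :=
    (Finset.eventually_all _).2 fun j hj =>
      (vanishTo_iff_taylorTerm hs).1 hv j (Finset.mem_range.1 hj)
  filter_upwards [this] with q hq
  rw [Finset.sum_range_succ, Finset.sum_eq_zero hq, zero_add]
  rfl

end vanishing

/-! ## Functions holomorphic in the parameters, and their Taylor expansion -/

section jets

section
variable {Y : Type} [NormedAddCommGroup Y] [NormedSpace ℝ Y] {S : Set ((Y × Θ) × (Y × Θ))}
  {q₀ : Y × Θ} {f : Y × Θ → G}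

lemma cderiv_dparam {q : Y × Θ} (hs : ContDiffAt ℝ ∞ f q) (v w : Y × Θ) (b : Θ) :
  cderiv v w (dparam f) q b = fderiv ℝ (cderiv v w f) q (0, b) := by
  have hd : DifferentiableAt ℝ (fderiv ℝ f) q :=
    (hs.fderiv_right (m := ∞) (by simp)).differentiableAt (by simp)
  have e : HasFDerivAt (fun q => fderiv ℝ f q v + I • fderiv ℝ f q w) _ q :=
    (hd.hasFDerivAt.clm_apply (hasFDerivAt_const v q)).add
      ((hd.hasFDerivAt.clm_apply (hasFDerivAt_const w q)).const_smul I)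
  have e' : fderiv ℝ (cderiv v w f) q = _ := e.fderiv
  have h₁ := fderiv_fderiv_comp hs (inr ℝ Y Θ) v b
  have h₂ := fderiv_fderiv_comp hs (inr ℝ Y Θ) w b
  rw [e']
  change fderiv ℝ (fun q => (fderiv ℝ f q).comp (inr ℝ Y Θ)) q v b +
    I • fderiv ℝ (fun q => (fderiv ℝ f q).comp (inr ℝ Y Θ)) q w b = _
  rw [h₁, h₂, fderiv_fderiv_symm hs, fderiv_fderiv_symm hs w]
  simp

lemma SmoothKer.dparam (h : SmoothKer S q₀ f) : SmoothKer S q₀ (dparam f) where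
  smooth := SmoothNear.dparam h.smooth
  ker p hp := by
    filter_upwards [h.smooth, eventually_eventually_nhds.2 (h.ker p hp)] with q h₁ h₂
    ext b
    rw [cderiv_dparam h₁, EventuallyEq.fderiv_eq (f := fun _ => (0 : G)) h₂]
    simp

end

variable [FiniteDimensional ℂ Θ] {q₀ : Fib m × Θ} {f : Fib m × Θ → G}

lemma cderiv_zero_iff {q : Fib m × Θ} (b : Θ) : cderiv (0, b) (0, I • b) f q = 0 ↔
  fderiv ℝ f q (0, I • b) = I • fderiv ℝ f q (0, b) := by
  rw [cderiv]
  constructor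
  · intro h
    have := congrArg (I • ·) h
    simp only [smul_add, smul_smul, Complex.I_mul_I, smul_zero] at this
    rw [neg_smul, one_smul, add_neg_eq_zero] at this
    exact this.symm
  · intro h
    rw [h, smul_smul, Complex.I_mul_I, neg_smul, one_smul, add_neg_cancel]

lemma hasFDerivAt_slice {q : Fib m × Θ} (hf : DifferentiableAt ℝ f q) :
  HasFDerivAt (fun τ => f (q.1, τ)) (dparam f q) q.2 := by
  have h := HasFDerivAt.comp q.2 (f := fun τ : Θ => (q.1, τ)) (g := f) hf.hasFDerivAt
    (hasFDerivAt_prodMk_right q.1 q.2)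
  exact h

lemma SmoothKer.differentiableAt_slice (h : SmoothKer (antiDirs m Θ) q₀ f) :
  ∀ᶠ q in 𝓝 q₀, DifferentiableAt ℂ (fun τ => f (q.1, τ)) q.2 := by
  filter_upwards [h.eventually_forall, h.differentiable] with q h₁ h₂
  refine hasFDerivAt_complex (hasFDerivAt_slice h₂).differentiableAt fun v => ?_
  rw [(hasFDerivAt_slice h₂).fderiv]
  exact (cderiv_zero_iff v).1 (h₁ v)

lemma SmoothKer.of_differentiableAt_slice (hs : SmoothNear q₀ f)
  (h : ∀ᶠ q in 𝓝 q₀, DifferentiableAt ℂ (fun τ => f (q.1, τ)) q.2) :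
  SmoothKer (antiDirs m Θ) q₀ f where
  smooth := hs
  ker := by
    rintro _ ⟨b, rfl⟩
    filter_upwards [h, hs.differentiable] with q h₁ h₂
    refine (cderiv_zero_iff b).2 ?_
    have e : _root_.dparam f q = (fderiv ℂ (fun τ => f (q.1, τ)) q.2).restrictScalars ℝ :=
      (hasFDerivAt_slice h₂).unique (h₁.hasFDerivAt.restrictScalars ℝ)
    have e' (v : Θ) : fderiv ℝ f q (0, v) = fderiv ℂ (fun τ => f (q.1, τ)) q.2 v :=
      congrArg (· v) e
    rw [e', e', map_smul]

lemma SmoothKer.taylorTerm (l : ℕ) (h : SmoothKer (antiDirs m Θ) q₀ f) :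
    SmoothKer (antiDirs m Θ) q₀ (taylorTerm q₀.2 l f) := by
  induction l generalizing G with
  | zero =>
    refine .of_differentiableAt_slice (SmoothNear.taylorTerm 0 h.smooth)
      (.of_forall fun q => ?_)
    exact differentiableAt_const (𝕜 := ℂ) (f (q.1, q₀.2))
  | succ l ih =>
    refine ⟨SmoothNear.taylorTerm _ h.smooth, ?_⟩
    rintro _ ⟨b, rfl⟩
    let ev (b : Θ) : (Θ →L[ℝ] G) →L[ℝ] G := applyCLM ℝ G b
    let A : (Θ →L[ℝ] G) →L[ℝ] G := ev b + I • ev (I • b)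
    have hA : (fun q => A (_root_.dparam f q)) =ᶠ[𝓝 q₀] fun _ => 0 := by
      filter_upwards [h.ker _ (mem_antiDirs b)] with q hq
      exact hq
    filter_upwards [(ih h.dparam).ker _ (mem_antiDirs b), (ih h.dparam).differentiable,
      taylorTerm_const_clm l h.dparam.smooth A, taylorTerm_congr l hA] with q h₁ h₂ h₃ h₄
    rw [taylorTerm_zero_fun, h₃] at h₄
    have e : HasFDerivAt (_root_.taylorTerm q₀.2 (l + 1) f) _ q :=
      (h₂.hasFDerivAt.clm_apply (hasFDerivAt_snd.sub_const q₀.2)).const_smul ((l : ℝ) + 1)⁻¹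
    rw [_root_.cderiv, e.fderiv]
    have h₅ := congrArg (· (q.2 - q₀.2)) h₁
    simp only [_root_.cderiv, add_apply, smul_apply, zero_apply] at h₅
    have h₆ : _root_.taylorTerm q₀.2 l (_root_.dparam f) q b +
      I • _root_.taylorTerm q₀.2 l (_root_.dparam f) q (I • b) = 0 := h₄
    simp only [smul_apply, add_apply, clm_comp_apply,
      ContinuousLinearMap.flip_apply, ContinuousLinearMap.coe_snd']
    rw [smul_comm I, ← smul_add, smul_add I, add_add_add_comm, h₅, h₆]
    simp

lemma tendsto_realPoint (y₀ : Fib m) (t₀ : Bas N) :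
  Tendsto (fun p : Fib m × Bas N => (p.1, (p.2, star p.2))) (𝓝 (y₀, t₀))
  (𝓝 (y₀, (t₀, star t₀))) := by
  have : Continuous fun p : Fib m × Bas N => (p.1, (p.2, star p.2)) := by fun_prop
  exact this.tendsto _

/-- A function that is holomorphic in the parameters is determined by its restriction to the real
locus. -/
lemma eq_zero_of_realLocus [CompleteSpace G] {y₀ : Fib m} {t₀ : Bas N}
  {f : Fib m × (Bas N × Bas N) → G}
  (h : ∀ᶠ q in 𝓝 (y₀, (t₀, star t₀)), DifferentiableAt ℂ (fun τ => f (q.1, τ)) q.2)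
  (h₀ : ∀ᶠ p in 𝓝 (y₀, t₀), f (p.1, (p.2, star p.2)) = 0) :
  ∀ᶠ q in 𝓝 (y₀, (t₀, star t₀)), f q = 0 := by
  let a (τ : Bas N × Bas N) : Bas N := (1 / 2 : ℂ) • (τ.1 + star τ.2)
  let b (τ : Bas N × Bas N) : Bas N := (-I / 2 : ℂ) • (τ.1 - star τ.2)
  let γ (τ : Bas N × Bas N) (c : ℂ) : Bas N × Bas N :=
    (a τ + c • b τ, star (a τ) + c • star (b τ))
  have hγ : Continuous fun p : (Fib m × (Bas N × Bas N)) × ℂ =>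
      (p.1.1, γ p.1.2 p.2) := by fun_prop
  have hγ' : Continuous fun p : (Fib m × (Bas N × Bas N)) × ℂ =>
      (p.1.1, a p.1.2 + p.2 • b p.1.2) := by fun_prop
  have ha : a (t₀, star t₀) = t₀ := by
    simp only [a, star_star]; module
  have hb : b (t₀, star t₀) = 0 := by simp [b]
  have hp (c : ℂ) : γ (t₀, star t₀) c = (t₀, star t₀) := by
    simp [γ, ha, hb]
  have h₁ : ∀ᶠ q in 𝓝 (y₀, (t₀, star t₀)), ∀ c ∈ closedBall (0 : ℂ) 2,
      DifferentiableAt ℂ (fun τ => f (q.1, τ)) (γ q.2 c) := by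
    refine (isCompact_closedBall (0 : ℂ) 2).eventually_forall_of_forall_eventually fun c _ => ?_
    refine (hγ.tendsto' ((y₀, (t₀, star t₀)), c) (y₀, (t₀, star t₀)) (by simp [hp])).eventually h
  have h₂ : ∀ᶠ q in 𝓝 (y₀, (t₀, star t₀)), ∀ᶠ c : ℂ in 𝓝 0,
      f (q.1, (a q.2 + c • b q.2, star (a q.2 + c • b q.2))) = 0 := by
    have : ∀ᶠ p in 𝓝 ((y₀, (t₀, star t₀)), (0 : ℂ)),
        f (p.1.1, (a p.1.2 + p.2 • b p.1.2, star (a p.1.2 + p.2 • b p.1.2))) = 0 :=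
      (hγ'.tendsto' ((y₀, (t₀, star t₀)), (0 : ℂ)) (y₀, t₀) (by simp [ha])).eventually h₀
    rw [nhds_prod_eq] at this
    exact this.curry
  filter_upwards [h₁, h₂] with q h₁ h₂
  let g : ℂ → G := fun c => f (q.1, γ q.2 c)
  have hg : DifferentiableOn ℂ g (ball 0 2) := fun c hc => by
    have hd : DifferentiableAt ℂ (γ q.2) c := by fun_prop
    exact (DifferentiableAt.comp c (h₁ c (Metric.ball_subset_closedBall hc)) hd).differentiableWithinAt
  have hfreq : ∃ᶠ c in 𝓝[≠] (0 : ℂ), g c = 0 := by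
    have hr : Tendsto (fun r : ℝ => (r : ℂ)) (𝓝[≠] 0) (𝓝[≠] 0) := by
      refine tendsto_nhdsWithin_iff.2 ⟨?_, ?_⟩
      · exact (Complex.continuous_ofReal.tendsto' 0 0 (by simp)).mono_left nhdsWithin_le_nhds
      · filter_upwards [self_mem_nhdsWithin] with r hr
        simpa using hr
    have : ∀ᶠ r : ℝ in 𝓝[≠] 0, g r = 0 := by
      filter_upwards [(hr.mono_right nhdsWithin_le_nhds).eventually h₂] with r hr
      have e : γ q.2 r = (a q.2 + (r : ℂ) • b q.2, star (a q.2 + (r : ℂ) • b q.2)) := by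
        simp [γ, star_smul]
      change f (q.1, γ q.2 r) = 0
      rw [e, hr]
    exact hr.frequently this.frequently
  have hz := (hg.analyticOnNhd Metric.isOpen_ball).eqOn_zero_of_preconnected_of_frequently_eq_zero
    (convex_ball _ _).isPreconnected (mem_ball_self (by norm_num)) hfreq
  have hI : g I = 0 := hz (by simp)
  have e : γ q.2 I = q.2 := by
    refine Prod.ext ?_ ?_
    · change a q.2 + I • b q.2 = q.2.1
      simp only [a, b, smul_smul, smul_sub, smul_add]
      have : I * (-I / 2) = 1 / 2 := by
        rw [mul_div_assoc', mul_neg, Complex.I_mul_I, neg_neg]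
      rw [this]
      module
    · change star (a q.2) + I • star (b q.2) = q.2.2
      simp only [a, b, star_smul, star_add, star_sub, star_star, smul_smul]
      have : I * star (-I / 2) = -1 / 2 := by
        simp only [star_div₀, star_neg, Complex.star_def, Complex.conj_I, neg_neg, Complex.conj_ofNat]
        rw [mul_div_assoc', Complex.I_mul_I]
      have h₂ : star (1 / 2 : ℂ) = 1 / 2 := by simp
      rw [this, h₂]
      module
  have : f (q.1, γ q.2 I) = 0 := hI
  rwa [e] at this

/-- The order of vanishing can be tested on the real locus. -/
lemma vanishTo_of_realLocus [CompleteSpace G] {y₀ : Fib m} {t₀ : Bas N} {k : ℕ}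
  {f : Fib m × (Bas N × Bas N) → G}
  (h : SmoothKer (antiDirs m (Bas N × Bas N)) (y₀, (t₀, star t₀)) f)
  (hb : ∃ C, ∀ᶠ p in 𝓝 (y₀, t₀), ‖f (p.1, (p.2, star p.2))‖ ≤ C * ‖p.2 - t₀‖ ^ k) :
  VanishTo (y₀, (t₀, star t₀)) k f := by
  refine (vanishTo_iff_taylorTerm h.smooth).2 fun j hj => ?_
  refine eq_zero_of_realLocus (h.taylorTerm j).differentiableAt_slice ?_
  obtain ⟨C, hC⟩ := hb
  have hproj : Tendsto (fun p : Fib m × Bas N => (p.1, t₀)) (𝓝 (y₀, t₀))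
      (𝓝 (y₀, t₀)) := tendsto_proj (y₀, t₀)
  filter_upwards [(tendsto_realPoint y₀ t₀).eventually (taylorTerm_eq_zero_of_ray k h.smooth),
    hproj.eventually (eventually_eventually_nhds.2 hC)] with p h₁ h₂
  refine h₁ ⟨C * ‖p.2 - t₀‖ ^ k, ?_⟩ j hj
  have hc : Continuous fun c : ℝ => (p.1, t₀ + c • (p.2 - t₀)) := by fun_prop
  filter_upwards [((hc.tendsto' 0 (p.1, t₀) (by simp)).mono_left nhdsWithin_le_nhds).eventually h₂,
    self_mem_nhdsWithin] with c hc hpos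
  have hpos : (0 : ℝ) < c := hpos
  have e : (t₀, star t₀) + c • ((p.2, star p.2) - (t₀, star t₀)) =
      (t₀ + c • (p.2 - t₀), star (t₀ + c • (p.2 - t₀))) := by
    simp [star_smul, star_add, star_sub]
  rw [e]
  refine hc.trans (le_of_eq ?_)
  rw [add_sub_cancel_left, norm_smul, Real.norm_of_nonneg hpos.le]
  ring

end jets

/-! ## Division in the parameters -/

section division

open MeasureTheory

lemma exists_contDiff_eventuallyEq [FiniteDimensional ℝ Q] {q₀ : Q} {f : Q → G}
  (hf : ∀ᶠ q in 𝓝 q₀, ContDiffAt ℝ ∞ f q) : ∃ g : Q → G, ContDiff ℝ ∞ g ∧ g =ᶠ[𝓝 q₀] f := by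
  obtain ⟨r, hr, hball⟩ := Metric.eventually_nhds_iff_ball.1 hf
  let χ : ContDiffBump q₀ := ⟨r / 4, r / 2, by linarith, by linarith⟩
  refine ⟨fun q => χ q • f q, contDiff_iff_contDiffAt.2 fun q => ?_, ?_⟩
  · by_cases hq : q ∈ ball q₀ r
    · exact χ.contDiff.contDiffAt.smul (hball q hq)
    · have h : q ∉ tsupport χ := by
        rw [χ.tsupport_eq]
        refine fun h => hq (Metric.closedBall_subset_ball ?_ h)
        change r / 2 < r
        linarith
      have e : (fun q => χ q • f q) =ᶠ[𝓝 q] fun _ => 0 := by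
        filter_upwards [notMem_tsupport_iff_eventuallyEq.1 h] with q hq
        rw [hq]
        exact zero_smul ℝ (f q)
      exact contDiffAt_const.congr_of_eventuallyEq e
  · filter_upwards [χ.eventuallyEq_one] with q hq
    rw [hq]
    exact one_smul ℝ (f q)

variable [FiniteDimensional ℂ Θ] [CompleteSpace G] {q₀ : Fib m × Θ}
  {f : Fib m × Θ → G} {S : Set ((Fib m × Θ) × (Fib m × Θ))}

/-- The vector fields are tangent to one of the two factors. -/
def IsSplit (S : Set ((Fib m × Θ) × (Fib m × Θ))) : Prop :=
  ∀ p ∈ S, (p.1.1 = 0 ∧ p.2.1 = 0) ∨ (p.1.2 = 0 ∧ p.2.2 = 0)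

/-- The segment from `(q.1, τ₀)` to `q`. -/
def seg (τ₀ : Θ) (q : Fib m × Θ) (a : ℝ) : Fib m × Θ := (q.1, τ₀ + a • (q.2 - τ₀))

lemma eventually_seg {A : Fib m × Θ → Prop} (h : ∀ᶠ q in 𝓝 q₀, A q) :
  ∀ᶠ q in 𝓝 q₀, ∀ a ∈ Icc (0 : ℝ) 1, A (seg q₀.2 q a) := by
  refine isCompact_Icc.eventually_forall_of_forall_eventually fun a _ => ?_
  have hc : Continuous fun p : (Fib m × Θ) × ℝ => seg q₀.2 p.1 p.2 := by
    unfold seg; fun_prop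
  exact (hc.tendsto' (q₀, a) q₀ (by simp [seg])).eventually h

lemma hasFDerivAt_seg (τ₀ : Θ) (q : Fib m × Θ) (a : ℝ) :
  HasFDerivAt (fun q : Fib m × Θ => seg τ₀ q a)
  ((ContinuousLinearMap.fst ℝ _ _).prod (a • ContinuousLinearMap.snd ℝ _ _)) q :=
  hasFDerivAt_fst.prodMk (((hasFDerivAt_snd.sub_const τ₀).const_smul a).const_add τ₀)

lemma hasDerivAt_seg (τ₀ : Θ) (q : Fib m × Θ) (a : ℝ) :
  HasDerivAt (fun a => seg τ₀ q a) (0, q.2 - τ₀) a := by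
  have h : HasDerivAt (fun a : ℝ => a • (q.2 - τ₀)) ((1 : ℝ) • (q.2 - τ₀)) a :=
    (hasDerivAt_id a).smul_const (q.2 - τ₀)
  rw [one_smul] at h
  exact (hasDerivAt_const a q.1).prodMk (h.const_add τ₀)

/-- The mean of a function along segments. -/
def segMean (τ₀ : Θ) (u : Fib m × Θ → G) (q : Fib m × Θ) : G :=
  ∫ a in Icc (0 : ℝ) 1, u (seg τ₀ q a)

lemma contDiff_comp_seg (τ₀ : Θ) {u : Fib m × Θ → G} (hu : ContDiff ℝ ∞ u) :
  ContDiff ℝ ∞ fun p : (Fib m × Θ) × ℝ => u (seg τ₀ p.1 p.2) := by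
  have : ContDiff ℝ ∞ fun p : (Fib m × Θ) × ℝ => seg τ₀ p.1 p.2 := by
    unfold seg; fun_prop
  exact hu.comp this

lemma SmoothKer.segMean (hS : IsSplit S) {u : Fib m × Θ → G} (hu : ContDiff ℝ ∞ u)
  (h : SmoothKer S q₀ u) : SmoothKer S q₀ (segMean q₀.2 u) where
  smooth := by
    have : FiniteDimensional ℝ Θ := Module.Finite.trans ℂ Θ
    exact Eventually.of_forall fun q =>
      (contDiff_setIntegral_param volume isCompact_Icc (contDiff_comp_seg q₀.2 hu)).contDiffAt
  ker p hp := by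
    have : FiniteDimensional ℝ Θ := Module.Finite.trans ℂ Θ
    filter_upwards [eventually_seg (h.ker p hp)] with q hq
    have hd (v : Fib m × Θ) : fderiv ℝ (_root_.segMean q₀.2 u) q v =
        ∫ a in Icc (0 : ℝ) 1, fderiv ℝ u (seg q₀.2 q a) (v.1, a • v.2) := by
      refine (fderiv_setIntegral_param_apply volume isCompact_Icc
        ((contDiff_comp_seg q₀.2 hu).of_le (by simp)) q v).trans ?_
      refine integral_congr_ae (.of_forall fun a => ?_)
      have e : HasFDerivAt (fun q => u (seg q₀.2 q a)) _ q :=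
        ((hu.differentiable (by simp)) (seg q₀.2 q a)).hasFDerivAt.comp q (hasFDerivAt_seg q₀.2 q a)
      simp only
      rw [e.fderiv]
      rfl
    have key (a : ℝ) (ha : a ∈ Icc (0 : ℝ) 1) :
        fderiv ℝ u (seg q₀.2 q a) (p.1.1, a • p.1.2) =
          (-I) • fderiv ℝ u (seg q₀.2 q a) (p.2.1, a • p.2.2) := by
      have h₀ := eq_neg_of_add_eq_zero_left (hq a ha)
      rcases hS p hp with ⟨h₁, h₂⟩ | ⟨h₁, h₂⟩
      · have e (v : Fib m × Θ) (hv : v.1 = 0) : ((v.1, a • v.2) : Fib m × Θ) = a • v :=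
          Prod.ext (by simp [hv]) rfl
        rw [e _ h₁, e _ h₂, map_smul, map_smul, h₀, smul_neg, neg_smul, smul_comm]
      · have e (v : Fib m × Θ) (hv : v.2 = 0) : ((v.1, a • v.2) : Fib m × Θ) = v :=
          Prod.ext rfl (by simp [hv])
        rw [e _ h₁, e _ h₂, h₀, neg_smul]
    rw [_root_.cderiv, hd, hd, setIntegral_congr_fun measurableSet_Icc key, integral_smul, neg_smul,
      neg_add_cancel]

lemma VanishTo.segMean {k : ℕ} {u : Fib m × Θ → G} (h : VanishTo q₀ k u) :
  VanishTo q₀ k (segMean q₀.2 u) := by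
  obtain ⟨C, hC0, hC⟩ := h.exists_pos
  refine ⟨C, ?_⟩
  filter_upwards [eventually_seg hC] with q hq
  have hb : ∀ a ∈ Icc (0 : ℝ) 1, ‖u (seg q₀.2 q a)‖ ≤ C * ‖q.2 - q₀.2‖ ^ k := fun a ha => by
    refine (hq a ha).trans ?_
    have e : (seg q₀.2 q a).2 - q₀.2 = a • (q.2 - q₀.2) := add_sub_cancel_left q₀.2 (a • (q.2 - q₀.2))
    rw [e, norm_smul, Real.norm_of_nonneg ha.1]
    have h₀ := mul_nonneg ha.1 (norm_nonneg (q.2 - q₀.2))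
    gcongr
    exact mul_le_of_le_one_left (norm_nonneg (q.2 - q₀.2)) ha.2
  have := norm_setIntegral_le_of_norm_le_const (μ := volume) (by simp) hb
  simpa [_root_.segMean] using this

/-- A function that vanishes to order `k + 1` is a combination of the parameters, with coefficients
that vanish to order `k`. -/
lemma exists_division (hS : IsSplit S) (hA : antiDirs m Θ ⊆ S) {n : ℕ}
  (b : Module.Basis (Fin n) ℂ Θ) {k : ℕ} (h : SmoothKer S q₀ f) (hv : VanishTo q₀ (k + 1) f) :
  ∃ g : Fin n → Fib m × Θ → G, (∀ i, SmoothKer S q₀ (g i)) ∧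
  (∀ i, VanishTo q₀ k (g i)) ∧ ∀ᶠ q in 𝓝 q₀, f q = ∑ i, b.repr (q.2 - q₀.2) i • g i q := by
  have : FiniteDimensional ℝ Θ := Module.Finite.trans ℂ Θ
  obtain ⟨F, hF, e⟩ := exists_contDiff_eventuallyEq h.smooth
  have h' : SmoothKer S q₀ F := h.congr e.symm
  let u (x : Θ) (q : Fib m × Θ) : G := fderiv ℝ F q (0, x)
  have hu (x : Θ) : ContDiff ℝ ∞ (u x) :=
    (hF.fderiv_right (m := ∞) (by simp)).clm_apply contDiff_const
  have hker (x : Θ) : SmoothKer S q₀ (u x) :=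
    (h'.cderiv (0, x) 0).congr (.of_forall fun q => by simp [cderiv, u])
  have hvan (x : Θ) : VanishTo q₀ k (u x) :=
    ((hv.congr e.symm).dparam h'.smooth).clm (applyCLM ℝ G x)
  refine ⟨fun i => segMean q₀.2 (u (b i)), fun i => (hker _).segMean hS (hu _),
    fun i => (hvan _).segMean, ?_⟩
  have hlin : ∀ᶠ q in 𝓝 q₀, ∀ x, u x q = ∑ i, b.repr x i • u (b i) q := by
    filter_upwards [(h'.mono hA).eventually_forall] with q hq x
    have hI (x : Θ) : u (I • x) q = I • u x q := (cderiv_zero_iff x).1 (hq x)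
    have hadd (x y : Θ) : u (x + y) q = u x q + u y q := by
      have : ((0, x + y) : Fib m × Θ) = (0, x) + (0, y) := by simp
      simp only [u, this, map_add]
    have hreal (r : ℝ) (x : Θ) : u (r • x) q = r • u x q := by
      have : ((0, r • x) : Fib m × Θ) = r • (0, x) := by simp
      simp only [u, this, map_smul]
    let L : Θ →ₗ[ℂ] G :=
      { toFun := fun x => u x q
        map_add' := hadd
        map_smul' := fun c x => by
          conv_lhs => rw [← Complex.re_add_im c]
          rw [add_smul, mul_smul, ← real_smul_eq, ← real_smul_eq, hadd, hreal, hreal, hI,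
            real_smul_eq, real_smul_eq, ← mul_smul, ← add_smul, Complex.re_add_im]
          rfl }
    have := congrArg L (b.sum_repr x)
    rw [map_sum] at this
    simp only [map_smul] at this
    exact this.symm
  obtain ⟨C, hC⟩ := hv.congr e.symm
  filter_upwards [e, eventually_seg hlin, (tendsto_proj q₀).eventually hC] with q h₁ h₂ h₃
  have h₀ : F (q.1, q₀.2) = 0 := by simpa using h₃
  have hcont (x : Θ) : Continuous fun a : ℝ => u x (seg q₀.2 q a) :=
    (contDiff_comp_seg q₀.2 (hu x)).continuous.comp (Continuous.prodMk_right q)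
  have hftc : ∫ a in (0 : ℝ)..1, u (q.2 - q₀.2) (seg q₀.2 q a) = F (seg q₀.2 q 1) - F (seg q₀.2 q 0) := by
    refine intervalIntegral.integral_eq_sub_of_hasDerivAt (f := fun a => F (seg q₀.2 q a))
      (fun a _ => ?_) ((hcont _).intervalIntegrable _ _)
    exact ((hF.differentiable (by simp)) _).hasFDerivAt.comp_hasDerivAt a (hasDerivAt_seg q₀.2 q a)
  have e₁ : seg q₀.2 q 1 = q := by simp [seg]
  have e₀ : seg q₀.2 q 0 = (q.1, q₀.2) := by simp [seg]
  rw [e₁, e₀, h₀, sub_zero, intervalIntegral.integral_of_le zero_le_one, ← integral_Icc_eq_integral_Ioc,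
    h₁] at hftc
  rw [← hftc, setIntegral_congr_fun measurableSet_Icc fun a ha => h₂ a ha _,
    integral_finsetSum _ fun i _ => Continuous.integrableOn_Icc
      (f := fun a => b.repr (q.2 - q₀.2) i • u (b i) (seg q₀.2 q a)) ((hcont _).const_smul _)]
  exact Finset.sum_congr rfl fun i _ => integral_smul _ _

lemma exists_division_pow (hS : IsSplit S) (hA : antiDirs m Θ ⊆ S) (k : ℕ) :
    ∀ {f : Fib m × Θ → G}, SmoothKer S q₀ f → VanishTo q₀ k f →
    ∃ (ι : Type) (_ : Fintype ι) (c : ι → Fin k → Θ →ₗ[ℂ] ℂ) (g : ι → Fib m × Θ → G),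
      (∀ i, SmoothKer S q₀ (g i)) ∧
      ∀ᶠ q in 𝓝 q₀, f q = ∑ i, (∏ l, c i l (q.2 - q₀.2)) • g i q := by
  induction k with
  | zero => exact fun {f} h _ => ⟨Unit, inferInstance, fun _ => Fin.elim0, fun _ => f, fun _ => h,
      Eventually.of_forall fun q => by simp⟩
  | succ k ih =>
    intro f h hv
    let b := Module.finBasis ℂ Θ
    obtain ⟨g, h₁, h₂, h₃⟩ := exists_division hS hA b h hv
    choose ι _ c g' h₄ h₅ using fun i => ih (h₁ i) (h₂ i)
    refine ⟨Σ i, ι i, inferInstance, fun p => Fin.cons (b.coord p.1) (c p.1 p.2),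
      fun p => g' p.1 p.2, fun p => h₄ p.1 p.2, ?_⟩
    filter_upwards [h₃, eventually_all.2 h₅] with q e₁ e₂
    rw [e₁, Fintype.sum_sigma]
    refine Finset.sum_congr rfl fun i _ => ?_
    rw [e₂ i, Finset.smul_sum]
    refine Finset.sum_congr rfl fun j _ => ?_
    rw [Fin.prod_univ_succ, smul_smul]
    rfl

end division

/-! ## The Dolbeault complex of jets -/

section jetExact

open ContinuousAlternatingMap (alternatizeUncurryFinCLM)

variable [FiniteDimensional ℂ Θ] {Z W : Fib m × Θ → Fib m} {q₀ : Fib m × Θ}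
  [FiniteDimensional ℂ F]

lemma differentiableAt_complex {f : Fib m × Θ → G} {q : Fib m × Θ}
  (hd : DifferentiableAt ℝ f q) (h₁ : pbar f q = 0)
  (h₂ : ∀ b : Θ, cderiv (0, b) (0, I • b) f q = 0) : DifferentiableAt ℂ f q := by
  refine hasFDerivAt_complex hd fun v => ?_
  have e₁ : fderiv ℝ f q (I • v.1, 0) = I • fderiv ℝ f q (v.1, 0) := by
    have := congrArg (fun L => (2 : ℂ) • L (star v.1)) h₁
    simp only [pbar_apply, star_star, smul_smul, zero_apply, smul_zero] at this
    norm_num at this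
    have h₅ := congrArg (I • ·) this
    simp only [cderiv, smul_add, smul_smul, Complex.I_mul_I, smul_zero] at h₅
    rw [neg_smul, one_smul, add_neg_eq_zero] at h₅
    exact h₅.symm
  have e (v : Fib m × Θ) : v = (v.1, 0) + (0, v.2) := by simp
  rw [e (I • v), map_add, Prod.smul_fst, Prod.smul_snd, e₁, (cderiv_zero_iff v.2).1 (h₂ _),
    ← smul_add, ← map_add, ← e]

/-- The function with its parameters frozen. -/
def freeze {H : Type} (τ₀ : Θ) (f : Fib m × Θ → H) (q : Fib m × Θ) : H := f (q.1, τ₀)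

lemma dfst_freeze {f : Fib m × Θ → G} (hs : SmoothNear q₀ f) :
  ∀ᶠ q in 𝓝 q₀, dfst (freeze q₀.2 f) q = dfst f (q.1, q₀.2) :=
  dfst_taylorTerm 0 hs

namespace IsFrame

lemma frameMap_freeze (h : IsFrame (antiDirs m Θ) q₀ Z W) : ∀ᶠ q in 𝓝 q₀,
  frameMap (freeze q₀.2 Z) (freeze q₀.2 W) q = frameMap Z W (q.1, q₀.2) := by
  filter_upwards [dfst_freeze h.left.smooth, dfst_freeze h.right.smooth] with q h₁ h₂
  change (complexify (dfst _ q)).prod (complexify (dfst _ q)) = _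
  rw [h₁, h₂]
  rfl

lemma freeze (h : IsFrame (antiDirs m Θ) q₀ Z W) :
  IsFrame (antiDirs m Θ) q₀ (freeze q₀.2 Z) (freeze q₀.2 W) where
  left := h.left.taylorTerm 0
  right := h.right.taylorTerm 0
  chart := by
    have e := (dfst_freeze h.left.smooth).self_of_nhds
    change (dfst _ q₀).IsInvertible
    rw [e]
    exact h.chart
  frame := by
    rw [h.frameMap_freeze.self_of_nhds]
    exact h.frame

lemma pop_freeze (h : IsFrame (antiDirs m Θ) q₀ Z W) : ∀ᶠ q in 𝓝 q₀, ∀ a : Fib m × Θ → G,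
  pop (_root_.freeze q₀.2 Z) (_root_.freeze q₀.2 W) a q = (complexify (dfst a q)).comp
  ((frameMap Z W (q.1, q₀.2)).inverse.comp (inr ℂ _ _)) := by
  filter_upwards [h.frameMap_freeze] with q hq a
  rw [pop, hq]
  rfl

lemma pop_taylorTerm (h : IsFrame (antiDirs m Θ) q₀ Z W) (l : ℕ) {a : Fib m × Θ → G}
  (hs : SmoothNear q₀ a) : ∀ᶠ q in 𝓝 q₀,
  pop (_root_.freeze q₀.2 Z) (_root_.freeze q₀.2 W) (taylorTerm q₀.2 l a) q =
  taylorTerm q₀.2 l (pop (_root_.freeze q₀.2 Z) (_root_.freeze q₀.2 W) a) q := by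
  let M := fun q => (frameMap Z W q).inverse.comp
    (inr ℂ (Fib m) (Fib m))
  let Λ : (Fib m →L[ℂ] Fib m × Fib m) →L[ℂ]
      (Fib m →L[ℝ] G) →L[ℂ] (Fib m →L[ℂ] G) :=
    ((compL ℂ (Fib m →L[ℝ] G) (Fib m × Fib m →L[ℂ] G)
      (Fib m →L[ℂ] G)).flip complexify).comp
      (compL ℂ (Fib m) (Fib m × Fib m) G).flip
  let A (y : Fib m) : (Fib m →L[ℝ] G) →L[ℝ] (Fib m →L[ℂ] G) :=
    (Λ (M (y, q₀.2))).restrictScalars ℝ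
  have hM : ∀ᶠ y in 𝓝 q₀.1, ContDiffAt ℝ ∞ M (y, q₀.2) := by
    have hc : Continuous fun y : Fib m => (y, q₀.2) := by fun_prop
    exact (hc.tendsto q₀.1).eventually h.smoothKer_inverse.smooth
  have hA : ∀ᶠ y in 𝓝 q₀.1, ContDiffAt ℝ ∞ A y := by
    filter_upwards [hM] with y hy
    have h₁ : ContDiffAt ℝ ∞ (fun y => M (y, q₀.2)) y :=
      hy.comp y (contDiffAt_id.prodMk contDiffAt_const)
    have hΛ : ContDiff ℂ ∞ (fun M => Λ M) := ContinuousLinearMap.contDiff (𝕜 := ℂ)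
      (E := Fib m →L[ℂ] Fib m × Fib m)
      (F := (Fib m →L[ℝ] G) →L[ℂ] (Fib m →L[ℂ] G)) Λ
    have h₂ : ContDiffAt ℝ ∞ (fun y => Λ (M (y, q₀.2))) y :=
      (hΛ.restrict_scalars ℝ).contDiffAt.comp y h₁
    exact (ContinuousLinearMap.contDiff (𝕜 := ℝ) (E := (Fib m →L[ℝ] G) →L[ℂ] Fib m →L[ℂ] G)
      (F := (Fib m →L[ℝ] G) →L[ℝ] Fib m →L[ℂ] G)
      (ContinuousLinearMap.restrictScalarsL ℂ _ _ ℝ ℝ)).contDiffAt.comp y h₂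
  have e : pop (_root_.freeze q₀.2 Z) (_root_.freeze q₀.2 W) a =ᶠ[𝓝 q₀]
      fun q => A q.1 (dfst a q) := by
    filter_upwards [h.pop_freeze (G := G)] with q hq
    exact hq a
  filter_upwards [h.pop_freeze (G := G), taylorTerm_congr l e, dfst_taylorTerm l hs,
    taylorTerm_clm l hs.dfst hA] with q h₁ h₂ h₃ h₄
  rw [h₁, h₂, h₄, h₃]
  rfl

lemma dbar_taylorTerm (h : IsFrame (antiDirs m Θ) q₀ Z W) (l : ℕ)
  {a : Fib m × Θ → CForm m p F} (hs : SmoothNear q₀ a) : ∀ᶠ q in 𝓝 q₀,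
  dbar (_root_.freeze q₀.2 Z) (_root_.freeze q₀.2 W) (taylorTerm q₀.2 l a) q =
  taylorTerm q₀.2 l (dbar (_root_.freeze q₀.2 Z) (_root_.freeze q₀.2 W) a) q := by
  have hp := (h.freeze.mono (Set.empty_subset _)).smoothKer_pop ⟨hs, by simp⟩
  filter_upwards [h.pop_taylorTerm l hs, taylorTerm_const_clm l hp.smooth
    ((alternatizeUncurryFinCLM ℂ (Fib m) F (n := p)).restrictScalars ℝ)] with q h₁ h₂
  rw [dbar, h₁]
  exact h₂.symm

lemma vanishTo_pop_sub (h : IsFrame (antiDirs m Θ) q₀ Z W) {l : ℕ} {a : Fib m × Θ → G}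
  (hs : SmoothNear q₀ a) (hv : VanishTo q₀ l a) :
  VanishTo q₀ (l + 1) (pop Z W a - pop (_root_.freeze q₀.2 Z) (_root_.freeze q₀.2 W) a) := by
  let M := fun q => (frameMap Z W q).inverse.comp
    (inr ℂ (Fib m) (Fib m))
  have hM : SmoothNear q₀ M := h.smoothKer_inverse.smooth
  have h₁ : VanishTo q₀ 1 (M - taylorTerm q₀.2 0 M) :=
    VanishTo.sub_taylorTerm hM (.of_continuousAt hM.self_of_nhds.continuousAt)
  have h₂ : VanishTo q₀ l (pderiv a) :=
    (hv.dfst hs).clm ((complexify (m := m) (G := G)).restrictScalars ℝ)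
  refine (h₂.bilin ((ContinuousLinearMap.restrictScalarsL ℂ _ _ ℝ ℝ).comp
    ((compL ℂ (Fib m) (Fib m × Fib m) G).restrictScalars ℝ))
    h₁).congr ?_
  filter_upwards [h.pop_freeze (G := G)] with q hq
  change (pderiv a q).comp (M q - M (q.1, q₀.2)) = pop Z W a q - pop _ _ a q
  rw [hq]
  rw [ContinuousLinearMap.comp_sub]
  rfl

lemma vanishTo_dbar_sub (h : IsFrame (antiDirs m Θ) q₀ Z W) {l : ℕ}
  {a : Fib m × Θ → CForm m p F} (hs : SmoothNear q₀ a) (hv : VanishTo q₀ l a) :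
  VanishTo q₀ (l + 1) (dbar Z W a - dbar (_root_.freeze q₀.2 Z) (_root_.freeze q₀.2 W) a) := by
  refine ((h.vanishTo_pop_sub hs hv).clm ((alternatizeUncurryFinCLM ℂ (Fib m) F
    (n := p)).restrictScalars ℝ)).congr (.of_forall fun q => ?_)
  exact map_sub (alternatizeUncurryFinCLM ℂ (Fib m) F (n := p)) _ _

/-- One step of the construction of primitives modulo a power of the parameters. -/
lemma exists_primitive_step (h : IsFrame (antiDirs m Θ) q₀ Z W) {l : ℕ}
  {α : Fib m × Θ → CForm m (p + 1) F} (hα : SmoothKer (antiDirs m Θ) q₀ α)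
  (hv : VanishTo q₀ l α) (hd : VanishTo q₀ (l + 1) (dbar Z W α)) :
  ∃ γ : Fib m × Θ → CForm m p F, SmoothKer (antiDirs m Θ) q₀ γ ∧
  VanishTo q₀ (l + 1) (α - dbar Z W γ) := by
  have h₀ := h.freeze
  have hT := hα.taylorTerm l
  have hd₀ : VanishTo q₀ (l + 1) (dbar (_root_.freeze q₀.2 Z) (_root_.freeze q₀.2 W) α) := by
    have := hd.sub (h.vanishTo_dbar_sub hα.smooth hv)
    rwa [sub_sub_cancel] at this
  have hz := (vanishTo_iff_taylorTerm (h₀.smoothKer_dbar hα).smooth).1 hd₀ l (Nat.lt_succ_self l)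
  obtain ⟨γ, hγ, hγ'⟩ := h₀.exists_primitive hT (by
    filter_upwards [h.dbar_taylorTerm l hα.smooth, hz] with q h₁ h₂
    rw [h₁, h₂])
  refine ⟨taylorTerm q₀.2 l γ, hγ.taylorTerm l, ?_⟩
  have h₁ := VanishTo.sub_taylorTerm hα.smooth hv
  have h₂ := VanishTo.sub_taylorTerm hT.smooth (vanishTo_taylorTerm l hα.smooth)
  have h₃ := h.vanishTo_dbar_sub (hγ.taylorTerm l).smooth (vanishTo_taylorTerm l hγ.smooth)
  refine ((h₁.add h₂).sub h₃).congr ?_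
  filter_upwards [h.dbar_taylorTerm l hγ.smooth, taylorTerm_congr l hγ'] with q e₁ e₂
  simp only [Pi.sub_apply, Pi.add_apply]
  rw [e₁, e₂]
  abel

/-- Exactness modulo a power of the parameters. -/
theorem exists_jet_primitive (h : IsFrame (antiDirs m Θ) q₀ Z W) (k : ℕ)
    {α : Fib m × Θ → CForm m (p + 1) F} (hα : SmoothKer (antiDirs m Θ) q₀ α)
    (hd : VanishTo q₀ k (dbar Z W α)) :
    ∃ γ : Fib m × Θ → CForm m p F, SmoothKer (antiDirs m Θ) q₀ γ ∧
      VanishTo q₀ k (α - dbar Z W γ) := by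
  have : FiniteDimensional ℝ Θ := Module.Finite.trans ℂ Θ
  have : CompleteSpace Θ := FiniteDimensional.complete ℝ Θ
  induction k with
  | zero =>
    refine ⟨0, .const _, .of_continuousAt ?_⟩
    exact (hα.sub (h.smoothKer_dbar (.const _))).smooth.self_of_nhds.continuousAt
  | succ k ih =>
    obtain ⟨γ, hγ, hv⟩ := ih (hd.mono (Nat.le_succ k))
    have hγ' := h.smoothKer_dbar hγ
    obtain ⟨γ', h₁, h₂⟩ := h.exists_primitive_step (hα.sub hγ') hv (hd.congr (by
      filter_upwards [hα.differentiable, hγ'.differentiable, h.dbar_dbar hγ.smooth] with q h₁ h₂ h₃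
      rw [dbar_sub h₁ h₂, h₃, sub_zero]))
    refine ⟨γ + γ', hγ.add h₁, h₂.congr ?_⟩
    filter_upwards [hγ.differentiable, h₁.differentiable] with q h₁ h₂
    simp only [Pi.sub_apply]
    rw [dbar_add h₁ h₂, sub_sub]

end IsFrame

lemma SmoothKer.snd : SmoothKer (antiDirs m Θ) q₀ (Prod.snd : Fib m × Θ → Θ) where
  smooth := Eventually.of_forall fun _ => contDiffAt_snd
  ker := by
    rintro _ ⟨b, rfl⟩
    refine Eventually.of_forall fun q => ?_
    simp [_root_.cderiv, fderiv_snd, smul_smul]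

namespace IsFrame

lemma exists_analytic [CompleteSpace G] (h : IsFrame (antiDirs m Θ) q₀ Z W)
  {a : Fib m × Θ → G} (ha : SmoothKer (antiDirs m Θ) q₀ a) (hp : ∀ᶠ q in 𝓝 q₀, pop Z W a q = 0) :
  ∃ g : Fib m × Θ → G, AnalyticAt ℂ g (frameChart Z q₀) ∧
  ∀ᶠ q in 𝓝 q₀, a q = g (frameChart Z q) := by
  have : FiniteDimensional ℝ Θ := Module.Finite.trans ℂ Θ
  have : CompleteSpace Θ := FiniteDimensional.complete ℝ Θ
  obtain ⟨Ψ, hΨ⟩ := h.exists_inverse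
  have hs : ∀ᶠ p in 𝓝 (frameChart Z q₀), ContDiffAt ℝ ∞ (fun p => a (Ψ p)) p := by
    filter_upwards [hΨ.smooth, hΨ.tendsto.eventually ha.smooth] with p h₁ h₂
    exact h₂.comp p h₁
  refine ⟨fun p => a (Ψ p), analyticAt_of_smooth hs ?_, ?_⟩
  · filter_upwards [hs, h.cderiv_straighten hΨ ha.smooth hp,
      hΨ.tendsto.eventually ha.eventually_forall] with p h₁ ⟨h₂, h₃⟩ h₄
    exact differentiableAt_complex (h₁.differentiableAt (by simp)) h₂ fun v => (h₃ v).trans (h₄ v)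
  · filter_upwards [hΨ.left] with q hq
    rw [hq]

lemma comp_analytic (h : IsFrame (antiDirs m Θ) q₀ Z W) {g : Fib m × Θ → G}
  [CompleteSpace G] (hg : AnalyticAt ℂ g (frameChart Z q₀)) :
  SmoothKer (antiDirs m Θ) q₀ (fun q => g (frameChart Z q)) ∧
  ∀ᶠ q in 𝓝 q₀, pop Z W (fun q => g (frameChart Z q)) q = 0 := by
  have hg' := hg.eventually_analyticAt
  have hd : ∀ᶠ p in 𝓝 (frameChart Z q₀), DifferentiableAt ℂ g p := hg'.mono fun _ h => h.differentiableAt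
  refine ⟨(h.left.prodMk .snd).comp_holomorphic (φ := g)
    (hg'.mono fun _ h => h.contDiffAt.restrict_scalars ℝ) hd, ?_⟩
  have hc : Tendsto (frameChart Z) (𝓝 q₀) (𝓝 (frameChart Z q₀)) :=
    h.left.smooth.self_of_nhds.continuousAt.prodMk continuousAt_snd
  filter_upwards [hc.eventually hd, h.left.differentiable, h.eventually_frame] with q h₁ h₂ h₃
  refine pop_unique h₃ ((fderiv ℂ g (frameChart Z q)).comp (inl ℂ _ _)) 0
    fun v => ?_
  have e : HasFDerivAt (fun q => g (frameChart Z q)) _ q :=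
    HasFDerivAt.comp q (f := frameChart Z) (h₁.hasFDerivAt.restrictScalars ℝ)
      (h₂.hasFDerivAt.prodMk hasFDerivAt_snd)
  rw [e.fderiv]
  simp

/-- Functions killed by the Dolbeault operator modulo a power of the parameters. -/
lemma exists_jet_analytic [CompleteSpace G] (h : IsFrame (antiDirs m Θ) q₀ Z W) (k : ℕ)
    {a : Fib m × Θ → G} (ha : SmoothKer (antiDirs m Θ) q₀ a)
    (hp : VanishTo q₀ k (pop Z W a)) :
    ∃ g : Fib m × Θ → G, AnalyticAt ℂ g (frameChart Z q₀) ∧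
      VanishTo q₀ k fun q => a q - g (frameChart Z q) := by
  have : FiniteDimensional ℝ Θ := Module.Finite.trans ℂ Θ
  have : CompleteSpace Θ := FiniteDimensional.complete ℝ Θ
  induction k with
  | zero =>
    refine ⟨0, analyticAt_const, .of_continuousAt ?_⟩
    exact ha.smooth.self_of_nhds.continuousAt.sub continuousAt_const
  | succ l ih =>
    obtain ⟨g₁, hg₁, hv₁⟩ := ih (hp.mono (Nat.le_succ l))
    obtain ⟨hc₁, hp₁⟩ := h.comp_analytic hg₁
    set b := a - fun q => g₁ (frameChart Z q) with hb
    have hbs : SmoothKer (antiDirs m Θ) q₀ b := ha.sub hc₁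
    have hbp : VanishTo q₀ (l + 1) (pop Z W b) := hp.congr (by
      have e : b = a + (-1 : ℂ) • fun q => g₁ (frameChart Z q) := by
        funext q
        simp [hb, sub_eq_add_neg]
      filter_upwards [ha.differentiable, hc₁.differentiable, hp₁] with q h₁ h₂ h₃
      have h₄ := pop_clm_comp (Z := Z) (W := W) h₂ ((-1 : ℂ) • idCLM ℂ G)
      have h₅ : pop Z W ((-1 : ℂ) • fun q => g₁ (frameChart Z q)) q = 0 := by
        refine h₄.trans ?_
        rw [h₃, ContinuousLinearMap.comp_zero]
      rw [e, pop_add h₁ (h₂.const_smul (-1 : ℂ)), h₅, add_zero])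
    have h₀ := h.freeze
    have hT := hbs.taylorTerm l
    have hd₀ : VanishTo q₀ (l + 1) (pop (_root_.freeze q₀.2 Z) (_root_.freeze q₀.2 W) b) := by
      have := hbp.sub (h.vanishTo_pop_sub hbs.smooth hv₁)
      rwa [sub_sub_cancel] at this
    have hz := (vanishTo_iff_taylorTerm (h₀.smoothKer_pop hbs).smooth).1 hd₀ l (Nat.lt_succ_self l)
    obtain ⟨g, hg, hgT⟩ := h₀.exists_analytic hT (by
      filter_upwards [h.pop_taylorTerm l hbs.smooth, hz] with q h₁ h₂
      rw [h₁, h₂])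
    have hgc : AnalyticAt ℂ g (frameChart Z q₀) := hg
    refine ⟨g₁ + g, hg₁.add hgc, ?_⟩
    have hdiff : VanishTo q₀ (l + 1) fun q =>
        g (frameChart (_root_.freeze q₀.2 Z) q) - g (frameChart Z q) := by
      have hgs : SmoothNear (frameChart Z q₀) g :=
        hgc.eventually_analyticAt.mono fun _ h => h.contDiffAt.restrict_scalars ℝ
      have hgv : VanishTo (frameChart Z q₀) l g := by
        obtain ⟨Ψ, hΨ⟩ := h₀.exists_inverse
        obtain ⟨C, hC⟩ := vanishTo_taylorTerm l hbs.smooth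
        refine ⟨C, ?_⟩
        filter_upwards [hΨ.tendsto.eventually hC, hΨ.tendsto.eventually hgT, hΨ.right] with p h₁ h₂ h₃
        rw [h₂, h₃] at h₁
        have e : (frameChart (_root_.freeze q₀.2 Z) (Ψ p)).2 = p.2 := by rw [h₃]
        change (Ψ p).2 = p.2 at e
        rwa [e] at h₁
      obtain ⟨C, hC0, hC⟩ := (hgv.dfst hgs).exists_pos
      obtain ⟨r, hr, hball⟩ := Metric.eventually_nhds_iff_ball.1 (hC.and hgs.differentiable)
      obtain ⟨C', hC0', hC'⟩ := (VanishTo.sub_taylorTerm h.left.smooth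
        (k := 0) (.of_continuousAt h.left.smooth.self_of_nhds.continuousAt)).exists_pos
      have hc : Tendsto (frameChart Z) (𝓝 q₀) (𝓝 (frameChart Z q₀)) :=
        h.left.smooth.self_of_nhds.continuousAt.prodMk continuousAt_snd
      have hc' : Tendsto (frameChart (_root_.freeze q₀.2 Z)) (𝓝 q₀) (𝓝 (frameChart Z q₀)) :=
        h₀.left.smooth.self_of_nhds.continuousAt.prodMk continuousAt_snd
      refine ⟨C * C', ?_⟩
      filter_upwards [hC', hc.eventually (Metric.ball_mem_nhds _ hr),
        hc'.eventually (Metric.ball_mem_nhds _ hr)] with q h₁ h₂ h₃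
      have hmem (z) (hz : z ∈ ball (Z q₀) r) : (z, q.2) ∈ ball (frameChart Z q₀) r :=
        max_lt hz ((le_max_right _ _).trans_lt h₂)
      have hm (z) (hz : z ∈ ball (Z q₀) r) :
          HasFDerivAt (fun z => g (z, q.2)) (dfst g (z, q.2)) z :=
        HasFDerivAt.comp z (f := fun z => (z, q.2)) (hball _ (hmem z hz)).2.hasFDerivAt
          (hasFDerivAt_prodMk_left z q.2)
      have := (convex_ball (Z q₀) r).norm_image_sub_le_of_norm_hasFDerivWithin_le
        (f := fun z => g (z, q.2)) (C := C * ‖q.2 - q₀.2‖ ^ l)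
        (fun z hz => (hm z hz).hasFDerivWithinAt) (fun z hz => (hball _ (hmem z hz)).1)
        ((le_max_left _ _).trans_lt h₂ : Z q ∈ _)
        ((le_max_left _ _).trans_lt h₃ : _root_.freeze q₀.2 Z q ∈ _)
      refine this.trans ?_
      have h₄ : ‖_root_.freeze q₀.2 Z q - Z q‖ ≤ C' * ‖q.2 - q₀.2‖ ^ (0 + 1) := by
        rw [norm_sub_rev]
        exact h₁
      calc _ ≤ C * ‖q.2 - q₀.2‖ ^ l * (C' * ‖q.2 - q₀.2‖ ^ (0 + 1)) := by gcongr
        _ = _ := by ring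
    refine ((VanishTo.sub_taylorTerm hbs.smooth hv₁).add hdiff).congr ?_
    filter_upwards [hgT] with q hq
    have hbq : b q = a q - g₁ (frameChart Z q) := rfl
    simp only [Pi.add_apply, Pi.sub_apply, hq, hbq]
    abel

end IsFrame

end jetExact

/-! ## Complex manifolds as real manifolds -/

section realStructure

variable {E E' : Type} [NormedAddCommGroup E] [NormedSpace ℝ E] [NormedSpace ℂ E]
  [IsScalarTower ℝ ℂ E] [NormedAddCommGroup E'] [NormedSpace ℝ E'] [NormedSpace ℂ E']
  [IsScalarTower ℝ ℂ E'] {M M' : Type} [TopologicalSpace M] [ChartedSpace E M]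
  [TopologicalSpace M'] [ChartedSpace E' M']

lemma isManifold_real (M : Type) [TopologicalSpace M] [ChartedSpace E M]
  [IsManifold 𝓘(ℂ, E) ω M] : IsManifold 𝓘(ℝ, E) ω M := by
  refine isManifold_of_contDiffOn _ _ _ fun e e' he he' => ?_
  have h := (mem_groupoid_of_pregroupoid.1 (HasGroupoid.compatible (G := contDiffGroupoid ω 𝓘(ℂ, E)) he he')).1
  exact (show ContDiffOn ℂ ω _ _ from h).restrict_scalars ℝ

lemma ContMDiffAt.real {n : ℕ∞ω} {f : M → M'} {x : M} (h : ContMDiffAt 𝓘(ℂ, E) 𝓘(ℂ, E') n f x) :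
  ContMDiffAt 𝓘(ℝ, E) 𝓘(ℝ, E') n f x := by
  rw [contMDiffAt_iff] at h ⊢
  exact ⟨h.1, h.2.restrict_scalars ℝ⟩

end realStructure

lemma mdifferentiable_of_mem_maximalAtlas {E : Type} [NormedAddCommGroup E] [NormedSpace ℂ E]
  {M : Type} [TopologicalSpace M] [ChartedSpace E M] [IsManifold 𝓘(ℂ, E) ω M]
  {ψ : OpenPartialHomeomorph M E} (hψ : ψ ∈ maximalAtlas 𝓘(ℂ, E) ω M) :
  ψ.MDifferentiable 𝓘(ℂ, E) 𝓘(ℂ, E) :=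
  ⟨(contMDiffOn_of_mem_maximalAtlas hψ).mdifferentiableOn (by simp),
    (contMDiffOn_symm_of_mem_maximalAtlas hψ).mdifferentiableOn (by simp)⟩

/-! ## Charts adapted to the fibration -/

section deformation

variable {X 𝒳 B : Type} [TopologicalSpace X] [ChartedSpace (Fib m) X]
  [IsManifold 𝓘(ℂ, Fib m) ω X] [TopologicalSpace 𝒳] [ChartedSpace (Tot m N) 𝒳]
  [IsManifold 𝓘(ℂ, Tot m N) ω 𝒳] [TopologicalSpace B] [ChartedSpace (Bas N) B]
  [IsManifold 𝓘(ℂ, Bas N) ω B] {D : Deformation m N X 𝒳 B} {x x₀ x₁ : 𝒳} {k : ℕ}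
  {ψ ψ' : OpenPartialHomeomorph 𝒳 (Tot m N)} {E : 𝒳 → Type}
  [TopologicalSpace (Bundle.TotalSpace F E)] [∀ x, TopologicalSpace (E x)]
  [∀ x, AddCommGroup (E x)] [∀ x, Module ℂ (E x)] [FiberBundle F E] [VectorBundle ℂ F E]

local notation "Dbl" => Bas N × Bas N
local notation "Crd" => Fib m × (Bas N × Bas N)
local notation "Dirs" => antiDirs m (Bas N × Bas N)
local notation "VChart" => OpenPartialHomeomorph 𝒳 (Tot m N)
local notation "𝓘T" => 𝓘(ℂ, Tot m N)
local notation "𝓘F" => 𝓘(ℂ, Fib m)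
local notation "𝓘B" => 𝓘(ℂ, Bas N)

namespace Deformation

variable (D)

/-- A holomorphic chart whose last coordinates come from a chart of the base. -/
structure IsVertChart (ψ : VChart) : Prop where
  mem_atlas : ψ ∈ maximalAtlas 𝓘T ω 𝒳
  base : ∃ φ ∈ maximalAtlas 𝓘B ω B,
    ∀ x ∈ ψ.source, D.π x ∈ φ.source ∧ (ψ x).2 = φ (D.π x)

variable {D}

lemma IsRelChart.isVertChart {x₀ : 𝒳} {ψ : VChart} (h : D.IsRelChart x₀ ψ) : D.IsVertChart ψ :=
  ⟨h.mem_atlas, _, chart_mem_maximalAtlas (D.π x₀), fun x hx =>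
    ⟨h.base_mem x hx, h.snd_eq x hx⟩⟩

variable (D)

lemma exists_complement (L : Tot m N →L[ℂ] Bas N) (hL : Function.Surjective L) :
  ∃ A : Tot m N →L[ℂ] Fib m, (A.prod L).IsInvertible := by
  have hr : LinearMap.range L.toLinearMap = ⊤ := LinearMap.range_eq_top.2 hL
  have hk : Module.finrank ℂ (LinearMap.ker L.toLinearMap) = m := by
    have h := L.toLinearMap.finrank_range_add_finrank_ker
    rw [hr, finrank_top] at h
    simp only [Module.finrank_prod, Module.finrank_fin_fun] at h
    omega
  let e : LinearMap.ker L.toLinearMap ≃ₗ[ℂ] Fib m :=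
    LinearEquiv.ofFinrankEq _ _ (by simpa using hk)
  obtain ⟨P, hP⟩ := Submodule.exists_isCompl (LinearMap.ker L.toLinearMap)
  obtain ⟨pr, hpr⟩ := (LinearMap.ker L.toLinearMap).subtype.exists_leftInverse_of_injective
    (Submodule.ker_subtype _)
  let A : Tot m N →L[ℂ] Fib m := LinearMap.toContinuousLinearMap (e.toLinearMap.comp pr)
  have hinj : Function.Injective (A.prod L) := by
    rw [injective_iff_map_eq_zero]
    intro v hv
    have h₁ : e (pr v) = 0 := congrArg Prod.fst hv
    have h₂ : L v = 0 := congrArg Prod.snd hv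
    have h₃ : pr v = ⟨v, h₂⟩ := congrArg (fun f => f ⟨v, h₂⟩) hpr
    rw [h₃, map_eq_zero_iff e e.injective] at h₁
    exact congrArg Subtype.val h₁
  exact ⟨A, (LinearEquiv.ofBijective (A.prod L).toLinearMap ⟨hinj,
    (LinearMap.injective_iff_surjective (f := (A.prod L).toLinearMap)).1 hinj⟩).toContinuousLinearEquiv,
    by ext <;> rfl⟩

lemma exists_isRelChart (x₀ : 𝒳) : ∃ ψ, D.IsRelChart x₀ ψ := by
  let χ := chartAt (Tot m N) x₀
  let φ := chartAt (Bas N) (D.π x₀)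
  have hχ : χ ∈ maximalAtlas 𝓘T ω 𝒳 :=
    chart_mem_maximalAtlas x₀
  have hφ : φ ∈ maximalAtlas 𝓘B ω B := chart_mem_maximalAtlas _
  let V : Set 𝒳 := χ.source ∩ D.π ⁻¹' φ.source
  have hV : IsOpen V := χ.open_source.inter (φ.open_source.preimage D.holomorphic_π.continuous)
  have hx₀V : x₀ ∈ V := ⟨mem_chart_source _ _, mem_chart_source _ _⟩
  let t : Tot m N → Bas N := fun ξ => φ (D.π (χ.symm ξ))
  have ht (x) (hx : x ∈ V) : ContDiffAt ℂ ω t (χ x) := by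
    rw [← contMDiffAt_iff_contDiffAt]
    refine ContMDiffAt.comp (I' := 𝓘B) (χ x) (g := φ) (f := fun ξ => D.π (χ.symm ξ)) ?_ ?_
    · simp only [χ.left_inv hx.1]
      exact contMDiffAt_of_mem_maximalAtlas hφ hx.2
    · refine ContMDiffAt.comp (I' := 𝓘T) (χ x) (D.holomorphic_π _) ?_
      exact contMDiffAt_symm_of_mem_maximalAtlas hχ (χ.map_source hx.1)
  have hL : Function.Surjective (fderiv ℂ t (χ x₀)) := by
    intro v
    have hφd := mdifferentiable_of_mem_maximalAtlas hφ
    have hχd := mdifferentiable_of_mem_maximalAtlas hχ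
    obtain ⟨u, hu⟩ := hφd.mfderiv_surjective hx₀V.2 v
    obtain ⟨w, rfl⟩ := D.submersion_π x₀ u
    refine ⟨mfderiv 𝓘T 𝓘T χ x₀ w, ?_⟩
    have h₁ := mfderiv_comp (I'' := 𝓘B) x₀ (hφd.mdifferentiableAt hx₀V.2)
      ((D.holomorphic_π x₀).mdifferentiableAt (by simp))
    have h₂ := mfderiv_comp (I'' := 𝓘B) x₀ (g := t)
      ((ht x₀ hx₀V).differentiableAt (by simp)).mdifferentiableAt (hχd.mdifferentiableAt hx₀V.1)
    have e : (φ ∘ D.π) =ᶠ[𝓝 x₀] t ∘ χ := by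
      filter_upwards [hV.mem_nhds hx₀V] with x hx
      simp only [t, Function.comp_apply, χ.left_inv hx.1]
    rw [e.mfderiv_eq, h₂, mfderiv_eq_fderiv] at h₁
    exact (congrArg (· w) h₁).trans hu
  obtain ⟨A, hA⟩ := exists_complement _ hL
  let f : Tot m N → Tot m N := fun ξ => (A ξ, t ξ)
  have hf (x) (hx : x ∈ V) : ContDiffAt ℂ ω f (χ x) := A.contDiff.contDiffAt.prodMk (ht x hx)
  have hf' (x) (hx : x ∈ V) : fderiv ℂ f (χ x) = A.prod (fderiv ℂ t (χ x)) :=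
    (A.hasFDerivAt.prodMk ((ht x hx).differentiableAt (by simp)).hasFDerivAt).fderiv
  have hinv : (fderiv ℂ f (χ x₀)).IsInvertible := by
    rw [hf' x₀ hx₀V]
    exact hA
  obtain ⟨e₀, he₀⟩ := id hinv
  let g := (hf x₀ hx₀V).toOpenPartialHomeomorph f
    (he₀ ▸ ((hf x₀ hx₀V).differentiableAt (by simp)).hasFDerivAt) (by simp)
  have hg : (g : Tot m N → Tot m N) = f := rfl
  have hg₀ : χ x₀ ∈ g.source := ContDiffAt.mem_toOpenPartialHomeomorph_source _ _ _
  have hev : ∀ᶠ ξ in 𝓝 (χ x₀), (fderiv ℂ f ξ).IsInvertible :=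
    eventually_isInvertible ((hf x₀ hx₀V).fderiv_right (m := ω) (by simp)).continuousAt hinv
  obtain ⟨O, hO, hOo, hxO⟩ := eventually_nhds_iff.1 hev
  let ψ := (χ.trans g).restrOpen (V ∩ (χ.source ∩ χ ⁻¹' O))
    (hV.inter (χ.isOpen_inter_preimage hOo))
  have hψs (x) (hx : x ∈ ψ.source) : x ∈ V ∧ χ x ∈ g.source ∧ χ x ∈ O := by
    simp only [ψ, OpenPartialHomeomorph.restrOpen_source, OpenPartialHomeomorph.trans_source] at hx
    exact ⟨hx.2.1, hx.1.2, hx.2.2.2⟩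
  have hψ (x : 𝒳) : ψ x = f (χ x) := rfl
  have hψ' (p) : ψ.symm p = χ.symm (g.symm p) := rfl
  refine ⟨ψ, ψ.mem_maximalAtlas_of_contMDiffOn (fun x hx => ?_) (fun p hp => ?_), ?_, ?_, ?_⟩
  · obtain ⟨h₁, h₂, h₃⟩ := hψs x hx
    exact (ContMDiffAt.comp (I' := 𝓘T) x (g := f) (hf x h₁).contMDiffAt
      (contMDiffAt_of_mem_maximalAtlas hχ h₁.1)).contMDiffWithinAt
  · obtain ⟨h₁, h₂, h₃⟩ := hψs _ (ψ.map_target hp)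
    have e : χ (ψ.symm p) = g.symm p := by
      have hp' : p ∈ (χ.trans g).target := by
        have := hp
        simp only [ψ, OpenPartialHomeomorph.restrOpen] at this
        exact this.1
      rw [hψ', χ.right_inv]
      have := (χ.trans g).map_target hp'
      simp only [OpenPartialHomeomorph.trans_target] at hp'
      exact hp'.2
    have hpt : p ∈ g.target := by
      have := g.map_source h₂
      rwa [hg, ← hψ, ψ.right_inv hp] at this
    obtain ⟨e₁, he₁⟩ := hO _ h₃
    have hgs : ContDiffAt ℂ ω g.symm p := by
      refine g.contDiffAt_symm hpt (f₀' := e₁) ?_ ?_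
      · rw [hg, ← e, he₁]
        exact ((hf _ h₁).differentiableAt (by simp)).hasFDerivAt
      · rw [hg, ← e]
        exact hf _ h₁
    refine (ContMDiffAt.comp (I' := 𝓘T) p (g := χ.symm) ?_
      hgs.contMDiffAt).contMDiffWithinAt
    rw [← e]
    exact contMDiffAt_symm_of_mem_maximalAtlas hχ (χ.map_source h₁.1)
  · simp only [ψ, OpenPartialHomeomorph.restrOpen_source, OpenPartialHomeomorph.trans_source]
    exact ⟨⟨hx₀V.1, hg₀⟩, hx₀V, hx₀V.1, hxO⟩
  · exact fun x hx => (hψs x hx).1.2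
  · intro x hx
    rw [hψ]
    change φ (D.π (χ.symm (χ x))) = φ (D.π x)
    rw [χ.left_inv (hψs x hx).1.1]

end Deformation

/-! ## The frame of a vertical chart -/

section conjugation

/-- Complex conjugation, with respect to the real locus. -/
def conjParam (m N : ℕ) : Fib m × (Bas N × Bas N) →L[ℝ] Fib m × (Bas N × Bas N) :=
  (ContinuousLinearMap.fst ℝ _ _).prod
    (((conjCLM N).comp ((ContinuousLinearMap.snd ℝ _ _).comp (ContinuousLinearMap.snd ℝ _ _))).prod
      ((conjCLM N).comp ((ContinuousLinearMap.fst ℝ _ _).comp (ContinuousLinearMap.snd ℝ _ _))))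

lemma conjParam_apply (q : Crd) : conjParam m N q = (q.1, (star q.2.2, star q.2.1)) := rfl

lemma SmoothKer.conj {q₀ : Crd} (hq₀ : conjParam m N q₀ = q₀) {f : Crd → G}
  (hf : SmoothKer Dirs q₀ f) (J : G →L[ℝ] G') (hJ : ∀ x, J (I • x) = -(I • J x)) :
  SmoothKer Dirs q₀ fun q => J (f (conjParam m N q)) := by
  have hc : Tendsto (conjParam m N) (𝓝 q₀) (𝓝 q₀) :=
    (conjParam m N).continuous.tendsto' _ _ hq₀
  refine ⟨?_, ?_⟩
  · filter_upwards [hc.eventually hf.smooth] with q hq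
    exact J.contDiff.contDiffAt.comp q (hq.comp q (conjParam m N).contDiff.contDiffAt)
  · rintro _ ⟨b, rfl⟩
    filter_upwards [hc.eventually hf.differentiable, hc.eventually hf.eventually_forall] with q h₁ h₂
    rw [cderiv_zero_iff]
    have e : HasFDerivAt (fun q => J (f (conjParam m N q))) _ q :=
      J.hasFDerivAt.comp q (HasFDerivAt.comp q (f := conjParam m N) h₁.hasFDerivAt
        (conjParam m N).hasFDerivAt)
    rw [e.fderiv]
    simp only [clm_comp_apply]
    have e₁ : conjParam m N (0, I • b) = -(0, I • (star b.2, star b.1)) := by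
      simp [conjParam_apply, star_smul]
    have e₂ : conjParam m N (0, b) = (0, (star b.2, star b.1)) := rfl
    rw [e₁, e₂, map_neg, (cderiv_zero_iff _).1 (h₂ _), map_neg, hJ, neg_neg]

end conjugation

namespace Deformation

variable (D)

/-- The coordinates given by the smooth trivialization. -/
def realCoord (x₀ x : 𝒳) : Fib m × Bas N :=
  (chartAt (Fib m) (D.T x₀).1 (D.T x).1, D.baseCoord x₀ x)

/-- The point with given coordinates. -/
def realPoint (x₀ : 𝒳) (p : Fib m × Bas N) : 𝒳 :=
  D.T.symm ((chartAt (Fib m) (D.T x₀).1).symm p.1, (chartAt (Bas N) (D.π x₀)).symm p.2)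

/-- The domain of the coordinates. -/
def realDom (x₀ : 𝒳) : Set 𝒳 :=
  {x | (D.T x).1 ∈ (chartAt (Fib m) (D.T x₀).1).source ∧
    D.π x ∈ (chartAt (Bas N) (D.π x₀)).source}

/-- The range of the coordinates. -/
def realTarget (x₀ : 𝒳) : Set (Fib m × Bas N) :=
  (chartAt (Fib m) (D.T x₀).1).target ×ˢ (chartAt (Bas N) (D.π x₀)).target

lemma isOpen_realDom (x₀ : 𝒳) : IsOpen (D.realDom x₀) :=
  ((chartAt (Fib m) (D.T x₀).1).open_source.preimage
    (continuous_fst.comp D.T.continuous)).inter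
  ((chartAt (Bas N) (D.π x₀)).open_source.preimage D.holomorphic_π.continuous)

lemma isOpen_realTarget (x₀ : 𝒳) : IsOpen (D.realTarget x₀) :=
  (OpenPartialHomeomorph.open_target _).prod (OpenPartialHomeomorph.open_target _)

lemma mem_realDom (x₀ : 𝒳) : x₀ ∈ D.realDom x₀ := ⟨mem_chart_source _ _, mem_chart_source _ _⟩

lemma realDom_mem_nhds (x₀ : 𝒳) : D.realDom x₀ ∈ 𝓝 x₀ :=
  (D.isOpen_realDom x₀).mem_nhds (D.mem_realDom x₀)

variable {D}

lemma realCoord_mem {x : 𝒳} (hx : x ∈ D.realDom x₀) : D.realCoord x₀ x ∈ D.realTarget x₀ :=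
  ⟨OpenPartialHomeomorph.map_source _ hx.1, OpenPartialHomeomorph.map_source _ hx.2⟩

lemma realTarget_mem_nhds : D.realTarget x₀ ∈ 𝓝 (D.realCoord x₀ x₀) :=
  (D.isOpen_realTarget x₀).mem_nhds (realCoord_mem (D.mem_realDom x₀))

lemma realPoint_realCoord {x : 𝒳} (hx : x ∈ D.realDom x₀) :
  D.realPoint x₀ (D.realCoord x₀ x) = x := by
  rw [realPoint, realCoord, baseCoord, OpenPartialHomeomorph.left_inv _ hx.1,
    OpenPartialHomeomorph.left_inv _ hx.2, ← D.T_snd]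
  exact D.T.symm_apply_apply x

lemma T_realPoint (p : Fib m × Bas N) : D.T (D.realPoint x₀ p) =
  ((chartAt (Fib m) (D.T x₀).1).symm p.1, (chartAt (Bas N) (D.π x₀)).symm p.2) :=
  D.T.apply_symm_apply _

lemma π_realPoint (p : Fib m × Bas N) :
  D.π (D.realPoint x₀ p) = (chartAt (Bas N) (D.π x₀)).symm p.2 := by
  rw [← D.T_snd, T_realPoint]

lemma realCoord_realPoint {p : Fib m × Bas N} (hp : p ∈ D.realTarget x₀) :
  D.realCoord x₀ (D.realPoint x₀ p) = p := by
  rw [realCoord, baseCoord, π_realPoint, T_realPoint, OpenPartialHomeomorph.right_inv _ hp.1,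
    OpenPartialHomeomorph.right_inv _ hp.2]

lemma contMDiffAt_realPoint {p : Fib m × Bas N} (hp : p ∈ D.realTarget x₀) :
  ContMDiffAt 𝓘(ℝ, Fib m × Bas N) 𝓘(ℝ, Tot m N) ∞ (D.realPoint x₀) p := by
  have := isManifold_real (E := Fib m) X
  have := isManifold_real (E := Bas N) B
  have h₁ : ContMDiffAt 𝓘(ℝ, Fib m × Bas N) 𝓘(ℝ, Fib m) ω
      (fun p : Fib m × Bas N => (chartAt (Fib m) (D.T x₀).1).symm p.1) p :=
    ContMDiffAt.comp p (I' := 𝓘(ℝ, Fib m)) (contMDiffAt_symm_of_mem_maximalAtlas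
      (chart_mem_maximalAtlas _) hp.1) contDiffAt_fst.contMDiffAt
  have h₂ : ContMDiffAt 𝓘(ℝ, Fib m × Bas N) 𝓘(ℝ, Bas N) ω
      (fun p : Fib m × Bas N => (chartAt (Bas N) (D.π x₀)).symm p.2) p :=
    ContMDiffAt.comp p (I' := 𝓘(ℝ, Bas N)) (contMDiffAt_symm_of_mem_maximalAtlas
      (chart_mem_maximalAtlas _) hp.2) contDiffAt_snd.contMDiffAt
  exact ContMDiffAt.comp p (D.T.symm.contMDiff _) ((h₁.prodMk h₂).of_le (by simp))

lemma contMDiffAt_realCoord {x : 𝒳} (hx : x ∈ D.realDom x₀) :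
  ContMDiffAt 𝓘(ℝ, Tot m N) 𝓘(ℝ, Fib m × Bas N) ∞ (D.realCoord x₀) x := by
  have := isManifold_real (E := Fib m) X
  have := isManifold_real (E := Bas N) B
  have h₁ : ContMDiffAt 𝓘(ℝ, Tot m N) 𝓘(ℝ, Fib m) ∞
      (fun x => chartAt (Fib m) (D.T x₀).1 (D.T x).1) x :=
    ContMDiffAt.comp x (I' := 𝓘(ℝ, Fib m)) ((contMDiffAt_of_mem_maximalAtlas
      (n := ω) (chart_mem_maximalAtlas _) hx.1).of_le (by simp))
      (contMDiffAt_fst.comp x (D.T.contMDiff x))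
  have h₂ : ContMDiffAt 𝓘(ℝ, Tot m N) 𝓘(ℝ, Bas N) ∞ (D.baseCoord x₀) x :=
    ContMDiffAt.comp x (I' := 𝓘(ℝ, Bas N)) ((contMDiffAt_of_mem_maximalAtlas
      (n := ω) (chart_mem_maximalAtlas _) hx.2).of_le (by simp))
      ((D.holomorphic_π x).real.of_le (by simp))
  exact h₁.prodMk_space h₂

lemma tendsto_realPoint' : Tendsto (D.realPoint x₀) (𝓝 (D.realCoord x₀ x₀)) (𝓝 x₀) := by
  have := (contMDiffAt_realPoint (D := D) (realCoord_mem (D.mem_realDom x₀))).continuousAt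
  rwa [ContinuousAt, realPoint_realCoord (D.mem_realDom x₀)] at this

lemma tendsto_realCoord : Tendsto (D.realCoord x₀) (𝓝 x₀) (𝓝 (D.realCoord x₀ x₀)) :=
  (contMDiffAt_realCoord (D.mem_realDom x₀)).continuousAt

lemma smoothCoord_eq (x : 𝒳) : D.smoothCoord x₀ x =
  ((D.realCoord x₀ x).1, ((D.realCoord x₀ x).2, star (D.realCoord x₀ x).2)) := rfl

lemma tendsto_smoothCoord : Tendsto (D.smoothCoord x₀) (𝓝 x₀) (𝓝 (D.smoothCoord x₀ x₀)) :=
  (tendsto_realPoint _ _).comp tendsto_realCoord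

lemma eventually_realCoord_iff {A : Fib m × Bas N → Prop} :
  (∀ᶠ x in 𝓝 x₀, A (D.realCoord x₀ x)) ↔ ∀ᶠ p in 𝓝 (D.realCoord x₀ x₀), A p := by
  refine ⟨fun h => ?_, fun h => tendsto_realCoord.eventually h⟩
  filter_upwards [tendsto_realPoint'.eventually h, realTarget_mem_nhds] with p h₁ h₂
  rwa [realCoord_realPoint h₂] at h₁

variable (D)

/-- The fibre coordinates of `ψ`, as functions of the coordinates given by the smooth
trivialization. -/
def vertZ (x₀ : 𝒳) (ψ : VChart) (q : Crd) : Fib m :=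
  (ψ (D.realPoint x₀ (q.1, q.2.1))).1

/-- The complex conjugates of the fibre coordinates. -/
def vertW (x₀ : 𝒳) (ψ : VChart) (q : Crd) : Fib m :=
  conjCLM m (D.vertZ x₀ ψ (conjParam m N q))

variable {D}

lemma vertZ_smoothCoord {x : 𝒳} (hx : x ∈ D.realDom x₀) :
  D.vertZ x₀ ψ (D.smoothCoord x₀ x) = (ψ x).1 := by
  rw [vertZ, smoothCoord_eq]
  exact congrArg (fun x => (ψ x).1) (realPoint_realCoord hx)

lemma conjParam_smoothCoord (x : 𝒳) : conjParam m N (D.smoothCoord x₀ x) = D.smoothCoord x₀ x := by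
  rw [conjParam_apply, smoothCoord_eq, star_star]

lemma vertW_smoothCoord {x : 𝒳} (hx : x ∈ D.realDom x₀) :
  D.vertW x₀ ψ (D.smoothCoord x₀ x) = star (ψ x).1 := by
  rw [vertW, conjParam_smoothCoord, vertZ_smoothCoord hx, conjCLM_apply]

lemma IsVertChart.contMDiffAt_symm_real (hψ : D.IsVertChart ψ) {p : Tot m N} (hp : p ∈ ψ.target) :
  ContMDiffAt 𝓘(ℝ, Tot m N) 𝓘(ℝ, Tot m N) ∞ ψ.symm p :=
  ((contMDiffAt_symm_of_mem_maximalAtlas hψ.mem_atlas hp).real).of_le (by simp)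

lemma IsVertChart.snd_eq_iff (hψ : D.IsVertChart ψ) {x x' : 𝒳} (hx : x ∈ ψ.source)
  (hx' : x' ∈ ψ.source) : (ψ x).2 = (ψ x').2 ↔ D.π x = D.π x' := by
  obtain ⟨φ, -, h⟩ := hψ.base
  rw [(h x hx).2, (h x' hx').2]
  exact φ.injOn.eq_iff (h x hx).1 (h x' hx').1

lemma tendsto_realProj : Tendsto (fun q : Crd =>
  (q.1, q.2.1)) (𝓝 (D.smoothCoord x₀ x₀)) (𝓝 (D.realCoord x₀ x₀)) := by
  have : Continuous fun q : Crd => (q.1, q.2.1) := by fun_prop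
  exact this.tendsto' _ _ rfl

lemma eventually_realPoint {A : 𝒳 → Prop} (h : ∀ᶠ x in 𝓝 x₀, A x) : ∀ᶠ q in 𝓝 (D.smoothCoord x₀ x₀),
  (q.1, q.2.1) ∈ D.realTarget x₀ ∧ A (D.realPoint x₀ (q.1, q.2.1)) :=
  tendsto_realProj.eventually (Filter.Eventually.and realTarget_mem_nhds
    (tendsto_realPoint'.eventually h))

/-- Holomorphic functions on the total space are smooth, and real analytic along the base. -/
lemma smoothKer_holomorphic {f : 𝒳 → G} (hf : ∀ᶠ x in 𝓝 x₀, ContMDiffAt 𝓘T 𝓘(ℂ, G) ω f x) :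
  SmoothKer Dirs (D.smoothCoord x₀ x₀) fun q => f (D.realPoint x₀ (q.1, q.2.1)) := by
  refine .of_differentiableAt_slice ?_ ?_
  · filter_upwards [eventually_realPoint (D := D) hf] with q ⟨h₁, h₂⟩
    have e : ContDiffAt ℝ ∞ (fun p => f (D.realPoint x₀ p)) (q.1, q.2.1) :=
      (ContMDiffAt.comp _ (h₂.real.of_le (by simp)) (contMDiffAt_realPoint h₁)).contDiffAt
    exact e.comp q (f := fun q : Crd =>
      (q.1, q.2.1)) (contDiffAt_fst.prodMk contDiffAt_snd.fst)
  · filter_upwards [eventually_realPoint (D := D) hf] with q ⟨h₁, h₂⟩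
    have e₁ : ContMDiffAt 𝓘B 𝓘B ω
        (chartAt (Bas N) (D.π x₀)).symm q.2.1 :=
      contMDiffAt_symm_of_mem_maximalAtlas (chart_mem_maximalAtlas _) h₁.2
    have e₂ := ContMDiffAt.comp q.2.1 (D.T_leaf ((chartAt (Fib m) (D.T x₀).1).symm q.1) _) e₁
    have e₃ : ContDiffAt ℂ ω (fun t => f (D.realPoint x₀ (q.1, t))) q.2.1 :=
      (ContMDiffAt.comp q.2.1 h₂ e₂).contDiffAt
    exact (e₃.differentiableAt (by simp)).comp q.2 differentiableAt_fst

lemma IsVertChart.eventually_contMDiffAt (hψ : D.IsVertChart ψ) (hx₀ : x₀ ∈ ψ.source) :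
  ∀ᶠ x in 𝓝 x₀, ContMDiffAt 𝓘T 𝓘T ω ψ x := by
  filter_upwards [ψ.open_source.mem_nhds hx₀] with x hx
  exact contMDiffAt_of_mem_maximalAtlas hψ.mem_atlas hx

lemma IsVertChart.smoothKer_vertZ (hψ : D.IsVertChart ψ) (hx₀ : x₀ ∈ ψ.source) :
  SmoothKer Dirs (D.smoothCoord x₀ x₀) (D.vertZ x₀ ψ) :=
  (smoothKer_holomorphic (hψ.eventually_contMDiffAt hx₀)).clm_comp
    (ContinuousLinearMap.fst ℂ (Fib m) (Bas N))

lemma IsVertChart.smoothKer_vertW (hψ : D.IsVertChart ψ) (hx₀ : x₀ ∈ ψ.source) :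
  SmoothKer Dirs (D.smoothCoord x₀ x₀) (D.vertW x₀ ψ) :=
  (hψ.smoothKer_vertZ hx₀).conj (conjParam_smoothCoord x₀) (conjCLM m) fun x => by
    simp [star_smul]

lemma fderiv_vertW {x : 𝒳} (h : DifferentiableAt ℝ (D.vertZ x₀ ψ) (D.smoothCoord x₀ x)) :
  dfst (D.vertW x₀ ψ) (D.smoothCoord x₀ x) =
  (conjCLM m).comp (dfst (D.vertZ x₀ ψ) (D.smoothCoord x₀ x)) := by
  have h' : DifferentiableAt ℝ (D.vertZ x₀ ψ) (conjParam m N (D.smoothCoord x₀ x)) := by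
    rwa [conjParam_smoothCoord]
  have e : HasFDerivAt (D.vertW x₀ ψ) _ (D.smoothCoord x₀ x) :=
    (conjCLM m).hasFDerivAt.comp _ (HasFDerivAt.comp (D.smoothCoord x₀ x) (f := conjParam m N)
      h'.hasFDerivAt (conjParam m N).hasFDerivAt)
  rw [dfst, e.fderiv, conjParam_smoothCoord]
  refine clm_ext fun v => ?_
  simp [dfst, conjParam_apply]
  rfl

lemma isInvertible_complexify {A : Fib m →L[ℝ] Fib m} (hA : A.IsInvertible) :
  ((complexify A).prod (complexify ((conjCLM m).comp A))).IsInvertible := by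
  obtain ⟨A, rfl⟩ := hA
  have key (A : Fib m ≃L[ℝ] Fib m) :
      ((complexify (A.symm : Fib m →L[ℝ] Fib m)).prod (complexify
        ((conjCLM m).comp (A.symm : Fib m →L[ℝ] Fib m)))).comp
      ((complexify (A : Fib m →L[ℝ] Fib m)).prod (complexify
        ((conjCLM m).comp (A : Fib m →L[ℝ] Fib m)))) =
      idCLM ℂ _ := by
    have h₁ := complexify_comp (A.symm : Fib m →L[ℝ] Fib m)
      (A : Fib m →L[ℝ] Fib m)
    have h₂ := complexify_comp ((conjCLM m).comp (A.symm : Fib m →L[ℝ] Fib m))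
      (A : Fib m →L[ℝ] Fib m)
    rw [ContinuousLinearMap.comp_assoc] at h₂
    have e : (A.symm : Fib m →L[ℝ] Fib m).comp (A : Fib m →L[ℝ] Fib m) =
        idCLM ℝ _ := by
      ext : 1
      simp
    rw [e] at h₁ h₂
    rw [complexify_id] at h₁
    rw [ContinuousLinearMap.comp_id, complexify_conjCLM] at h₂
    refine clm_ext fun v => Prod.ext ?_ ?_
    · exact (congrArg (· v) h₁).symm
    · exact (congrArg (· v) h₂).symm
  refine ContinuousLinearMap.IsInvertible.of_inverse (g := (complexify
    (A.symm : Fib m →L[ℝ] Fib m)).prod (complexify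
        ((conjCLM m).comp (A.symm : Fib m →L[ℝ] Fib m)))) ?_ ?_
  · exact key A.symm
  · exact key A

lemma IsVertChart.isFrame (hψ : D.IsVertChart ψ) (hx₀ : x₀ ∈ ψ.source) :
  IsFrame Dirs (D.smoothCoord x₀ x₀) (D.vertZ x₀ ψ) (D.vertW x₀ ψ) := by
  have hZ := hψ.smoothKer_vertZ hx₀
  set q₀ := D.smoothCoord x₀ x₀ with hq₀
  have hd := hZ.differentiable.self_of_nhds
  have hchart : (dfst (D.vertZ x₀ ψ) q₀).IsInvertible := by
    let Y : Fib m → Fib m := fun z => (D.realCoord x₀ (ψ.symm (z, (ψ x₀).2))).1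
    let A : Fib m → Fib m := fun y => D.vertZ x₀ ψ (y, q₀.2)
    have hA : HasFDerivAt A (dfst (D.vertZ x₀ ψ) q₀) q₀.1 :=
      HasFDerivAt.comp q₀.1 (f := fun y => (y, q₀.2)) hd.hasFDerivAt (hasFDerivAt_prodMk_left _ _)
    have hA₀ : A q₀.1 = (ψ x₀).1 := vertZ_smoothCoord (D.mem_realDom x₀)
    have hY : DifferentiableAt ℝ Y (ψ x₀).1 := by
      have e : ContDiffAt ℝ ∞ (fun p => D.realCoord x₀ (ψ.symm p)) (ψ x₀) :=
        (ContMDiffAt.comp (ψ x₀) (g := D.realCoord x₀) (f := ψ.symm) (by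
          rw [ψ.left_inv hx₀]
          exact contMDiffAt_realCoord (D.mem_realDom x₀))
          (hψ.contMDiffAt_symm_real (ψ.map_source hx₀))).contDiffAt
      exact differentiableAt_fst.comp (ψ x₀).1 ((e.differentiableAt (by simp)).comp (ψ x₀).1
        (f := fun z => (z, (ψ x₀).2)) (by fun_prop))
    have hc₁ : Tendsto (fun y => (y, q₀.2)) (𝓝 q₀.1) (𝓝 q₀) :=
      (Continuous.prodMk_left q₀.2).tendsto q₀.1
    have h₁ : ∀ᶠ y in 𝓝 q₀.1, Y (A y) = y := by
      filter_upwards [hc₁.eventually (eventually_realPoint (D := D)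
        (ψ.open_source.mem_nhds hx₀))] with y ⟨e₁, e₂⟩
      have e₃ : (ψ (D.realPoint x₀ (y, q₀.2.1))).2 = (ψ x₀).2 := by
        rw [hψ.snd_eq_iff e₂ hx₀, π_realPoint]
        exact OpenPartialHomeomorph.left_inv _ (mem_chart_source _ _)
      have e₄ : (A y, (ψ x₀).2) = ψ (D.realPoint x₀ (y, q₀.2.1)) := Prod.ext rfl e₃.symm
      change (D.realCoord x₀ (ψ.symm (A y, (ψ x₀).2))).1 = y
      rw [e₄, ψ.left_inv e₂, realCoord_realPoint e₁]
    have hc₂ : Tendsto (fun z => (z, (ψ x₀).2)) (𝓝 (ψ x₀).1) (𝓝 (ψ x₀)) :=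
      (Continuous.prodMk_left (ψ x₀).2).tendsto (ψ x₀).1
    have hc₃ : Tendsto ψ.symm (𝓝 (ψ x₀)) (𝓝 x₀) := ψ.tendsto_symm hx₀
    have h₂ : ∀ᶠ z in 𝓝 (ψ x₀).1, A (Y z) = z := by
      filter_upwards [hc₂.eventually (ψ.open_target.mem_nhds (ψ.map_source hx₀)),
        (hc₃.comp hc₂).eventually (D.realDom_mem_nhds x₀)] with z e₁ e₂
      have e₂ : ψ.symm (z, (ψ x₀).2) ∈ D.realDom x₀ := e₂
      have e₃ : D.π (ψ.symm (z, (ψ x₀).2)) = D.π x₀ := by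
        rw [← hψ.snd_eq_iff (ψ.map_target e₁) hx₀, ψ.right_inv e₁]
      have e₄ : (Y z, q₀.2.1) = D.realCoord x₀ (ψ.symm (z, (ψ x₀).2)) :=
        Prod.ext rfl (by simp only [realCoord, baseCoord, e₃]; rfl)
      change (ψ (D.realPoint x₀ (Y z, q₀.2.1))).1 = z
      rw [e₄, realPoint_realCoord e₂, ψ.right_inv e₁]
    have hA' : HasFDerivAt A (dfst (D.vertZ x₀ ψ) q₀) (Y (ψ x₀).1) := by
      have : Y (ψ x₀).1 = q₀.1 := by rw [← hA₀]; exact h₁.self_of_nhds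
      rwa [this]
    refine ContinuousLinearMap.IsInvertible.of_inverse (g := fderiv ℝ Y (ψ x₀).1) ?_ ?_
    · exact (hA'.comp (ψ x₀).1 hY.hasFDerivAt).unique ((hasFDerivAt_id _).congr_of_eventuallyEq h₂)
    · rw [← hA₀] at hY ⊢
      exact (HasFDerivAt.comp q₀.1 (g := Y) hY.hasFDerivAt hA).unique
        ((hasFDerivAt_id _).congr_of_eventuallyEq h₁)
  refine ⟨hZ, hψ.smoothKer_vertW hx₀, hchart, ?_⟩
  have := isInvertible_complexify hchart
  rw [← fderiv_vertW hd] at this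
  exact this

end Deformation

/-! ## Smooth functions that are real analytic along the base -/

lemma differentiableAt_star_star {f : Bas N → Bas N} {s : Bas N}
  (h : DifferentiableAt ℂ f (star s)) : DifferentiableAt ℂ (fun s => star (f (star s))) s := by
  have e : HasFDerivAt (fun s => star (f (star s))) _ s :=
    (conjCLM N).hasFDerivAt.comp s (HasFDerivAt.comp s (f := conjCLM N)
      (h.hasFDerivAt.restrictScalars ℝ) (conjCLM N).hasFDerivAt)
  refine hasFDerivAt_complex e.differentiableAt fun v => ?_
  rw [e.fderiv]
  simp [star_smul]

section slice

variable {a : Fib m × P → G} {p : Fib m × P}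

lemma pbar_of_slice (hd : DifferentiableAt ℝ a p) {L : Fib m →L[ℝ] G}
  (h : HasFDerivAt (fun z => a (z, p.2)) L p.1) (v : Fib m) :
  pbar a p v = (1 / 2 : ℂ) • (L (star v) + I • L (I • star v)) := by
  have e : HasFDerivAt (fun z => a (z, p.2)) _ p.1 :=
    HasFDerivAt.comp p.1 (f := fun z => (z, p.2)) hd.hasFDerivAt (hasFDerivAt_prodMk_left _ _)
  rw [pbar_apply, ← e.unique h]
  rfl

lemma pbar_eq_zero_of_slice (h : DifferentiableAt ℂ (fun z => a (z, p.2)) p.1) : pbar a p = 0 := by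
  refine clm_ext fun v => ?_
  by_cases hd : DifferentiableAt ℝ a p
  · rw [pbar_of_slice hd (h.hasFDerivAt.restrictScalars ℝ)]
    simp [smul_smul]
  · rw [pbar_apply]
    simp [cderiv, fderiv_zero_of_not_differentiableAt hd]

end slice

namespace Deformation

lemma isSmoothAnalyticAt_iff {f : 𝒳 → G} : D.IsSmoothAnalyticAt x₀ f ↔ ∃ h : Crd → G,
  SmoothKer Dirs (D.smoothCoord x₀ x₀) h ∧ ∀ᶠ x in 𝓝 x₀, f x = h (D.smoothCoord x₀ x) := by
  constructor
  · rintro ⟨O, H, hO, hx, hs, hd, e⟩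
    have hO' : ∀ᶠ q in 𝓝 (D.smoothCoord x₀ x₀), q ∈ O := hO.mem_nhds hx
    exact ⟨H, .of_differentiableAt_slice (hO'.mono fun q hq => hs.contDiffAt (hO.mem_nhds hq))
      (hO'.mono hd), e⟩
  · rintro ⟨h, hs, e⟩
    obtain ⟨O, hO, hOo, hx⟩ := eventually_nhds_iff.1 (hs.smooth.and hs.differentiableAt_slice)
    exact ⟨O, h, hOo, hx, fun q hq => (hO q hq).1.contDiffWithinAt, fun q hq => (hO q hq).2, e⟩

lemma eventually_eq_zero_of_smoothCoord [CompleteSpace G] {h : Crd → G}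
  (hs : SmoothKer Dirs (D.smoothCoord x₀ x₀) h) (h₀ : ∀ᶠ x in 𝓝 x₀, h (D.smoothCoord x₀ x) = 0) :
  ∀ᶠ q in 𝓝 (D.smoothCoord x₀ x₀), h q = 0 :=
  eq_zero_of_realLocus hs.differentiableAt_slice
    ((eventually_realCoord_iff (A := fun p => h (p.1, (p.2, star p.2)) = 0)).1 h₀)

lemma vanishTo_of_smoothCoord [CompleteSpace G] {k : ℕ} {h : Crd → G}
  (hs : SmoothKer Dirs (D.smoothCoord x₀ x₀) h) (h₀ : ∃ C, ∀ᶠ x in 𝓝 x₀, ‖h (D.smoothCoord x₀ x)‖ ≤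
  C * ‖D.baseCoord x₀ x - D.baseCoord x₀ x₀‖ ^ k) : VanishTo (D.smoothCoord x₀ x₀) k h := by
  obtain ⟨C, hC⟩ := h₀
  exact vanishTo_of_realLocus hs ⟨C, (eventually_realCoord_iff (A := fun p =>
    ‖h (p.1, (p.2, star p.2))‖ ≤ C * ‖p.2 - D.baseCoord x₀ x₀‖ ^ k)).1 hC⟩

namespace IsSmoothAnalyticAt

lemma congr {f g : 𝒳 → G} (hf : D.IsSmoothAnalyticAt x₀ f) (e : f =ᶠ[𝓝 x₀] g) :
  D.IsSmoothAnalyticAt x₀ g := by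
  obtain ⟨O, H, h₁, h₂, h₃, h₄, h₅⟩ := hf
  exact ⟨O, H, h₁, h₂, h₃, h₄, by filter_upwards [h₅, e] with x h₁ h₂; rw [← h₂, h₁]⟩

lemma clm {f : 𝒳 → G} (hf : D.IsSmoothAnalyticAt x₀ f) (L : G →L[ℂ] G') :
  D.IsSmoothAnalyticAt x₀ fun x => L (f x) := by
  obtain ⟨h, hs, e⟩ := isSmoothAnalyticAt_iff.1 hf
  exact isSmoothAnalyticAt_iff.2 ⟨_, hs.clm_comp L, e.mono fun x hx => by rw [hx]⟩

lemma bilin {f : 𝒳 → G} {g : 𝒳 → G'} (hf : D.IsSmoothAnalyticAt x₀ f)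
  (hg : D.IsSmoothAnalyticAt x₀ g) (L : G →L[ℂ] G' →L[ℂ] G'') :
  D.IsSmoothAnalyticAt x₀ fun x => L (f x) (g x) := by
  obtain ⟨h, hs, e⟩ := isSmoothAnalyticAt_iff.1 hf
  obtain ⟨h', hs', e'⟩ := isSmoothAnalyticAt_iff.1 hg
  refine isSmoothAnalyticAt_iff.2 ⟨_, hs.bilin L hs', ?_⟩
  filter_upwards [e, e'] with x h₁ h₂
  rw [h₁, h₂]

lemma formComp [FiniteDimensional ℂ F] {f : 𝒳 → CForm m p F}
  {g : 𝒳 → Fib m →L[ℂ] Fib m} (hf : D.IsSmoothAnalyticAt x₀ f) (hg : D.IsSmoothAnalyticAt x₀ g) :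
  D.IsSmoothAnalyticAt x₀ fun x => (f x).compContinuousLinearMap (g x) := by
  obtain ⟨h, hs, e⟩ := isSmoothAnalyticAt_iff.1 hf
  obtain ⟨h', hs', e'⟩ := isSmoothAnalyticAt_iff.1 hg
  refine isSmoothAnalyticAt_iff.2 ⟨_, hs.formComp hs', ?_⟩
  filter_upwards [e, e'] with x h₁ h₂
  rw [h₁, h₂]

lemma continuousAt {f : 𝒳 → G} (hf : D.IsSmoothAnalyticAt x₀ f) : ContinuousAt f x₀ := by
  obtain ⟨h, hs, e⟩ := isSmoothAnalyticAt_iff.1 hf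
  have : ContinuousAt (fun x => h (D.smoothCoord x₀ x)) x₀ :=
    Tendsto.comp hs.smooth.self_of_nhds.continuousAt tendsto_smoothCoord
  exact this.congr (e.mono fun x hx => hx.symm)

/-- The change of coordinates between two base points. -/
lemma eventually {f : 𝒳 → G} (hf : D.IsSmoothAnalyticAt x₀ f) :
  ∀ᶠ x in 𝓝 x₀, D.IsSmoothAnalyticAt x f := by
  have := isManifold_real (E := Fib m) X
  obtain ⟨O, H, h₁, h₂, h₃, h₄, h₅⟩ := hf
  have hO : ∀ᶠ x in 𝓝 x₀, D.smoothCoord x₀ x ∈ O := tendsto_smoothCoord.eventually (h₁.mem_nhds h₂)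
  filter_upwards [hO, D.realDom_mem_nhds x₀, eventually_eventually_nhds.2 h₅] with x₁ e₁ e₂ e₃
  let κ (y : Fib m) : Fib m :=
    chartAt (Fib m) (D.T x₀).1 ((chartAt (Fib m) (D.T x₁).1).symm y)
  let θ (t : Bas N) : Bas N :=
    chartAt (Bas N) (D.π x₀) ((chartAt (Bas N) (D.π x₁)).symm t)
  let ν (q : Crd) : Crd :=
    (κ q.1, (θ q.2.1, star (θ (star q.2.2))))
  have hν : ∀ᶠ x in 𝓝 x₁, ν (D.smoothCoord x₁ x) = D.smoothCoord x₀ x := by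
    filter_upwards [D.realDom_mem_nhds x₁] with x hx
    have a₁ : κ (D.smoothCoord x₁ x).1 = (D.smoothCoord x₀ x).1 :=
      congrArg (chartAt (Fib m) (D.T x₀).1) (OpenPartialHomeomorph.left_inv _ hx.1)
    have a₂ : θ (D.baseCoord x₁ x) = D.baseCoord x₀ x :=
      congrArg (chartAt (Bas N) (D.π x₀)) (OpenPartialHomeomorph.left_inv _ hx.2)
    refine Prod.ext a₁ (Prod.ext a₂ ?_)
    change star (θ (star (star (D.baseCoord x₁ x)))) = star (D.baseCoord x₀ x)
    rw [star_star, a₂]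
  have hκ : ContDiffAt ℝ ω κ (D.smoothCoord x₁ x₁).1 := by
    have s₁ : (D.T x₁).1 ∈ (chartAt (Fib m) (D.T x₁).1).source := mem_chart_source _ _
    refine (ContMDiffAt.comp (I' := 𝓘(ℝ, Fib m)) _ ?_ (contMDiffAt_symm_of_mem_maximalAtlas
      (chart_mem_maximalAtlas _) (OpenPartialHomeomorph.map_source _ s₁))).contDiffAt
    rw [OpenPartialHomeomorph.left_inv _ s₁]
    exact contMDiffAt_of_mem_maximalAtlas (chart_mem_maximalAtlas _) e₂.1
  have hθ : ContDiffAt ℂ ω θ (D.baseCoord x₁ x₁) := by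
    have s₁ : D.π x₁ ∈ (chartAt (Bas N) (D.π x₁)).source := mem_chart_source _ _
    refine (ContMDiffAt.comp (I' := 𝓘B) _ ?_ (contMDiffAt_symm_of_mem_maximalAtlas
      (chart_mem_maximalAtlas _) (OpenPartialHomeomorph.map_source _ s₁))).contDiffAt
    rw [OpenPartialHomeomorph.left_inv _ s₁]
    exact contMDiffAt_of_mem_maximalAtlas (chart_mem_maximalAtlas _) e₂.2
  have hκ' := hκ.eventually (by simp)
  have hθ' := hθ.eventually (by simp)
  set q₁ := D.smoothCoord x₁ x₁ with hq₁
  have c₁ : Tendsto (fun q : Crd => q.1) (𝓝 q₁) (𝓝 q₁.1) :=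
    continuous_fst.tendsto q₁
  have c₂ : Tendsto (fun q : Crd => q.2.1) (𝓝 q₁)
      (𝓝 (D.baseCoord x₁ x₁)) := (by fun_prop : Continuous _).tendsto' _ _ rfl
  have c₃ : Tendsto (fun q : Crd => star q.2.2) (𝓝 q₁)
      (𝓝 (D.baseCoord x₁ x₁)) := (by fun_prop : Continuous _).tendsto' _ _ (star_star _)
  have hνs (q : Crd) (b₁ : ContDiffAt ℝ ω κ q.1)
      (b₂ : ContDiffAt ℂ ω θ q.2.1) (b₃ : ContDiffAt ℂ ω θ (star q.2.2)) : ContDiffAt ℝ ∞ ν q := by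
    have d₂ : ContDiffAt ℝ ∞ θ q.2.1 := (b₂.restrict_scalars ℝ).of_le (by simp)
    have d₃ : ContDiffAt ℝ ∞ θ (star q.2.2) := (b₃.restrict_scalars ℝ).of_le (by simp)
    refine ((b₁.of_le (by simp)).comp q contDiffAt_fst).prodMk ((d₂.comp q contDiffAt_snd.fst).prodMk ?_)
    exact (conjCLM N).contDiff.contDiffAt.comp q (d₃.comp q
      (f := fun q : Crd => star q.2.2)
      ((conjCLM N).contDiff.contDiffAt.comp q contDiffAt_snd.snd))
  have hνc : Tendsto ν (𝓝 q₁) (𝓝 (D.smoothCoord x₀ x₁)) := by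
    rw [← hν.self_of_nhds]
    exact (hνs q₁ hκ hθ (by
      have : star q₁.2.2 = D.baseCoord x₁ x₁ := star_star _
      rwa [this])).continuousAt
  refine isSmoothAnalyticAt_iff.2 ⟨fun q => H (ν q), .of_differentiableAt_slice ?_ ?_, ?_⟩
  · filter_upwards [hνc.eventually (h₁.mem_nhds e₁), c₁.eventually hκ', c₂.eventually hθ',
      c₃.eventually hθ'] with q b₀ b₁ b₂ b₃
    exact (h₃.contDiffAt (h₁.mem_nhds b₀)).comp q (hνs q b₁ b₂ b₃)
  · filter_upwards [hνc.eventually (h₁.mem_nhds e₁), c₂.eventually hθ',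
      c₃.eventually hθ'] with q b₀ b₂ b₃
    refine DifferentiableAt.comp q.2 (g := fun τ => H (κ q.1, τ))
      (f := fun τ : Bas N × Bas N => (θ τ.1, star (θ (star τ.2)))) (h₄ _ b₀) ?_
    exact ((b₂.differentiableAt (by simp)).comp q.2 differentiableAt_fst).prodMk
      ((differentiableAt_star_star (b₃.differentiableAt (by simp))).comp q.2 differentiableAt_snd)
  · filter_upwards [e₃, hν] with x b₁ b₂
    rw [b₁, b₂]

end IsSmoothAnalyticAt

lemma isSmoothAnalyticAt_of_holomorphic {f : 𝒳 → G}
  (hf : ∀ᶠ x in 𝓝 x₀, ContMDiffAt 𝓘T 𝓘(ℂ, G) ω f x) : D.IsSmoothAnalyticAt x₀ f := by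
  refine isSmoothAnalyticAt_iff.2 ⟨_, smoothKer_holomorphic hf, ?_⟩
  filter_upwards [D.realDom_mem_nhds x₀] with x hx
  exact congrArg f (realPoint_realCoord hx).symm

/-- The derivative of `f` along the conjugates of the fibre coordinates of `ψ`. -/
def vbar (ψ : VChart) (f : 𝒳 → G) (x : 𝒳) : Fib m →L[ℂ] G :=
  pbar (fun p : Fib m × Bas N => f (ψ.symm p)) (ψ x)

lemma vbar_congr {f g : 𝒳 → G} {x : 𝒳} (hx : x ∈ ψ.source) (e : f =ᶠ[𝓝 x] g) :
  vbar ψ f x = vbar ψ g x := by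
  have : (fun p : Fib m × Bas N => f (ψ.symm p)) =ᶠ[𝓝 (ψ x)]
      fun p => g (ψ.symm p) := (ψ.tendsto_symm hx).eventually e
  rw [vbar, vbar, pbar, pbar, pderiv_congr this]

/-- Smooth functions, in the coordinates of a vertical chart. -/
lemma IsSmoothAnalyticAt.contDiffAt_symm (hψ : D.IsVertChart ψ) (hx₀ : x₀ ∈ ψ.source) {f : 𝒳 → G}
  (hf : D.IsSmoothAnalyticAt x₀ f) : ContDiffAt ℝ ∞ (fun p => f (ψ.symm p)) (ψ x₀) := by
  obtain ⟨h, hs, e⟩ := isSmoothAnalyticAt_iff.1 hf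
  have e₁ : ContDiffAt ℝ ∞ (fun p => D.realCoord x₀ (ψ.symm p)) (ψ x₀) :=
    (ContMDiffAt.comp (ψ x₀) (g := D.realCoord x₀) (f := ψ.symm) (by
      rw [ψ.left_inv hx₀]
      exact contMDiffAt_realCoord (D.mem_realDom x₀))
      (hψ.contMDiffAt_symm_real (ψ.map_source hx₀))).contDiffAt
  have e₂ : ContDiffAt ℝ ∞ (fun p => D.smoothCoord x₀ (ψ.symm p)) (ψ x₀) :=
    e₁.fst.prodMk (e₁.snd.prodMk ((conjCLM N).contDiff.contDiffAt.comp (ψ x₀) e₁.snd))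
  have e₃ : ContDiffAt ℝ ∞ (fun p => h (D.smoothCoord x₀ (ψ.symm p))) (ψ x₀) := by
    refine ContDiffAt.comp (ψ x₀) ?_ e₂
    rw [ψ.left_inv hx₀]
    exact hs.smooth.self_of_nhds
  exact e₃.congr_of_eventuallyEq ((ψ.tendsto_symm hx₀).eventually e)

/-- The derivative along the conjugate fibre coordinates, in the coordinates given by the smooth
trivialization. -/
lemma vbar_eq_pop (hψ : D.IsVertChart ψ) (hx₀ : x₀ ∈ ψ.source) {f : 𝒳 → G} {h : Crd → G}
  (hs : SmoothKer Dirs (D.smoothCoord x₀ x₀) h) (e : ∀ᶠ x in 𝓝 x₀, f x = h (D.smoothCoord x₀ x)) :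
  ∀ᶠ x in 𝓝 x₀, vbar ψ f x = pop (D.vertZ x₀ ψ) (D.vertW x₀ ψ) h (D.smoothCoord x₀ x) := by
  have hfr := hψ.isFrame hx₀
  have hf : D.IsSmoothAnalyticAt x₀ f := isSmoothAnalyticAt_iff.2 ⟨h, hs, e⟩
  filter_upwards [hf.eventually, ψ.open_source.mem_nhds hx₀, eventually_eventually_nhds.2 e,
    D.isOpen_realDom x₀ |>.mem_nhds (D.mem_realDom x₀),
    tendsto_smoothCoord.eventually hs.differentiable,
    tendsto_smoothCoord.eventually hfr.left.differentiable,
    tendsto_smoothCoord.eventually hfr.eventually_frame] with x h₁ h₂ h₃ h₄ h₅ h₆ h₇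
  have hd := (h₁.contDiffAt_symm hψ h₂).differentiableAt (by simp)
  set q := D.smoothCoord x₀ x with hq
  have hq₂ : q = (q.1, ((D.realCoord x₀ x).2, star (D.realCoord x₀ x).2)) := rfl
  let g : Fib m × Bas N → G := fun p => f (ψ.symm p)
  have hZq : D.vertZ x₀ ψ q = (ψ x).1 := vertZ_smoothCoord h₄
  have key : (fun y => h (y, q.2)) =ᶠ[𝓝 q.1] fun y => g (D.vertZ x₀ ψ (y, q.2), (ψ x).2) := by
    have hc : Tendsto (fun y => (y, (D.realCoord x₀ x).2)) (𝓝 q.1) (𝓝 (D.realCoord x₀ x)) :=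
      (Continuous.prodMk_left (D.realCoord x₀ x).2).tendsto q.1
    have hc' : Tendsto (D.realPoint x₀) (𝓝 (D.realCoord x₀ x)) (𝓝 x) := by
      have := (contMDiffAt_realPoint (D := D) (realCoord_mem h₄)).continuousAt
      rwa [ContinuousAt, realPoint_realCoord h₄] at this
    filter_upwards [(hc'.comp hc).eventually h₃, (hc'.comp hc).eventually (ψ.open_source.mem_nhds h₂),
      hc.eventually ((D.isOpen_realTarget x₀).mem_nhds (realCoord_mem h₄))] with y b₁ b₂ b₃
    have b₂ : D.realPoint x₀ (y, (D.realCoord x₀ x).2) ∈ ψ.source := b₂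
    have b₄ : (ψ (D.realPoint x₀ (y, (D.realCoord x₀ x).2))).2 = (ψ x).2 := by
      rw [hψ.snd_eq_iff b₂ h₂, π_realPoint]
      exact OpenPartialHomeomorph.left_inv _ h₄.2
    have b₅ : (D.vertZ x₀ ψ (y, q.2), (ψ x).2) =
      ψ (D.realPoint x₀ (y, (D.realCoord x₀ x).2)) := Prod.ext rfl b₄.symm
    change _ = f (ψ.symm (D.vertZ x₀ ψ (y, q.2), (ψ x).2))
    rw [b₅, ψ.left_inv b₂]
    refine Eq.trans ?_ b₁.symm
    change _ = h (D.smoothCoord x₀ (D.realPoint x₀ (y, (D.realCoord x₀ x).2)))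
    rw [smoothCoord_eq, realCoord_realPoint b₃]
    rfl
  have hdg : DifferentiableAt ℝ g (D.vertZ x₀ ψ q, (ψ x).2) := by
    rw [hZq]
    exact hd
  have hfd (v : Fib m) : fderiv ℝ h q (v, 0) =
      fderiv ℝ g (ψ x) (fderiv ℝ (D.vertZ x₀ ψ) q (v, 0), 0) := by
    have a₁ : HasFDerivAt (fun y => h (y, q.2)) _ q.1 :=
      HasFDerivAt.comp q.1 (f := fun y => (y, q.2)) h₅.hasFDerivAt (hasFDerivAt_prodMk_left _ _)
    have a₂ : HasFDerivAt (fun y => D.vertZ x₀ ψ (y, q.2)) _ q.1 :=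
      HasFDerivAt.comp q.1 (f := fun y => (y, q.2)) h₆.hasFDerivAt (hasFDerivAt_prodMk_left _ _)
    have a₃ : HasFDerivAt (fun y => g (D.vertZ x₀ ψ (y, q.2), (ψ x).2)) _ q.1 :=
      HasFDerivAt.comp q.1 (f := fun y => (D.vertZ x₀ ψ (y, q.2), (ψ x).2)) hdg.hasFDerivAt
        (a₂.prodMk (hasFDerivAt_const (ψ x).2 q.1))
    have a₄ := a₁.unique (a₃.congr_of_eventuallyEq key)
    have a₅ : (D.vertZ x₀ ψ q, (ψ x).2) = ψ x := Prod.ext hZq rfl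
    rw [a₅] at a₄
    exact congrArg (· v) a₄
  symm
  refine pop_unique h₇ ((pderiv g (ψ x)).comp (inl ℂ _ _)) _ fun v => ?_
  have hW : fderiv ℝ (D.vertW x₀ ψ) q (v, 0) = star (fderiv ℝ (D.vertZ x₀ ψ) q (v, 0)) :=
    congrArg (· v) (fderiv_vertW h₆)
  rw [hfd, hW]
  set u := fderiv ℝ (D.vertZ x₀ ψ) q (v, 0)
  have : pderiv g (ψ x) (u, star u) = fderiv ℝ g (ψ x) (u, 0) := complexify_conj _ u
  rw [← this, vbar, pbar, clm_comp_apply, clm_comp_apply, ← map_add]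
  simp

lemma IsSmoothAnalyticAt.vbar (hψ : D.IsVertChart ψ) (hx₀ : x₀ ∈ ψ.source) {f : 𝒳 → G}
  (hf : D.IsSmoothAnalyticAt x₀ f) : D.IsSmoothAnalyticAt x₀ (vbar ψ f) := by
  obtain ⟨h, hs, e⟩ := isSmoothAnalyticAt_iff.1 hf
  exact isSmoothAnalyticAt_iff.2 ⟨_, (hψ.isFrame hx₀).smoothKer_pop hs, vbar_eq_pop hψ hx₀ hs e⟩

end Deformation

/-! ## Change of vertical charts -/

namespace Deformation

/-- The derivative of the fibre coordinates of `ψ` with respect to those of `ψ'`. -/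
def jac (ψ ψ' : VChart) (x : 𝒳) : Fib m →L[ℂ] Fib m :=
  (fderiv ℂ (fun p => (ψ (ψ'.symm p)).1) (ψ' x)).comp (inl ℂ _ _)

/-- The conjugate of `jac ψ ψ'`. -/
def cbar (ψ ψ' : VChart) : 𝒳 → Fib m →L[ℂ] Fib m :=
  vbar ψ' fun y => star (ψ y).1

lemma IsVertChart.differentiableAt_change (hψ : D.IsVertChart ψ) (hψ' : D.IsVertChart ψ')
  (hx : x ∈ ψ.source) (hx' : x ∈ ψ'.source) :
  DifferentiableAt ℂ (fun p => ψ (ψ'.symm p)) (ψ' x) := by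
  have h : ContMDiffAt 𝓘T 𝓘T ω (fun p => ψ (ψ'.symm p)) (ψ' x) := by
    refine ContMDiffAt.comp (I' := 𝓘T) _ ?_
      (contMDiffAt_symm_of_mem_maximalAtlas hψ'.mem_atlas (ψ'.map_source hx'))
    rw [ψ'.left_inv hx']
    exact contMDiffAt_of_mem_maximalAtlas hψ.mem_atlas hx
  exact h.contDiffAt.differentiableAt (by simp)

lemma IsVertChart.hasFDerivAt_change (hψ : D.IsVertChart ψ) (hψ' : D.IsVertChart ψ')
  (hx : x ∈ ψ.source) (hx' : x ∈ ψ'.source) :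
  HasFDerivAt (fun z => (ψ (ψ'.symm (z, (ψ' x).2))).1) (jac ψ ψ' x) (ψ' x).1 :=
  HasFDerivAt.comp (ψ' x).1 (g := fun p => (ψ (ψ'.symm p)).1) (f := fun z => (z, (ψ' x).2))
    (hψ.differentiableAt_change hψ' hx hx').fst.hasFDerivAt (hasFDerivAt_prodMk_left _ _)

lemma cbar_apply (hψ : D.IsVertChart ψ) (hψ' : D.IsVertChart ψ') (hx : x ∈ ψ.source)
  (hx' : x ∈ ψ'.source) (v : Fib m) : cbar ψ ψ' x v = star (jac ψ ψ' x (star v)) := by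
  have h : HasFDerivAt (fun z => star (ψ (ψ'.symm (z, (ψ' x).2))).1) _ (ψ' x).1 :=
    (conjCLM m).hasFDerivAt.comp (ψ' x).1
      ((hψ.hasFDerivAt_change hψ' hx hx').restrictScalars ℝ)
  have hd : DifferentiableAt ℝ (fun p => star (ψ (ψ'.symm p)).1) (ψ' x) :=
    (conjCLM m).differentiableAt.comp (ψ' x)
      ((hψ.differentiableAt_change hψ' hx hx').fst.restrictScalars ℝ)
  refine (pbar_of_slice hd h v).trans ?_
  simp [star_smul, smul_smul]
  module

lemma vbar_change (hψ : D.IsVertChart ψ) (hψ' : D.IsVertChart ψ') (hx : x ∈ ψ.source)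
  (hx' : x ∈ ψ'.source) {f : 𝒳 → G} (hf : DifferentiableAt ℝ (fun p => f (ψ.symm p)) (ψ x)) :
  vbar ψ' f x = (vbar ψ f x).comp (cbar ψ ψ' x) := by
  have hc : Tendsto ψ'.symm (𝓝 (ψ' x)) (𝓝 x) := ψ'.tendsto_symm hx'
  have hc' : Tendsto (fun z => (z, (ψ' x).2)) (𝓝 (ψ' x).1) (𝓝 (ψ' x)) :=
    (Continuous.prodMk_left (ψ' x).2).tendsto _
  have e₀ : ψ (ψ'.symm (ψ' x)) = ψ x := by rw [ψ'.left_inv hx']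
  have hd : DifferentiableAt ℝ (fun p => f (ψ'.symm p)) (ψ' x) := by
    have h : DifferentiableAt ℝ (fun p => f (ψ.symm (ψ (ψ'.symm p)))) (ψ' x) :=
      DifferentiableAt.comp (ψ' x) (g := fun p => f (ψ.symm p)) (by rwa [e₀])
        ((hψ.differentiableAt_change hψ' hx hx').restrictScalars ℝ)
    refine h.congr_of_eventuallyEq ?_
    filter_upwards [hc.eventually (ψ.open_source.mem_nhds hx)] with p hp
    rw [ψ.left_inv hp]
  have h₁ : HasFDerivAt (𝕜 := ℝ) (fun z => f (ψ.symm (z, (ψ x).2)))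
      ((fderiv ℝ (fun p => f (ψ.symm p)) (ψ x)).comp (inl ℝ _ _)) (ψ x).1 :=
    HasFDerivAt.comp (ψ x).1 (f := fun z => (z, (ψ x).2)) hf.hasFDerivAt
      (hasFDerivAt_prodMk_left _ _)
  have h₂ : HasFDerivAt (𝕜 := ℝ) (fun z => f (ψ'.symm (z, (ψ' x).2)))
      (((fderiv ℝ (fun p => f (ψ.symm p)) (ψ x)).comp (inl ℝ _ _)).comp
        ((jac ψ ψ' x).restrictScalars ℝ)) (ψ' x).1 := by
    refine (HasFDerivAt.comp (ψ' x).1 (g := fun z => f (ψ.symm (z, (ψ x).2)))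
      (f := fun z => (ψ (ψ'.symm (z, (ψ' x).2))).1) (by
        rw [show (ψ (ψ'.symm ((ψ' x).1, (ψ' x).2))).1 = (ψ x).1 from congrArg Prod.fst e₀]
        exact h₁) ((hψ.hasFDerivAt_change hψ' hx hx').restrictScalars ℝ)).congr_of_eventuallyEq ?_
    filter_upwards [(hc.comp hc').eventually (ψ.open_source.mem_nhds hx),
      hc'.eventually (ψ'.open_target.mem_nhds (ψ'.map_source hx'))] with z b₁ b₂
    have b₁ : ψ'.symm (z, (ψ' x).2) ∈ ψ.source := b₁
    have b₃ : (ψ (ψ'.symm (z, (ψ' x).2))).2 = (ψ x).2 := by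
      rw [hψ.snd_eq_iff b₁ hx, ← hψ'.snd_eq_iff (ψ'.map_target b₂) hx', ψ'.right_inv b₂]
    have b₄ : ψ (ψ'.symm (z, (ψ' x).2)) = ((ψ (ψ'.symm (z, (ψ' x).2))).1, (ψ x).2) := Prod.ext rfl b₃
    refine (congrArg f (ψ.left_inv b₁)).symm.trans ?_
    rw [b₄]
    rfl
  refine clm_ext fun v => ?_
  rw [clm_comp_apply, cbar_apply hψ hψ' hx hx', vbar, vbar, pbar_of_slice hd h₂,
    pbar_of_slice hf h₁]
  simp

lemma IsVertChart.smoothAnalytic_star (hψ : D.IsVertChart ψ) (hx : x ∈ ψ.source) :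
  D.IsSmoothAnalyticAt x fun y => star (ψ y).1 := by
  refine isSmoothAnalyticAt_iff.2 ⟨_, hψ.smoothKer_vertW hx, ?_⟩
  filter_upwards [D.realDom_mem_nhds x] with y hy
  exact (vertW_smoothCoord hy).symm

lemma IsVertChart.smoothAnalytic_cbar (hψ : D.IsVertChart ψ) (hψ' : D.IsVertChart ψ')
  (hx : x ∈ ψ.source) (hx' : x ∈ ψ'.source) : D.IsSmoothAnalyticAt x (cbar ψ ψ') :=
  (hψ.smoothAnalytic_star hx).vbar hψ' hx'

/-! ## Holomorphic functions along the fibres -/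

lemma vbar_eq_zero (hψ : D.IsVertChart ψ) (hx : x ∈ ψ.source) {f : 𝒳 → G}
  (hf : ContMDiffAt 𝓘T 𝓘(ℂ, G) ω f x) : vbar ψ f x = 0 := by
  have h : ContMDiffAt 𝓘T 𝓘(ℂ, G) ω (fun p => f (ψ.symm p)) (ψ x) := by
    refine ContMDiffAt.comp (I' := 𝓘T) _ ?_
      (contMDiffAt_symm_of_mem_maximalAtlas hψ.mem_atlas (ψ.map_source hx))
    rwa [ψ.left_inv hx]
  exact pbar_eq_zero_of_slice (DifferentiableAt.comp (ψ x).1 (f := fun z => (z, (ψ x).2))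
    (h.contDiffAt.differentiableAt (by simp)) (by fun_prop))

/-- Multiplication by a function that is holomorphic along the fibres. -/
lemma vbar_bilin {g : 𝒳 → G'} {f : 𝒳 → G} (hg : DifferentiableAt ℝ (fun p => g (ψ.symm p)) (ψ x))
  (hf : DifferentiableAt ℝ (fun p => f (ψ.symm p)) (ψ x)) (h₀ : vbar ψ g x = 0)
  (hx : x ∈ ψ.source) (L : G' →L[ℂ] G →L[ℂ] G'') :
  vbar ψ (fun y => L (g y) (f y)) x = (L (g x)).comp (vbar ψ f x) := by
  let L' : G' →L[ℝ] G →L[ℝ] G'' :=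
    (ContinuousLinearMap.restrictScalarsL ℂ G G'' ℝ ℝ).comp (L.restrictScalars ℝ)
  have h := L'.hasFDerivAt_of_bilinear hg.hasFDerivAt hf.hasFDerivAt
  have e (v) : fderiv ℝ (fun p => L (g (ψ.symm p)) (f (ψ.symm p))) (ψ x) v =
      L (g x) (fderiv ℝ (fun p => f (ψ.symm p)) (ψ x) v) +
        L (fderiv ℝ (fun p => g (ψ.symm p)) (ψ x) v) (f x) := by
    refine (congrArg (· v) h.fderiv).trans ?_
    simp [L', ψ.left_inv hx]
  refine clm_ext fun v => ?_
  have h₀' := congrArg (fun T => L (T v) (f x)) h₀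
  simp only [vbar, pbar_apply, cderiv, zero_apply, map_zero, map_smul, map_add, smul_apply,
    add_apply] at h₀'
  rw [clm_comp_apply, vbar, vbar, pbar_apply, pbar_apply, cderiv, cderiv, e, e,
    map_smul, map_add, map_smul, ← sub_eq_zero, ← h₀']
  module

lemma analyticAt_change {χ ψ : VChart} (hχ : χ ∈ maximalAtlas 𝓘T ω 𝒳)
  (hψ : ψ ∈ maximalAtlas 𝓘T ω 𝒳) (h : x ∈ χ.source)
  (h' : x ∈ ψ.source) : AnalyticAt ℂ (fun p => χ (ψ.symm p)) (ψ x) := by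
  have h : ContMDiffAt 𝓘T 𝓘T ω (fun p => χ (ψ.symm p)) (ψ x) := by
    refine ContMDiffAt.comp (I' := 𝓘T) _ ?_
      (contMDiffAt_symm_of_mem_maximalAtlas hψ (ψ.map_source h'))
    rw [ψ.left_inv h']
    exact contMDiffAt_of_mem_maximalAtlas hχ h
  exact h.contDiffAt.analyticAt

lemma frameChart_smoothCoord (hψ : D.IsRelChart x ψ) :
  ∀ᶠ y in 𝓝 x, frameChart (D.vertZ x ψ) (D.smoothCoord x y) =
  ((ψ y).1, ((ψ y).2, star (ψ y).2)) := by
  filter_upwards [D.realDom_mem_nhds x, ψ.open_source.mem_nhds hψ.mem_source] with y h₁ h₂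
  rw [hψ.snd_eq y h₂]
  exact Prod.ext (vertZ_smoothCoord h₁) rfl

lemma isRelAnalyticAt_iff_frameChart (hψ : D.IsRelChart x ψ) {f : 𝒳 → G} :
  D.IsRelAnalyticAt x f ↔ ∃ g : Crd → G,
  AnalyticAt ℂ g (frameChart (D.vertZ x ψ) (D.smoothCoord x x)) ∧
  ∀ᶠ y in 𝓝 x, f y = g (frameChart (D.vertZ x ψ) (D.smoothCoord x y)) := by
  have hχ := chart_mem_maximalAtlas (I := 𝓘T) (n := ω) x
  set χ := chartAt (Tot m N) x with hχ'
  have hxχ : x ∈ χ.source := mem_chart_source _ _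
  have hx := hψ.mem_source
  have ha (y) (hy : y ∈ ψ.source) : D.analyticCoord x y = (χ y, star (ψ y).2) := by
    rw [hψ.snd_eq y hy]
    rfl
  rw [(frameChart_smoothCoord hψ).self_of_nhds]
  constructor
  · rintro ⟨H, hH, e⟩
    rw [ha x hx] at hH
    refine ⟨fun q => H (χ (ψ.symm (q.1, q.2.1)), q.2.2), ?_, ?_⟩
    · refine AnalyticAt.fun_comp (g := H) (f := fun q : Crd =>
        (χ (ψ.symm (q.1, q.2.1)), q.2.2)) (by simpa [ψ.left_inv hx] using hH)
          (AnalyticAt.prod ?_ (analyticAt_snd.fun_comp analyticAt_snd))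
      exact AnalyticAt.fun_comp (g := fun p => χ (ψ.symm p))
        (f := fun q : Crd => (q.1, q.2.1))
        (x := ((ψ x).1, ((ψ x).2, star (ψ x).2))) (analyticAt_change hχ hψ.mem_atlas hxχ hx)
        (analyticAt_fst.prod (analyticAt_fst.fun_comp analyticAt_snd))
    · filter_upwards [e, ψ.open_source.mem_nhds hx, frameChart_smoothCoord hψ] with y h₁ h₂ h₃
      rw [h₁, ha y h₂, h₃]
      simp [ψ.left_inv h₂]
  · rintro ⟨g, hg, e⟩
    refine ⟨fun p => g ((ψ (χ.symm p.1)).1, ((ψ (χ.symm p.1)).2, p.2)), ?_, ?_⟩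
    · rw [ha x hx]
      have h := AnalyticAt.fun_comp (f := fun p : Tot m N × Bas N => p.1)
        (x := (χ x, star (ψ x).2)) (analyticAt_change hψ.mem_atlas hχ hx hxχ) analyticAt_fst
      refine AnalyticAt.fun_comp (g := g) (f := fun p : Tot m N × Bas N =>
        ((ψ (χ.symm p.1)).1, ((ψ (χ.symm p.1)).2, p.2))) (by simpa [χ.left_inv hxχ] using hg) ?_
      exact AnalyticAt.prod (analyticAt_fst.fun_comp h) (AnalyticAt.prod (analyticAt_snd.fun_comp h)
        analyticAt_snd)
    · filter_upwards [e, ψ.open_source.mem_nhds hx, χ.open_source.mem_nhds hxχ,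
        frameChart_smoothCoord hψ] with y h₁ h₂ h₃ h₄
      rw [h₁, ha y h₂, h₄]
      simp [χ.left_inv h₃]

/-- The functions of `𝒪^ω` are those of the class that are holomorphic along the fibres. -/
lemma isRelAnalyticAt_iff [CompleteSpace G] (hψ : D.IsVertChart ψ) (hx : x ∈ ψ.source) {f : 𝒳 → G} :
  D.IsRelAnalyticAt x f ↔ D.IsSmoothAnalyticAt x f ∧ ∀ᶠ y in 𝓝 x, vbar ψ f y = 0 := by
  obtain ⟨ψ', h'⟩ := D.exists_isRelChart x
  have hψ' := h'.isVertChart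
  have hfr := hψ'.isFrame h'.mem_source
  have key {ψ ψ'} (hψ : D.IsVertChart ψ) (hψ' : D.IsVertChart ψ') (hx : x ∈ ψ.source)
      (hx' : x ∈ ψ'.source) (hf : D.IsSmoothAnalyticAt x f) (h : ∀ᶠ y in 𝓝 x, vbar ψ f y = 0) :
      ∀ᶠ y in 𝓝 x, vbar ψ' f y = 0 := by
    filter_upwards [h, hf.eventually, ψ.open_source.mem_nhds hx, ψ'.open_source.mem_nhds hx']
      with y h₁ h₂ h₃ h₄
    rw [vbar_change hψ hψ' h₃ h₄ ((h₂.contDiffAt_symm hψ h₃).differentiableAt (by simp)), h₁,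
      ContinuousLinearMap.zero_comp]
  rw [isRelAnalyticAt_iff_frameChart h']
  constructor
  · rintro ⟨g, hg, e⟩
    obtain ⟨h₁, h₂⟩ := hfr.comp_analytic hg
    have hf := isSmoothAnalyticAt_iff.2 ⟨_, h₁, e⟩
    refine ⟨hf, key hψ' hψ h'.mem_source hx hf ?_⟩
    filter_upwards [vbar_eq_pop hψ' h'.mem_source h₁ e, tendsto_smoothCoord.eventually h₂]
      with y b₁ b₂
    rw [b₁, b₂]
  · rintro ⟨hf, h₀⟩
    obtain ⟨h, hs, e⟩ := isSmoothAnalyticAt_iff.1 hf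
    obtain ⟨g, hg, e'⟩ := hfr.exists_analytic hs (eventually_eq_zero_of_smoothCoord
      (hfr.smoothKer_pop hs) (by
        filter_upwards [key hψ hψ' hx h'.mem_source hf h₀, vbar_eq_pop hψ' h'.mem_source hs e]
          with y b₁ b₂
        rw [← b₂, b₁]))
    exact ⟨g, hg, by
      filter_upwards [e, tendsto_smoothCoord.eventually e'] with y b₁ b₂
      rw [b₁, b₂]⟩

end Deformation

/-! ## Relative forms in coordinates -/

namespace Deformation

variable (D)

/-- The differential of the fibre coordinates, as a linear map. -/
def dzLin (ψ : VChart) (x : 𝒳) : D.vert x →ₗ[ℂ] Fib m where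
  toFun := D.dz ψ x
  map_add' _ _ := map_add (mfderiv 𝓘T 𝓘F _ x) _ _
  map_smul' _ _ := map_smul (mfderiv 𝓘T 𝓘F _ x) _ _

open scoped Classical in
/-- The vertical vector with given fibre coordinates. -/
def lift (ψ : VChart) (x : 𝒳) : Fib m →ₗ[ℂ] D.vert x :=
  if h : Function.Bijective (D.dzLin ψ x) then (LinearEquiv.ofBijective _ h).symm else 0

variable {D}

namespace IsVertChart

lemma mfderiv_vert (hψ : D.IsVertChart ψ) (hx : x ∈ ψ.source) (w : D.vert x) :
  mfderiv 𝓘T 𝓘T ψ x w.1 = (D.dz ψ x w, 0) := by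
  have hd := (mdifferentiable_of_mem_maximalAtlas hψ.mem_atlas).mdifferentiableAt hx
  obtain ⟨φ, hφ, hb⟩ := hψ.base
  have h₁ : mfderiv 𝓘T 𝓘F (fun y => (ψ y).1) x w.1 =
      (mfderiv 𝓘T 𝓘T ψ x w.1).1 := by
    have := mfderiv_comp (I'' := 𝓘F) x (g := Prod.fst)
      differentiableAt_fst.mdifferentiableAt hd
    rw [mfderiv_eq_fderiv, fderiv_fst] at this
    exact congrArg (· w.1) this
  have h₂ : mfderiv 𝓘T 𝓘B (fun y => (ψ y).2) x w.1 =
      (mfderiv 𝓘T 𝓘T ψ x w.1).2 := by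
    have := mfderiv_comp (I'' := 𝓘B) x (g := Prod.snd)
      differentiableAt_snd.mdifferentiableAt hd
    rw [mfderiv_eq_fderiv, fderiv_snd] at this
    exact congrArg (· w.1) this
  have h₃ := mfderiv_comp (I'' := 𝓘B) x
    ((mdifferentiable_of_mem_maximalAtlas hφ).mdifferentiableAt (hb x hx).1)
    ((D.holomorphic_π x).mdifferentiableAt (by simp))
  have e : (fun y => (ψ y).2) =ᶠ[𝓝 x] φ ∘ D.π := by
    filter_upwards [ψ.open_source.mem_nhds hx] with y hy
    exact (hb y hy).2
  rw [e.mfderiv_eq, h₃] at h₂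
  refine Prod.ext h₁.symm (h₂.symm.trans ?_)
  have : mfderiv 𝓘T 𝓘B D.π x w.1 = 0 := w.2
  exact (congrArg (mfderiv 𝓘B 𝓘B φ (D.π x)) this).trans (map_zero _)

lemma bijective_dzLin (hψ : D.IsVertChart ψ) (hx : x ∈ ψ.source) :
  Function.Bijective (D.dzLin ψ x) := by
  have hm := mdifferentiable_of_mem_maximalAtlas hψ.mem_atlas
  obtain ⟨φ, hφ, hb⟩ := hψ.base
  have hm' := mdifferentiable_of_mem_maximalAtlas hφ
  constructor
  · rw [injective_iff_map_eq_zero]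
    intro w hw
    have h := hψ.mfderiv_vert hx w
    rw [show D.dz ψ x w = 0 from hw] at h
    exact Subtype.ext (hm.mfderiv_injective hx (h.trans (map_zero _).symm))
  · intro v
    obtain ⟨w, hw⟩ := hm.mfderiv_surjective hx (v, 0)
    have h₂ : mfderiv 𝓘T 𝓘B (fun y => (ψ y).2) x w = 0 := by
      have := mfderiv_comp (I'' := 𝓘B) x (g := Prod.snd)
        differentiableAt_snd.mdifferentiableAt (hm.mdifferentiableAt hx)
      rw [mfderiv_eq_fderiv, fderiv_snd] at this
      exact (congrArg (· w) this).trans (congrArg Prod.snd hw)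
    have h₃ := mfderiv_comp (I'' := 𝓘B) x (hm'.mdifferentiableAt (hb x hx).1)
      ((D.holomorphic_π x).mdifferentiableAt (by simp))
    have e : (fun y => (ψ y).2) =ᶠ[𝓝 x] φ ∘ D.π := by
      filter_upwards [ψ.open_source.mem_nhds hx] with y hy
      exact (hb y hy).2
    rw [e.mfderiv_eq, h₃] at h₂
    have hv : mfderiv 𝓘T 𝓘B D.π x w = 0 :=
      hm'.mfderiv_injective (hb x hx).1 (h₂.trans (map_zero _).symm)
    refine ⟨⟨w, hv⟩, ?_⟩
    exact congrArg Prod.fst ((hψ.mfderiv_vert hx ⟨w, hv⟩).symm.trans hw)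

lemma dz_lift (hψ : D.IsVertChart ψ) (hx : x ∈ ψ.source) (v : Fib m) :
  D.dz ψ x (D.lift ψ x v) = v := by
  rw [lift, dif_pos (hψ.bijective_dzLin hx)]
  exact LinearEquiv.apply_symm_apply (LinearEquiv.ofBijective _ (hψ.bijective_dzLin hx)) v

lemma lift_dz (hψ : D.IsVertChart ψ) (hx : x ∈ ψ.source) (w : D.vert x) :
  D.lift ψ x (D.dz ψ x w) = w := by
  rw [lift, dif_pos (hψ.bijective_dzLin hx)]
  exact LinearEquiv.symm_apply_apply (LinearEquiv.ofBijective _ (hψ.bijective_dzLin hx)) w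

lemma dz_eq_jac (hψ : D.IsVertChart ψ) (hψ' : D.IsVertChart ψ') (hx : x ∈ ψ.source)
  (hx' : x ∈ ψ'.source) (w : D.vert x) : D.dz ψ x w = jac ψ ψ' x (D.dz ψ' x w) := by
  have h := mfderiv_comp (I'' := 𝓘F) x (g := fun p => (ψ (ψ'.symm p)).1)
    (hψ.differentiableAt_change hψ' hx hx').fst.mdifferentiableAt
    ((mdifferentiable_of_mem_maximalAtlas hψ'.mem_atlas).mdifferentiableAt hx')
  have e : (fun y => (ψ y).1) =ᶠ[𝓝 x] (fun p => (ψ (ψ'.symm p)).1) ∘ ψ' := by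
    filter_upwards [ψ'.open_source.mem_nhds hx'] with y hy
    simp [ψ'.left_inv hy]
  rw [dz, e.mfderiv_eq, h, mfderiv_eq_fderiv]
  exact congrArg (fderiv ℂ (fun p => (ψ (ψ'.symm p)).1) (ψ' x)) (hψ'.mfderiv_vert hx' w)

end IsVertChart

section bundle

variable (F E) in
/-- The domain of the preferred trivialization at `x₀`. -/
abbrev bset (x₀ : 𝒳) : Set 𝒳 := (trivializationAt F E x₀).baseSet

variable (F E) in
/-- The inverse of `triv`. -/
def utriv (x₀ x : 𝒳) : F →ₗ[ℂ] E x := (trivializationAt F E x₀).symmₗ ℂ x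

lemma triv_utriv (hx : x ∈ bset F E x₀) (v : F) : triv F E x₀ x (utriv F E x₀ x v) = v :=
  Bundle.Trivialization.linearMapAt_symmₗ _ hx v

lemma utriv_triv (hx : x ∈ bset F E x₀) (v : E x) : utriv F E x₀ x (triv F E x₀ x v) = v :=
  Bundle.Trivialization.symmₗ_linearMapAt _ hx v

/-- Alternating forms on a finite dimensional space are continuous. -/
def toCForm (h : Fib m [⋀^Fin p]→ₗ[ℂ] F) : CForm m p F :=
  { h with
    cont := by
      have e (v : Fin p → Fib m) : h v = ∑ r : Fin p → Fin m,
          (∏ i, v i (r i)) • h fun i => Pi.single (r i) 1 := by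
        have h₁ : v = fun i => ∑ j, v i j • Pi.single j (1 : ℂ) :=
          funext fun i => pi_eq_sum_univ' (v i)
        conv_lhs => rw [h₁]
        refine (h.toMultilinearMap.map_sum _).trans (Finset.sum_congr rfl fun r _ => ?_)
        exact h.toMultilinearMap.map_smul_univ _ _
      refine Continuous.congr ?_ fun v => (e v).symm
      fun_prop }

lemma lift_star_update [DecidableEq (Fin p)] (v : Fin p → Fib m) (i : Fin p)
  (a : Fib m) : (fun j => D.lift ψ x (star (Function.update v i a j))) =
  Function.update (fun j => D.lift ψ x (star (v j))) i (D.lift ψ x (star a)) :=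
  funext fun j => Function.apply_update (fun _ w => D.lift ψ x (star w)) v i a j

lemma dzLin_star_update [DecidableEq (Fin p)] (v : Fin p → D.vert x) (i : Fin p) (a : D.vert x) :
  (fun j => star (D.dzLin ψ x (Function.update v i a j))) =
  Function.update (fun j => star (D.dzLin ψ x (v j))) i (star (D.dzLin ψ x a)) :=
  funext fun j => Function.apply_update (fun _ w => star (D.dzLin ψ x w)) v i a j

variable (D F E) in
/-- The coordinates of a relative form at `x`: the form `h` such that
`α = h (dz̄, …, dz̄)`. -/
def flat (ψ : VChart) (x₀ x : 𝒳) : D.RelForm E p x →ₗ[ℂ] CForm m p F where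
  toFun α := toCForm
    { toFun := fun v => triv F E x₀ x (α.1 fun j => D.lift ψ x (star (v j)))
      map_update_add' := by
        intro _ v i a b
        simp only [lift_star_update, star_add, map_add, AlternatingMap.map_update_add]
      map_update_smul' := by
        intro inst v i c a
        obtain rfl : inst = instDecidableEqFin p := Subsingleton.elim _ _
        have h := α.2 (Function.update (fun j => D.lift ψ x (star (v j))) i (D.lift ψ x (star a))) i
          (starRingEnd ℂ c)
        simp only [lift_star_update, star_smul, map_smul]
        simp only [Function.update_idem, Function.update_self, Complex.conj_conj] at h
        exact (congrArg (triv F E x₀ x) h).trans (map_smul (triv F E x₀ x) _ _)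
      map_eq_zero_of_eq' := by
        intro v i j hv hij
        rw [α.1.map_eq_zero_of_eq _ (by simp only [hv]) hij, map_zero] }
  map_add' α β := by
    ext v
    exact map_add (triv F E x₀ x) _ _
  map_smul' c α := by
    ext v
    exact map_smul (triv F E x₀ x) _ _

lemma flat_apply (α : D.RelForm E p x) (v : Fin p → Fib m) : D.flat F E ψ x₀ x α v =
  triv F E x₀ x (α.1 fun j => D.lift ψ x (star (v j))) := rfl

lemma flat_dz (hψ : D.IsVertChart ψ) (hx : x ∈ ψ.source) (α : D.RelForm E p x)
  (w : Fin p → D.vert x) :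
  D.flat F E ψ x₀ x α (fun j => star (D.dz ψ x (w j))) = triv F E x₀ x (α.1 w) := by
  simp only [flat_apply, star_star, hψ.lift_dz hx]

variable (D F E) in
/-- The relative form with given coordinates. -/
def unflat (ψ : VChart) (x₀ x : 𝒳) (h : CForm m p F) : D.RelForm E p x :=
  ⟨{ toFun := fun w => utriv F E x₀ x (h fun j => star (D.dzLin ψ x (w j)))
     map_update_add' := by
        intro _ v i a b
        simp only [dzLin_star_update, star_add, map_add, ContinuousAlternatingMap.map_update_add]
     map_update_smul' := by
        intro _ v i c a
        have e : D.dzLin ψ x (c • a) = (c : ℂ) • D.dzLin ψ x a := map_smul (D.dzLin ψ x) (c : ℂ) a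
        have e' : star ((c : ℂ) • D.dzLin ψ x a) = (c : ℂ) • star (D.dzLin ψ x a) := by
          simp [star_smul]
        rw [dzLin_star_update, dzLin_star_update, e, e', h.map_update_smul, map_smul]
        rfl
     map_eq_zero_of_eq' := by
        intro v i j hv hij
        rw [h.map_eq_zero_of_eq _ (by simp only [hv]) hij, map_zero] }, fun v j c => by
    have h' := h.map_update_smul (fun j => star (D.dzLin ψ x (v j))) j (starRingEnd ℂ c)
      (star (D.dzLin ψ x (v j)))
    rw [Function.update_eq_self] at h'
    refine (congrArg (utriv F E x₀ x) (Eq.trans ?_ h')).trans (map_smul _ _ _)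
    rw [dzLin_star_update, map_smul, star_smul]
    rfl⟩

lemma flat_unflat (hψ : D.IsVertChart ψ) (hx : x ∈ ψ.source) (hx' : x ∈ bset F E x₀)
  (h : CForm m p F) : D.flat F E ψ x₀ x (D.unflat F E ψ x₀ x h) = h := by
  ext v
  refine (triv_utriv hx' _).trans (congrArg h (funext fun j => ?_))
  exact (congrArg star (hψ.dz_lift hx _)).trans (star_star _)

lemma flat_injective (hψ : D.IsVertChart ψ) (hx : x ∈ ψ.source) (hx' : x ∈ bset F E x₀) :
  Function.Injective (D.flat (p := p) F E ψ x₀ x) := by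
  intro α β h
  refine Subtype.ext (AlternatingMap.ext fun w => ?_)
  rw [← utriv_triv hx' (α.1 w), ← utriv_triv hx' (β.1 w), ← flat_dz hψ hx, h, flat_dz hψ hx]

variable (F E) in
/-- The change of trivialization. -/
def gtriv (x₀ x₁ x : 𝒳) : F →L[ℂ] F :=
  (trivializationAt F E x₀).coordChangeL ℂ (trivializationAt F E x₁) x

lemma gtriv_triv (hx : x ∈ bset F E x₀) (hx' : x ∈ bset F E x₁) (v : E x) :
  gtriv F E x₀ x₁ x (triv F E x₀ x v) = triv F E x₁ x v := by
  refine (Bundle.Trivialization.coordChangeL_apply _ _ ⟨hx, hx'⟩ _).trans ?_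
  have h : (trivializationAt F E x₀).symm x (triv F E x₀ x v) = v := by
    rw [← Bundle.Trivialization.symmₗ_apply (R := ℂ) _ hx]
    exact utriv_triv hx v
  rw [h, triv, Bundle.Trivialization.linearMapAt_apply, if_pos hx']

lemma flat_change (hψ : D.IsVertChart ψ) (hψ' : D.IsVertChart ψ') (hx : x ∈ ψ.source)
  (hx' : x ∈ ψ'.source) (h₀ : x ∈ bset F E x₀) (h₁ : x ∈ bset F E x₁) (α : D.RelForm E p x) :
  D.flat F E ψ' x₁ x α = (gtriv F E x₀ x₁ x).compContinuousAlternatingMap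
  ((D.flat F E ψ x₀ x α).compContinuousLinearMap (cbar ψ ψ' x)) := by
  ext v
  rw [flat_apply, ← gtriv_triv h₀ h₁]
  refine congrArg _ ?_
  rw [← flat_dz hψ hx]
  refine congrArg _ (funext fun j => ?_)
  rw [hψ.dz_eq_jac hψ' hx hx', hψ'.dz_lift hx']
  exact (cbar_apply hψ hψ' hx hx' (v j)).symm

end bundle

end Deformation

/-! ## The relative Dolbeault operator -/

section realForms

/-- The conjugate-linear form `v ↦ h (v̄)`. -/
def realForm : CForm m p F →ₗ[ℂ] Fib m [⋀^Fin p]→L[ℝ] F where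
  toFun h := (h.restrictScalars ℝ).compContinuousLinearMap (conjCLM m)
  map_add' _ _ := rfl
  map_smul' _ _ := rfl

lemma realForm_apply (h : CForm m p F) (v : Fin p → Fib m) :
  realForm h v = h fun j => star (v j) := rfl

lemma realForm_injective : Function.Injective (realForm : CForm m p F →ₗ[ℂ] _) := by
  intro h h' e
  ext v
  have := congrArg (fun f => f fun j => star (v j)) e
  simpa [realForm_apply] using this

lemma realForm_alternatize (T : Fib m →L[ℂ] CForm m p F) (T' : Fib m →L[ℝ] Fib m [⋀^Fin p]→L[ℝ] F)
  (h : ∀ v, T' v = realForm (T (star v))) : ContinuousAlternatingMap.alternatizeUncurryFin T' =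
  realForm (ContinuousAlternatingMap.alternatizeUncurryFin T) := by
  ext v
  rw [realForm_apply, ContinuousAlternatingMap.alternatizeUncurryFin_apply,
    ContinuousAlternatingMap.alternatizeUncurryFin_apply]
  refine Finset.sum_congr rfl fun i _ => ?_
  rw [h, realForm_apply]
  rfl

lemma alternatize_comp (g : F →L[ℂ] F) (T : Fib m →L[ℂ] CForm m p F) :
  ContinuousAlternatingMap.alternatizeUncurryFin
  ((ContinuousLinearMap.compContinuousAlternatingMapCLM ℂ (Fib m) F F (Fin p) g).comp T) =
  g.compContinuousAlternatingMap (ContinuousAlternatingMap.alternatizeUncurryFin T) := by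
  ext v
  simp [ContinuousAlternatingMap.alternatizeUncurryFin_apply]

variable [FiniteDimensional ℂ F]

instance : FiniteDimensional ℂ (CForm m p F) := finiteDimensional_alternating ℂ _ F p

instance : FiniteDimensional ℂ (Fib m [⋀^Fin p]→L[ℝ] F) :=
  haveI : FiniteDimensional ℝ F := Module.Finite.trans ℂ F
  haveI := finiteDimensional_alternating ℝ (Fib m) F p
  Module.Finite.right ℝ ℂ _

end realForms

namespace Deformation

variable (D) [FiniteDimensional ℂ F]

/-- The coordinates of a family of relative forms. -/
def coef (F : Type) [NormedAddCommGroup F] [NormedSpace ℂ F]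
  (E : 𝒳 → Type) [TopologicalSpace (Bundle.TotalSpace F E)] [∀ x, TopologicalSpace (E x)]
  [∀ x, AddCommGroup (E x)] [∀ x, Module ℂ (E x)] [FiberBundle F E] [VectorBundle ℂ F E]
  (ψ : VChart) (x₀ : 𝒳) (α : ∀ x, D.RelForm E p x) (x : 𝒳) : CForm m p F :=
  D.flat F E ψ x₀ x (α x)

/-- The Dolbeault operator in the coordinates of `ψ`. -/
def fdbar (ψ : VChart) (b : 𝒳 → CForm m p F) (x : 𝒳) : CForm m (p + 1) F :=
  ContinuousAlternatingMap.alternatizeUncurryFin (vbar ψ b x)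

/-- The relative Dolbeault operator. -/
def dForm (F : Type) [NormedAddCommGroup F] [NormedSpace ℂ F] {E : 𝒳 → Type}
  [TopologicalSpace (Bundle.TotalSpace F E)] [∀ x, TopologicalSpace (E x)]
  [∀ x, AddCommGroup (E x)] [∀ x, Module ℂ (E x)] [FiberBundle F E] [VectorBundle ℂ F E]
  (α : ∀ x, D.RelForm E p x) (x : 𝒳) : D.RelForm E (p + 1) x :=
  D.unflat F E (D.exists_isRelChart x).choose x x
    (fdbar (D.exists_isRelChart x).choose (D.coef F E (D.exists_isRelChart x).choose x α) x)

variable {D}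

lemma mem_bset (x : 𝒳) : x ∈ bset F E x := FiberBundle.mem_baseSet_trivializationAt' x

lemma bset_mem_nhds (hx : x ∈ bset F E x₀) : bset F E x₀ ∈ 𝓝 x :=
  (trivializationAt F E x₀).open_baseSet.mem_nhds hx

variable (F E) in
lemma contMDiffAt_gtriv [ContMDiffVectorBundle ω F E 𝓘T]
  (h₀ : x ∈ bset F E x₀) (h₁ : x ∈ bset F E x₁) :
  ContMDiffAt 𝓘T 𝓘(ℂ, F →L[ℂ] F) ω (gtriv F E x₀ x₁) x :=
  contMDiffAt_coordChangeL h₀ h₁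

variable (F E) in
lemma smoothAnalytic_gtriv [ContMDiffVectorBundle ω F E 𝓘T]
  (h₀ : x ∈ bset F E x₀) (h₁ : x ∈ bset F E x₁) : D.IsSmoothAnalyticAt x (gtriv F E x₀ x₁) :=
  isSmoothAnalyticAt_of_holomorphic (by
    filter_upwards [bset_mem_nhds h₀, bset_mem_nhds h₁] with y h₀ h₁
    exact contMDiffAt_gtriv F E h₀ h₁)

lemma coef_change (hψ : D.IsVertChart ψ) (hψ' : D.IsVertChart ψ') (hx : x ∈ ψ.source)
  (hx' : x ∈ ψ'.source) (h₀ : x ∈ bset F E x₀) (h₁ : x ∈ bset F E x₁) (α : ∀ x, D.RelForm E p x) :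
  ∀ᶠ y in 𝓝 x, ContinuousLinearMap.compContinuousAlternatingMapCLM ℂ (Fib m) F F (Fin p)
  (gtriv F E x₀ x₁ y) ((D.coef F E ψ x₀ α y).compContinuousLinearMap (cbar ψ ψ' y)) =
  D.coef F E ψ' x₁ α y := by
  filter_upwards [ψ.open_source.mem_nhds hx, ψ'.open_source.mem_nhds hx', bset_mem_nhds h₀,
    bset_mem_nhds h₁] with y b₁ b₂ b₃ b₄
  exact (flat_change hψ hψ' b₁ b₂ b₃ b₄ _).symm

variable [ContMDiffVectorBundle ω F E 𝓘(ℂ, Tot m N)]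

lemma smoothAnalytic_coef_change (hψ : D.IsVertChart ψ) (hψ' : D.IsVertChart ψ')
  (hx : x ∈ ψ.source) (hx' : x ∈ ψ'.source) (h₀ : x ∈ bset F E x₀) (h₁ : x ∈ bset F E x₁)
  {α : ∀ x, D.RelForm E p x} (h : D.IsSmoothAnalyticAt x (D.coef F E ψ x₀ α)) :
  D.IsSmoothAnalyticAt x (D.coef F E ψ' x₁ α) :=
  ((smoothAnalytic_gtriv F E h₀ h₁).bilin (h.formComp (hψ.smoothAnalytic_cbar hψ' hx hx'))
    (ContinuousLinearMap.compContinuousAlternatingMapCLM ℂ _ F F (Fin p))).congr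
    (coef_change hψ hψ' hx hx' h₀ h₁ α)

lemma fdbar_change (hψ : D.IsVertChart ψ) (hψ' : D.IsVertChart ψ')
  (hx : x ∈ ψ.source) (hx' : x ∈ ψ'.source) (h₀ : x ∈ bset F E x₀) (h₁ : x ∈ bset F E x₁)
  {α : ∀ x, D.RelForm E p x} (h : D.IsSmoothAnalyticAt x (D.coef F E ψ x₀ α)) :
  fdbar ψ' (D.coef F E ψ' x₁ α) x = (gtriv F E x₀ x₁ x).compContinuousAlternatingMap
  ((fdbar ψ (D.coef F E ψ x₀ α) x).compContinuousLinearMap (cbar ψ ψ' x)) := by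
  have hc := hψ.smoothAnalytic_cbar hψ' hx hx'
  rw [fdbar, ← vbar_congr hx' (coef_change hψ hψ' hx hx' h₀ h₁ α),
    vbar_bilin (((smoothAnalytic_gtriv F E h₀ h₁).contDiffAt_symm hψ' hx').differentiableAt (by simp))
      (((h.formComp hc).contDiffAt_symm hψ' hx').differentiableAt (by simp))
      (vbar_eq_zero hψ' hx' (contMDiffAt_gtriv F E h₀ h₁)) hx', alternatize_comp]
  congr 1
  have e := dbarStd_formComp (b := fun p => D.coef F E ψ x₀ α (ψ'.symm p))
    (W' := fun p => star (ψ (ψ'.symm p)).1) (q := ψ' x)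
    (T := vbar ψ (D.coef F E ψ x₀ α) x) ((h.contDiffAt_symm hψ' hx').differentiableAt (by simp))
    ((hψ.smoothAnalytic_star hx).contDiffAt_symm hψ' hx')
    (vbar_change hψ hψ' hx hx' ((h.contDiffAt_symm hψ hx).differentiableAt (by simp)))
  refine Eq.trans (dbarStd_congr ?_) e
  filter_upwards [ψ'.open_target.mem_nhds (ψ'.map_source hx')] with p hp
  rw [cbar, vbar, ψ'.right_inv hp]

lemma mem_smoothForms_iff (hψ : D.IsVertChart ψ) (hx : x ∈ ψ.source) (h₀ : x ∈ bset F E x₀)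
  {α : ∀ x, D.RelForm E p x} : α ∈ (D.smoothForms F E p).at_ x ↔
  D.IsSmoothAnalyticAt x (D.coef F E ψ x₀ α) := by
  constructor
  · intro h
    obtain ⟨ψ', h'⟩ := D.exists_isRelChart x
    obtain ⟨a, ha, hr⟩ := h ψ' h'
    obtain ⟨L, hL⟩ := exists_clm_leftInverse (realForm : CForm m p F →ₗ[ℂ] _) realForm_injective
    refine smoothAnalytic_coef_change h'.isVertChart hψ h'.mem_source hx (mem_bset x) h₀
      ((ha.clm L).congr ?_)
    filter_upwards [hr, ψ'.open_source.mem_nhds h'.mem_source] with y h₁ h₂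
    rw [← hL (D.coef F E ψ' x α y)]
    congr 1
    ext v
    rw [realForm_apply, coef, flat_apply, h₁]
    simp [h'.isVertChart.dz_lift h₂]
  · intro h ψ' h'
    have h₁ := smoothAnalytic_coef_change hψ h'.isVertChart hx h'.mem_source h₀ (mem_bset x) h
    refine ⟨_, h₁.clm (LinearMap.toContinuousLinearMap realForm), ?_⟩
    filter_upwards [ψ'.open_source.mem_nhds h'.mem_source] with y hy w
    exact (flat_dz h'.isVertChart hy (α y) w).symm

lemma eventually_mem_smoothForms {α : ∀ x, D.RelForm E p x}
  (h : α ∈ (D.smoothForms F E p).at_ x) : ∀ᶠ y in 𝓝 x, α ∈ (D.smoothForms F E p).at_ y := by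
  obtain ⟨ψ, hψ⟩ := D.exists_isRelChart x
  filter_upwards [((mem_smoothForms_iff hψ.isVertChart hψ.mem_source (mem_bset x)).1 h).eventually,
    ψ.open_source.mem_nhds hψ.mem_source, bset_mem_nhds (F := F) (E := E) (mem_bset x)]
    with y h₁ h₂ h₃
  exact (mem_smoothForms_iff hψ.isVertChart h₂ h₃).2 h₁

/-- The Dolbeault operator in the coordinates of any vertical chart. -/
lemma coef_dForm (hψ : D.IsVertChart ψ) (hx : x ∈ ψ.source) (h₀ : x ∈ bset F E x₀)
  {α : ∀ x, D.RelForm E p x} (h : α ∈ (D.smoothForms F E p).at_ x) :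
  D.coef F E ψ x₀ (D.dForm F α) x = fdbar ψ (D.coef F E ψ x₀ α) x := by
  have h' := (D.exists_isRelChart x).choose_spec
  rw [fdbar_change h'.isVertChart hψ h'.mem_source hx (mem_bset x) h₀
    ((mem_smoothForms_iff h'.isVertChart h'.mem_source (mem_bset x)).1 h), coef,
    flat_change h'.isVertChart hψ h'.mem_source hx (mem_bset x) h₀, dForm,
    flat_unflat h'.isVertChart h'.mem_source (mem_bset x)]

lemma fdbar_eq_dbar (hψ : D.IsVertChart ψ) (hx : x ∈ ψ.source) {f : 𝒳 → CForm m p F}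
  {h : Crd → CForm m p F} (hs : SmoothKer Dirs (D.smoothCoord x x) h)
  (e : ∀ᶠ y in 𝓝 x, f y = h (D.smoothCoord x y)) :
  ∀ᶠ y in 𝓝 x, fdbar ψ f y = dbar (D.vertZ x ψ) (D.vertW x ψ) h (D.smoothCoord x y) := by
  filter_upwards [vbar_eq_pop hψ hx hs e] with y hy
  rw [fdbar, hy]
  rfl

lemma dForm_mem {α : ∀ x, D.RelForm E p x} (h : α ∈ (D.smoothForms F E p).at_ x) :
  D.dForm F α ∈ (D.smoothForms F E (p + 1)).at_ x := by
  obtain ⟨ψ, hψ⟩ := D.exists_isRelChart x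
  rw [mem_smoothForms_iff hψ.isVertChart hψ.mem_source (mem_bset x)]
  refine ((((mem_smoothForms_iff hψ.isVertChart hψ.mem_source (mem_bset x)).1 h).vbar
    hψ.isVertChart hψ.mem_source).clm
    (ContinuousAlternatingMap.alternatizeUncurryFinCLM ℂ (Fib m) F)).congr ?_
  filter_upwards [eventually_mem_smoothForms h, ψ.open_source.mem_nhds hψ.mem_source,
    bset_mem_nhds (F := F) (E := E) (mem_bset x)] with y h₁ h₂ h₃
  exact (coef_dForm hψ.isVertChart h₂ h₃ h₁).symm

lemma isDbarAt_dForm {α : ∀ x, D.RelForm E p x} (h : α ∈ (D.smoothForms F E p).at_ x) :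
  D.IsDbarAt F E x α (D.dForm F α) := by
  intro ψ hψ a b ha hb
  have hs := (((mem_smoothForms_iff hψ.isVertChart hψ.mem_source (mem_bset x)).1 h).contDiffAt_symm
    hψ.isVertChart hψ.mem_source).differentiableAt (by simp)
  have key {p : ℕ} {α : ∀ x, D.RelForm E p x} {a} (ha : D.Represents F E x ψ α a) :
      ∀ᶠ y in 𝓝 x, a y = realForm (D.coef F E ψ x α y) := by
    filter_upwards [ha, ψ.open_source.mem_nhds hψ.mem_source] with y h₁ h₂
    ext v
    rw [realForm_apply, coef, flat_apply, h₁]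
    simp [hψ.isVertChart.dz_lift h₂]
  rw [(key hb).self_of_nhds, coef_dForm hψ.isVertChart hψ.mem_source (mem_bset x) h, coordDbar,
    fdbar]
  refine (realForm_alternatize _ _ fun v => ?_).symm
  let R : CForm m p F →L[ℂ] Fib m [⋀^Fin p]→L[ℝ] F := LinearMap.toContinuousLinearMap realForm
  have h₁ : HasFDerivAt (fun z => D.coef F E ψ x α (ψ.symm (z, (ψ x).2))) _ (ψ x).1 :=
    HasFDerivAt.comp (ψ x).1 (f := fun z => (z, (ψ x).2)) hs.hasFDerivAt
      (hasFDerivAt_prodMk_left _ _)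
  have h₂ : HasFDerivAt (fun z => a (ψ.symm (z, (ψ x).2))) _ (ψ x).1 :=
    ((R.restrictScalars ℝ).hasFDerivAt.comp (ψ x).1 h₁).congr_of_eventuallyEq (by
      have hc : Tendsto (fun z => ψ.symm (z, (ψ x).2)) (𝓝 (ψ x).1) (𝓝 x) :=
        (ψ.tendsto_symm hψ.mem_source).comp ((Continuous.prodMk_left (ψ x).2).tendsto (ψ x).1)
      exact hc.eventually (key ha))
  rw [h₂.fderiv, vbar, pbar_of_slice hs h₁, star_star]
  refine Eq.trans ?_ (congrArg R rfl)
  rw [map_smul, map_add, map_smul]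
  rfl

end Deformation

/-! ## Vanishing along the parameters: complements -/

section vanishing

variable [FiniteDimensional ℂ Θ] {Z W : Fib m × Θ → Fib m} {q₀ : Fib m × Θ}

lemma IsFrame.vanishTo_pop (h : IsFrame (antiDirs m Θ) q₀ Z W) {a : Fib m × Θ → G}
  (hs : SmoothNear q₀ a) (hv : VanishTo q₀ k a) : VanishTo q₀ k (pop Z W a) :=
  ((hv.dfst hs).clm ((complexify (m := m) (G := G)).restrictScalars ℝ)).bilin
    ((ContinuousLinearMap.restrictScalarsL ℂ _ _ ℝ ℝ).comp
      ((compL ℂ (Fib m) (Fib m × Fib m) G).restrictScalars ℝ))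
    (.of_continuousAt h.smoothKer_inverse.smooth.self_of_nhds.continuousAt)

lemma IsFrame.vanishTo_of_comp (h : IsFrame (antiDirs m Θ) q₀ Z W) {g : Fib m × Θ → G}
  (hv : VanishTo q₀ k fun q => g (frameChart Z q)) : VanishTo (frameChart Z q₀) k g := by
  have : FiniteDimensional ℝ Θ := Module.Finite.trans ℂ Θ
  have : CompleteSpace Θ := FiniteDimensional.complete ℝ Θ
  obtain ⟨Ψ, hΨ⟩ := h.exists_inverse
  obtain ⟨C, hC⟩ := hv
  refine ⟨C, ?_⟩
  filter_upwards [hΨ.tendsto.eventually hC, hΨ.right] with p h₁ h₂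
  have h₃ : (Ψ p).2 = p.2 := (congrArg Prod.snd h₂ : (frameChart Z (Ψ p)).2 = p.2)
  rw [h₂, h₃] at h₁
  exact h₁

lemma exists_analytic_division [CompleteSpace G] {g : Fib m × Θ → G} (hg : AnalyticAt ℂ g q₀)
  (hv : VanishTo q₀ k g) : ∃ (ι : Type) (_ : Fintype ι) (c : ι → Fin k → Θ →ₗ[ℂ] ℂ)
  (f : ι → Fib m × Θ → G), (∀ i, AnalyticAt ℂ (f i) q₀) ∧
  ∀ᶠ q in 𝓝 q₀, g q = ∑ i, (∏ l, c i l (q.2 - q₀.2)) • f i q := by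
  let S : Set ((Fib m × Θ) × (Fib m × Θ)) :=
    antiDirs m Θ ∪ Set.range fun v : Fib m => ((v, 0), (I • v, 0))
  have hS : IsSplit S := by
    rintro _ (⟨b, rfl⟩ | ⟨v, rfl⟩)
    · exact Or.inl ⟨rfl, rfl⟩
    · exact Or.inr ⟨rfl, rfl⟩
  have hgs : SmoothKer S q₀ g := by
    refine ⟨hg.eventually_analyticAt.mono fun _ h => h.contDiffAt.restrict_scalars ℝ, ?_⟩
    have key (v : Fib m × Θ) : ∀ᶠ q in 𝓝 q₀, cderiv v (I • v) g q = 0 := by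
      filter_upwards [hg.eventually_analyticAt] with q hq
      rw [cderiv, (hq.differentiableAt.hasFDerivAt.restrictScalars ℝ).fderiv]
      simp [smul_smul]
    rintro _ (⟨b, rfl⟩ | ⟨v, rfl⟩)
    · simpa using key (0, b)
    · simpa using key (v, 0)
  obtain ⟨ι, hι, c, f, hf, e⟩ := exists_division_pow hS Set.subset_union_left k hgs hv
  refine ⟨ι, hι, c, f, fun i => analyticAt_of_smooth (hf i).smooth ?_, e⟩
  have h₁ := ((hf i).mono Set.subset_union_left).eventually_forall
  have h₂ : ∀ᶠ q in 𝓝 q₀, ∀ j : Fin m, pbar (f i) q (Pi.single j 1) = 0 :=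
    eventually_all.2 fun j => ((hf i).ker _ (Or.inr ⟨star (Pi.single j 1), rfl⟩)).mono fun q hq => by
      rw [pbar_apply, hq, smul_zero]
  filter_upwards [(hf i).differentiable, h₁, h₂] with q b₁ b₂ b₃
  refine differentiableAt_complex b₁ (clm_ext fun v => ?_) b₂
  rw [pi_eq_sum_univ' v, map_sum]
  exact Finset.sum_eq_zero fun j _ => by rw [map_smul, b₃, smul_zero]

end vanishing

/-! ## The powers of the ideal -/

namespace Deformation

variable [T2Space B]

section general

variable {T T' : 𝒳 → Type} [∀ y, AddCommGroup (T y)] [∀ y, Module ℂ (T y)]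
  [∀ y, AddCommGroup (T' y)] [∀ y, Module ℂ (T' y)] {P : LocalCondition T} {Q : LocalCondition T'}
  {s : ∀ y, T y}

lemma mem_idealMul_of_ne (hx : D.π x ≠ D.b₀) (hs : ∀ᶠ y in 𝓝 x, s ∈ P.at_ y) :
  s ∈ (D.idealMul P k).at_ x := by
  classical
  have hn : ∀ᶠ b in 𝓝 (D.π x), b ≠ D.b₀ := isOpen_ne.mem_nhds hx
  refine ⟨hs.self_of_nhds, Submodule.subset_span
    ⟨fun _ b => if b = D.b₀ then 0 else 1, s, fun l => ⟨?_, if_pos rfl⟩, hs, ?_⟩⟩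
  · exact (contMDiffAt_const (c := (1 : ℂ))).congr_of_eventuallyEq
      (hn.mono fun b hb => if_neg hb)
  · filter_upwards [D.holomorphic_π.continuous.continuousAt.eventually hn] with y hy
    simp [hy]

lemma idealMul_map (L : ∀ y, T y →ₗ[ℂ] T' y)
  (hL : ∀ y, ∀ a ∈ P.at_ y, (fun z => L z (a z)) ∈ Q.at_ y) (hs : s ∈ (D.idealMul P k).at_ x) :
  (fun z => L z (s z)) ∈ (D.idealMul Q k).at_ x := by
  refine ⟨hL x s hs.1, ?_⟩
  let M : (∀ y, T y) →ₗ[ℂ] ∀ y, T' y := LinearMap.pi fun y => (L y).comp (LinearMap.proj y)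
  refine Submodule.span_le (p := Submodule.comap M (Submodule.span ℂ _)) |>.2 ?_ hs.2
  rintro s ⟨f, a, hf, ha, e⟩
  exact Submodule.subset_span ⟨f, M a, hf, ha.mono fun y hy => hL y a hy,
    e.mono fun y hy => (congrArg (L y) hy).trans (map_smul _ _ _)⟩

lemma eventually_mem_idealMul (hP : ∀ s x, s ∈ P.at_ x → ∀ᶠ y in 𝓝 x, s ∈ P.at_ y)
    (hs : s ∈ (D.idealMul P k).at_ x) : ∀ᶠ y in 𝓝 x, s ∈ (D.idealMul P k).at_ y := by
  have := isManifold_real (E := Bas N) B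
  refine (hP s x hs.1).and ?_
  obtain ⟨-, h⟩ := hs
  induction h using Submodule.span_induction with
  | mem s h =>
    obtain ⟨f, a, hf, ha, e⟩ := h
    have hf' : ∀ᶠ y in 𝓝 x, ∀ l, ContMDiffAt 𝓘(ℝ, Bas N) 𝓘(ℝ, ℂ) ω (f l) (D.π y) :=
      eventually_all.2 fun l =>
        D.holomorphic_π.continuous.continuousAt.eventually ((contMDiffAt_iff_contMDiffAt_nhds (by simp)).1 (hf l).1)
    filter_upwards [hf', eventually_eventually_nhds.2 ha, eventually_eventually_nhds.2 e]
      with y h₁ h₂ h₃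
    exact Submodule.subset_span ⟨f, a, fun l => ⟨h₁ l, (hf l).2⟩, h₂, h₃⟩
  | zero => exact Eventually.of_forall fun y => Submodule.zero_mem _
  | add s t _ _ h h' => filter_upwards [h, h'] with y h h' using Submodule.add_mem _ h h'
  | smul c s _ h => filter_upwards [h] with y h using Submodule.smul_mem _ c h

lemma isBigO_of_mem_idealMul (κ : ∀ y, T y →ₗ[ℂ] G)
    (hκ : ∀ a ∈ P.at_ x, ContinuousAt (fun y => κ y (a y)) x)
    (hx : D.π x = D.b₀) (hs : s ∈ (D.idealMul P k).at_ x) :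
    ∃ C, ∀ᶠ y in 𝓝 x, ‖κ y (s y)‖ ≤ C * ‖D.baseCoord x y - D.baseCoord x x‖ ^ k := by
  suffices h : (fun y => κ y (s y)) =O[𝓝 x] fun y => ‖D.baseCoord x y - D.baseCoord x x‖ ^ k by
    obtain ⟨C, hC⟩ := h.bound
    exact ⟨C, hC.mono fun y hy => hy.trans (le_of_eq (by simp))⟩
  obtain ⟨-, h⟩ := hs
  induction h using Submodule.span_induction with
  | mem s h =>
    obtain ⟨f, a, hf, ha, e⟩ := h
    have key (l) : (fun y => f l (D.π y)) =O[𝓝 x] fun y =>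
        ‖D.baseCoord x y - D.baseCoord x x‖ := by
      have := isManifold_real (E := Bas N) B
      have h₁ := ((contMDiffAt_iff_of_mem_source (mem_chart_source (Bas N) (D.π x))
        (mem_chart_source ℂ (f l (D.π x)))).1 (hf l).1).2
      simp only [mfld_simps] at h₁
      have h₂ := ((contDiffWithinAt_univ.1 h₁).differentiableAt (by simp)).hasFDerivAt.isBigO_sub
      have hc : Tendsto (D.baseCoord x) (𝓝 x) (𝓝 (D.baseCoord x x)) :=
        ((chartAt (Bas N) (D.π x)).continuousAt (mem_chart_source _ _)).tendsto.comp
          D.holomorphic_π.continuous.continuousAt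
      refine ((h₂.comp_tendsto hc).congr' ?_ .rfl).norm_right
      filter_upwards [D.holomorphic_π.continuous.continuousAt.eventually
        ((chartAt (Bas N) (D.π x)).open_source.mem_nhds (mem_chart_source _ _))] with y hy
      have e₁ := (chartAt (Bas N) (D.π x)).left_inv hy
      have e₂ := (chartAt (Bas N) (D.π x)).left_inv (mem_chart_source _ (D.π x))
      simp only [Function.comp_apply, baseCoord, e₁, e₂]
      rw [hx, (hf l).2]
      exact sub_zero _
    have h₁ := (Asymptotics.IsBigO.finsetProd (s := Finset.univ) fun l _ => key l).smul
      ((hκ a ha.self_of_nhds).norm.isBoundedUnder_le.isBigO_one ℝ)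
    refine (h₁.congr' ?_ (.of_forall fun y => ?_))
    · filter_upwards [e] with y hy
      rw [hy, map_smul]
    · simp
  | zero => simpa using Asymptotics.isBigO_zero _ _
  | add s t _ _ h h' => simpa using h.add h'
  | smul c s _ h => exact (h.const_smul_left c).congr_left fun y => (map_smul _ _ _).symm

lemma mem_idealMul_of_sum (hs : s ∈ P.at_ x) (hx : D.π x = D.b₀) {ι : Type} [Fintype ι]
  (c : ι → Fin k → Dbl →ₗ[ℂ] ℂ) (a : ι → ∀ y, T y) (ha : ∀ i, ∀ᶠ y in 𝓝 x, a i ∈ P.at_ y)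
  (e : ∀ᶠ y in 𝓝 x, s y = ∑ i, (∏ l, c i l ((D.smoothCoord x y).2 - (D.smoothCoord x x).2)) • a i y) :
  s ∈ (D.idealMul P k).at_ x := by
  have := isManifold_real (E := Bas N) B
  let φ (b : B) : Bas N := chartAt (Bas N) (D.π x) b
  let f (i l) (b : B) : ℂ := c i l ((φ b, star (φ b)) - (φ (D.π x), star (φ (D.π x))))
  have hφ : ContMDiffAt 𝓘(ℝ, Bas N) 𝓘(ℝ, Bas N) ω φ (D.π x) :=
    contMDiffAt_of_mem_maximalAtlas (chart_mem_maximalAtlas (D.π x))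
      (mem_chart_source _ _)
  have hf (i l) : ContMDiffAt 𝓘(ℝ, Bas N) 𝓘(ℝ, ℂ) ω (f i l) (D.π x) :=
    ContMDiffAt.comp (D.π x) (I' := 𝓘(ℝ, Bas N)) (f := φ)
      (g := fun t => c i l ((t, star t) - (φ (D.π x), star (φ (D.π x))))) (ContDiffAt.contMDiffAt (by
        let L := ((LinearMap.toContinuousLinearMap (c i l)).restrictScalars ℝ).comp
          ((idCLM ℝ (Bas N)).prod (conjCLM N))
        have e : (fun t => c i l ((t, star t) - (φ (D.π x), star (φ (D.π x))))) = fun t => L t - c i l (φ (D.π x), star (φ (D.π x))) :=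
          funext fun t => map_sub (c i l) _ _
        rw [e]
        exact (L.contDiff.sub contDiff_const).contDiffAt)) hφ
  have hs' : (fun y => ∑ i, (∏ l, f i l (D.π y)) • a i y) ∈ (D.idealMul P k).at_ x := by
    have h₁ : (fun y => ∑ i, (∏ l, f i l (D.π y)) • a i y) =
      ∑ i, fun y => (∏ l, f i l (D.π y)) • a i y := by
      funext y
      simp
    refine ⟨P.congr_at x s _ e hs, ?_⟩
    rw [h₁]
    exact Submodule.sum_mem _ fun i _ => Submodule.subset_span
      ⟨f i, a i, fun l => ⟨hf i l, (congrArg (c i l) (by rw [hx, sub_self])).trans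
        (map_zero _)⟩, ha i, Eventually.of_forall fun y => rfl⟩
  exact (D.idealMul P k).congr_at x _ s (e.mono fun y hy => hy.symm) hs'

end general

end Deformation

namespace Deformation

variable [T2Space B]

/-! ## Germs of relative forms in coordinates -/

variable [FiniteDimensional ℂ F] [ContMDiffVectorBundle ω F E 𝓘(ℂ, Tot m N)]
  {α β : ∀ y, D.RelForm E p y} {a b : Fib m × (Bas N × Bas N) → CForm m p F}

variable (F) in
/-- The germ at `x` of the form `α` is given, in the coordinates of `ψ`, by the germ `a`. -/
structure IsCoord (ψ : VChart) (x : 𝒳) (α : ∀ y, D.RelForm E p y) (a : Crd → CForm m p F) :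
  Prop where
  smooth : SmoothKer Dirs (D.smoothCoord x x) a
  eq : ∀ᶠ y in 𝓝 x, D.coef F E ψ x α y = a (D.smoothCoord x y)

lemma exists_isCoord (hψ : D.IsRelChart x ψ) (h : α ∈ (D.smoothForms F E p).at_ x) :
  ∃ a, IsCoord F ψ x α a := by
  obtain ⟨a, h₁, h₂⟩ := isSmoothAnalyticAt_iff.1
    ((mem_smoothForms_iff hψ.isVertChart hψ.mem_source (mem_bset x)).1 h)
  exact ⟨a, h₁, h₂⟩

lemma eventually_good (hψ : D.IsRelChart x ψ) : ∀ᶠ y in 𝓝 x, y ∈ ψ.source ∧ y ∈ bset F E x :=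
  Filter.Eventually.and (ψ.open_source.mem_nhds hψ.mem_source) (bset_mem_nhds (mem_bset x))

lemma IsCoord.mem (hψ : D.IsRelChart x ψ) (h : IsCoord F ψ x α a) :
  α ∈ (D.smoothForms F E p).at_ x :=
  (mem_smoothForms_iff hψ.isVertChart hψ.mem_source (mem_bset x)).2
    (isSmoothAnalyticAt_iff.2 ⟨a, h.smooth, h.eq⟩)

lemma exists_form (hψ : D.IsRelChart x ψ) (h : SmoothKer Dirs (D.smoothCoord x x) a) :
  ∃ α : ∀ y, D.RelForm E p y, IsCoord F ψ x α a :=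
  ⟨fun y => D.unflat F E ψ x y (a (D.smoothCoord x y)), h,
    (eventually_good (F := F) (E := E) hψ).mono fun _ hy => flat_unflat hψ.isVertChart hy.1 hy.2 _⟩

namespace IsCoord

lemma dForm (hψ : D.IsRelChart x ψ) (h : IsCoord F ψ x α a) :
  IsCoord F ψ x (D.dForm F α) (dbar (D.vertZ x ψ) (D.vertW x ψ) a) := by
  refine ⟨(hψ.isVertChart.isFrame hψ.mem_source).smoothKer_dbar h.smooth, ?_⟩
  filter_upwards [fdbar_eq_dbar hψ.isVertChart hψ.mem_source h.smooth h.eq,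
    eventually_good (F := F) (E := E) hψ, eventually_mem_smoothForms (h.mem hψ)] with y h₁ h₂ h₃
  rw [coef_dForm hψ.isVertChart h₂.1 h₂.2 h₃, h₁]

lemma add (h : IsCoord F ψ x α a) (h' : IsCoord F ψ x β b) : IsCoord F ψ x (α + β) (a + b) :=
  ⟨h.smooth.add h'.smooth, by
    filter_upwards [h.eq, h'.eq] with y h₁ h₂
    exact (map_add (D.flat F E ψ x y) _ _).trans (congrArg₂ _ h₁ h₂)⟩

lemma sub (h : IsCoord F ψ x α a) (h' : IsCoord F ψ x β b) : IsCoord F ψ x (α - β) (a - b) :=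
  ⟨h.smooth.sub h'.smooth, by
    filter_upwards [h.eq, h'.eq] with y h₁ h₂
    exact (map_sub (D.flat F E ψ x y) _ _).trans (congrArg₂ _ h₁ h₂)⟩

lemma smul (c : ℂ) (h : IsCoord F ψ x α a) :
  IsCoord F ψ x (c • α) (fun q => (c • idCLM ℂ (CForm m p F)) (a q)) :=
  ⟨h.smooth.clm_comp _, by
    filter_upwards [h.eq] with y h₁
    exact (map_smul (D.flat F E ψ x y) _ _).trans (congrArg _ h₁)⟩

lemma eventually_eq (hψ : D.IsRelChart x ψ) (h : IsCoord F ψ x α a) (h' : IsCoord F ψ x β b)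
  (e : ∀ᶠ q in 𝓝 (D.smoothCoord x x), a q = b q) : ∀ᶠ y in 𝓝 x, α y = β y := by
  filter_upwards [h.eq, h'.eq, tendsto_smoothCoord.eventually e,
    eventually_good (F := F) (E := E) hψ] with y h₁ h₂ h₃ h₄
  exact flat_injective hψ.isVertChart h₄.1 h₄.2 (h₁.trans (h₃.trans h₂.symm))

lemma eventually_zero (h : IsCoord F ψ x α a) (e : ∀ᶠ y in 𝓝 x, α y = 0) :
  ∀ᶠ q in 𝓝 (D.smoothCoord x x), a q = 0 :=
  eventually_eq_zero_of_smoothCoord h.smooth (by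
    filter_upwards [h.eq, e] with y h₁ h₂
    rw [← h₁, coef, h₂, map_zero])

lemma mem_idealMul_iff (hψ : D.IsRelChart x ψ) (hx : D.π x = D.b₀) (h : IsCoord F ψ x α a) :
  α ∈ (D.idealMul (D.smoothForms F E p) k).at_ x ↔ VanishTo (D.smoothCoord x x) k a := by
  constructor
  · intro hα
    obtain ⟨C, hC⟩ := isBigO_of_mem_idealMul (fun y => D.flat F E ψ x y) (fun β hβ =>
      ((mem_smoothForms_iff hψ.isVertChart hψ.mem_source (mem_bset x)).1 hβ).continuousAt) hx hα
    refine vanishTo_of_smoothCoord h.smooth ⟨C, ?_⟩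
    filter_upwards [hC, h.eq] with y h₁ h₂
    rwa [← h₂]
  · intro hv
    obtain ⟨ι, _, c, g, hg, e⟩ := exists_division_pow
      (fun p hp => by obtain ⟨b, rfl⟩ := hp; exact Or.inl ⟨rfl, rfl⟩) subset_rfl k h.smooth hv
    choose γ hγ using fun i => exists_form (E := E) hψ (hg i)
    refine mem_idealMul_of_sum (h.mem hψ) hx c γ
      (fun i => eventually_mem_smoothForms ((hγ i).mem hψ)) ?_
    filter_upwards [h.eq, eventually_all.2 fun i => (hγ i).eq, tendsto_smoothCoord.eventually e,
      eventually_good (F := F) (E := E) hψ] with y h₁ h₂ h₃ h₄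
    refine flat_injective hψ.isVertChart h₄.1 h₄.2 (h₁.trans (h₃.trans ?_))
    rw [map_sum]
    exact Finset.sum_congr rfl fun i _ => (congrArg _ (h₂ i)).symm.trans (map_smul _ _ _).symm

end IsCoord

/-! ## The Dolbeault complex of germs -/

lemma eventually_dForm_add (hα : α ∈ (D.smoothForms F E p).at_ x)
  (hβ : β ∈ (D.smoothForms F E p).at_ x) :
  ∀ᶠ y in 𝓝 x, D.dForm F (α + β) y = D.dForm F α y + D.dForm F β y := by
  obtain ⟨ψ, hψ⟩ := D.exists_isRelChart x
  obtain ⟨a, ha⟩ := exists_isCoord hψ hα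
  obtain ⟨b, hb⟩ := exists_isCoord hψ hβ
  refine ((ha.add hb).dForm hψ).eventually_eq hψ ((ha.dForm hψ).add (hb.dForm hψ)) ?_
  filter_upwards [ha.smooth.differentiable, hb.smooth.differentiable] with q h₁ h₂
  exact dbar_add h₁ h₂

lemma eventually_dForm_smul (c : ℂ) (hα : α ∈ (D.smoothForms F E p).at_ x) :
  ∀ᶠ y in 𝓝 x, D.dForm F (c • α) y = c • D.dForm F α y := by
  obtain ⟨ψ, hψ⟩ := D.exists_isRelChart x
  obtain ⟨a, ha⟩ := exists_isCoord hψ hα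
  refine ((ha.smul c).dForm hψ).eventually_eq hψ ((ha.dForm hψ).smul c) ?_
  filter_upwards [ha.smooth.differentiable] with q h₁
  rw [dbar, pop_clm_comp h₁]
  ext v
  simp [dbar, ContinuousAlternatingMap.alternatizeUncurryFin_apply, Finset.smul_sum, smul_comm c]

lemma eventually_dForm_dForm (hα : α ∈ (D.smoothForms F E p).at_ x) :
  ∀ᶠ y in 𝓝 x, D.dForm F (D.dForm F α) y = 0 := by
  obtain ⟨ψ, hψ⟩ := D.exists_isRelChart x
  obtain ⟨a, ha⟩ := exists_isCoord hψ hα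
  filter_upwards [((ha.dForm hψ).dForm hψ).eq, tendsto_smoothCoord.eventually
    ((hψ.isVertChart.isFrame hψ.mem_source).dbar_dbar ha.smooth.smooth),
    eventually_good (F := F) (E := E) hψ] with y h₁ h₂ h₃
  exact flat_injective hψ.isVertChart h₃.1 h₃.2 (h₁.trans (h₂.trans (map_zero _).symm))

lemma exists_dForm_eq {α : ∀ y, D.RelForm E (p + 1) y} (hα : α ∈ (D.smoothForms F E (p + 1)).at_ x)
  (hd : ∀ᶠ y in 𝓝 x, D.dForm F α y = 0) :
  ∃ γ ∈ (D.smoothForms F E p).at_ x, ∀ᶠ y in 𝓝 x, D.dForm F γ y = α y := by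
  obtain ⟨ψ, hψ⟩ := D.exists_isRelChart x
  obtain ⟨a, ha⟩ := exists_isCoord hψ hα
  obtain ⟨c, hc, e⟩ := (hψ.isVertChart.isFrame hψ.mem_source).exists_primitive ha.smooth
    ((ha.dForm hψ).eventually_zero hd)
  obtain ⟨γ, hγ⟩ := exists_form (E := E) hψ hc
  exact ⟨γ, hγ.mem hψ, (hγ.dForm hψ).eventually_eq hψ ha e⟩

lemma exists_jet_dForm_eq {α : ∀ y, D.RelForm E (p + 1) y}
  (hα : α ∈ (D.smoothForms F E (p + 1)).at_ x)
  (hd : D.dForm F α ∈ (D.idealMul (D.smoothForms F E (p + 1 + 1)) k).at_ x) :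
  ∃ γ ∈ (D.smoothForms F E p).at_ x,
  α - D.dForm F γ ∈ (D.idealMul (D.smoothForms F E (p + 1)) k).at_ x := by
  by_cases hx : D.π x = D.b₀
  · obtain ⟨ψ, hψ⟩ := D.exists_isRelChart x
    obtain ⟨a, ha⟩ := exists_isCoord hψ hα
    obtain ⟨c, hc, e⟩ := (hψ.isVertChart.isFrame hψ.mem_source).exists_jet_primitive k ha.smooth
      (((ha.dForm hψ).mem_idealMul_iff hψ hx).1 hd)
    have h₁ := exists_form (E := E) (p := p) (a := c) hψ hc
    cases h₁ with
    | intro γ hγ =>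
    have h₂ := ha.sub (hγ.dForm hψ)
    have h₃ := (h₂.mem_idealMul_iff (k := k) hψ hx).2 e
    have h₄ := hγ.mem hψ
    exact ⟨γ, h₄, h₃⟩
  · have h₀ : (0 : ∀ y, D.RelForm E p y) ∈ (D.smoothForms F E p).at_ x := Submodule.zero_mem _
    have h₁ : α - D.dForm F (0 : ∀ y, D.RelForm E p y) ∈ (D.smoothForms F E (p + 1)).at_ x :=
      Submodule.sub_mem _ hα (dForm_mem h₀)
    exact ⟨0, h₀, mem_idealMul_of_ne hx (eventually_mem_smoothForms h₁)⟩

lemma dForm_mem_idealMul (hα : α ∈ (D.idealMul (D.smoothForms F E p) k).at_ x) :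
  D.dForm F α ∈ (D.idealMul (D.smoothForms F E (p + 1)) k).at_ x := by
  by_cases hx : D.π x = D.b₀
  · obtain ⟨ψ, hψ⟩ := D.exists_isRelChart x
    obtain ⟨a, ha⟩ := exists_isCoord hψ hα.1
    exact ((ha.dForm hψ).mem_idealMul_iff hψ hx).2
      (((hψ.isVertChart.isFrame hψ.mem_source).vanishTo_pop ha.smooth.smooth
        ((ha.mem_idealMul_iff hψ hx).1 hα)).clm
        ((ContinuousAlternatingMap.alternatizeUncurryFinCLM ℂ (Fib m) F
          (n := p)).restrictScalars ℝ))
  · exact mem_idealMul_of_ne hx (eventually_mem_smoothForms (dForm_mem hα.1))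

lemma subsingleton_relForm (F : Type) [NormedAddCommGroup F] [NormedSpace ℂ F]
  [FiniteDimensional ℂ F] (E : 𝒳 → Type) [TopologicalSpace (Bundle.TotalSpace F E)] [∀ x, TopologicalSpace (E x)]
  [∀ x, AddCommGroup (E x)] [∀ x, Module ℂ (E x)] [FiberBundle F E] [VectorBundle ℂ F E]
  (hp : m < p) (x : 𝒳) : Subsingleton (D.RelForm E p x) := by
  obtain ⟨ψ, hψ⟩ := D.exists_isRelChart x
  have : Subsingleton (CForm m p F) := ⟨fun a b => by
    ext v
    have hv : ¬ LinearIndependent ℂ v := fun h => by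
      have := h.fintype_card_le_finrank
      simp at this
      omega
    rw [← ContinuousAlternatingMap.coe_toAlternatingMap, AlternatingMap.map_linearDependent _ v hv,
      ← ContinuousAlternatingMap.coe_toAlternatingMap, AlternatingMap.map_linearDependent _ v hv]⟩
  exact (flat_injective (F := F) hψ.isVertChart hψ.mem_source (mem_bset x)).subsingleton

end Deformation

namespace Deformation

variable [T2Space B] [FiniteDimensional ℂ F]

/-! ## Sections as forms of degree zero -/

variable (D E) in
/-- A vector, as a form of degree `0`. -/
def zeroForm (y : 𝒳) : E y →ₗ[ℂ] D.RelForm E 0 y where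
  toFun v := ⟨AlternatingMap.constOfIsEmpty ℝ _ (Fin 0) v, fun _ j => j.elim0⟩
  map_add' _ _ := rfl
  map_smul' _ _ := rfl

variable (D) in
/-- A section, as a form of degree `0`. -/
def ofSec (s : ∀ y, E y) (y : 𝒳) : D.RelForm E 0 y := D.zeroForm E y (s y)

lemma ofSec_value (α : ∀ y, D.RelForm E 0 y) : D.ofSec (fun y => (α y).1 Fin.elim0) = α := by
  refine funext fun y => Subtype.ext (AlternatingMap.ext fun w => ?_)
  exact congrArg (α y).1 (Subsingleton.elim _ _)

variable (m F) in
/-- The forms of degree `0`. -/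
def constForm : F ≃ₗᵢ[ℂ] CForm m 0 F :=
  ContinuousAlternatingMap.constOfIsEmptyLIE ℂ (Fib m) F (Fin 0)

lemma coef_ofSec (s : ∀ y, E y) (x₀ : 𝒳) : D.coef F E ψ x₀ (D.ofSec s) =
  fun y => (constForm m F : F →L[ℂ] CForm m 0 F) (triv F E x₀ y (s y)) := rfl

lemma isSmoothAnalyticAt_constForm {f : 𝒳 → F} :
  D.IsSmoothAnalyticAt x (fun y => (constForm m F : F →L[ℂ] CForm m 0 F) (f y)) ↔
  D.IsSmoothAnalyticAt x f :=
  ⟨fun h => (h.clm ((constForm m F).symm : CForm m 0 F →L[ℂ] F)).congr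
    (.of_forall fun y => (constForm m F).symm_apply_apply (f y)), fun h => h.clm _⟩

variable [ContMDiffVectorBundle ω F E 𝓘(ℂ, Tot m N)] {s : ∀ y, E y}

lemma mem_analyticSections_iff : s ∈ (D.analyticSections F E).at_ x ↔
  D.ofSec s ∈ (D.smoothForms F E 0).at_ x ∧ ∀ᶠ y in 𝓝 x, D.dForm F (D.ofSec s) y = 0 := by
  obtain ⟨ψ, hψ⟩ := D.exists_isRelChart x
  rw [mem_smoothForms_iff hψ.isVertChart hψ.mem_source (mem_bset x), coef_ofSec,
    isSmoothAnalyticAt_constForm]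
  refine (isRelAnalyticAt_iff hψ.isVertChart hψ.mem_source).trans
    (and_congr_right fun hs => eventually_congr ?_)
  have hs' : D.ofSec s ∈ (D.smoothForms F E 0).at_ x :=
    (mem_smoothForms_iff hψ.isVertChart hψ.mem_source (mem_bset x)).2
      (isSmoothAnalyticAt_constForm.2 hs)
  filter_upwards [hs.eventually, eventually_good (F := F) (E := E) hψ,
    eventually_mem_smoothForms hs'] with y h₁ h₂ h₃
  rw [← (flat_injective (F := F) hψ.isVertChart h₂.1 h₂.2).eq_iff, map_zero]
  change _ ↔ D.coef F E ψ x (D.dForm F (D.ofSec s)) y = 0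
  have h₄ : vbar ψ (fun y => (constForm m F : F →L[ℂ] CForm m 0 F) (triv F E x y (s y))) y = _ :=
    pbar_clm_comp ((h₁.contDiffAt_symm hψ.isVertChart h₂.1).differentiableAt (by simp)) _
  rw [coef_dForm hψ.isVertChart h₂.1 h₂.2 h₃, coef_ofSec, fdbar, h₄]
  refine Iff.trans ?_ (Eq.congr_left (z := (0 : CForm m 1 F))
    (ContinuousAlternatingMap.alternatizeUncurryFin_constOfIsEmptyLIE_comp _).symm)
  exact ((ContinuousAlternatingMap.ofSubsingletonLIE (𝕜 := ℂ) (E := Fib m) (F := F) (0 : Fin 1)).map_eq_zero_iff).symm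

lemma eventually_mem_analyticSections (h : s ∈ (D.analyticSections F E).at_ x) :
  ∀ᶠ y in 𝓝 x, s ∈ (D.analyticSections F E).at_ y := by
  obtain ⟨h₁, h₂⟩ := mem_analyticSections_iff.1 h
  filter_upwards [eventually_mem_smoothForms h₁, eventually_eventually_nhds.2 h₂] with y h₁ h₂
  exact mem_analyticSections_iff.2 ⟨h₁, h₂⟩

/-- The analytic section with given coordinates. -/
lemma exists_analyticSection (hψ : D.IsRelChart x ψ) {g : Crd → F}
  (hg : AnalyticAt ℂ g (frameChart (D.vertZ x ψ) (D.smoothCoord x x))) :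
  ∃ s ∈ (D.analyticSections F E).at_ x,
  ∀ᶠ y in 𝓝 x, triv F E x y (s y) = g (frameChart (D.vertZ x ψ) (D.smoothCoord x y)) := by
  have h : ∀ᶠ y in 𝓝 x, triv F E x y (utriv F E x y
      (g (frameChart (D.vertZ x ψ) (D.smoothCoord x y)))) =
      g (frameChart (D.vertZ x ψ) (D.smoothCoord x y)) :=
    (eventually_good (F := F) (E := E) hψ).mono fun y hy => triv_utriv hy.2 _
  exact ⟨_, (isRelAnalyticAt_iff_frameChart hψ).2 ⟨g, hg, h⟩, h⟩

lemma mem_idealMul_analyticSections (hs : s ∈ (D.analyticSections F E).at_ x)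
  (h : D.ofSec s ∈ (D.idealMul (D.smoothForms F E 0) k).at_ x) :
  s ∈ (D.idealMul (D.analyticSections F E) k).at_ x := by
  by_cases hx : D.π x = D.b₀
  · obtain ⟨ψ, hψ⟩ := D.exists_isRelChart x
    have hfr := hψ.isVertChart.isFrame hψ.mem_source
    obtain ⟨g, hg, e⟩ := (isRelAnalyticAt_iff_frameChart hψ).1 hs
    have hc : IsCoord F ψ x (D.ofSec s) fun q => (constForm m F : F →L[ℂ] CForm m 0 F)
        (g (frameChart (D.vertZ x ψ) q)) :=
      ⟨(hfr.comp_analytic hg).1.clm_comp _, e.mono fun y hy => congrArg (constForm m F) hy⟩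
    have hv := hfr.vanishTo_of_comp (((hc.mem_idealMul_iff hψ hx).1 h).clm
      (((constForm m F).symm : CForm m 0 F →L[ℂ] F).restrictScalars ℝ) |>.congr
        (.of_forall fun q => (constForm m F).symm_apply_apply _))
    obtain ⟨ι, _, c, f, hf, e'⟩ := exists_analytic_division hg hv
    choose a ha ha' using fun i => exists_analyticSection (E := E) hψ (hf i)
    refine mem_idealMul_of_sum hs hx c a (fun i => eventually_mem_analyticSections (ha i)) ?_
    have ht : Tendsto (frameChart (D.vertZ x ψ)) (𝓝 (D.smoothCoord x x))
        (𝓝 (frameChart (D.vertZ x ψ) (D.smoothCoord x x))) :=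
      (contDiffAt_frameChart hfr.left.smooth.self_of_nhds).continuousAt
    filter_upwards [e, eventually_all.2 ha', (ht.comp tendsto_smoothCoord).eventually e',
      eventually_good (F := F) (E := E) hψ] with y h₁ h₂ h₃ h₄
    rw [← utriv_triv (F := F) h₄.2 (s y), h₁]
    refine (congrArg (utriv F E x y) h₃).trans ?_
    rw [map_sum]
    refine Finset.sum_congr rfl fun i _ => ?_
    rw [map_smul, ← utriv_triv (F := F) h₄.2 (a i y), h₂ i]
    rfl
  · exact mem_idealMul_of_ne hx (eventually_mem_analyticSections hs)

lemma exists_jet_ofSec_eq {α : ∀ y, D.RelForm E 0 y} (hα : α ∈ (D.smoothForms F E 0).at_ x)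
  (hd : D.dForm F α ∈ (D.idealMul (D.smoothForms F E (0 + 1)) k).at_ x) :
  ∃ s ∈ (D.analyticSections F E).at_ x,
  α - D.ofSec s ∈ (D.idealMul (D.smoothForms F E 0) k).at_ x := by
  by_cases hx : D.π x = D.b₀
  · obtain ⟨ψ, hψ⟩ := D.exists_isRelChart x
    have hfr := hψ.isVertChart.isFrame hψ.mem_source
    obtain ⟨a, ha⟩ := exists_isCoord hψ hα
    let κ : F →L[ℂ] CForm m 0 F := constForm m F
    let κ' : CForm m 0 F →L[ℂ] F := (constForm m F).symm
    have hκ (v) : κ (κ' v) = v := (constForm m F).apply_symm_apply v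
    let ρ : CForm m 1 F →L[ℂ] Fib m →L[ℂ] F :=
      (ContinuousAlternatingMap.ofSubsingletonLIE (𝕜 := ℂ) (E := Fib m) (F := F) (0 : Fin 1)).symm
    have hv : VanishTo (D.smoothCoord x x) k
        (pop (D.vertZ x ψ) (D.vertW x ψ) fun q => κ' (a q)) := by
      refine ((((ha.dForm hψ).mem_idealMul_iff hψ hx).1 hd).clm (ρ.restrictScalars ℝ)).congr ?_
      filter_upwards [ha.smooth.differentiable] with q hq
      have h₁ : a = fun q => κ (κ' (a q)) := funext fun q => (hκ _).symm
      have h₂ := pop_clm_comp (Z := D.vertZ x ψ) (W := D.vertW x ψ)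
        (κ'.restrictScalars ℝ |>.differentiableAt.comp q hq) κ
      refine Eq.trans ?_ ((ContinuousAlternatingMap.ofSubsingletonLIE
        (𝕜 := ℂ) (E := Fib m) (F := F) (0 : Fin 1)).symm_apply_apply _)
      refine congrArg ρ ?_
      rw [dbar, h₁]
      exact (congrArg _ h₂).trans
        (ContinuousAlternatingMap.alternatizeUncurryFin_constOfIsEmptyLIE_comp _)
    obtain ⟨g, hg, hg'⟩ := hfr.exists_jet_analytic k (ha.smooth.clm_comp κ') hv
    obtain ⟨s, hs, e⟩ := exists_analyticSection (E := E) hψ hg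
    have hc : IsCoord F ψ x (D.ofSec s) fun q => κ (g (frameChart (D.vertZ x ψ) q)) :=
      ⟨(hfr.comp_analytic hg).1.clm_comp _, e.mono fun y hy => congrArg κ hy⟩
    refine ⟨s, hs, ((ha.sub hc).mem_idealMul_iff hψ hx).2
      ((hg'.clm (κ.restrictScalars ℝ)).congr (.of_forall fun q => ?_))⟩
    exact (map_sub κ _ _).trans (congrArg₂ _ (hκ _) rfl)
  · have h₀ : (0 : ∀ y, E y) ∈ (D.analyticSections F E).at_ x := Submodule.zero_mem _
    exact ⟨0, h₀, mem_idealMul_of_ne hx (eventually_mem_smoothForms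
      (Submodule.sub_mem _ hα (mem_analyticSections_iff.1 h₀).1))⟩

end Deformation

/-! ## Operators on sheaves given by local conditions -/

section operators

variable {Y : Type} [TopologicalSpace Y] {T T' T'' : Y → Type}
  [∀ y, AddCommGroup (T y)] [∀ y, Module ℂ (T y)] [∀ y, AddCommGroup (T' y)] [∀ y, Module ℂ (T' y)]
  [∀ y, AddCommGroup (T'' y)] [∀ y, Module ℂ (T'' y)]

/-- A condition that holds near every point where it holds. -/
def LocalCondition.IsOpen (P : LocalCondition T) : Prop :=
  ∀ x, ∀ s ∈ P.at_ x, ∀ᶠ y in 𝓝 x, s ∈ P.at_ y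

/-- A local operator, linear on the sections of `P`, with values in the sections of `Q`. -/
structure LocalOp (P : LocalCondition T) (Q : LocalCondition T') where
  toFun : (∀ y, T y) → ∀ y, T' y
  congr : ∀ x s s', (∀ᶠ y in 𝓝 x, s y = s' y) → toFun s x = toFun s' x
  add : ∀ x, ∀ s ∈ P.at_ x, ∀ s' ∈ P.at_ x, toFun (s + s') x = toFun s x + toFun s' x
  smul : ∀ x (c : ℂ), ∀ s ∈ P.at_ x, toFun (c • s) x = c • toFun s x
  mem : ∀ x, ∀ s ∈ P.at_ x, toFun s ∈ Q.at_ x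

variable {P I : LocalCondition T} {Q J : LocalCondition T'} {R K : LocalCondition T''}

/-- A family, as a section. -/
def LocalCondition.sec (P : LocalCondition T) (U : Opens Y) (s : ∀ y, T y)
  (h : ∀ x ∈ U, s ∈ P.at_ x) : Sh.Sec P.sheaf U :=
  (⟨fun y => s y, fun x hx => P.congr_at x s (extendZero U fun y : U => s y) (by
    filter_upwards [U.isOpen.mem_nhds hx] with y hy
    exact (extendZero_apply (fun y : U => s y) hy).symm) (h x hx)⟩ :
      P.sections U)

/-- The family of values of a section. -/
def LocalCondition.val {U : Opens Y} (s : Sh.Sec P.sheaf U) : ∀ y, T y :=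
  extendZero U (show P.sections U from s).1

lemma LocalCondition.val_mem {U : Opens Y} (s : Sh.Sec P.sheaf U) {x : Y} (hx : x ∈ U) :
  val s ∈ P.at_ x := (show P.sections U from s).2 x hx

lemma LocalCondition.val_apply {U : Opens Y} (s : Sh.Sec P.sheaf U) {x : Y} (hx : x ∈ U) :
  val s x = (show P.sections U from s).1 ⟨x, hx⟩ := extendZero_apply _ hx

lemma LocalCondition.val_zero {U : Opens Y} (x : Y) : val (0 : Sh.Sec P.sheaf U) x = 0 :=
  congrFun (map_zero (extendZero U)) x

lemma LocalCondition.val_res {U V : Opens Y} (h : V ≤ U) (s : Sh.Sec P.sheaf U) {x : Y}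
  (hx : x ∈ V) : val (Sh.res P.sheaf h s) x = val s x :=
  (extendZero_apply _ hx).trans (extendZero_apply _ (h hx)).symm

lemma LocalCondition.sec_ext {U : Opens Y} {s t : Sh.Sec P.sheaf U}
  (h : ∀ x ∈ U, val s x = val t x) : s = t :=
  Subtype.ext (funext fun y => (extendZero_apply _ y.2).symm.trans
    ((h y y.2).trans (extendZero_apply _ y.2)))

open LocalCondition

namespace LocalOp

/-- The morphism of sheaves defined by a local operator. -/
def hom (δ : LocalOp P Q) : P.sheaf ⟶ Q.sheaf :=
  ⟨{ app U := ModuleCat.ofHom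
      { toFun s := Q.sec U.unop (δ.toFun (val s)) fun x hx => δ.mem x _ (val_mem s hx)
        map_add' s t := Subtype.ext (funext fun y =>
          (congrArg (fun r => δ.toFun r y.1) (map_add (extendZero U.unop) s.1 t.1)).trans
            (δ.add _ _ (val_mem s y.2) _ (val_mem t y.2)))
        map_smul' c s := Subtype.ext (funext fun y =>
          (congrArg (fun r => δ.toFun r y.1) (map_smul (extendZero U.unop) c s.1)).trans
            (δ.smul _ _ _ (val_mem s y.2))) }
     naturality U V f := by
      ext s
      refine sec_ext fun x hx => ?_
      refine (val_apply _ hx).trans (Eq.trans ?_ (val_res (leOfHom f.unop) _ hx).symm)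
      refine Eq.trans ?_ (val_apply _ (leOfHom f.unop hx)).symm
      refine δ.congr _ _ _ ?_
      filter_upwards [V.unop.isOpen.mem_nhds hx] with y hy using val_res (leOfHom f.unop) s hy }⟩

lemma val_hom (δ : LocalOp P Q) {U : Opens Y} (s : Sh.Sec P.sheaf U) {x : Y} (hx : x ∈ U) :
  val (Sh.mapSec δ.hom U s) x = δ.toFun (val s) x := val_apply _ hx

lemma hom_comp_eq_zero (δ : LocalOp P Q) (δ' : LocalOp Q R)
  (h : ∀ x, ∀ s ∈ P.at_ x, δ'.toFun (δ.toFun s) x = 0) : δ.hom ≫ δ'.hom = 0 := by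
  refine Sh.hom_ext_sec fun U s => sec_ext fun x hx => ?_
  refine (val_hom δ' _ hx).trans ?_
  rw [δ'.congr x _ (δ.toFun (val s)) (by
    filter_upwards [U.isOpen.mem_nhds hx] with y hy using val_hom δ s hy), h x _ (val_mem s hx)]
  exact (val_zero x).symm

lemma locallyExact_hom (δ : LocalOp P Q) (δ' : LocalOp Q R) (hP : P.IsOpen)
  (h : ∀ x, ∀ s ∈ Q.at_ x, (∀ᶠ y in 𝓝 x, δ'.toFun s y = 0) →
  ∃ r ∈ P.at_ x, ∀ᶠ y in 𝓝 x, δ.toFun r y = s y) : Sh.LocallyExact δ.hom δ'.hom := by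
  intro U s hs x hx
  obtain ⟨r, hr, e⟩ := h x (val s) (val_mem s hx) (by
    filter_upwards [U.isOpen.mem_nhds hx] with y hy
    rw [← val_hom δ' s hy, hs, val_zero])
  obtain ⟨V, hV, hVo, hxV⟩ := eventually_nhds_iff.1 ((hP x r hr).and e)
  let W : Opens Y := ⟨V, hVo⟩ ⊓ U
  refine ⟨W, inf_le_right, ⟨hxV, hx⟩, P.sec W r fun y hy => (hV y hy.1).1,
    sec_ext fun y hy => ?_⟩
  refine (val_hom δ _ hy).trans (Eq.trans ?_ (val_res inf_le_right s hy).symm)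
  rw [← (hV y hy.1).2]
  refine δ.congr _ _ _ ?_
  filter_upwards [W.isOpen.mem_nhds hy] with z hz using val_apply _ hz

lemma mono_hom (δ : LocalOp P Q) (h : ∀ s x, δ.toFun s x = 0 → s x = 0) : Mono δ.hom := by
  refine (Sh.mono_iff_injective _).2 fun U => (injective_iff_map_eq_zero _).2 fun s hs => ?_
  refine sec_ext fun x hx => (h _ _ ?_).trans (val_zero x).symm
  rw [← val_hom δ s hx, hs, val_zero]

end LocalOp

instance mono_incl (hI : ∀ x, I.at_ x ≤ P.at_ x) : Mono (incl hI) :=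
  (Sh.mono_iff_injective _).2 fun U _ _ h => sec_ext fun x _ =>
    congrArg (fun r : Sh.Sec P.sheaf U => val r x) h

/-- The sections in the kernel of the projection to the quotient. -/
lemma cokernel_π_eq_zero_iff (hI : ∀ x, I.at_ x ≤ P.at_ x) {U : Opens Y} (s : Sh.Sec P.sheaf U) :
  Sh.mapSec (Limits.cokernel.π (incl hI)) U s = 0 ↔ ∀ x ∈ U, val s ∈ I.at_ x := by
  constructor
  · intro h x hx
    obtain ⟨r, rfl⟩ := Sh.exists_of_cokernel_eq_zero (S := TopCat.of Y) (incl hI) U s h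
    exact val_mem r hx
  · intro h
    have e : s = Sh.mapSec (incl hI) U (I.sec U (val s) h) :=
      sec_ext fun x hx => (val_apply (Sh.mapSec (incl hI) U (I.sec U (val s) h)) hx).symm
    rw [e, ← Sh.mapSec_comp, Limits.cokernel.condition]
    rfl

namespace LocalOp

/-- The operator induced on the quotients. -/
def coker (δ : LocalOp P Q) (hI : ∀ x, I.at_ x ≤ P.at_ x) (hJ : ∀ x, J.at_ x ≤ Q.at_ x)
  (h : ∀ x, ∀ s ∈ I.at_ x, δ.toFun s ∈ J.at_ x) :
  Limits.cokernel (incl hI) ⟶ Limits.cokernel (incl hJ) :=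
  Limits.cokernel.desc _ (δ.hom ≫ Limits.cokernel.π _) (Sh.hom_ext_sec fun U s =>
    (cokernel_π_eq_zero_iff hJ _).2 fun x hx => J.congr_at x _ _ (by
      filter_upwards [U.isOpen.mem_nhds hx] with y hy
      exact (val_hom δ (Sh.mapSec (incl hI) U s) hy).symm) (h x _ (val_mem s hx)))

variable {hI : ∀ x, I.at_ x ≤ P.at_ x} {hJ : ∀ x, J.at_ x ≤ Q.at_ x} {hK : ∀ x, K.at_ x ≤ R.at_ x}

lemma π_coker (δ : LocalOp P Q) (h : ∀ x, ∀ s ∈ I.at_ x, δ.toFun s ∈ J.at_ x) :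
  Limits.cokernel.π (incl hI) ≫ δ.coker hI hJ h = δ.hom ≫ Limits.cokernel.π (incl hJ) :=
  Limits.cokernel.π_desc _ _ _

lemma coker_apply (δ : LocalOp P Q) (h : ∀ x, ∀ s ∈ I.at_ x, δ.toFun s ∈ J.at_ x) {U : Opens Y}
  (s : Sh.Sec P.sheaf U) :
  Sh.mapSec (δ.coker hI hJ h) U (Sh.mapSec (Limits.cokernel.π (incl hI)) U s) =
  Sh.mapSec (Limits.cokernel.π (incl hJ)) U (Sh.mapSec δ.hom U s) :=
  congrArg (fun f => Sh.mapSec f U s) (π_coker (hI := hI) (hJ := hJ) δ h)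

lemma hom_mem (δ : LocalOp P Q) {U : Opens Y} {s : Sh.Sec P.sheaf U} {x : Y} (hx : x ∈ U)
  (h : val (Sh.mapSec δ.hom U s) ∈ J.at_ x) : δ.toFun (val s) ∈ J.at_ x :=
  J.congr_at x _ _ (by filter_upwards [U.isOpen.mem_nhds hx] with y hy using val_hom δ s hy) h

lemma coker_comp_eq_zero (δ : LocalOp P Q) (δ' : LocalOp Q R) (h h')
  (h₀ : δ.hom ≫ δ'.hom = 0) : δ.coker hI hJ h ≫ δ'.coker hJ hK h' = 0 := by
  rw [← cancel_epi (Limits.cokernel.π (incl hI)), ← Category.assoc, π_coker, Category.assoc,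
    π_coker, ← Category.assoc, h₀, Limits.zero_comp, Limits.comp_zero]

lemma locallyExact_coker (δ : LocalOp P Q) (δ' : LocalOp Q R) (h h') (hP : P.IsOpen)
  (hJo : J.IsOpen) (e : ∀ x, ∀ s ∈ Q.at_ x, δ'.toFun s ∈ K.at_ x →
  ∃ r ∈ P.at_ x, s - δ.toFun r ∈ J.at_ x) :
  Sh.LocallyExact (δ.coker hI hJ h) (δ'.coker hJ hK h') := by
  intro U s hs x hx
  obtain ⟨V, hV, hxV, t, ht⟩ := Sh.locally_surjective (Limits.cokernel.π (incl hJ)) U s x hx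
  have h₁ : Sh.mapSec (Limits.cokernel.π (incl hK)) V (Sh.mapSec δ'.hom V t) = 0 := by
    rw [← coker_apply (hI := hJ) δ' h', ht, Sh.mapSec_res, hs, map_zero]
  obtain ⟨r, hr, hrJ⟩ := e x _ (val_mem t hxV)
    (hom_mem δ' hxV ((cokernel_π_eq_zero_iff hK _).1 h₁ x hxV))
  obtain ⟨W, hW, hWo, hxW⟩ := eventually_nhds_iff.1 ((hP x r hr).and (hJo x _ hrJ))
  let O : Opens Y := ⟨W, hWo⟩ ⊓ V
  refine ⟨O, inf_le_right.trans hV, ⟨hxW, hxV⟩, Sh.mapSec (Limits.cokernel.π (incl hI)) O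
    (P.sec O r fun y hy => (hW y hy.1).1), ?_⟩
  rw [coker_apply, ← Sh.res_res _ hV (inf_le_right : O ≤ V), ← ht, ← Sh.mapSec_res, eq_comm,
    ← sub_eq_zero, ← map_sub, cokernel_π_eq_zero_iff]
  intro y hy
  refine J.congr_at y _ _ ?_ (hW y hy.1).2
  filter_upwards [O.isOpen.mem_nhds hy] with z hz
  refine Eq.trans ?_ (congrFun (map_sub (extendZero O) _ _) z).symm
  refine congrArg₂ _ (val_res inf_le_right t hz).symm (Eq.trans ?_ (val_hom δ _ hz).symm)
  refine δ.congr _ _ _ ?_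
  filter_upwards [O.isOpen.mem_nhds hz] with w hw
  exact (val_apply (P.sec O r fun y hy => (hW y hy.1).1) hw).symm

lemma mono_coker (δ : LocalOp P Q) (h)
  (e : ∀ x, ∀ s ∈ P.at_ x, δ.toFun s ∈ J.at_ x → s ∈ I.at_ x) : Mono (δ.coker hI hJ h) := by
  refine (Sh.mono_iff_injective _).2 fun U => (injective_iff_map_eq_zero _).2 fun s hs => ?_
  refine Sh.eq_of_locally _ fun x hx => ?_
  obtain ⟨V, hV, hxV, t, ht⟩ := Sh.locally_surjective (Limits.cokernel.π (incl hI)) U s x hx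
  refine ⟨V, hV, hxV, ?_⟩
  have h₁ : Sh.mapSec (Limits.cokernel.π (incl hJ)) V (Sh.mapSec δ.hom V t) = 0 := by
    rw [← coker_apply (hI := hI) δ h, ht, Sh.mapSec_res, hs, map_zero]
  rw [← ht, map_zero, cokernel_π_eq_zero_iff]
  exact fun y hy => e y _ (val_mem t hy) (hom_mem δ hy ((cokernel_π_eq_zero_iff hJ _).1 h₁ y hy))

/-- Multiplication by a function. -/
def mul (P : LocalCondition T) (u : Y → ℂ) (h : ∀ x, ∀ s ∈ P.at_ x, (fun y => u y • s y) ∈ P.at_ x) :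
  LocalOp P P where
  toFun s y := u y • s y
  congr x s s' h := by rw [h.self_of_nhds]
  add x s _ s' _ := smul_add _ _ _
  smul x c s _ := smul_comm _ _ _
  mem := h

end LocalOp

/-! ## Morphisms that vanish over an open set -/

section vanishing

variable {S : TopCat.{0}} {F F' G : Sh S}

/-- The morphism `f` vanishes over `O`. -/
def Sh.VanishOn (f : F ⟶ G) (O : Opens S) : Prop := ∀ V ≤ O, ∀ s : F.Sec V, Sh.mapSec f V s = 0

lemma Sh.VanishOn.of_epi {q : F' ⟶ F} [Epi q] {f : F ⟶ G} {O : Opens S}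
  (h : VanishOn (q ≫ f) O) : VanishOn f O := by
  intro V hV s
  refine Sh.eq_of_locally _ fun x hx => ?_
  obtain ⟨W, hW, hxW, t, ht⟩ := Sh.locally_surjective q V s x hx
  refine ⟨W, hW, hxW, ?_⟩
  rw [← Sh.mapSec_res, ← ht, map_zero]
  exact h W (hW.trans hV) t

lemma Sh.VanishOn.stalk {f : F ⟶ G} {O : Opens S} (h : VanishOn f O) {x : S} (hx : x ∈ O) :
  (stalkAt x).map f = 0 := by
  ext t
  obtain ⟨U, hU, s, rfl⟩ := F.exists_germ t
  refine (congrArg _ (F.germ_res (inf_le_left : U ⊓ O ≤ U) x (show x ∈ U ⊓ O from ⟨hU, hx⟩) s).symm).trans ?_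
  refine (stalk_germ f (U ⊓ O) x ⟨hU, hx⟩ _).trans ?_
  rw [h _ inf_le_right, map_zero]
  rfl

end vanishing

end operators

namespace Deformation

open LocalCondition

variable [T2Space B]

/-! ## Fineness -/

lemma isSmoothAnalyticAt_comp_T {χ : X → ℝ} (hχ : ContMDiff 𝓘(ℝ, Fib m) 𝓘(ℝ, ℝ) ∞ χ) :
  D.IsSmoothAnalyticAt x fun y => (χ (D.T y).1 : ℂ) := by
  have := isManifold_real (E := Fib m) X
  let φ := chartAt (Fib m) (D.T x).1
  let h (q : Crd) : ℂ := χ (φ.symm q.1)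
  have hφ : ContDiffAt ℝ ∞ (fun y => χ (φ.symm y)) (φ (D.T x).1) :=
    (ContMDiffAt.comp _ (I' := 𝓘(ℝ, Fib m)) (g := χ) (f := φ.symm) hχ.contMDiffAt
      ((contMDiffAt_symm_of_mem_maximalAtlas (n := ω) (chart_mem_maximalAtlas _)
        (φ.map_source (mem_chart_source _ _))).of_le (by simp))).contDiffAt
  have hφ' : ∀ᶠ y in 𝓝 (φ (D.T x).1), ContDiffAt ℝ ∞ (fun y => χ (φ.symm y)) y := by
    filter_upwards [φ.open_target.mem_nhds (φ.map_source (mem_chart_source _ _))] with y hy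
    exact (ContMDiffAt.comp y (I' := 𝓘(ℝ, Fib m)) (g := χ) (f := φ.symm) hχ.contMDiffAt
      ((contMDiffAt_symm_of_mem_maximalAtlas (n := ω) (chart_mem_maximalAtlas _)
        hy).of_le (by simp))).contDiffAt
  have hs : ∀ᶠ q in 𝓝 (D.smoothCoord x x), ContDiffAt ℝ ∞ h q := by
    have ht : Tendsto Prod.fst (𝓝 (D.smoothCoord x x)) (𝓝 (φ (D.T x).1)) :=
      continuous_fst.tendsto (D.smoothCoord x x)
    filter_upwards [ht.eventually hφ'] with q hq
    exact Complex.ofRealCLM.contDiff.contDiffAt.comp q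
      (ContDiffAt.comp q (g := fun y => χ (φ.symm y)) hq contDiffAt_fst)
  refine isSmoothAnalyticAt_iff.2 ⟨h, .of_differentiableAt_slice hs (.of_forall fun q =>
    differentiableAt_const (𝕜 := ℂ) (χ (φ.symm q.1) : ℂ)), ?_⟩
  filter_upwards [D.realDom_mem_nhds x] with y hy
  exact congrArg (fun z => (χ z : ℂ)) (φ.left_inv hy.1).symm

lemma isFine_restr [CompactSpace X] [T2Space X] {G : Sh (TopCat.of 𝒳)}
  (H : ∀ χ : X → ℝ, ContMDiff 𝓘(ℝ, Fib m) 𝓘(ℝ, ℝ) ∞ χ → ∃ φ : G ⟶ G,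
  (∀ O : Opens 𝒳, (∀ y ∈ O, χ (D.T y).1 = 1) → Sh.VanishOn (φ - 𝟙 G) O) ∧
  ∀ O : Opens 𝒳, (∀ y ∈ O, χ (D.T y).1 = 0) → Sh.VanishOn φ O) : Sh.IsFine (D.restr.obj G) := by
  intro U K hK hKU
  have := isManifold_real (E := Fib m) X
  let j (y : X) : X := (D.T (D.i y)).1
  have hj : Continuous j := continuous_fst.comp (D.T.continuous.comp D.holomorphic_i.continuous)
  have hπ (y) : D.π (D.i y) = D.b₀ := by
    have : D.i y ∈ D.π ⁻¹' {D.b₀} := D.range_i ▸ Set.mem_range_self y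
    exact this
  have hji : Function.Injective j := fun y y' h => D.injective_i (D.T.injective (Prod.ext h
    (((D.T_snd _).trans (hπ y)).trans ((D.T_snd _).trans (hπ y')).symm)))
  obtain ⟨χ, h₀, h₁, -⟩ := exists_contMDiffMap_zero_one_nhds_of_isClosed (n := (⊤ : ℕ∞))
    𝓘(ℝ, Fib m) (s := j '' (U : Set X)ᶜ) (t := j '' K)
    (U.isOpen.isClosed_compl.isCompact.image hj).isClosed (hK.isCompact.image hj).isClosed
    ((Set.disjoint_image_iff hji).2 (Set.disjoint_left.2 fun y hy hy' => hy (hKU hy')))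
  obtain ⟨φ, hφ₁, hφ₀⟩ := H χ χ.contMDiff
  have hc : Continuous fun y => (D.T y).1 := continuous_fst.comp D.T.continuous
  let O (c : ℝ) : Opens 𝒳 :=
    ⟨(fun y => (D.T y).1) ⁻¹' interior {z | χ z = c}, isOpen_interior.preimage hc⟩
  have hO (c) : ∀ y ∈ O c, χ (D.T y).1 = c := fun y hy =>
    (interior_subset : interior {z | χ z = c} ⊆ _) hy
  let W (c : ℝ) : Opens X := ⟨D.i ⁻¹' (O c), (O c).isOpen.preimage D.holomorphic_i.continuous⟩
  refine ⟨D.restr.map φ, W 1, W 0, fun y hy => ?_, ?_, fun y hy => ?_, fun y hy => ?_⟩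
  · exact mem_interior_iff_mem_nhds.2
      (h₁.filter_mono (nhds_le_nhdsSet (Set.mem_image_of_mem j hy)))
  · refine top_unique fun y _ => ?_
    by_cases hy : y ∈ U
    · exact Or.inl hy
    · exact Or.inr (mem_interior_iff_mem_nhds.2
        (h₀.filter_mono (nhds_le_nhdsSet (Set.mem_image_of_mem j hy))))
  · have e : D.restr.map φ - 𝟙 _ = D.restr.map (φ - 𝟙 G) := by
      have : D.restr.Additive := inferInstanceAs (TopCat.Sheaf.pullback _ D.incl).Additive
      rw [Functor.map_sub, CategoryTheory.Functor.map_id]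
    rw [e]
    exact Sh.pullback_stalk_eq_zero D.incl y _ ((hφ₁ _ (hO 1)).stalk hy)
  · exact Sh.pullback_stalk_eq_zero D.incl y _ ((hφ₀ _ (hO 0)).stalk hy)

section bump

variable {T : 𝒳 → Type} [∀ y, AddCommGroup (T y)] [∀ y, Module ℂ (T y)] {P : LocalCondition T}

variable (D P) in
/-- The sections of `P` are stable under multiplication by the functions constant on the leaves. -/
def IsStable : Prop := ∀ χ : X → ℝ, ContMDiff 𝓘(ℝ, Fib m) 𝓘(ℝ, ℝ) ∞ χ →
  ∀ x, ∀ s ∈ P.at_ x, (fun y => (χ (D.T y).1 : ℂ) • s y) ∈ P.at_ x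

lemma vanishOn_mul_sub {u : 𝒳 → ℂ} (hu) {O : Opens 𝒳} (h : ∀ y ∈ O, u y = 1) :
  Sh.VanishOn ((LocalOp.mul P u hu).hom - 𝟙 P.sheaf) O := fun V hV s => by
  rw [Sh.mapSec_sub, sub_eq_zero]
  refine sec_ext fun y hy => (LocalOp.val_hom _ s hy).trans ?_
  exact (congrArg (· • val s y) (h y (hV hy))).trans (one_smul ℂ _)

lemma vanishOn_mul {u : 𝒳 → ℂ} (hu) {O : Opens 𝒳} (h : ∀ y ∈ O, u y = 0) :
  Sh.VanishOn (LocalOp.mul P u hu).hom O := fun V hV s => by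
  refine sec_ext fun y hy => (LocalOp.val_hom _ s hy).trans ?_
  exact (congrArg (· • val s y) (h y (hV hy))).trans ((zero_smul ℂ _).trans (val_zero y).symm)

variable [CompactSpace X] [T2Space X]

lemma IsStable.isSoft (hP : D.IsStable P) : Sh.IsSoft (D.restr.obj P.sheaf) :=
  (isFine_restr fun χ hχ => ⟨(LocalOp.mul P _ (hP χ hχ)).hom,
    fun _ h => vanishOn_mul_sub _ fun y hy => by rw [h y hy, Complex.ofReal_one],
    fun _ h => vanishOn_mul _ fun y hy => by rw [h y hy, Complex.ofReal_zero]⟩).isSoft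

lemma IsStable.isSoft_jet (hP : D.IsStable P) (n : ℕ) :
  Sh.IsSoft (D.restr.obj (D.jetSheaf P n)) := by
  refine (isFine_restr fun χ hχ => ?_).isSoft
  let δ := LocalOp.mul P _ (hP χ hχ)
  let q : P.sheaf ⟶ D.jetSheaf P n := D.jetProj P n
  let φ : D.jetSheaf P n ⟶ D.jetSheaf P n := δ.coker (fun _ => inf_le_left) (fun _ => inf_le_left)
    fun x s hs => idealMul_map (P := P) (Q := P) (k := n + 1)
      (fun y => (χ (D.T y).1 : ℂ) • LinearMap.id) (hP χ hχ) hs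
  have hq : Epi q := inferInstanceAs (Epi (Limits.cokernel.π _))
  have e : q ≫ φ = δ.hom ≫ q := LocalOp.π_coker δ _
  refine ⟨φ, fun O h => Sh.VanishOn.of_epi (q := q) ?_, fun O h => Sh.VanishOn.of_epi (q := q) ?_⟩
  · have e' : q ≫ (φ - 𝟙 _) = (δ.hom - 𝟙 _) ≫ q := by
      rw [Preadditive.comp_sub, e, Preadditive.sub_comp, Category.comp_id, Category.id_comp]
    rw [e']
    intro V hV s
    rw [Sh.mapSec_comp, vanishOn_mul_sub _ (fun y hy => by rw [h y hy, Complex.ofReal_one]) V hV s,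
      map_zero]
  · rw [e]
    intro V hV s
    rw [Sh.mapSec_comp, vanishOn_mul _ (fun y hy => by rw [h y hy, Complex.ofReal_zero]) V hV s,
      map_zero]

end bump

/-! ## The Dolbeault complex -/

variable [FiniteDimensional ℂ F] [ContMDiffVectorBundle ω F E 𝓘(ℂ, Tot m N)]

variable (D F E)

lemma isStable_smoothForms (p : ℕ) : D.IsStable (D.smoothForms F E p) := by
  intro χ hχ x α hα
  obtain ⟨ψ, hψ⟩ := D.exists_isRelChart x
  rw [mem_smoothForms_iff hψ.isVertChart hψ.mem_source (mem_bset x)] at hα ⊢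
  refine ((isSmoothAnalyticAt_comp_T hχ).bilin hα (ContinuousLinearMap.lsmul ℂ ℂ)).congr
    (.of_forall fun y => ?_)
  exact (map_smul (D.flat F E ψ x y) _ _).symm

/-- The Dolbeault operator, as a local operator. -/
def dOp (p : ℕ) : LocalOp (D.smoothForms F E p) (D.smoothForms F E (p + 1)) where
  toFun := D.dForm F
  congr x α β h := by
    have h' := (D.exists_isRelChart x).choose_spec
    rw [dForm, dForm, fdbar, fdbar, vbar_congr h'.mem_source (g := D.coef F E _ x β)]
    filter_upwards [h] with y hy
    rw [coef, coef, hy]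
  add _ _ hα _ hβ := (eventually_dForm_add hα hβ).self_of_nhds
  smul _ c _ hα := (eventually_dForm_smul c hα).self_of_nhds
  mem _ _ hα := dForm_mem hα

/-- The inclusion of the sections in the forms, as a local operator. -/
def secOp : LocalOp (D.analyticSections F E) (D.smoothForms F E 0) where
  toFun := D.ofSec
  congr x _ _ h := congrArg (D.zeroForm E x) h.self_of_nhds
  add x _ _ _ _ := map_add (D.zeroForm E x) _ _
  smul x _ _ _ := map_smul (D.zeroForm E x) _ _
  mem _ _ hs := (mem_analyticSections_iff.1 hs).1

lemma ofSec_eq_zero (s : ∀ y, E y) (x : 𝒳) (h : D.ofSec s x = 0) : s x = 0 :=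
  congrArg (fun α : D.RelForm E 0 x => α.1 Fin.elim0) h

lemma secOp_comp : (D.secOp F E).hom ≫ (D.dOp F E 0).hom = 0 :=
  LocalOp.hom_comp_eq_zero _ _ fun _ _ hs => (mem_analyticSections_iff.1 hs).2.self_of_nhds

lemma dOp_comp (p : ℕ) : (D.dOp F E p).hom ≫ (D.dOp F E (p + 1)).hom = 0 :=
  LocalOp.hom_comp_eq_zero _ _ fun _ _ hα => (eventually_dForm_dForm hα).self_of_nhds

lemma exact_secOp : (ShortComplex.mk _ _ (D.secOp_comp F E)).Exact :=
  (Sh.exact_iff_locallyExact _).2 (LocalOp.locallyExact_hom _ _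
    (fun _ _ h => eventually_mem_analyticSections h) fun _ α hα hd =>
      ⟨_, mem_analyticSections_iff.2 (by rw [ofSec_value]; exact ⟨hα, hd⟩),
        Eventually.of_forall (congrFun (ofSec_value α))⟩)

lemma exact_dOp (p : ℕ) : (ShortComplex.mk _ _ (D.dOp_comp F E p)).Exact :=
  (Sh.exact_iff_locallyExact _).2 (LocalOp.locallyExact_hom _ _
    (fun _ _ h => eventually_mem_smoothForms h) fun _ _ hα hd => exists_dForm_eq hα hd)

lemma secOp_idealMul : ∀ x, ∀ s ∈ (D.idealMul (D.analyticSections F E) k).at_ x,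
  (D.secOp F E).toFun s ∈ (D.idealMul (D.smoothForms F E 0) k).at_ x :=
  fun _ _ hs => idealMul_map (D.zeroForm E) (D.secOp F E).mem hs

lemma dOp_idealMul (p : ℕ) : ∀ x, ∀ α ∈ (D.idealMul (D.smoothForms F E p) k).at_ x,
  (D.dOp F E p).toFun α ∈ (D.idealMul (D.smoothForms F E (p + 1)) k).at_ x :=
  fun _ _ hα => dForm_mem_idealMul hα

/-- The inclusion on the infinitesimal neighbourhoods. -/
def secJet (n : ℕ) : D.jetSheaf (D.analyticSections F E) n ⟶ D.jetSheaf (D.smoothForms F E 0) n :=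
  (D.secOp F E).coker (fun _ => inf_le_left) (fun _ => inf_le_left) (D.secOp_idealMul F E)

/-- The Dolbeault operators of the infinitesimal neighbourhoods. -/
def dJet (n p : ℕ) :
  D.jetSheaf (D.smoothForms F E p) n ⟶ D.jetSheaf (D.smoothForms F E (p + 1)) n :=
  (D.dOp F E p).coker (fun _ => inf_le_left) (fun _ => inf_le_left) (D.dOp_idealMul F E p)

lemma secJet_comp (n : ℕ) : D.secJet F E n ≫ D.dJet F E n 0 = 0 :=
  LocalOp.coker_comp_eq_zero _ _ (D.secOp_idealMul F E) (D.dOp_idealMul F E 0) (D.secOp_comp F E)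

lemma dJet_comp (n p : ℕ) : D.dJet F E n p ≫ D.dJet F E n (p + 1) = 0 :=
  LocalOp.coker_comp_eq_zero _ _ (D.dOp_idealMul F E p) (D.dOp_idealMul F E (p + 1)) (D.dOp_comp F E p)

lemma exact_secJet (n : ℕ) : (ShortComplex.mk _ _ (D.secJet_comp F E n)).Exact :=
  (Sh.exact_iff_locallyExact _).2 (LocalOp.locallyExact_coker _ _ (D.secOp_idealMul F E) (D.dOp_idealMul F E 0)
    (fun _ _ h => eventually_mem_analyticSections h)
    (fun _ _ h => eventually_mem_idealMul (fun _ _ h => eventually_mem_smoothForms h) h)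
    fun _ _ hα hd => exists_jet_ofSec_eq hα hd)

lemma exact_dJet (n p : ℕ) : (ShortComplex.mk _ _ (D.dJet_comp F E n p)).Exact :=
  (Sh.exact_iff_locallyExact _).2 (LocalOp.locallyExact_coker _ _ (D.dOp_idealMul F E p) (D.dOp_idealMul F E (p + 1))
    (fun _ _ h => eventually_mem_smoothForms h)
    (fun _ _ h => eventually_mem_idealMul (fun _ _ h => eventually_mem_smoothForms h) h)
    fun _ _ hα hd => exists_jet_dForm_eq hα hd)

lemma mono_secOp : Mono (D.secOp F E).hom := LocalOp.mono_hom _ (D.ofSec_eq_zero (E := E))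

lemma mono_secJet (n : ℕ) : Mono (D.secJet F E n) :=
  LocalOp.mono_coker _ (D.secOp_idealMul F E) fun _ _ hs h => mem_idealMul_analyticSections hs h

lemma isZero_formSheaf (hp : m < p) : Limits.IsZero (D.formSheaf F E p) :=
  Sh.isZero_of_subsingleton fun _ => ⟨fun _ _ => sec_ext fun x _ =>
    (subsingleton_relForm F E hp x).elim _ _⟩

end Deformation

/-- The inverse image of a resolution by sheaves with soft inverse images. -/
lemma resolution_restr {S Z : TopCat.{0}} [CompactSpace S] [T2Space S] (φ : S ⟶ Z) {G : Sh Z}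
  {A : ℕ → Sh Z} (ε : G ⟶ A 0) [Mono ε] (d : ∀ p, A p ⟶ A (p + 1)) (wε : ε ≫ d 0 = 0)
  (w : ∀ p, d p ≫ d (p + 1) = 0) (e₀ : (ShortComplex.mk _ _ wε).Exact)
  (e : ∀ p, (ShortComplex.mk _ _ (w p)).Exact)
  (hA : ∀ p, Sh.IsSoft ((TopCat.Sheaf.pullback _ φ).obj (A p))) :
  IsAcyclicResolution ((TopCat.Sheaf.pullback _ φ).map ε)
  (fun p => (TopCat.Sheaf.pullback _ φ).map (d p)) ∧
  ∀ p, Nonempty (sheafCohomology p ((TopCat.Sheaf.pullback _ φ).obj G) ≃ₗ[ℂ]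
  GlobalCohomology (fun p => (TopCat.Sheaf.pullback _ φ).map (d p)) p) := by
  have := Sh.pullback_mono φ ε
  have h₀ := Sh.pullback_exact φ e₀
  have h (p) := Sh.pullback_exact φ (e p)
  let ε' := (TopCat.Sheaf.pullback (ModuleCat.{0} ℂ) φ).map ε
  let d' (p) := (TopCat.Sheaf.pullback (ModuleCat.{0} ℂ) φ).map (d p)
  have : Mono ε' := this
  have wε' : ε' ≫ d' 0 = 0 := ((ShortComplex.mk _ _ wε).map (TopCat.Sheaf.pullback (ModuleCat.{0} ℂ) φ)).zero
  have w' (p) : d' p ≫ d' (p + 1) = 0 := ((ShortComplex.mk _ _ (w p)).map (TopCat.Sheaf.pullback (ModuleCat.{0} ℂ) φ)).zero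
  exact ⟨Sh.isAcyclicResolution_of_isSoft ε' d' wε' w' h₀ h hA,
    Sh.nonempty_cohomology_equiv ε' d' wε' w'
      ((Sh.exact_iff_locallyExact _).1 h₀) (fun p => (Sh.exact_iff_locallyExact _).1 (h p)) hA⟩

end deformation

end

theorem theorem2p1 {m N : ℕ} {X 𝒳 B : Type}
    [TopologicalSpace X] [ChartedSpace (FibreModel m) X]
    [IsManifold 𝓘(ℂ, FibreModel m) ω X] [CompactSpace X] [T2Space X]
    [TopologicalSpace 𝒳] [ChartedSpace (TotalModel m N) 𝒳]
    [IsManifold 𝓘(ℂ, TotalModel m N) ω 𝒳] [T2Space 𝒳]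
    [TopologicalSpace B] [ChartedSpace (BaseModel N) B]
    [IsManifold 𝓘(ℂ, BaseModel N) ω B] [T2Space B]
    (D : Deformation m N X 𝒳 B)
    (F : Type) [NormedAddCommGroup F] [NormedSpace ℂ F] [FiniteDimensional ℂ F]
    (E : 𝒳 → Type) [TopologicalSpace (Bundle.TotalSpace F E)] [∀ x, TopologicalSpace (E x)]
    [∀ x, AddCommGroup (E x)] [∀ x, Module ℂ (E x)] [FiberBundle F E] [VectorBundle ℂ F E]
    [ContMDiffVectorBundle ω F E 𝓘(ℂ, TotalModel m N)] :
    ∃ (ε : D.analyticSheaf F E ⟶ D.formSheaf F E 0)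
      (d : ∀ p, D.formSheaf F E p ⟶ D.formSheaf F E (p + 1)),
      D.IsInclusion F E ε ∧ D.IsDolbeault F E d ∧
      -- the statement over `X_∞^ω`
      (∀ p, m < p → Limits.IsZero (D.restr.obj (D.formSheaf F E p))) ∧
      IsAcyclicResolution (D.restr.map ε) (fun p => D.restr.map (d p)) ∧
      (∀ p, Nonempty (sheafCohomology p (D.restr.obj (D.analyticSheaf F E)) ≃ₗ[ℂ]
        GlobalCohomology (fun p => D.restr.map (d p)) p)) ∧
      -- the statement over `X_n^ω`
      ∀ n : ℕ, ∃ (εn : D.jetSheaf (D.analyticSections F E) n ⟶ D.jetSheaf (D.smoothForms F E 0) n)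
        (dn : ∀ p, D.jetSheaf (D.smoothForms F E p) n ⟶ D.jetSheaf (D.smoothForms F E (p + 1)) n),
        D.jetProj (D.analyticSections F E) n ≫ εn = ε ≫ D.jetProj (D.smoothForms F E 0) n ∧
        (∀ p, D.jetProj (D.smoothForms F E p) n ≫ dn p =
          d p ≫ D.jetProj (D.smoothForms F E (p + 1)) n) ∧
        (∀ p, m < p → Limits.IsZero (D.restr.obj (D.jetSheaf (D.smoothForms F E p) n))) ∧
        IsAcyclicResolution (D.restr.map εn) (fun p => D.restr.map (dn p)) ∧
        (∀ p, Nonempty (sheafCohomology p (D.restr.obj (D.jetSheaf (D.analyticSections F E) n))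
          ≃ₗ[ℂ] GlobalCohomology (fun p => D.restr.map (dn p)) p)) := by
  have := D.mono_secOp F E
  have hadd : D.restr.Additive := inferInstanceAs (TopCat.Sheaf.pullback _ D.incl).Additive
  have h := resolution_restr D.incl _ _ _ _ (D.exact_secOp F E) (D.exact_dOp F E)
    fun p => (D.isStable_smoothForms F E p).isSoft
  refine ⟨(D.secOp F E).hom, fun p => (D.dOp F E p).hom, ?_, ?_,
    fun p hp => D.restr.map_isZero (D.isZero_formSheaf F E hp), h.1, h.2, fun n => ?_⟩
  · rintro U s _ rfl x w
    exact congrArg (fun s : ∀ y, E y => s x) (rfl : _ = extendZero U s.1) |>.trans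
      (extendZero_apply _ x.2)
  · rintro p U α _ rfl x hx ψ hψ a b ha hb
    refine Deformation.isDbarAt_dForm (α.2 x hx) ψ hψ a b ha ?_
    filter_upwards [hb, U.isOpen.mem_nhds hx] with y hy hyU w
    rw [← hy w, extendZero_apply _ hyU]
    rfl
  · have := D.mono_secJet F E n
    have h := resolution_restr D.incl _ _ _ _ (D.exact_secJet F E n) (D.exact_dJet F E n)
      fun p => (D.isStable_smoothForms F E p).isSoft_jet n
    refine ⟨D.secJet F E n, D.dJet F E n, LocalOp.π_coker _ _, fun p => LocalOp.π_coker _ _,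
      fun p hp => D.restr.map_isZero ?_, h.1, h.2⟩
    have : Epi (D.jetProj (D.smoothForms F E p) n) := inferInstanceAs (Epi (Limits.cokernel.π _))
    exact Limits.IsZero.of_epi (D.jetProj (D.smoothForms F E p) n) (D.isZero_formSheaf F E hp)

end
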